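/- **The algorithm Balance.** Let $G$ be a multigraph without loops on $n$ vertices and let $U$ be the set of vertices not yet classified (initially all). Let $m$ be the sum of the degrees in $G[U]$, let $\alpha=m^{-\tau}$, and for $\epsilon,\mu$ let $\zeta(\epsilon,\mu)=2(\delta_0-\ln(1-\epsilon))/\mu$, $\ell(\epsilon,\mu)=\lceil \ln(4m/\delta_0^2)/\zeta(\epsilon,\mu)\rceil$. All walks are lazy: at each step, with probability $\frac12$ stay, otherwise move along a random incident edge of $G[U]$; a walk is even or odd according to its number of moves. "Random vertex" means with probability proportional to degree. The procedures are: * *CutOrBound* runs $O(\ell^2\log(n+m)/\alpha)$ walks of length $\ell=\ell(\epsilon_1,\mu_1)$ from a vertex. For each time $l\le\ell$ it sorts the vertices by the number of walks at the vertex at time $l$ divided by the degree. It outputs a set of the first $k\le \lceil \ell/(2(1-2\phi)\alpha)\rceil$ vertices, for some $l,k$, whose conductance for the lazy walk is less than $\phi$, if there is one. Here $-\ln\frac{\sqrt{1-2\phi}+\sqrt{1+2\phi}}2=\zeta(\epsilon_1,\mu_1)\,\tau$. * *Find*$(i;\epsilon,\mu,\alpha)$ goes through the thresholds $t=(1-\gamma)^r\ge\gamma/m^{1+\mu/2}$,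 $r=0,1,\dots$. For each it runs $O(\log (n+m)\max\{\alpha,t\}/t^2)$ walks of length $\ell(\epsilon,\mu)$ from $i$ and puts each new vertex $j$ in Even (in Odd) if (number of even minus number of odd walks ending at $j$)/(degree of $j$ times number of walks) is $>t$ (is $<-t$). It succeeds as soon as the number of edges between Even and Odd plus half of the edges leaving $\mathrm{Even}\cup\mathrm{Odd}$ is at least $f(\sigma(\epsilon,\mu))$ times the number of edges incident to $\mathrm{Even}\cup\mathrm{Odd}$ and $|\mathrm{Even}\cup\mathrm{Odd}|\ge c\,(\Delta t^2m^{1+\mu}\log(n+m))^{-1}$, with $\Delta$ the maximum degree. Here $1-\sigma(\epsilon,\mu)=(1-\eta)(1-\epsilon)^{1+1/\mu}$, and $f(s)=\frac12$ for $s>\frac13$, $f(s)=\frac{-1+\sqrt{4s^2-8s+5}}{2(1-s)}$ for $s_0<s\le\frac13$, $f(s)=\frac1{1+2\sqrt{s(1-s)}}$ for $s\le s_0$, where $s_0=0.22815\ldots$ is the point where the last two expressions agree. * *Simple*$(\epsilon,\mu)$ runs Find with $\alpha=1$ in parallel from $O(\log(n+m))$ random vertices, puts the Even set of the first success on one side and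 its Odd set on the other (by a coin flip), and recurses on the remaining induced subgraph with $\epsilon$ divided by the fraction of the edges that remains. It stops with a uniformly random cut of the rest once $f(\sigma(\epsilon,\mu))=\frac12$ or no edge is left; if all runs of Find fail, it outputs a uniformly random cut of everything. *Simple*$'(\mu)$ takes the best of the cuts for all $1-\epsilon=(1-\gamma)^r\ge\frac12$. * *Balance* takes a set $P$ of $O(\log(n+m))$ random vertices of $G[U]$ and runs CutOrBound from them. If a set $S$ is found, it cuts $G[S]$ by Simple$'(\mu_2)$ and recurses on $U\setminus S$, combining the cuts by a coin flip. Otherwise it runs Find$(i;\epsilon_1,\mu_1,\alpha)$ in parallel for $i\in P$, splits the classified vertices by a coin flip, and recurses on the rest; if all runs fail, or no edge is left, the rest is cut uniformly at random. At the end the better of this cut and a uniformly random cut of $G$ is output. **Theorem.** For every constant $b>1.5$ there are a choice of the constants of Balance (among them $\epsilon_1,\mu_1,\mu_2>0$ and $0<\tau<1$) and a constant $\delta>0$ such that: 1. For every multigraph $G$ the expected number of edges cut by the output of Balance is at least $(\frac12+\delta)$ times the maximum cut of $G$. For all constants $A,k$, on multigraphs with $n\ge2$ vertices and maximum degree at most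 $A(\log n)^k$, Balance always runs in $\tilde O(n^b)$ time. 2. Consequently there is an algorithm for arbitrary graphs with nonnegative edge weights, which accesses the graph only through the degrees of vertices and through random incident edges (chosen in unit time with probability proportional to weight). It always runs in $\tilde O(n^b)$ time for $n\ge2$, and with probability at least $1-1/n$ its output is a cut of weight at least $(\frac12+\delta)$ times the maximum. It reduces the graph to a multigraph with at most $2n$ vertices and maximum degree $O(\log n)$: each vertex is replaced by a number of copies proportional to its degree, and $O(n)$ random edges are put between random copies of their endpoints (if the degree bound fails, a random cut is taken). It runs Balance on it, puts each vertex on the side of a random copy, repeats all this $O(\log n)$ times, and keeps the cut that separates the endpoints of the most out of $O(\log n)$ fresh random edges. Time is counted in elementary operations (random choices, arithmetic operations, comparisons, memory accesses), an operation on a search tree counting as logarithmically many; $\tilde O$ hides a constant factor and a power of $\log n$, which depend only on $b$ (and on $A,k$ in the first part). -/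

import Mathlib

open scoped NNReal ENNReal

noncomputable section

namespace MaxCut

/-! ## Graphs and cuts -/

/-- A finite graph with nonnegative edge weights (weight `0` means that there is no edge). -/
structure WGraph (V : Type) where
  weight : V → V → ℝ≥0
  symm : ∀ u v, weight u v = weight v u
  loopless : ∀ v, weight v v = 0

/-- An unweighted multigraph: `mult u v` parallel edges join `u` and `v`. -/
structure MultiGraph (V : Type) where
  mult : V → V → ℕ
  symm : ∀ u v, mult u v = mult v u
  loopless : ∀ v, mult v v = 0

/-- A multigraph as a weighted graph. -/
def MultiGraph.toWGraph {V : Type} (G : MultiGraph V) : WGraph V where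
  weight u v := (G.mult u v : ℝ≥0)
  symm u v := by rw [G.symm u v]
  loopless v := by rw [G.loopless v, Nat.cast_zero]

open scoped Classical in
/-- The total weight of the edges cut by the partition `(L, V \ L)`. -/
def WGraph.cutWeight {V : Type} [Fintype V] (G : WGraph V) (L : Finset V) : ℝ :=
  ∑ u ∈ L, ∑ v ∈ Lᶜ, (G.weight u v : ℝ)

/-- The largest total weight of the edges cut by a partition of the vertices. -/
def WGraph.maxCut {V : Type} [Fintype V] (G : WGraph V) : ℝ :=
  Finset.univ.sup' ⟨∅, Finset.mem_univ _⟩ G.cutWeight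

/-! ## Randomized algorithms with a step count -/

/-- A randomized computation: the joint law of its output and of the number of steps it makes. -/
def RandAlg (α : Type) : Type := PMF (α × ℕ)

namespace RandAlg

/-- Return a value, at no cost. -/
protected def pure {α : Type} (a : α) : RandAlg α := PMF.pure (a, 0)

/-- Sequential composition: the steps add up. -/
protected def bind {α β : Type} (x : RandAlg α) (f : α → RandAlg β) : RandAlg β :=
  PMF.bind x fun a => PMF.map (fun b : β × ℕ => (b.1, a.2 + b.2)) (f a.1)

instance : Monad RandAlg where
  pure := RandAlg.pure
  bind := RandAlg.bind

/-- Charge `k` steps. -/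
def tick (k : ℕ) : RandAlg Unit := PMF.pure ((), k)

/-- Make one random choice; it costs one step. -/
def choose {α : Type} (x : PMF α) : RandAlg α := PMF.map (fun a => (a, 1)) x

/-- Toss a fair coin. -/
def coin : RandAlg Bool := choose (PMF.uniformOfFintype Bool)

/-- Return one of two values, each with probability one half. -/
def flip {α : Type} (a b : α) : RandAlg α := do
  let c ← coin
  pure (if c then a else b)

/-- Run a computation for every element of a list and collect the outputs. -/
def collect {α β : Type} (f : α → RandAlg β) : List α → RandAlg (List β)
  | [] => pure []
  | a :: l => do
    let b ← f a
    let bs ← collect f l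
    pure (b :: bs)

/-- Run a computation `k` times independently. -/
def repeated {α : Type} (k : ℕ) (x : RandAlg α) : RandAlg (List α) :=
  collect (fun _ => x) (List.range k)

/-- Run a computation for the elements of a list in turn until one of them yields an output. -/
def firstSome {α β : Type} (f : α → RandAlg (Option β)) : List α → RandAlg (Option β)
  | [] => pure none
  | a :: l => do
    match ← f a with
    | some b => pure (some b)
    | none => firstSome f l

/-- The law of the output. -/
def law {α : Type} (x : RandAlg α) : PMF α := PMF.map Prod.fst x

/-- Whatever the random choices, at most `T` steps are made. -/
def RunsWithin {α : Type} (x : RandAlg α) (T : ℝ) : Prop :=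
  ∀ o : α × ℕ, o ∈ PMF.support x → (o.2 : ℝ) ≤ T

/-- The expectation of a real function of the output, for finitely many possible outputs. -/
def expect {α : Type} [Fintype α] (x : RandAlg α) (f : α → ℝ) : ℝ :=
  ∑ a, (x.law a).toReal * f a

/-- The probability that the output has a property. -/
def prob {α : Type} (x : RandAlg α) (s : Set α) : ℝ := (x.law.toOuterMeasure s).toReal

end RandAlg

open RandAlg

/-- Choose an element with probability proportional to its weight (`none` if all weights are
zero). -/
def pick {α : Type} [Fintype α] (w : α → ℝ≥0) : PMF (Option α) :=
  if h : ∑ a, w a = 0 then PMF.pure none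
  else PMF.map some (PMF.normalize (fun a => (w a : ℝ≥0∞))
    (by rw [tsum_fintype, ← ENNReal.ofNNReal_finsetSum]; exact_mod_cast h)
    (by rw [tsum_fintype, ← ENNReal.ofNNReal_finsetSum]; exact ENNReal.coe_ne_top))

/-! ## Parameters -/

/-- The constants on which the algorithms depend. -/
structure Params where
  /-- the MaxCut defect for which Balance looks for tripartitions -/
  eps₁ : ℝ
  /-- the exponent that Balance uses to look for tripartitions -/
  mu₁ : ℝ
  /-- the exponent that Balance hands to Simple -/
  mu₂ : ℝ
  /-- the exponent of the probability bound `α = m ^ (-τ)` -/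
  tau : ℝ
  /-- the small constant in the length of the walks -/
  delta : ℝ
  /-- the ratio of consecutive thresholds is `1 - γ` -/
  gamma : ℝ
  /-- the slack in the definition of `σ` -/
  eta : ℝ
  /-- the constant factor in the number of walks -/
  walkConst : ℝ
  /-- the constant factor in the number `O(log n)` of starting vertices -/
  startConst : ℝ
  /-- the constant factor in the least number of vertices that a tripartition must classify -/
  sizeConst : ℝ
  /-- edges sampled per vertex in the reduction to small degree -/
  sampleConst : ℝ
  /-- the constant factor in the degree bound of the reduction to small degree -/
  degConst : ℝ
  /-- the constant factor in the number `O(log n)` of independent repetitions -/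
  repConst : ℝ

/-- The point `0.22815…` at which the two expressions agree. -/
def sotoPoint : ℝ :=
  sInf {s : ℝ | 0 ≤ s ∧ s ≤ 1 / 3 ∧
    (-1 + √(4 * s ^ 2 - 8 * s + 5)) / (2 * (1 - s)) = 1 / (1 + 2 * √(s * (1 - s)))}

/-- The fraction of the incident edges that a tripartition from a vector of Rayleigh quotient at
least `2 * (1 - s)` cuts. -/
def soto (s : ℝ) : ℝ :=
  if 1 / 3 < s then 1 / 2
  else if sotoPoint < s then (-1 + √(4 * s ^ 2 - 8 * s + 5)) / (2 * (1 - s))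
  else 1 / (1 + 2 * √(s * (1 - s)))

namespace Params

/-- `σ(ε, μ) = 1 - (1 - ε) ^ (1 + 1 / μ)`, up to a slack that is as small as we please. -/
def sigma (p : Params) (ε μ : ℝ) : ℝ := 1 - (1 - p.eta) * (max (1 - ε) 0) ^ (1 + 1 / μ)

/-- `ζ(ε, μ)`: walks have length about `log m / ζ`. -/
def zeta (p : Params) (ε μ : ℝ) : ℝ := 2 * (p.delta - Real.log (1 - ε)) / μ

/-- The length `ℓ(ε, μ)` of the walks in a graph whose degrees sum to `m`. -/
def len (p : Params) (m : ℕ) (ε μ : ℝ) : ℕ :=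
  ⌈Real.log (4 * m / p.delta ^ 2) / p.zeta ε μ⌉₊

/-- The target conductance. -/
def phi (p : Params) : ℝ :=
  Real.exp (-(p.zeta p.eps₁ p.mu₁ * p.tau)) *
    √(1 - Real.exp (-(p.zeta p.eps₁ p.mu₁ * p.tau)) ^ 2)

/-- The probability bound `α = m ^ (-τ)`. -/
def alpha (p : Params) (m : ℕ) : ℝ := (m : ℝ) ^ (-p.tau)

/-- The ranges of the constants. -/
structure Valid (p : Params) : Prop where
  eps₁_pos : 0 < p.eps₁
  eps₁_lt : p.eps₁ < 1 / 2
  mu₁_pos : 0 < p.mu₁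
  mu₂_pos : 0 < p.mu₂
  tau_pos : 0 < p.tau
  tau_lt : p.tau < 1
  delta_pos : 0 < p.delta
  delta_lt : p.delta < 1
  gamma_pos : 0 < p.gamma
  gamma_lt : p.gamma < 1
  eta_pos : 0 < p.eta
  eta_lt : p.eta < 1
  walkConst_pos : 0 < p.walkConst
  startConst_pos : 0 < p.startConst
  sizeConst_pos : 0 < p.sizeConst
  sampleConst_pos : 0 < p.sampleConst
  degConst_pos : 0 < p.degConst
  repConst_pos : 0 < p.repConst
  soto_gt : 1 / 2 < soto (p.sigma p.eps₁ p.mu₁)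
  zeta_tau_lt : p.zeta p.eps₁ p.mu₁ * p.tau < 1 / 8

/-- The defining equation of the target conductance. -/
theorem Valid.phi_eq {p : Params} (h : p.Valid) :
    -Real.log ((√(1 - 2 * p.phi) + √(1 + 2 * p.phi)) / 2) = p.zeta p.eps₁ p.mu₁ * p.tau := by
  unfold phi
  have h0 : 0 ≤ p.zeta p.eps₁ p.mu₁ * p.tau := by
    have h1 : Real.log (1 - p.eps₁) ≤ 0 :=
      Real.log_nonpos (by linarith [h.eps₁_lt]) (by linarith [h.eps₁_pos])
    have h2 := h.delta_pos
    have h3 : 0 ≤ p.zeta p.eps₁ p.mu₁ :=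
      div_nonneg (mul_nonneg (by norm_num) (by linarith)) h.mu₁_pos.le
    exact mul_nonneg h3 h.tau_pos.le
  have h8 := h.zeta_tau_lt
  set s := p.zeta p.eps₁ p.mu₁ * p.tau
  set c := Real.exp (-s) with hc
  have c1 : c ≤ 1 := Real.exp_le_one_iff.mpr (by linarith)
  have c2 : 7 / 8 ≤ c := by linarith [Real.add_one_le_exp (-s)]
  have hq : √(1 - c ^ 2) ^ 2 = 1 - c ^ 2 := Real.sq_sqrt (by nlinarith)
  have hle : √(1 - c ^ 2) ≤ c := (Real.sqrt_le_left (by linarith)).mpr (by nlinarith)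
  have hn : 0 ≤ √(1 - c ^ 2) := Real.sqrt_nonneg _
  have e1 : 1 - 2 * (c * √(1 - c ^ 2)) = (c - √(1 - c ^ 2)) ^ 2 := by linear_combination -hq
  have e2 : 1 + 2 * (c * √(1 - c ^ 2)) = (c + √(1 - c ^ 2)) ^ 2 := by linear_combination -hq
  rw [e1, e2, Real.sqrt_sq (by linarith), Real.sqrt_sq (by linarith)]
  have e3 : (c - √(1 - c ^ 2) + (c + √(1 - c ^ 2))) / 2 = c := by ring
  rw [e3, hc, Real.log_exp, neg_neg]

end Params

/-! ## Induced subgraphs of a multigraph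

All algorithms work on the subgraph induced by the set `U` of the vertices that are not yet
classified. -/

section
variable {V : Type} [Fintype V] (G : MultiGraph V)

namespace MultiGraph

/-- The degree of `j` in the subgraph induced by `U`. -/
def deg (U : Finset V) (j : V) : ℕ := ∑ k ∈ U, G.mult j k

/-- The volume of `S` in the subgraph induced by `U`. -/
def vol (U S : Finset V) : ℕ := ∑ j ∈ S, G.deg U j

/-- The sum `m` of the degrees in the subgraph induced by `U`. -/
def total (U : Finset V) : ℕ := G.vol U U

/-- The number of edges between two disjoint sets. -/
def edges (A B : Finset V) : ℕ := ∑ a ∈ A, ∑ b ∈ B, G.mult a b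

/-- The maximum degree. -/
def maxDeg : ℕ := Finset.univ.sup (G.deg Finset.univ)

/-- The logarithm of the size of the whole graph: an upper bound on the number of steps of a
search, an insertion, a deletion or a weighted random choice in a balanced search tree. -/
def lg : ℕ := Nat.clog 2 (Fintype.card V + G.total Finset.univ + 2)

open scoped Classical in
/-- The number of edges with only one endpoint in `A ∪ B`. -/
def cross (U A B : Finset V) : ℕ := G.edges (A ∪ B) (U \ (A ∪ B))

open scoped Classical in
/-- The number of edges incident to `A ∪ B`. -/
def inc (U A B : Finset V) : ℝ := (G.edges (A ∪ B) (A ∪ B) : ℝ) / 2 + G.cross U A B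

/-- Edges between `A` and `B`, and half of the edges that leave `A ∪ B`. -/
def cut (U A B : Finset V) : ℝ := (G.edges A B : ℝ) + (G.cross U A B : ℝ) / 2

open scoped Classical in
/-- The conductance of `S`, for the lazy walk on the subgraph induced by `U`, is less than `φ`.
(Laziness doubles all volumes; the inequality is false if one side has volume zero.) -/
def LowConductance (U : Finset V) (φ : ℝ) (S : Finset V) : Prop :=
  (G.edges S (U \ S) : ℝ) < φ * (2 * min (G.vol U S) (G.vol U (U \ S)) : ℕ)

end MultiGraph

/-! ## Random walks -/

open scoped Classical in
/-- A random vertex, with probability proportional to its degree. -/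
def randomVertex (U : Finset V) : RandAlg (Option V) := do
  tick G.lg
  choose (pick fun j => if j ∈ U then (G.deg U j : ℝ≥0) else 0)

/-- The random set of `O(log n)` starting vertices. -/
def startVertices (p : Params) (U : Finset V) : RandAlg (List V) := do
  let l ← repeated ⌈p.startConst * G.lg⌉₊ (randomVertex G U)
  pure l.reduceOption

open scoped Classical in
/-- One step of the lazy walk: with probability one half, move along a random incident edge. The
Boolean is the parity of the number of moves (`true` is odd). -/
def step (U : Finset V) (s : V × Bool) : RandAlg (V × Bool) := do
  if ← coin then
    match ← choose (pick fun k => if k ∈ U then (G.mult s.1 k : ℝ≥0) else 0) with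
    | some k => pure (k, !s.2)
    | none => pure s
  else pure s

/-- The states at times `0, 1, …, l` of a lazy walk from the state `s`. -/
def walk (U : Finset V) : ℕ → V × Bool → RandAlg (List (V × Bool))
  | 0, s => pure [s]
  | l + 1, s => do
    let s' ← step G U s
    let rest ← walk U l s'
    pure (s :: rest)

/-- Put every vertex of `U` on a random side. The output is one side. -/
def randomCut (U : Finset V) : RandAlg (Finset V) := do
  tick U.card
  choose (PMF.uniformOfFinset U.powerset ⟨∅, Finset.empty_mem_powerset U⟩)

/-- The cost of deleting the set `S` from the data structures for the subgraph induced by `U`, of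
copying it, or of counting the edges that are incident to it. -/
def scanCost (U S : Finset V) : ℕ := G.lg * (G.vol U S + S.card + 1)

/-! ## Threshold and Find -/

open scoped Classical in
/-- (The number of walks that end at `j` with even parity minus the number of those with odd
parity) divided by (the degree of `j` times the number of walks). -/
def estimate (U : Finset V) (ends : List (V × Bool)) (j : V) : ℝ :=
  ((ends.countP fun s => s = (j, false) : ℕ) - (ends.countP fun s => s = (j, true) : ℕ) : ℝ) /
    (G.deg U j * ends.length)

open scoped Classical in
/-- Threshold, from the vertex `i`: `c` holds the classified vertices (`Even`, `Odd`). -/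
def threshold (p : Params) (U : Finset V) (ε μ α : ℝ) (i : V) (t : ℝ)
    (c : Finset V × Finset V) : RandAlg (Finset V × Finset V) := do
  let w := ⌈p.walkConst * G.lg * max α t / t ^ 2⌉₊
  let traces ← repeated w (walk G U (p.len (G.total U) ε μ) (i, false))
  tick (G.lg * w)
  let ends := traces.map fun T => T.getLastD (i, false)
  let new := U \ (c.1 ∪ c.2)
  pure (c.1 ∪ new.filter (fun j => t < estimate G U ends j),
    c.2 ∪ new.filter (fun j => estimate G U ends j < -t))

open scoped Classical in
/-- The test for success in Find: many edges are cut and sufficiently many vertices are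
classified. -/
def Accepts (p : Params) (U : Finset V) (ε μ t : ℝ) (c : Finset V × Finset V) : Prop :=
  soto (p.sigma ε μ) * G.inc U c.1 c.2 ≤ G.cut U c.1 c.2 ∧
    p.sizeConst / (max G.maxDeg 1 * t ^ 2 * (G.total U : ℝ) ^ (1 + μ) * G.lg) ≤
      ((c.1 ∪ c.2).card : ℝ)

/-- The thresholds `t = (1 - γ) ^ r`, `r = 0, 1, 2, …`, as long as `t ≥ γ / m ^ (1 + μ / 2)`. -/
def thresholds (p : Params) (m : ℕ) (μ : ℝ) : List ℝ :=
  (List.range (⌊Real.log ((m : ℝ) ^ (1 + μ / 2) / p.gamma) / -Real.log (1 - p.gamma)⌋₊ + 1)).map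
    fun r => (1 - p.gamma) ^ r

open scoped Classical in
/-- The runs of Find from several vertices proceed in parallel, one threshold after the other, and
stop as soon as one of them succeeds. A run is given by its starting vertex and by the vertices
that it has classified. -/
def findRuns (p : Params) (U : Finset V) (ε μ α : ℝ) :
    List ℝ → List (V × Finset V × Finset V) → RandAlg (Option (Finset V × Finset V))
  | [], _ => pure none
  | t :: ts, runs => do
    let runs' ← collect (fun s => do
      let c ← threshold G p U ε μ α s.1 t s.2
      tick (scanCost G U (c.1 ∪ c.2))
      pure (s.1, c)) runs
    match runs'.find? (fun s => Accepts G p U ε μ t s.2) with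
    | some s => pure (some s.2)
    | none => findRuns p U ε μ α ts runs'

/-- Find, in parallel from all vertices of `P`. -/
def find (p : Params) (U : Finset V) (ε μ α : ℝ) (P : List V) :
    RandAlg (Option (Finset V × Finset V)) :=
  findRuns G p U ε μ α (thresholds p (G.total U) μ) (P.map fun i => (i, ∅, ∅))

/-! ## Simple -/

open scoped Classical in
/-- The recursion of Simple, with `α = 1`: one side of a cut of the subgraph induced by `U`, and
whether it succeeded. Every recursive call has fewer vertices, so the first argument does not run
out when it is larger than the number of vertices. -/
def simpleRec (p : Params) (μ : ℝ) : ℕ → Finset V → ℝ → RandAlg (Finset V × Bool)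
  | 0, _, _ => pure (∅, false)
  | fuel + 1, U, ε => do
    if G.total U = 0 ∨ soto (p.sigma ε μ) = 1 / 2 then
      let L ← randomCut U
      pure (L, true)
    else
      let P ← startVertices G p U
      match ← find G p U ε μ 1 P with
      | none => pure (∅, false)
      | some (A, B) =>
        let L ← flip A B
        tick (scanCost G U (A ∪ B))
        let U' := U \ (A ∪ B)
        let r ← simpleRec p μ fuel U' (ε * G.total U / G.total U')
        pure (L ∪ r.1, r.2)

/-- Simple: if the recursion fails, every vertex goes to a random side. -/
def simple (p : Params) (μ : ℝ) (U : Finset V) (ε : ℝ) : RandAlg (Finset V) := do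
  tick (scanCost G U U)
  let r ← simpleRec G p μ (U.card + 1) U ε
  if r.2 then pure r.1 else randomCut U

open scoped Classical in
/-- Simple': the best cut that Simple finds for `ε` with `1 - ε = (1 - γ) ^ r ≥ 1 / 2`. -/
def simple' (p : Params) (μ : ℝ) (U : Finset V) : RandAlg (Finset V) := do
  let cuts ← collect (fun r : ℕ => do
    let L ← simple G p μ U (1 - (1 - p.gamma) ^ r)
    tick (scanCost G U U)
    pure L) (List.range (⌊Real.log 2 / -Real.log (1 - p.gamma)⌋₊ + 1))
  pure ((cuts.argmax fun L => G.edges L (U \ L)).getD ∅)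

/-! ## CutOrBound -/

open scoped Classical in
/-- The vertices of positive degree in decreasing order of (the number of walks that are at `j` at
time `l`) divided by (the degree of `j`), with ties broken arbitrarily. -/
def sweepOrder (U : Finset V) (traces : List (List (V × Bool))) (l : ℕ) : List V :=
  let ratio : V → ℝ := fun j =>
    (traces.countP fun T => T[l]?.map Prod.fst = some j : ℕ) / (G.deg U j : ℝ)
  (U.filter fun j => 0 < G.deg U j).toList.mergeSort fun j k => ratio k ≤ ratio j

open scoped Classical in
/-- CutOrBound: a set of low conductance among the top sets of the sweep orders, if there is
one. -/
def cutOrBound (p : Params) (U : Finset V) (i : V) : RandAlg (Option (Finset V)) := do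
  let m := G.total U
  let ℓ := p.len m p.eps₁ p.mu₁
  let w := ⌈p.walkConst * ℓ ^ 2 * G.lg / p.alpha m⌉₊
  let b := ⌈ℓ / (2 * (1 - 2 * p.phi) * p.alpha m)⌉₊
  let traces ← repeated w (walk G U ℓ (i, false))
  tick (G.lg * (ℓ + 1) * (w + b * (G.maxDeg + 1)))
  let tops := (List.range (ℓ + 1)).flatMap fun l =>
    (List.range b).map fun k => ((sweepOrder G U traces l).take (k + 1)).toFinset
  pure (tops.find? fun S => G.LowConductance U p.phi S)

/-! ## Balance -/

open scoped Classical in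
/-- The recursion of Balance: one side of a cut of the subgraph induced by `U`. Every recursive
call has fewer vertices, so the first argument does not run out when it is larger than the number
of vertices. -/
def balanceRec (p : Params) : ℕ → Finset V → RandAlg (Finset V)
  | 0, _ => pure ∅
  | fuel + 1, U => do
    if G.total U = 0 then randomCut U
    else
      let P ← startVertices G p U
      match ← firstSome (cutOrBound G p U) P with
      | some S =>
        let L₀ ← simple' G p p.mu₂ S
        let L ← flip L₀ (S \ L₀)
        tick (scanCost G U S)
        let L' ← balanceRec p fuel (U \ S)
        pure (L ∪ L')
      | none =>
        match ← find G p U p.eps₁ p.mu₁ (p.alpha (G.total U)) P with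
        | none => randomCut U
        | some (A, B) =>
          let L ← flip A B
          tick (scanCost G U (A ∪ B))
          let L' ← balanceRec p fuel (U \ (A ∪ B))
          pure (L ∪ L')

open scoped Classical in
/-- Balance: the better of the cut that the recursion finds and the random cut. -/
def balance (p : Params) : RandAlg (Finset V) := do
  tick (scanCost G Finset.univ Finset.univ)
  let L ← balanceRec G p (Fintype.card V + 1) Finset.univ
  let L₀ ← randomCut Finset.univ
  tick (scanCost G Finset.univ Finset.univ)
  pure (if G.edges L₀ L₀ᶜ ≤ G.edges L Lᶜ then L else L₀)

end

/-! ## Arbitrary weighted graphs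

Weighted graphs are accessed through the degrees of the vertices and through random incident edges
only. They are reduced to multigraphs of small degree: every vertex is replaced by a number of
copies proportional to its degree, and random edges join random copies of their endpoints. -/

/-- The logarithm of the number of vertices: the cost of a search in a table. -/
def logSize (V : Type) [Fintype V] : ℕ := Nat.clog 2 (Fintype.card V + 2)

section
variable {V : Type} [Fintype V] (W : WGraph V)

/-- The weighted degree of a vertex. -/
def WGraph.deg (v : V) : ℝ≥0 := ∑ u, W.weight v u

/-- The number of copies of a vertex; there are at most `2 * n` copies in all. -/
def WGraph.copyCount (v : V) : ℕ :=
  ⌈(Fintype.card V * W.deg v / ∑ u, W.deg u : ℝ)⌉₊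

/-- The copies of the vertices. -/
abbrev WGraph.Copy : Type := Σ v : V, Fin (W.copyCount v)

open scoped Classical in
/-- A random copy of a vertex. -/
def randomCopy (v : V) : RandAlg (Option W.Copy) :=
  choose (pick fun x : W.Copy => if x.1 = v then 1 else 0)

/-- A random edge, with probability proportional to its weight: a random vertex, with probability
proportional to its degree, and a random incident edge. -/
def randomEdge : RandAlg (Option (V × V)) := do
  tick (logSize V)
  match ← choose (pick W.deg) with
  | none => pure none
  | some u =>
    match ← choose (pick (W.weight u)) with
    | none => pure none
    | some v => pure (some (u, v))

/-- A random edge between random copies of its endpoints. -/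
def randomCopyEdge : RandAlg (Option (W.Copy × W.Copy)) := do
  match ← randomEdge W with
  | none => pure none
  | some (u, v) =>
    match ← randomCopy W u, ← randomCopy W v with
    | some x, some y => pure (some (x, y))
    | _, _ => pure none

open scoped Classical in
/-- The multigraph with a given list of edges. -/
def MultiGraph.ofEdges {X : Type} (es : List (X × X)) : MultiGraph X where
  mult x y := if x = y then 0 else es.countP fun e => e = (x, y) ∨ e = (y, x)
  symm x y := by simp only [eq_comm (a := x) (b := y), or_comm]
  loopless x := by simp

open scoped Classical in
/-- Reduce to small degree, run Balance, and put every vertex on the side of a random copy. -/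
def reduceAndBalance (p : Params) : RandAlg (Finset V) := do
  tick (logSize V * (Fintype.card V + 1))
  let es ← repeated ⌈p.sampleConst * Fintype.card V⌉₊ (randomCopyEdge W)
  let H := MultiGraph.ofEdges es.reduceOption
  tick (logSize V * (Fintype.card V + es.length))
  if (H.maxDeg : ℝ) ≤ p.degConst * logSize V then
    let L ← balance H p
    let sides ← collect (fun v => do
      let x ← randomCopy W v
      pure (v, x)) Finset.univ.toList
    pure (Finset.univ.filter fun v => ∃ x ∈ L, (v, some x) ∈ sides)
  else randomCut Finset.univ

open scoped Classical in
/-- Repeat `O(log n)` times and keep the cut that separates the endpoints of most of `O(log n)`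
random edges. -/
def approxMaxCut (p : Params) : RandAlg (Finset V) := do
  let cuts ← repeated ⌈p.repConst * logSize V⌉₊ (reduceAndBalance W p)
  let es ← repeated ⌈p.repConst * logSize V⌉₊ (randomEdge W)
  tick (logSize V * (cuts.length + 1) * (es.length + 1))
  pure ((cuts.argmax fun L =>
    es.reduceOption.countP fun e => ¬(e.1 ∈ L ↔ e.2 ∈ L)).getD ∅)

end

end MaxCut

end

/-! Let `m` be the sum of the degrees in `G[U]`, and let `q` be the signed density (even minus odd,
divided by degrees) of a lazy walk from `i`. It is `L^ℓ` applied to a point mass, where `L` is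
`lazyOp` with sign `-1`, self-adjoint with `0 ≤ L ≤ 1` for the degree-weighted inner product. If
some cut misses only a fraction `ε` of the edges, its sign vector has Rayleigh quotient at least `1
- ε`, so its moments decay slowly. Expanding that vector in point masses shows that vertices of at
least a fraction `δ/8` of the volume are good starts, from which `‖q‖²` stays above a constant times
`m^{-(1+μ)}` (`exists_large_moment`, `vol_goodStart_ge`). The moments of `L` are logarithmically
convex, so such a norm at time `ℓ` forces the Rayleigh quotient of `q` close to one (`rayleigh_ge`).
Weighted suitably, the tripartitions of `q` by decreasing thresholds have a positive total gain, so
one of them is accepted (`sum_levels_ge`, `exists_accepts`). Sampling `q` to sufficient accuracy is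
affordable if the density of the walk is at most `6α` (`pr_find_none_le`).

If it is not, then some level set met by the walk has low conductance. Otherwise Cheeger's
inequality would contract, in every step, the excess of the density over a slowly rising threshold
(`excess_le`, `density_le_of_expands`); so CutOrBound finds a set (`pr_cutOrBound_none_le`).

For the approximation factor, `E_balanceRec_ge` carries the potential `balanceBound` through the
recursion. A tripartition gains a fixed fraction of its incident edges over one half. A set `S` of
low conductance gains if the optimal cut is almost perfect inside `S`, because Simple' then does
well; the other sets `S` are paid for by the edges that the optimal cut misses. If the optimum
itself is far from all edges, a random cut is good enough (`E_balance_ge`).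

For the running time, success of Find at threshold `t` classifies at least about `1/(t² m^{1+μ})`
vertices, so Find costs about `α m^{1+μ} + 1/α` per classified vertex (`ens_find_cost`). With `α =
m^{-1/2}` this is `m^{1/2+μ}`. A set `S` has about `√m` vertices, and Simple' costs about
`|S|^{1+μ}` per vertex, which is the same. A failed Find costs `m^{3/2+μ}`, but happens at most once
(`ens_balanceRec_cost`). Hence `τ = 1/2` and `μ = min (b - 3/2) 1`.

Weighted graphs are handled by sampling: `O(n)` random edges between copies reproduce all cuts of
the at most `2n` copies up to a small fraction of the total weight, and the optimum is at least half
of that weight (`pr_not_goodSample_le`, `E_balanceSample_ge`). Repetition amplifies the constant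
success probability (`pr_approxMaxCut_lt_le`).

Since only some `δ > 0` is wanted, constants are crude. In particular the slack `η = 8/25` keeps `σ`
above `8/25`, where the ratio demanded from a tripartition is at most `13/25` and a simple rounding
inequality replaces the exact curve. -/

set_option linter.unusedSectionVars false

section
open scoped Classical

noncomputable section

namespace MaxCut

/-! ### Expectations, probabilities and cost assertions for randomized computations -/

namespace RandAlg

variable {α β γ : Type}

/-- The joint law of output and step count as a probability mass function. -/
def toPMF (x : RandAlg α) : PMF (α × ℕ) := x

/-- A computation with finitely many outcomes. -/
class Finitary (x : RandAlg α) : Prop where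
  finite : x.toPMF.support.Finite

/-- The expectation of a real function of the output. -/
def E (x : RandAlg α) (f : α → ℝ) : ℝ := ∑' o : α × ℕ, (x.toPMF o).toReal * f o.1

/-- A property of output and step count that holds for every outcome. -/
def Ens (x : RandAlg α) (P : α → ℕ → Prop) : Prop := ∀ o ∈ x.toPMF.support, P o.1 o.2

/-- The probability that the output has a property. -/
def pr (x : RandAlg α) (Q : α → Prop) : ℝ := E x fun a => if Q a then 1 else 0

theorem runsWithin_iff (x : RandAlg α) (T : ℝ) : x.RunsWithin T ↔ Ens x fun _ k => (k : ℝ) ≤ T :=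
  Iff.rfl

/-! ### Supports -/

theorem toPMF_bind (x : RandAlg α) (f : α → RandAlg β) :
    (x >>= f).toPMF =
      PMF.bind x.toPMF fun a => PMF.map (fun b : β × ℕ => (b.1, a.2 + b.2)) (f a.1).toPMF := rfl

theorem toPMF_pure (a : α) : (pure a : RandAlg α).toPMF = PMF.pure (a, 0) := rfl

theorem toPMF_tick (k : ℕ) : (tick k).toPMF = PMF.pure ((), k) := rfl

theorem toPMF_choose (x : PMF α) : (choose x).toPMF = PMF.map (fun a => (a, 1)) x := rfl

theorem mem_support_bind {x : RandAlg α} {f : α → RandAlg β} {o : β × ℕ} :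
    o ∈ (x >>= f).toPMF.support ↔ ∃ a k j, (a, k) ∈ x.toPMF.support ∧
      (o.1, j) ∈ (f a).toPMF.support ∧ o.2 = k + j := by
  rw [toPMF_bind, PMF.mem_support_bind_iff]
  constructor
  · rintro ⟨⟨a, k⟩, h, h'⟩
    rw [PMF.mem_support_map_iff] at h'
    obtain ⟨⟨b, j⟩, hb, rfl⟩ := h'
    exact ⟨a, k, j, h, hb, rfl⟩
  · rintro ⟨a, k, j, h, h', e⟩
    refine ⟨(a, k), h, ?_⟩
    rw [PMF.mem_support_map_iff]
    exact ⟨(o.1, j), h', by ext <;> simp [e]⟩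

/-- The composition rule of a program logic: `Q` is the assertion between the two stages, and the
final assertion is shifted by the steps already made. Invariants of outputs and worst-case running
times are both proved with it. -/
theorem Ens.bind {x : RandAlg α} {f : α → RandAlg β} {P : β → ℕ → Prop} (Q : α → ℕ → Prop)
    (hx : Ens x Q) (hf : ∀ a k, Q a k → Ens (f a) fun b j => P b (k + j)) : Ens (x >>= f) P := by
  intro o ho
  obtain ⟨a, k, j, h, h', e⟩ := mem_support_bind.1 ho
  rw [e]
  exact hf a k (hx _ h) _ h'

theorem Ens.mono {x : RandAlg α} {P Q : α → ℕ → Prop} (hx : Ens x P) (h : ∀ a k, P a k → Q a k) :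
    Ens x Q := fun o ho => h _ _ (hx o ho)

theorem Ens.and {x : RandAlg α} {P Q : α → ℕ → Prop} (h : Ens x P) (h' : Ens x Q) :
    Ens x fun a k => P a k ∧ Q a k := fun o ho => ⟨h o ho, h' o ho⟩

theorem Ens.true {x : RandAlg α} : Ens x fun _ _ => True := fun _ _ => trivial

@[simp] theorem ens_pure {a : α} {P : α → ℕ → Prop} : Ens (pure a : RandAlg α) P ↔ P a 0 := by
  simp [Ens, toPMF_pure, PMF.support_pure]

@[simp] theorem ens_tick {k : ℕ} {P : Unit → ℕ → Prop} : Ens (tick k) P ↔ P () k := by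
  simp [Ens, toPMF_tick, PMF.support_pure]

theorem ens_choose {x : PMF α} {P : α → ℕ → Prop} :
    Ens (choose x) P ↔ ∀ a ∈ x.support, P a 1 := by
  simp only [Ens, toPMF_choose, PMF.support_map, Set.mem_image]
  constructor
  · intro h a ha
    exact h (a, 1) ⟨a, ha, rfl⟩
  · rintro h _ ⟨a, ha, rfl⟩
    exact h a ha

theorem ens_tick_bind {k : ℕ} {f : Unit → RandAlg β} {P : β → ℕ → Prop}
    (h : Ens (f ()) fun b j => P b (k + j)) : Ens (tick k >>= f) P :=
  Ens.bind (fun _ j => j = k) (ens_tick.2 rfl) (by rintro ⟨⟩ _ rfl; exact h)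

/-! ### Finitely many outcomes -/

instance (a : α) : Finitary (pure a : RandAlg α) :=
  ⟨by rw [toPMF_pure, PMF.support_pure]; exact Set.finite_singleton _⟩

instance (k : ℕ) : Finitary (tick k) :=
  ⟨by rw [toPMF_tick, PMF.support_pure]; exact Set.finite_singleton _⟩

instance [Finite α] (x : PMF α) : Finitary (choose x) :=
  ⟨by rw [toPMF_choose, PMF.support_map]; exact (Set.toFinite _).image _⟩

instance (x : RandAlg α) (f : α → RandAlg β) [hx : Finitary x] [hf : ∀ a, Finitary (f a)] :
    Finitary (x >>= f) :=
  ⟨by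
    rw [toPMF_bind, PMF.support_bind]
    refine hx.finite.biUnion fun a _ => ?_
    rw [PMF.support_map]
    exact (hf a.1).finite.image _⟩

instance : Finitary coin := by unfold coin; infer_instance

instance (a b : α) : Finitary (flip a b) := by unfold flip; infer_instance

instance (f : α → RandAlg β) [∀ a, Finitary (f a)] (l : List α) : Finitary (collect f l) := by
  induction l with
  | nil => unfold collect; infer_instance
  | cons a l ih => unfold collect; infer_instance

instance (k : ℕ) (x : RandAlg α) [Finitary x] : Finitary (repeated k x) := by
  unfold repeated; infer_instance

instance (f : α → RandAlg (Option β)) [∀ a, Finitary (f a)] (l : List α) :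
    Finitary (firstSome f l) := by
  induction l with
  | nil => unfold firstSome; infer_instance
  | cons a l ih =>
    unfold firstSome
    refine @instFinitaryBind _ _ _ _ _ fun o => ?_
    cases o
    · exact ih
    · infer_instance

/-! ### Expectations -/

/-- Finite support makes the expectation a finite sum, so that no summability has to be checked for
linearity and monotonicity. -/
theorem E_eq_sum (x : RandAlg α) [hx : Finitary x] (f : α → ℝ) :
    E x f = ∑ o ∈ hx.finite.toFinset, (x.toPMF o).toReal * f o.1 := by
  refine tsum_eq_sum fun o ho => ?_
  have : x.toPMF o = 0 := by
    by_contra h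
    exact ho (hx.finite.mem_toFinset.2 ((PMF.mem_support_iff _ _).2 h))
  simp [this]

theorem E_one (x : RandAlg α) : E x (fun _ => 1) = 1 := by
  unfold E
  simp only [mul_one]
  rw [← ENNReal.tsum_toReal_eq fun o => PMF.apply_ne_top _ _, PMF.tsum_coe, ENNReal.toReal_one]

theorem E_add (x : RandAlg α) [Finitary x] (f g : α → ℝ) :
    E x (fun a => f a + g a) = E x f + E x g := by
  simp only [E_eq_sum, mul_add, Finset.sum_add_distrib]

theorem E_sub (x : RandAlg α) [Finitary x] (f g : α → ℝ) :
    E x (fun a => f a - g a) = E x f - E x g := by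
  simp only [E_eq_sum, mul_sub, Finset.sum_sub_distrib]

theorem E_mul_left (x : RandAlg α) (c : ℝ) (f : α → ℝ) :
    E x (fun a => c * f a) = c * E x f := by
  unfold E
  rw [← tsum_mul_left]
  congr 1; ext o; ring

theorem E_mul_right (x : RandAlg α) (c : ℝ) (f : α → ℝ) :
    E x (fun a => f a * c) = E x f * c := by
  simp only [mul_comm _ c, E_mul_left]

@[simp] theorem E_const (x : RandAlg α) (c : ℝ) : E x (fun _ => c) = c := by
  have := E_mul_left x c fun _ => 1
  simpa [E_one] using this

theorem E_sum {ι : Type} (x : RandAlg α) [Finitary x] (s : Finset ι) (f : ι → α → ℝ) :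
    E x (fun a => ∑ i ∈ s, f i a) = ∑ i ∈ s, E x (f i) := by
  induction s using Finset.induction_on with
  | empty => simp
  | insert i s hi ih => simp only [Finset.sum_insert hi, E_add, ih]

/-- Only outcomes in the support count, so invariants established by `Ens` may be used under an
expectation. -/
theorem E_mono_of_ens {x : RandAlg α} [hx : Finitary x] {f g : α → ℝ}
    (h : Ens x fun a _ => f a ≤ g a) : E x f ≤ E x g := by
  rw [E_eq_sum, E_eq_sum]
  refine Finset.sum_le_sum fun o ho => mul_le_mul_of_nonneg_left ?_ ENNReal.toReal_nonneg
  exact h o (hx.finite.mem_toFinset.1 ho)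

theorem E_mono (x : RandAlg α) [Finitary x] {f g : α → ℝ} (h : ∀ a, f a ≤ g a) : E x f ≤ E x g :=
  E_mono_of_ens fun o _ => h o.1

theorem E_congr_of_ens {x : RandAlg α} [Finitary x] {f g : α → ℝ}
    (h : Ens x fun a _ => f a = g a) : E x f = E x g :=
  le_antisymm (E_mono_of_ens (h.mono fun _ _ e => e.le)) (E_mono_of_ens (h.mono fun _ _ e => e.ge))

theorem E_nonneg (x : RandAlg α) {f : α → ℝ} (h : ∀ a, 0 ≤ f a) : 0 ≤ E x f :=
  tsum_nonneg fun o => mul_nonneg ENNReal.toReal_nonneg (h o.1)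

theorem le_E_of_ens {x : RandAlg α} [Finitary x] {f : α → ℝ} {c : ℝ}
    (h : Ens x fun a _ => c ≤ f a) : c ≤ E x f := by
  rw [← E_const x c]; exact E_mono_of_ens h

theorem E_le_of_ens {x : RandAlg α} [Finitary x] {f : α → ℝ} {c : ℝ}
    (h : Ens x fun a _ => f a ≤ c) : E x f ≤ c := by
  rw [← E_const x c]; exact E_mono_of_ens h

@[simp] theorem E_pure (a : α) (f : α → ℝ) : E (pure a : RandAlg α) f = f a := by
  unfold E
  rw [toPMF_pure, tsum_eq_single (a, 0)]
  · simp
  · intro o ho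
    simp [PMF.pure_apply, ho]

theorem toReal_bind_apply {ι κ : Type} (μ : PMF ι) (k : ι → PMF κ) (hμ : μ.support.Finite) (b : κ) :
    (PMF.bind μ k b).toReal = ∑ a ∈ hμ.toFinset, (μ a).toReal * (k a b).toReal := by
  rw [PMF.bind_apply, tsum_eq_sum (s := hμ.toFinset), ENNReal.toReal_sum]
  · simp only [ENNReal.toReal_mul]
  · exact fun a _ => ENNReal.mul_ne_top (PMF.apply_ne_top _ _) (PMF.apply_ne_top _ _)
  · intro a ha
    have : μ a = 0 := by
      by_contra h
      exact ha (hμ.mem_toFinset.2 ((PMF.mem_support_iff _ _).2 h))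
    simp [this]

theorem tsum_map {ι κ : Type} (μ : PMF ι) (hμ : μ.support.Finite) (g : ι → κ) (f : κ → ℝ) :
    ∑' b, (PMF.map g μ b).toReal * f b = ∑ a ∈ hμ.toFinset, (μ a).toReal * f (g a) := by
  have key : ∀ b, (PMF.map g μ b).toReal * f b =
      ∑ a ∈ hμ.toFinset, if b = g a then (μ a).toReal * f (g a) else 0 := by
    intro b
    have := toReal_bind_apply μ (fun a => PMF.pure (g a)) hμ b
    rw [show PMF.map g μ = PMF.bind μ fun a => PMF.pure (g a) from rfl, this, Finset.sum_mul]
    refine Finset.sum_congr rfl fun a _ => ?_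
    by_cases h : b = g a
    · simp [PMF.pure_apply, h]
    · simp [PMF.pure_apply, h]
  simp only [key]
  rw [Summable.tsum_finsetSum]
  · refine Finset.sum_congr rfl fun a _ => ?_
    rw [tsum_ite_eq]
  · intro a _
    refine summable_of_hasFiniteSupport ((Set.finite_singleton (g a)).subset ?_)
    intro b hb
    by_contra h
    exact hb (if_neg h)

/-- The tower property. Finiteness of both supports justifies the exchange of the two sums. -/
theorem E_bind (x : RandAlg α) [hx : Finitary x] (f : α → RandAlg β) [hf : ∀ a, Finitary (f a)]
    (g : β → ℝ) : E (x >>= f) g = E x fun a => E (f a) g := by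
  rw [E_eq_sum x]
  unfold E
  simp only [toPMF_bind, toReal_bind_apply _ _ hx.finite, Finset.sum_mul, mul_assoc]
  rw [Summable.tsum_finsetSum]
  · refine Finset.sum_congr rfl fun a _ => ?_
    rw [tsum_mul_left, tsum_map _ (hf a.1).finite _ fun o : β × ℕ => g o.1]
    congr 1
    exact (E_eq_sum (f a.1) g).symm
  · intro a _
    refine Summable.mul_left _ (summable_of_hasFiniteSupport ?_)
    refine ((hf a.1).finite.image fun b : β × ℕ => (b.1, a.2 + b.2)).subset ?_
    intro o ho
    rw [← PMF.support_map]
    rw [PMF.mem_support_iff]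
    intro h
    exact ho (by simp only [h, ENNReal.toReal_zero, zero_mul])

@[simp] theorem E_tick_bind (k : ℕ) (f : Unit → RandAlg β) [∀ a, Finitary (f a)] (g : β → ℝ) :
    E (tick k >>= f) g = E (f ()) g := by
  rw [E_bind]
  have := E_const (tick k) (E (f ()) g)
  exact this

theorem E_choose [Fintype α] (μ : PMF α) (f : α → ℝ) :
    E (choose μ) f = ∑ a, (μ a).toReal * f a := by
  unfold E
  rw [toPMF_choose, tsum_map μ (Set.toFinite _)]
  refine Finset.sum_subset (Finset.subset_univ _) fun a _ ha => ?_
  have : μ a = 0 := by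
    by_contra h
    exact ha ((Set.toFinite _).mem_toFinset.2 ((PMF.mem_support_iff _ _).2 h))
  simp [this]

theorem E_coin (f : Bool → ℝ) : E coin f = (f true + f false) / 2 := by
  unfold coin
  rw [E_choose]
  simp
  ring

theorem E_flip (a b : α) (f : α → ℝ) : E (flip a b) f = (f a + f b) / 2 := by
  unfold flip
  rw [E_bind, E_coin]
  simp

theorem expect_eq [Fintype α] (x : RandAlg α) [hx : Finitary x] (f : α → ℝ) :
    x.expect f = E x f := by
  unfold RandAlg.expect RandAlg.law
  rw [E_eq_sum, ← tsum_fintype (L := SummationFilter.unconditional _)]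
  exact tsum_map x.toPMF hx.finite Prod.fst f

/-! ### Probabilities -/

theorem prob_eq [Fintype α] (x : RandAlg α) [hx : Finitary x] (s : Set α) :
    x.prob s = pr x (· ∈ s) := by
  unfold RandAlg.prob pr
  rw [← expect_eq, RandAlg.expect, PMF.toOuterMeasure_apply_fintype, ENNReal.toReal_sum]
  · refine Finset.sum_congr rfl fun a _ => ?_
    by_cases h : a ∈ s <;> simp [h]
  · intro a _
    by_cases h : a ∈ s <;> simp [h, PMF.apply_ne_top]

theorem pr_nonneg (x : RandAlg α) (Q : α → Prop) : 0 ≤ pr x Q :=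
  E_nonneg x fun a => by split_ifs <;> norm_num

theorem pr_mono_of_ens {x : RandAlg α} [Finitary x] {Q R : α → Prop}
    (h : Ens x fun a _ => Q a → R a) : pr x Q ≤ pr x R := by
  refine E_mono_of_ens (h.mono fun a _ e => ?_)
  by_cases hq : Q a
  · simp [hq, e hq]
  · simp only [hq, if_false]; split_ifs <;> norm_num

theorem pr_mono (x : RandAlg α) [Finitary x] {Q R : α → Prop} (h : ∀ a, Q a → R a) :
    pr x Q ≤ pr x R := pr_mono_of_ens fun o _ => h o.1

theorem pr_le_one (x : RandAlg α) [Finitary x] (Q : α → Prop) : pr x Q ≤ 1 :=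
  E_le_of_ens fun o _ => by show ite _ _ _ ≤ _; split_ifs <;> norm_num

theorem pr_or_le (x : RandAlg α) [Finitary x] (Q R : α → Prop) :
    pr x (fun a => Q a ∨ R a) ≤ pr x Q + pr x R := by
  unfold pr
  rw [← E_add]
  refine E_mono x fun a => ?_
  by_cases h : Q a <;> by_cases h' : R a <;> simp [h, h']

theorem pr_not (x : RandAlg α) [Finitary x] (Q : α → Prop) : pr x (fun a => ¬Q a) = 1 - pr x Q := by
  unfold pr
  rw [← E_one x, ← E_sub]
  congr 1; ext a
  by_cases h : Q a <;> simp [h]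

theorem pr_exists_le {ι : Type} (x : RandAlg α) [Finitary x] (s : Finset ι) (Q : ι → α → Prop) :
    pr x (fun a => ∃ i ∈ s, Q i a) ≤ ∑ i ∈ s, pr x (Q i) := by
  unfold pr
  rw [← E_sum]
  refine E_mono x fun a => ?_
  by_cases h : ∃ i ∈ s, Q i a
  · obtain ⟨i, hi, hq⟩ := h
    rw [if_pos ⟨i, hi, hq⟩]
    have := Finset.single_le_sum (s := s) (f := fun i => if Q i a then (1 : ℝ) else 0)
      (fun j _ => by split_ifs <;> norm_num) hi
    simpa [hq] using this
  · rw [if_neg h]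
    exact Finset.sum_nonneg fun j _ => by split_ifs <;> norm_num

theorem pr_exists_le_card {ι : Type} (x : RandAlg α) [Finitary x] (s : Finset ι)
    (Q : ι → α → Prop) {c : ℝ} (h : ∀ i ∈ s, pr x (Q i) ≤ c) :
    pr x (fun a => ∃ i ∈ s, Q i a) ≤ s.card * c := by
  refine (pr_exists_le x s Q).trans ?_
  rw [← nsmul_eq_mul]
  exact Finset.sum_le_card_nsmul s _ c h

/-- A union bound along sequential composition: `R` collects the bad outcomes of the first stage,
and `d` bounds the failure of the second stage after a good one. -/
theorem pr_bind_le {x : RandAlg α} [Finitary x] {f : α → RandAlg β} [∀ a, Finitary (f a)]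
    {Q : β → Prop} (R : α → Prop) {c d : ℝ} (hx : pr x R ≤ c) (hd : 0 ≤ d)
    (hf : ∀ a, ¬R a → pr (f a) Q ≤ d) : pr (x >>= f) Q ≤ c + d := by
  unfold pr at *
  rw [E_bind]
  have : E x (fun a => (if R a then 1 else 0) + d) ≤ c + d := by rw [E_add, E_const]; linarith
  refine (E_mono x fun a => ?_).trans this
  by_cases h : R a
  · have := pr_le_one (f a) Q
    unfold pr at this
    simp only [h, if_true]; linarith
  · simp only [h, if_false]; linarith [hf a h]

theorem pr_eq_zero {x : RandAlg α} [Finitary x] {Q : α → Prop} (h : Ens x fun a _ => ¬Q a) :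
    pr x Q = 0 := by
  refine le_antisymm (E_le_of_ens (h.mono fun a _ e => by simp [e])) (pr_nonneg x Q)

/-! ### Lists of independent runs -/

/-- Independence of the runs, as multiplicativity of expectations. The Chernoff bound and the
independence of the sides of random copies are derived from it. -/
theorem E_collect_prod (f : α → RandAlg β) [∀ a, Finitary (f a)] (h : α → ℝ) (k : β → ℝ)
    (l : List α) (hk : ∀ a ∈ l, E (f a) k = h a) :
    E (collect f l) (fun bs => (bs.map k).prod) = (l.map h).prod := by
  induction l with
  | nil => simp [collect]
  | cons a l ih =>
    unfold collect
    rw [E_bind]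
    simp only [E_bind, E_pure, List.map_cons, List.prod_cons, E_mul_left, E_mul_right,
      ih fun b hb => hk b (List.mem_cons_of_mem _ hb)]
    rw [hk a List.mem_cons_self]

theorem E_repeated_prod (x : RandAlg α) [Finitary x] (k : α → ℝ) (w : ℕ) :
    E (repeated w x) (fun bs => (bs.map k).prod) = E x k ^ w := by
  unfold repeated
  rw [E_collect_prod (fun _ : ℕ => x) (fun _ => E x k) k _ fun _ _ => rfl]
  simp

theorem ens_collect_length (f : α → RandAlg β) (l : List α) :
    Ens (collect f l) fun bs _ => bs.length = l.length := by
  induction l with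
  | nil => simp [collect]
  | cons a l ih =>
    unfold collect
    refine Ens.bind (fun _ _ => True) Ens.true fun b _ _ => ?_
    refine Ens.bind (fun bs _ => bs.length = l.length) ih fun bs _ h => ?_
    simp [h]

theorem ens_repeated_length (x : RandAlg α) (w : ℕ) :
    Ens (repeated w x) fun bs _ => bs.length = w := by
  have := ens_collect_length (fun _ : ℕ => x) (List.range w)
  simpa [repeated] using this

theorem ens_collect_forall {f : α → RandAlg β} {P : α → β → Prop} {l : List α}
    (h : ∀ a ∈ l, Ens (f a) fun b _ => P a b) :
    Ens (collect f l) fun bs _ => ∀ b ∈ bs, ∃ a ∈ l, P a b := by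
  induction l with
  | nil => simp [collect]
  | cons a l ih =>
    unfold collect
    refine Ens.bind (fun b _ => P a b) (h a List.mem_cons_self) fun b _ hb => ?_
    refine Ens.bind _ (ih fun c hc => h c (List.mem_cons_of_mem _ hc)) fun bs _ hbs => ?_
    simp only [ens_pure, List.mem_cons, forall_eq_or_imp]
    refine ⟨⟨a, Or.inl rfl, hb⟩, fun c hc => ?_⟩
    obtain ⟨d, hd, hp⟩ := hbs c hc
    exact ⟨d, Or.inr hd, hp⟩

/-- If one of the runs yields an output with property `Q` except with probability `c`, some output
has it except with probability `c`. -/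
theorem pr_collect_le (f : α → RandAlg β) [∀ a, Finitary (f a)] (Q : β → Prop) {c : ℝ} {a : α}
    {l : List α} (ha : a ∈ l) (hc : pr (f a) (fun b => ¬Q b) ≤ c) :
    pr (collect f l) (fun bs => ∀ b ∈ bs, ¬Q b) ≤ c := by
  induction l with
  | nil => simp at ha
  | cons a' l ih =>
    unfold collect
    rcases List.mem_cons.1 ha with rfl | h
    · have := pr_bind_le (x := f a) (f := fun b => do let bs ← collect f l; pure (b :: bs))
        (Q := fun bs => ∀ b ∈ bs, ¬Q b) (fun b => ¬Q b) hc le_rfl fun b hb => ?_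
      · simpa using this
      · rw [pr_eq_zero]
        refine Ens.bind (fun _ _ => True) Ens.true fun bs _ _ => ?_
        rw [ens_pure]
        exact fun h => h b List.mem_cons_self (not_not.1 hb)
    · unfold pr at *
      rw [E_bind]
      refine E_le_of_ens fun o _ => ?_
      show E _ _ ≤ _
      rw [E_bind]
      refine (E_mono _ fun bs => ?_).trans (ih h)
      rw [E_pure]
      by_cases hb : ∀ b ∈ o.1 :: bs, ¬Q b
      · rw [if_pos hb, if_pos fun b hb' => hb b (List.mem_cons_of_mem _ hb')]
      · rw [if_neg hb]; split_ifs <;> norm_num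

theorem pr_repeated_all (x : RandAlg α) [Finitary x] (Q : α → Prop) (w : ℕ) :
    pr (repeated w x) (fun bs => ∀ b ∈ bs, Q b) = pr x Q ^ w := by
  unfold pr
  rw [← E_repeated_prod]
  congr 1; ext bs
  induction bs with
  | nil => simp
  | cons b bs ih =>
    simp only [List.forall_mem_cons, List.map_cons, List.prod_cons, ← ih]
    by_cases h : Q b <;> simp [h]

/-! ### A Chernoff bound -/

theorem exp_countP (lam : ℝ) (Q : α → Prop) (bs : List α) :
    Real.exp (lam * (bs.countP fun a => Q a : ℕ)) =
      (bs.map fun a => if Q a then Real.exp lam else 1).prod := by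
  induction bs with
  | nil => simp
  | cons b bs ih =>
    rw [List.map_cons, List.prod_cons, ← ih, List.countP_cons]
    by_cases h : Q b
    · simp only [h, decide_true, if_true]
      rw [← Real.exp_add]
      push_cast
      ring_nf
    · simp [h]

/-- The moment generating function factors over the independent runs, and `1 + z ≤ e^z` bounds each
factor. -/
theorem E_exp_countP_le (x : RandAlg α) [Finitary x] (Q : α → Prop) (lam : ℝ) (w : ℕ) :
    E (repeated w x) (fun bs => Real.exp (lam * (bs.countP fun a => Q a : ℕ))) ≤
      Real.exp (w * (pr x Q * (Real.exp lam - 1))) := by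
  simp only [exp_countP]
  rw [E_repeated_prod, Real.exp_nat_mul]
  have e : E x (fun a => if Q a then Real.exp lam else 1) = 1 + pr x Q * (Real.exp lam - 1) := by
    unfold pr
    rw [← E_mul_right]
    conv_rhs => rw [← E_one x, ← E_add]
    congr 1; ext a
    by_cases h : Q a <;> simp [h]
  refine pow_le_pow_left₀ (E_nonneg x fun a => by split_ifs <;> positivity) ?_ w
  rw [e, add_comm]
  exact Real.add_one_le_exp _

/-- Markov's inequality for the exponential of `f`. -/
theorem pr_le_of_exp (x : RandAlg α) [Finitary x] (f : α → ℝ) (c B : ℝ)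
    (h : E x (fun a => Real.exp (f a)) ≤ Real.exp B) :
    pr x (fun a => c ≤ f a) ≤ Real.exp (B - c) := by
  have : pr x (fun a => c ≤ f a) ≤ E x fun a => Real.exp (f a) * Real.exp (-c) := by
    refine E_mono x fun a => ?_
    by_cases hc : c ≤ f a
    · rw [if_pos hc, ← Real.exp_add]; exact Real.one_le_exp (by linarith)
    · rw [if_neg hc]; positivity
  rw [E_mul_right] at this
  refine this.trans ?_
  rw [sub_eq_add_neg, Real.exp_add]
  exact mul_le_mul_of_nonneg_right h (Real.exp_pos _).le

/-- The deviation is measured against an upper bound `M` of the success probability, since only such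
a bound is known in the applications. Exponentiating at `u/2`, the second-order term is at most `M
u²/4` per trial, half of the gain `M u²/2` from the deviation. -/
theorem chernoff_upper (x : RandAlg α) [Finitary x] (Q : α → Prop) (w : ℕ) {M u : ℝ}
    (hM : pr x Q ≤ M) (h0 : 0 ≤ u) (h1 : u ≤ 1) :
    pr (repeated w x) (fun bs => w * (pr x Q + u * M) ≤ (bs.countP fun a => Q a : ℕ)) ≤
      Real.exp (-(w * u ^ 2 * M / 4)) := by
  have hp := pr_nonneg x Q
  rcases h0.eq_or_lt with rfl | hu
  · simpa using pr_le_one _ _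
  have h := pr_le_of_exp (repeated w x) (fun bs => u / 2 * (bs.countP fun a => Q a : ℕ))
    (u / 2 * (w * (pr x Q + u * M))) _ (E_exp_countP_le x Q (u / 2) w)
  refine (pr_mono _ fun bs hb => ?_).trans (h.trans (Real.exp_le_exp.2 ?_))
  · exact mul_le_mul_of_nonneg_left hb (by positivity)
  · have he : Real.exp (u / 2) - 1 ≤ u / 2 + (u / 2) ^ 2 := by
      have := Real.abs_exp_sub_one_sub_id_le (x := u / 2) (by rw [abs_of_nonneg] <;> linarith)
      have := (abs_le.1 this).2
      linarith
    have hw : (0 : ℝ) ≤ w := Nat.cast_nonneg w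
    have h2 : pr x Q * (Real.exp (u / 2) - 1) ≤ pr x Q * (u / 2) + M * (u / 2) ^ 2 := by
      have := mul_le_mul_of_nonneg_left he hp
      nlinarith [sq_nonneg u]
    have := mul_le_mul_of_nonneg_left h2 hw
    nlinarith

theorem chernoff_lower (x : RandAlg α) [Finitary x] (Q : α → Prop) (w : ℕ) {M u : ℝ}
    (hM : pr x Q ≤ M) (h0 : 0 ≤ u) (h1 : u ≤ 1) :
    pr (repeated w x) (fun bs => ((bs.countP fun a => Q a : ℕ) : ℝ) ≤ w * (pr x Q - u * M)) ≤
      Real.exp (-(w * u ^ 2 * M / 4)) := by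
  have hp := pr_nonneg x Q
  rcases h0.eq_or_lt with rfl | hu
  · simpa using pr_le_one _ _
  have h := pr_le_of_exp (repeated w x) (fun bs => -(u / 2) * (bs.countP fun a => Q a : ℕ))
    (-(u / 2) * (w * (pr x Q - u * M))) _ (E_exp_countP_le x Q (-(u / 2)) w)
  refine (pr_mono _ fun bs hb => ?_).trans (h.trans (Real.exp_le_exp.2 ?_))
  · exact mul_le_mul_of_nonpos_left hb (by linarith)
  · have he : Real.exp (-(u / 2)) - 1 ≤ -(u / 2) + (u / 2) ^ 2 := by
      have := Real.abs_exp_sub_one_sub_id_le (x := -(u / 2))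
        (by rw [abs_neg, abs_of_nonneg] <;> linarith)
      have := (abs_le.1 this).2
      nlinarith
    have hw : (0 : ℝ) ≤ w := Nat.cast_nonneg w
    have h2 : pr x Q * (Real.exp (-(u / 2)) - 1) ≤ pr x Q * (-(u / 2)) + M * (u / 2) ^ 2 := by
      have := mul_le_mul_of_nonneg_left he hp
      nlinarith [sq_nonneg u]
    have := mul_le_mul_of_nonneg_left h2 hw
    nlinarith

/-- The number of successes in `w` independent trials is close to its expectation. -/
theorem chernoff (x : RandAlg α) [Finitary x] (Q : α → Prop) (w : ℕ) {M u : ℝ}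
    (hM : pr x Q ≤ M) (h0 : 0 ≤ u) (h1 : u ≤ 1) :
    pr (repeated w x) (fun bs => w * (u * M) ≤ |((bs.countP fun a => Q a : ℕ) : ℝ) - w * pr x Q|) ≤
      2 * Real.exp (-(w * u ^ 2 * M / 4)) := by
  have a := chernoff_upper x Q w hM h0 h1
  have b := chernoff_lower x Q w hM h0 h1
  rw [two_mul]
  refine (pr_mono _ fun bs h => ?_).trans ((pr_or_le _ _ _).trans (add_le_add a b))
  rcases le_abs.1 h with h | h
  · left; rw [mul_add]; linarith
  · right; rw [mul_sub]; linarith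

end RandAlg

namespace MultiGraph

variable {V : Type} (G : MultiGraph V) (U : Finset V)

/-! ### The lazy walk operator and its quadratic forms -/

theorem sum_mult_comm (F : V → V → ℝ) :
    ∑ j ∈ U, ∑ k ∈ U, (G.mult j k : ℝ) * F j k = ∑ j ∈ U, ∑ k ∈ U, (G.mult j k : ℝ) * F k j := by
  rw [Finset.sum_comm]
  simp only [G.symm]

theorem cast_deg (j : V) : (G.deg U j : ℝ) = ∑ k ∈ U, (G.mult j k : ℝ) := by
  simp [deg]

theorem sum_mult_left (f : V → ℝ) :
    ∑ j ∈ U, ∑ k ∈ U, (G.mult j k : ℝ) * f j = ∑ j ∈ U, G.deg U j * f j := by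
  simp only [cast_deg, Finset.sum_mul]

theorem sum_mult_right (f : V → ℝ) :
    ∑ j ∈ U, ∑ k ∈ U, (G.mult j k : ℝ) * f k = ∑ j ∈ U, G.deg U j * f j := by
  rw [G.sum_mult_comm U fun _ k => f k, sum_mult_left]

theorem cast_total : (G.total U : ℝ) = ∑ j ∈ U, (G.deg U j : ℝ) := by
  simp [total, vol]

theorem cast_vol (S : Finset V) : (G.vol U S : ℝ) = ∑ j ∈ S, (G.deg U j : ℝ) := by
  simp [vol]

theorem sum_mult_eq_total : ∑ j ∈ U, ∑ k ∈ U, (G.mult j k : ℝ) = G.total U := by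
  simp only [cast_total, cast_deg]

/-- The operator of the lazy walk on the subgraph induced by `U`; with `s = -1`, moves change the
sign. -/
def lazyOp (s : ℝ) (f : V → ℝ) (j : V) : ℝ :=
  if G.deg U j = 0 then f j else (f j + s * (∑ k ∈ U, G.mult j k * f k) / G.deg U j) / 2

/-- The inner product weighted by degrees. -/
def ip (f g : V → ℝ) : ℝ := ∑ j ∈ U, G.deg U j * f j * g j

/-- The Dirichlet form. -/
def form (f : V → ℝ) : ℝ := (∑ j ∈ U, ∑ k ∈ U, (G.mult j k : ℝ) * (f j - f k) ^ 2) / 2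

theorem ip_comm (f g : V → ℝ) : G.ip U f g = G.ip U g f :=
  Finset.sum_congr rfl fun _ _ => by ring

theorem ip_self_nonneg (f : V → ℝ) : 0 ≤ G.ip U f f :=
  Finset.sum_nonneg fun j _ => by rw [mul_assoc]; exact mul_nonneg (by positivity) (mul_self_nonneg _)

theorem ip_add_mul (f g h : V → ℝ) (t : ℝ) :
    G.ip U f (fun j => g j + t * h j) = G.ip U f g + t * G.ip U f h := by
  simp only [ip, Finset.mul_sum, ← Finset.sum_add_distrib]
  exact Finset.sum_congr rfl fun _ _ => by ring

theorem sum_mult_eq_zero {j : V} (hj : G.deg U j = 0) (f : V → ℝ) :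
    ∑ k ∈ U, G.mult j k * f k = 0 := by
  refine Finset.sum_eq_zero fun k hk => ?_
  have := (Finset.sum_eq_zero_iff.1 hj) k hk
  simp [this]

/-- After multiplication by the degree, the two cases of the definition obey one formula, because a
vertex of degree zero contributes nothing. -/
theorem deg_mul_lazyOp (s : ℝ) (f : V → ℝ) (j : V) :
    G.deg U j * G.lazyOp U s f j = (G.deg U j * f j + s * ∑ k ∈ U, G.mult j k * f k) / 2 := by
  unfold lazyOp
  split_ifs with h
  · rw [sum_mult_eq_zero G U h, h]; simp
  · have : (G.deg U j : ℝ) ≠ 0 := by exact_mod_cast h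
    field_simp

theorem ip_lazyOp (s : ℝ) (f g : V → ℝ) : G.ip U g (G.lazyOp U s f) =
    (G.ip U g f + s * ∑ j ∈ U, ∑ k ∈ U, G.mult j k * (g j * f k)) / 2 := by
  have : ∀ j, G.deg U j * g j * G.lazyOp U s f j =
      (G.deg U j * g j * f j + s * ∑ k ∈ U, G.mult j k * (g j * f k)) / 2 := by
    intro j
    have h := G.deg_mul_lazyOp U s f j
    have e : ∑ k ∈ U, (G.mult j k : ℝ) * (g j * f k) = g j * ∑ k ∈ U, G.mult j k * f k := by
      rw [Finset.mul_sum]; exact Finset.sum_congr rfl fun _ _ => by ring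
    rw [e]
    linear_combination g j * h
  simp only [ip, this, Finset.mul_sum, ← Finset.sum_add_distrib, ← Finset.sum_div]

theorem ip_lazyOp_comm (s : ℝ) (f g : V → ℝ) :
    G.ip U (G.lazyOp U s f) g = G.ip U f (G.lazyOp U s g) := by
  rw [ip_comm, ip_lazyOp, ip_lazyOp, ip_comm G U g f, G.sum_mult_comm U fun j k => g j * f k]
  simp only [mul_comm (g _)]

theorem ip_self_eq (f : V → ℝ) :
    G.ip U f f = (∑ j ∈ U, ∑ k ∈ U, (G.mult j k : ℝ) * (f j ^ 2 + f k ^ 2)) / 2 := by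
  simp only [mul_add, Finset.sum_add_distrib]
  rw [G.sum_mult_left U fun j => f j ^ 2, G.sum_mult_right U fun j => f j ^ 2]
  simp only [ip, pow_two, mul_assoc]
  ring

/-- Laziness completes the square: half of the identity plus `s/2` times the walk is a sum of
squares over the edges. Positivity follows without spectral theory. -/
theorem ip_lazyOp_self {s : ℝ} (hs : s ^ 2 = 1) (f : V → ℝ) :
    G.ip U f (G.lazyOp U s f) =
      (∑ j ∈ U, ∑ k ∈ U, (G.mult j k : ℝ) * (f j + s * f k) ^ 2) / 4 := by
  rw [ip_lazyOp, ip_self_eq]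
  simp only [Finset.mul_sum, Finset.sum_div, ← Finset.sum_add_distrib]
  refine Finset.sum_congr rfl fun j _ => Finset.sum_congr rfl fun k _ => ?_
  linear_combination (-(G.mult j k : ℝ) * f k ^ 2 / 4) * hs

theorem ip_lazyOp_nonneg {s : ℝ} (hs : s ^ 2 = 1) (f : V → ℝ) :
    0 ≤ G.ip U f (G.lazyOp U s f) := by
  rw [ip_lazyOp_self G U hs]
  positivity

/-- The forms of the operators for `s` and `-s` add up to the inner product, so positivity of one is
the upper bound for the other. -/
theorem ip_lazyOp_le {s : ℝ} (hs : s ^ 2 = 1) (f : V → ℝ) :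
    G.ip U f (G.lazyOp U s f) ≤ G.ip U f f := by
  have h := G.ip_lazyOp_nonneg U (s := -s) (by simpa using hs) f
  rw [ip_lazyOp] at h ⊢
  linarith

/-- The form in terms of the alternating walk. -/
theorem form_eq_neg (f : V → ℝ) : G.form U f = 2 * G.ip U f (G.lazyOp U (-1) f) := by
  rw [ip_lazyOp_self G U (by norm_num), form]
  simp only [neg_one_mul, ← sub_eq_add_neg]
  ring

theorem form_eq (f : V → ℝ) : G.form U f = 2 * (G.ip U f f - G.ip U f (G.lazyOp U 1 f)) := by
  rw [form_eq_neg, ip_lazyOp, ip_lazyOp]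
  ring

theorem lazyOp_add_mul (s : ℝ) (f g : V → ℝ) (t : ℝ) :
    G.lazyOp U s (fun j => f j + t * g j) = fun j => G.lazyOp U s f j + t * G.lazyOp U s g j := by
  ext j
  unfold lazyOp
  split_ifs
  · rfl
  · have : ∑ k ∈ U, (G.mult j k : ℝ) * (f k + t * g k) =
        ∑ k ∈ U, G.mult j k * f k + t * ∑ k ∈ U, G.mult j k * g k := by
      rw [Finset.mul_sum, ← Finset.sum_add_distrib]
      exact Finset.sum_congr rfl fun _ _ => by ring
    rw [this]; ring

theorem sq_le_mul_of_forall_nonneg {a b c : ℝ} (h : ∀ t : ℝ, 0 ≤ a + t * (2 * b) + t ^ 2 * c) :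
    b ^ 2 ≤ a * c := by
  have := discrim_le_zero (a := c) (b := 2 * b) (c := a) fun t => by linarith [h t]
  unfold discrim at this
  linarith

theorem ip_sq_le (f g : V → ℝ) : G.ip U f g ^ 2 ≤ G.ip U f f * G.ip U g g := by
  refine sq_le_mul_of_forall_nonneg fun t => ?_
  have := G.ip_self_nonneg U fun j => f j + t * g j
  rw [ip_add_mul, ip_comm, ip_add_mul, ip_comm G U (fun j => f j + t * g j) g, ip_add_mul,
    ip_comm G U g f] at this
  linarith

theorem ip_lazyOp_sq_le {s : ℝ} (hs : s ^ 2 = 1) (f g : V → ℝ) :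
    G.ip U f (G.lazyOp U s g) ^ 2 ≤
      G.ip U f (G.lazyOp U s f) * G.ip U g (G.lazyOp U s g) := by
  refine sq_le_mul_of_forall_nonneg fun t => ?_
  have := G.ip_lazyOp_nonneg U hs fun j => f j + t * g j
  rw [lazyOp_add_mul, ip_add_mul, ip_comm, ip_add_mul, ip_comm G U _ (G.lazyOp U s g), ip_add_mul,
    ip_comm G U _ f, ip_comm G U _ g, ip_comm G U _ f, ip_comm G U _ g] at this
  have e : G.ip U g (G.lazyOp U s f) = G.ip U f (G.lazyOp U s g) := by
    rw [← ip_lazyOp_comm, ip_comm]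
  rw [e] at this
  linarith

theorem ip_iterate_comm (s : ℝ) (k : ℕ) (f g : V → ℝ) :
    G.ip U ((G.lazyOp U s)^[k] f) g = G.ip U f ((G.lazyOp U s)^[k] g) := by
  induction k generalizing f g with
  | zero => rfl
  | succ k ih => rw [Function.iterate_succ_apply, ih, ip_lazyOp_comm, Function.iterate_succ_apply']

/-- The moments of the lazy walk operator at `f`. -/
def moment (s : ℝ) (f : V → ℝ) (k : ℕ) : ℝ := G.ip U f ((G.lazyOp U s)^[k] f)

theorem ip_iterate_iterate (s : ℝ) (f : V → ℝ) (a b : ℕ) :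
    G.ip U ((G.lazyOp U s)^[a] f) ((G.lazyOp U s)^[b] f) = G.moment U s f (a + b) := by
  rw [ip_iterate_comm, ← Function.iterate_add_apply]; rfl

theorem moment_even (s : ℝ) (f : V → ℝ) (r : ℕ) : G.moment U s f (2 * r) =
    G.ip U ((G.lazyOp U s)^[r] f) ((G.lazyOp U s)^[r] f) := by
  rw [ip_iterate_iterate, two_mul]

theorem moment_odd (s : ℝ) (f : V → ℝ) (r : ℕ) : G.moment U s f (2 * r + 1) =
    G.ip U ((G.lazyOp U s)^[r] f) (G.lazyOp U s ((G.lazyOp U s)^[r] f)) := by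
  rw [← Function.iterate_succ_apply' (G.lazyOp U s), ip_iterate_iterate]
  congr 1; omega

theorem moment_nonneg {s : ℝ} (hs : s ^ 2 = 1) (f : V → ℝ) (k : ℕ) : 0 ≤ G.moment U s f k := by
  rcases Nat.even_or_odd' k with ⟨r, rfl | rfl⟩
  · rw [moment_even]; exact G.ip_self_nonneg U _
  · rw [moment_odd]; exact G.ip_lazyOp_nonneg U hs _

/-- Logarithmic convexity is Cauchy–Schwarz for `L^r f` and `L^{r+1} f`: with the inner product if
the outer moments are even, with the semidefinite form `⟨·, L ·⟩` if they are odd. -/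
theorem moment_sq_le {s : ℝ} (hs : s ^ 2 = 1) (f : V → ℝ) (k : ℕ) :
    G.moment U s f (k + 1) ^ 2 ≤ G.moment U s f k * G.moment U s f (k + 2) := by
  rcases Nat.even_or_odd' k with ⟨r, rfl | rfl⟩
  · rw [show 2 * r + 2 = 2 * (r + 1) by ring, moment_even, moment_even, moment_odd,
      Function.iterate_succ_apply']
    exact G.ip_sq_le U _ _
  · rw [show 2 * r + 1 + 1 = 2 * (r + 1) by ring, show 2 * r + 1 + 2 = 2 * (r + 1) + 1 by ring,
      moment_even, moment_odd, moment_odd, Function.iterate_succ_apply']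
    have := G.ip_lazyOp_sq_le U hs ((G.lazyOp U s)^[r] f) (G.lazyOp U s ((G.lazyOp U s)^[r] f))
    rwa [← ip_lazyOp_comm] at this

theorem moment_succ_le {s : ℝ} (hs : s ^ 2 = 1) (f : V → ℝ) (k : ℕ) :
    G.moment U s f (k + 1) ≤ G.moment U s f k := by
  rcases Nat.even_or_odd' k with ⟨r, rfl | rfl⟩
  · rw [moment_even, moment_odd]; exact G.ip_lazyOp_le U hs _
  · rw [show 2 * r + 1 + 1 = 2 * (r + 1) by ring, moment_even, moment_odd,
      Function.iterate_succ_apply']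
    set g := (G.lazyOp U s)^[r] f
    -- Here `‖Lg‖⁴ ≤ ⟨g, Lg⟩ ⟨Lg, L²g⟩ ≤ ⟨g, Lg⟩ ‖Lg‖²`, and one factor `‖Lg‖²` cancels.
    have h1 := G.ip_lazyOp_sq_le U hs g (G.lazyOp U s g)
    have h2 := G.ip_lazyOp_le U hs (G.lazyOp U s g)
    have h3 := G.ip_lazyOp_nonneg U hs g
    have h4 := G.ip_self_nonneg U (G.lazyOp U s g)
    rw [← ip_lazyOp_comm] at h1
    nlinarith

end MultiGraph

/-! ### Logarithmically convex sequences -/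

/-- Logarithmic convexity makes the ratios of successive terms nondecreasing, so the first ratio
bounds all of them from below. Monotonicity covers the case that a term vanishes. -/
theorem pow_mul_le_of_logConvex {a : ℕ → ℝ} (h0 : ∀ k, 0 ≤ a k) (hd : ∀ k, a (k + 1) ≤ a k)
    (hc : ∀ k, a (k + 1) ^ 2 ≤ a k * a (k + 2)) {R : ℝ} (hR : 0 ≤ R) (h1 : R * a 0 ≤ a 1) (k : ℕ) :
    R ^ k * a 0 ≤ a k := by
  have step : ∀ k, R * a k ≤ a (k + 1) := by
    intro k
    induction k with
    | zero => exact h1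
    | succ k ih =>
      rcases (h0 k).eq_or_lt with h | h
      · have : a (k + 1) = 0 := le_antisymm (by rw [h]; exact hd k) (h0 _)
        rw [this, mul_zero]; exact h0 _
      · have h2 := hc k
        have h3 : a k * (R * a (k + 1)) ≤ a k * a (k + 2) := by
          refine le_trans ?_ h2
          nlinarith [h0 (k + 1)]
        exact le_of_mul_le_mul_left h3 h
  induction k with
  | zero => simp
  | succ k ih =>
    rw [pow_succ]
    nlinarith [step k, mul_le_mul_of_nonneg_left ih hR]

/-- The ratio at `K` is at least the geometric mean of the `K` ratios before it. For `K = 0` there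
are none, hence the hypothesis `0 < K`. -/
theorem ratio_le_of_logConvex {a : ℕ → ℝ} (h0 : ∀ k, 0 ≤ a k)
    (hc : ∀ k, a (k + 1) ^ 2 ≤ a k * a (k + 2)) {X : ℝ} (hX : 0 ≤ X) {K : ℕ} (hK : 0 < K)
    (h : X ^ K * a 0 ≤ a K) : X * a K ≤ a (K + 1) := by
  by_contra! hlt
  have hpos : 0 < a K := by
    rcases (h0 K).eq_or_lt with h' | h'
    · rw [← h', mul_zero] at hlt; exact absurd (h0 (K + 1)) (not_le.2 hlt)
    · exact h'
  -- ratios increase, so all earlier ratios are smaller than `X`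
  have back : ∀ r ≤ K, 0 < a (K - r) ∧ a (K - r + 1) < X * a (K - r) := by
    intro r
    induction r with
    | zero => exact fun _ => ⟨hpos, hlt⟩
    | succ r ih =>
      intro hr
      obtain ⟨p, q⟩ := ih (by omega)
      have e : K - r = K - (r + 1) + 1 := by omega
      set k := K - (r + 1)
      rw [e] at p q
      have h2 := hc k
      have hk : 0 < a k := by
        rcases (h0 k).eq_or_lt with h' | h'
        · rw [← h', zero_mul] at h2; nlinarith
        · exact h'
      refine ⟨hk, ?_⟩
      have : a (k + 1) * a (k + 1) < a (k + 1) * (X * a k) := by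
        have := mul_lt_mul_of_pos_left q hk
        nlinarith
      exact lt_of_mul_lt_mul_left this p.le
  have up : ∀ r ≤ K, 0 < r → a r < X ^ r * a 0 := by
    intro r
    induction r with
    | zero => intro _ h; omega
    | succ r ih =>
      intro hr _
      obtain ⟨p, q⟩ := back (K - r) (by omega)
      rw [show K - (K - r) = r by omega] at p q
      rcases r.eq_zero_or_pos with rfl | hr0
      · simpa using q
      · refine q.trans_le ?_
        rw [pow_succ, mul_comm (X ^ r), mul_assoc]
        exact mul_le_mul_of_nonneg_left (ih (by omega) hr0).le hX
  exact absurd h (not_le.2 (up K le_rfl hK))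

namespace MultiGraph

variable {V : Type} (G : MultiGraph V) (U : Finset V)

/-! ### Good starting vertices -/

/-- Twice the number of edges inside `U` that a partition does not cut. -/
def uncut (χ : V → Bool) (U : Finset V) : ℝ :=
  ∑ j ∈ U, ∑ k ∈ U, (G.mult j k : ℝ) * if χ j = χ k then 1 else 0

theorem uncut_nonneg (χ : V → Bool) : 0 ≤ G.uncut χ U :=
  Finset.sum_nonneg fun _ _ => Finset.sum_nonneg fun _ _ => by positivity

/-- The unit mass at `i` divided by the degree of `i`. -/
def pointMass (i : V) (j : V) : ℝ := if j = i then 1 / (G.deg U i : ℝ) else 0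

theorem ip_pointMass {i : V} (hi : i ∈ U) (hd : G.deg U i ≠ 0) (g : V → ℝ) :
    G.ip U (G.pointMass U i) g = g i := by
  unfold ip pointMass
  rw [Finset.sum_eq_single i]
  · have : (G.deg U i : ℝ) ≠ 0 := by exact_mod_cast hd
    simp [this]
  · intro j _ h; simp [h]
  · exact fun h => absurd hi h

/-- Let `y` be the sign vector of the cut, set to zero outside `B`. Its Rayleigh quotient is at
least `R = 1 - ε - θ`, so its moment `Y` of order `2l` is at least `R^{2l} vol B`. On the other hand
`Y` is the sum over `i ∈ B` of `± deg i ⟨L^l p_i, L^l y⟩`, where `p_i` is the point mass. The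
arithmetic-geometric mean inequality turns this into `Y ≤ vol B · ∑ deg i ‖L^l p_i‖²`, so the `‖L^l
p_i‖²` cannot all be smaller than `R^{2l}/m`. -/
theorem exists_large_moment {B : Finset V} (hB : B ⊆ U) (χ : V → Bool) {ε θ : ℝ}
    (hχ : G.uncut χ U ≤ ε * G.total U) (hU : 0 < G.total U)
    (hθ : (G.vol U (U \ B) : ℝ) ≤ θ * G.total U) (hθ1 : θ < 1) (h2 : 2 * ε + 2 * θ ≤ 1) (l : ℕ) :
    ∃ i ∈ B, 0 < G.deg U i ∧
      (1 - ε - θ) ^ (2 * l) / G.total U ≤ G.moment U (-1) (G.pointMass U i) (2 * l) := by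
  set m : ℝ := (G.total U : ℝ) with hm
  have hm0 : 0 < m := by rw [hm]; exact_mod_cast hU
  set vB : ℝ := (G.vol U B : ℝ) with hvB
  have hsplit : m = vB + G.vol U (U \ B) := by
    rw [hm, hvB, cast_total, cast_vol, cast_vol, add_comm, Finset.sum_sdiff hB]
  have hvB0 : 0 < vB := by nlinarith
  have hvBm : vB ≤ m := by
    have : (0 : ℝ) ≤ G.vol U (U \ B) := Nat.cast_nonneg _
    linarith
  set R := 1 - ε - θ with hR
  have hε0 : 0 ≤ ε := by
    have := (G.uncut_nonneg U χ).trans hχ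
    exact nonneg_of_mul_nonneg_left this hm0
  have hR0 : 0 < R := by linarith
  by_contra! hcon
  set σ : V → ℝ := fun j => if χ j then 1 else -1 with hσ
  set y : V → ℝ := fun j => if j ∈ B then σ j else 0 with hy
  have hσ2 : ∀ j, σ j * σ j = 1 := by intro j; simp only [hσ]; split_ifs <;> norm_num
  have hyy : G.ip U y y = vB := by
    rw [hvB, cast_vol, ip, ← Finset.sum_sdiff hB, Finset.sum_eq_zero, zero_add]
    · exact Finset.sum_congr rfl fun j hj => by simp only [hy, hj, if_true, mul_assoc, hσ2, mul_one]
    · intro j hj; simp [hy, (Finset.mem_sdiff.1 hj).2]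
  have h1 : R * vB ≤ G.ip U y (G.lazyOp U (-1) y) := by
    -- Equality for two vertices of `B`. Otherwise the left side vanishes, and the two last terms on
    -- the right compensate the `-1`.
    have hp : ∑ j ∈ U, ∑ k ∈ U, (G.mult j k : ℝ) * (y j * y k) ≤
        ∑ j ∈ U, ∑ k ∈ U, (G.mult j k : ℝ) * (2 * (if χ j = χ k then 1 else 0) - 1 +
          (if j ∈ B then 0 else 1) + if k ∈ B then 0 else 1) := by
      refine Finset.sum_le_sum fun j _ => Finset.sum_le_sum fun k _ =>
        mul_le_mul_of_nonneg_left ?_ (Nat.cast_nonneg _)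
      by_cases h1 : j ∈ B <;> by_cases h2 : k ∈ B <;> cases h3 : χ j <;> cases h4 : χ k <;>
        simp [hy, hσ, h1, h2, h3, h4] <;> norm_num
    have hv : ∑ j ∈ U, (G.deg U j : ℝ) * (if j ∈ B then 0 else 1) = G.vol U (U \ B) := by
      rw [cast_vol, ← Finset.sum_sdiff hB, Finset.sum_eq_zero (s := B), add_zero]
      · exact Finset.sum_congr rfl fun j hj => by simp [(Finset.mem_sdiff.1 hj).2]
      · intro j hj; simp [hj]
    have he : ∑ j ∈ U, ∑ k ∈ U, (G.mult j k : ℝ) * (2 * (if χ j = χ k then 1 else 0) - 1 +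
          (if j ∈ B then 0 else 1) + if k ∈ B then 0 else 1) =
        2 * G.uncut χ U - m + 2 * G.vol U (U \ B) := by
      simp only [mul_add, mul_sub, Finset.sum_add_distrib, Finset.sum_sub_distrib]
      rw [G.sum_mult_left U fun j => if j ∈ B then 0 else 1,
        G.sum_mult_right U fun j => if j ∈ B then 0 else 1, hv]
      simp only [mul_one, sum_mult_eq_total, uncut, Finset.mul_sum]
      rw [← hm]
      simp only [mul_left_comm _ (2 : ℝ)]
      ring
    -- With `vol (U \ B) = θ' m` the bound is `m (1 - ε - 3θ'/2)`. It dominates `(1 - ε - θ')(1 -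
    -- θ') m` because `ε + θ' ≤ 1/2`.
    rw [ip_lazyOp, hyy]
    rw [he] at hp
    nlinarith
  set Y := G.moment U (-1) y (2 * l) with hY
  have hYlow : R ^ (2 * l) * vB ≤ Y := by
    have := pow_mul_le_of_logConvex (a := G.moment U (-1) y)
      (G.moment_nonneg U (by norm_num) y) (G.moment_succ_le U (by norm_num) y)
      (G.moment_sq_le U (by norm_num) y) hR0.le (by
        show R * G.ip U y y ≤ _
        rw [hyy]; exact h1) (2 * l)
    have e : G.moment U (-1) y 0 = vB := hyy
    rwa [e] at this
  have hup : Y ≤ ∑ i ∈ B, G.deg U i *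
      ((vB * G.moment U (-1) (G.pointMass U i) (2 * l) + Y / vB) / 2) := by
    have e : Y = ∑ i ∈ B, G.deg U i * (σ i * (G.lazyOp U (-1))^[2 * l] y i) := by
      rw [hY, moment, ip, ← Finset.sum_sdiff hB, Finset.sum_eq_zero, zero_add]
      · exact Finset.sum_congr rfl fun j hj => by simp only [hy, hj, if_true]; ring
      · intro j hj; simp [hy, (Finset.mem_sdiff.1 hj).2]
    conv_lhs => rw [e]
    refine Finset.sum_le_sum fun i hi => ?_
    rcases Nat.eq_zero_or_pos (G.deg U i) with h0 | hpos
    · simp [h0]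
    refine mul_le_mul_of_nonneg_left ?_ (Nat.cast_nonneg _)
    rw [← G.ip_pointMass U (hB hi) hpos.ne' ((G.lazyOp U (-1))^[2 * l] y), two_mul, Function.iterate_add_apply,
      ← ip_iterate_comm, ← two_mul, moment_even, hY, moment_even]
    set f := (G.lazyOp U (-1))^[l] (G.pointMass U i)
    set g := (G.lazyOp U (-1))^[l] y
    -- The coefficient `σ i / vol B` is chosen such that the terms with `g`, weighted by degrees and
    -- summed over `B`, amount to exactly `Y/2`.
    have hsq := G.ip_self_nonneg U fun j => f j + -(σ i / vB) * g j
    rw [ip_add_mul, ip_comm, ip_add_mul, ip_comm G U (fun j => f j + -(σ i / vB) * g j) g,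
      ip_add_mul, ip_comm G U g f] at hsq
    have h3 : vB * (G.ip U f f + -(σ i / vB) * G.ip U f g +
        -(σ i / vB) * (G.ip U f g + -(σ i / vB) * G.ip U g g)) =
        vB * G.ip U f f - 2 * (σ i * G.ip U f g) + σ i * σ i * (G.ip U g g / vB) := by
      field_simp; ring
    have h4 := mul_nonneg hvB0.le hsq
    rw [h3, hσ2] at h4
    linarith
  have hsum : ∑ i ∈ B, G.deg U i * G.moment U (-1) (G.pointMass U i) (2 * l) < R ^ (2 * l) := by
    have hne : ∃ i ∈ B, 0 < G.deg U i := by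
      by_contra! h
      have : vB = 0 := by
        rw [hvB, cast_vol]
        exact Finset.sum_eq_zero fun i hi => by simp [Nat.le_zero.1 (h i hi)]
      linarith
    obtain ⟨i, hi, hdi⟩ := hne
    have : ∑ i ∈ B, G.deg U i * G.moment U (-1) (G.pointMass U i) (2 * l) <
        ∑ i ∈ B, G.deg U i * (R ^ (2 * l) / m) := by
      refine Finset.sum_lt_sum (fun j hj => ?_) ⟨i, hi, ?_⟩
      · rcases Nat.eq_zero_or_pos (G.deg U j) with h0 | hpos
        · simp [h0]
        · exact mul_le_mul_of_nonneg_left (hcon j hj hpos).le (Nat.cast_nonneg _)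
      · exact mul_lt_mul_of_pos_left (hcon i hi hdi) (by exact_mod_cast hdi)
    refine this.trans_le ?_
    rw [← Finset.sum_mul, ← cast_vol, ← hvB, mul_div_assoc', div_le_iff₀ hm0, mul_comm]
    exact mul_le_mul_of_nonneg_left hvBm (by positivity)
  have hfin : ∑ i ∈ B, G.deg U i *
      ((vB * G.moment U (-1) (G.pointMass U i) (2 * l) + Y / vB) / 2) =
      (vB * (∑ i ∈ B, G.deg U i * G.moment U (-1) (G.pointMass U i) (2 * l)) + Y) / 2 := by
    have : Y = ∑ i ∈ B, G.deg U i * (Y / vB) := by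
      rw [← Finset.sum_mul, ← cast_vol, ← hvB]; field_simp
    conv_rhs => rw [this]
    rw [Finset.mul_sum, ← Finset.sum_add_distrib, Finset.sum_div]
    exact Finset.sum_congr rfl fun _ _ => by ring
  rw [hfin] at hup
  nlinarith

/-- The Rayleigh quotient of the distribution of a walk from a good vertex is large. -/
theorem rayleigh_ge {i : V} (hi : i ∈ U) (hd : 0 < G.deg U i) {X : ℝ} (hX : 0 ≤ X) {l : ℕ}
    (hl : 0 < l) (h : X ^ (2 * l) ≤ G.moment U (-1) (G.pointMass U i) (2 * l)) :
    X * G.ip U ((G.lazyOp U (-1))^[l] (G.pointMass U i)) ((G.lazyOp U (-1))^[l] (G.pointMass U i)) ≤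
      G.ip U ((G.lazyOp U (-1))^[l] (G.pointMass U i))
        (G.lazyOp U (-1) ((G.lazyOp U (-1))^[l] (G.pointMass U i))) := by
  rw [← moment_even, ← moment_odd]
  refine ratio_le_of_logConvex (a := G.moment U (-1) (G.pointMass U i))
    (G.moment_nonneg U (by norm_num) _) (G.moment_sq_le U (by norm_num) _) hX (by omega) ?_
  refine le_trans ?_ h
  -- The zeroth moment of the point mass is `1 / deg i`.
  have : G.moment U (-1) (G.pointMass U i) 0 ≤ 1 := by
    show G.ip U (G.pointMass U i) (G.pointMass U i) ≤ 1
    rw [G.ip_pointMass U hi hd.ne']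
    simp only [pointMass, if_true]
    rw [div_le_one (by exact_mod_cast hd)]
    exact_mod_cast hd
  exact mul_le_of_le_one_right (by positivity) this

end MultiGraph

namespace MultiGraph

variable {V : Type} (G : MultiGraph V) (U : Finset V)

/-! ### Rounding a vector to a tripartition -/

/-- The real indicator of a set. -/
def ind (A : Finset V) (j : V) : ℝ := if j ∈ A then 1 else 0

theorem cast_edges {A B : Finset V} (hA : A ⊆ U) (hB : B ⊆ U) :
    (G.edges A B : ℝ) = ∑ j ∈ U, ∑ k ∈ U, (G.mult j k : ℝ) * (ind A j * ind B k) := by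
  have h : ∀ j, ∑ k ∈ U, (G.mult j k : ℝ) * (ind A j * ind B k) =
      if j ∈ A then ∑ k ∈ B, (G.mult j k : ℝ) else 0 := by
    intro j
    by_cases hj : j ∈ A
    · simp only [ind, hj, if_true, mul_ite, mul_one, mul_zero]
      rw [← Finset.sum_filter, Finset.filter_mem_eq_inter, Finset.inter_eq_right.2 hB]
    · simp [ind, hj]
  simp only [h]
  rw [← Finset.sum_filter, Finset.filter_mem_eq_inter, Finset.inter_eq_right.2 hA]
  simp [edges]

theorem edges_comm (A B : Finset V) : G.edges A B = G.edges B A := by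
  unfold edges
  rw [Finset.sum_comm]
  simp only [G.symm]

theorem ind_union_of_disjoint {A B : Finset V} (h : Disjoint A B) (j : V) :
    ind (A ∪ B) j = ind A j + ind B j := by
  by_cases h1 : j ∈ A
  · have h2 : j ∉ B := Finset.disjoint_left.1 h h1
    simp [ind, h1, h2]
  · simp [ind, h1]

theorem ind_sdiff {S : Finset V} {j : V} (hj : j ∈ U) : ind (U \ S) j = 1 - ind S j := by
  by_cases h : j ∈ S <;> simp [ind, h, hj]

/-- Written as a symmetric sum over ordered pairs, the gain of a tripartition can be bounded edge by
edge. -/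
theorem cut_sub_inc {A B : Finset V} (hA : A ⊆ U) (hB : B ⊆ U) (f : ℝ) :
    G.cut U A B - f * G.inc U A B = (∑ j ∈ U, ∑ k ∈ U, (G.mult j k : ℝ) *
      (ind A j * ind B k + ind B j * ind A k +
        (ind (A ∪ B) j + ind (A ∪ B) k - 2 * (ind (A ∪ B) j * ind (A ∪ B) k)) / 2 -
        f * (ind (A ∪ B) j + ind (A ∪ B) k - ind (A ∪ B) j * ind (A ∪ B) k))) / 2 := by
  have hS : A ∪ B ⊆ U := Finset.union_subset hA hB
  have e1 := G.cast_edges U hA hB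
  have e2 := G.cast_edges U hB hA
  have e3 := G.cast_edges U hS hS
  have e4 := G.cast_edges U hS (Finset.sdiff_subset (s := U) (t := A ∪ B))
  have e5 := G.cast_edges U (Finset.sdiff_subset (s := U) (t := A ∪ B)) hS
  rw [G.edges_comm B A] at e2
  rw [G.edges_comm _ (A ∪ B)] at e5
  have key : ∑ j ∈ U, ∑ k ∈ U, (G.mult j k : ℝ) *
      (ind A j * ind B k + ind B j * ind A k +
        (ind (A ∪ B) j + ind (A ∪ B) k - 2 * (ind (A ∪ B) j * ind (A ∪ B) k)) / 2 -
        f * (ind (A ∪ B) j + ind (A ∪ B) k - ind (A ∪ B) j * ind (A ∪ B) k)) =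
      (G.edges A B + G.edges A B : ℝ) + (G.edges (A ∪ B) (U \ (A ∪ B)) / 2 +
        G.edges (A ∪ B) (U \ (A ∪ B)) / 2) - f * (G.edges (A ∪ B) (A ∪ B) +
        (G.edges (A ∪ B) (U \ (A ∪ B)) + G.edges (A ∪ B) (U \ (A ∪ B)))) := by
    nth_rewrite 1 [e1]
    rw [e2, e3]
    nth_rewrite 1 [e4]
    nth_rewrite 2 [e4]
    rw [e5]
    simp only [Finset.mul_sum, Finset.sum_div, ← Finset.sum_add_distrib,
      ← Finset.sum_sub_distrib]
    refine Finset.sum_congr rfl fun j hj => Finset.sum_congr rfl fun k hk => ?_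
    rw [ind_sdiff U hj, ind_sdiff U hk]
    ring
  rw [key]
  unfold cut inc cross
  ring

theorem cut_le_card [Fintype V] {A B : Finset V} : G.cut U A B ≤ 2 * (G.maxDeg * (A ∪ B).card) := by
  have h : ∀ S B : Finset V, (G.edges S B : ℝ) ≤ G.maxDeg * S.card := by
    intro S B
    have : G.edges S B ≤ S.card • G.maxDeg := by
      refine Finset.sum_le_card_nsmul _ _ _ fun j _ => ?_
      refine le_trans ?_ (Finset.le_sup (f := G.deg Finset.univ) (Finset.mem_univ j))
      exact Finset.sum_le_sum_of_subset (Finset.subset_univ _)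
    rw [smul_eq_mul, mul_comm] at this
    exact_mod_cast this
  have h1 := h A B
  have h2 := h (A ∪ B) (U \ (A ∪ B))
  have h3 : (A.card : ℝ) ≤ (A ∪ B).card := by
    exact_mod_cast Finset.card_le_card Finset.subset_union_left
  have h4 := mul_le_mul_of_nonneg_left h3 (Nat.cast_nonneg (α := ℝ) G.maxDeg)
  have h5 : (0 : ℝ) ≤ G.edges (A ∪ B) (U \ (A ∪ B)) := Nat.cast_nonneg _
  unfold cut cross
  linarith

theorem inc_nonneg (A B : Finset V) : 0 ≤ G.inc U A B := by unfold inc; positivity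

/-- The vertices of positive sign up to a given level. -/
def posLevel (q : V → ℝ) (lev : V → ℕ) (r : ℕ) : Finset V := U.filter fun j => lev j ≤ r ∧ 0 < q j

/-- The vertices of negative sign up to a given level. -/
def negLevel (q : V → ℝ) (lev : V → ℕ) (r : ℕ) : Finset V := U.filter fun j => lev j ≤ r ∧ q j < 0

/-- The vector that has absolute value `t r` on level `r` and vanishes above level `R`. -/
def levelVec (q : V → ℝ) (lev : V → ℕ) (t : ℕ → ℝ) (R : ℕ) (j : V) : ℝ :=
  if lev j ≤ R then (if 0 < q j then t (lev j) else -t (lev j)) else 0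

/-- The right side is what an edge with end values `x` and `y`, `|y| ≤ |x|`, contributes after
summation over the levels. The constant `187/500` is dictated by opposite signs: for `f = 13/25` the
difference of the two sides is `0.104 x² + 0.5 x y + 0.624 y²`, a positive form since `4 · 0.104 ·
0.624 > 0.25`. -/
theorem rounding_pair {f x y : ℝ} (hf : f ≤ 13 / 25) (hxy : y ^ 2 ≤ x ^ 2) :
    (x - y) ^ 2 / 4 - 187 / 500 * (x ^ 2 + y ^ 2) ≤
      (if x * y < 0 then 1 else 0) * y ^ 2 + (x ^ 2 + y ^ 2 - 2 * y ^ 2) / 2 -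
        f * (x ^ 2 + y ^ 2 - y ^ 2) := by
  have h := mul_le_mul_of_nonneg_right hf (sq_nonneg x)
  split_ifs with hs
  · nlinarith [sq_nonneg (2 * x + 5 * y), sq_nonneg (5 * x + 12 * y)]
  · push Not at hs
    have : y ^ 2 ≤ x * y := by
      have := sq_le_sq.1 hxy
      rw [← abs_of_nonneg hs, abs_mul, ← sq_abs]
      nlinarith [abs_nonneg y]
    nlinarith [sq_nonneg x, sq_nonneg y]

/-- The weights `t_r² - t_{r+1}²` of the levels `r ≥ s` telescope to `t_s²`; the last level `R` has
the full weight `t_R²`. -/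
theorem sum_weights {t : ℕ → ℝ} {R : ℕ} (s : ℕ) :
    ∑ r ∈ Finset.range (R + 1), ((if r ≤ R then t r ^ 2 else 0) -
      (if r + 1 ≤ R then t (r + 1) ^ 2 else 0)) * (if s ≤ r then 1 else 0) =
      if s ≤ R then t s ^ 2 else 0 := by
  set T : ℕ → ℝ := fun r => if r ≤ R then t r ^ 2 else 0 with hT
  have : ∀ N, ∑ r ∈ Finset.range N, (T r - T (r + 1)) * (if s ≤ r then 1 else 0) =
      if s ≤ N then T s - T N else 0 := by
    intro N
    induction N with
    | zero =>
      by_cases h : s = 0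
      · simp [h]
      · simp [h]
    | succ N ih =>
      rw [Finset.sum_range_succ, ih]
      by_cases h : s ≤ N
      · rw [if_pos h, if_pos h, if_pos (by omega)]; ring
      · rw [if_neg h, if_neg h]
        by_cases h' : s ≤ N + 1
        · rw [if_pos h', show s = N + 1 by omega]; simp
        · rw [if_neg h']; simp
  have h2 := this (R + 1)
  rw [show (∑ r ∈ Finset.range (R + 1), ((if r ≤ R then t r ^ 2 else 0) -
      (if r + 1 ≤ R then t (r + 1) ^ 2 else 0)) * (if s ≤ r then (1 : ℝ) else 0)) =
      ∑ r ∈ Finset.range (R + 1), (T r - T (r + 1)) * (if s ≤ r then 1 else 0) from rfl, h2]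
  by_cases h : s ≤ R
  · rw [if_pos (by omega), if_pos h]
    simp [hT, h]
  · rw [if_neg h]
    by_cases h' : s ≤ R + 1
    · rw [if_pos h', show s = R + 1 by omega]; simp
    · rw [if_neg h']

/-- A weighted average over the levels turns counting functions of sets into quadratic functions of
`x`. A vertex lies in the sets of all levels from its own on, of total weight `x_j²`; both ends of
an edge are inside from the larger of their levels on, of total weight the smaller of the two
squares. What remains is `rounding_pair` for every edge. -/
theorem sum_levels_ge {q : V → ℝ} {lev : V → ℕ} {t : ℕ → ℝ} {R : ℕ} (ht0 : ∀ r, 0 < t r)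
    (ht : Antitone t) (hq : ∀ j ∈ U, lev j ≤ R → q j ≠ 0) {f : ℝ} (hf : f ≤ 13 / 25) :
    G.form U (levelVec q lev t R) / 4 -
        187 / 500 * G.ip U (levelVec q lev t R) (levelVec q lev t R) ≤
      ∑ r ∈ Finset.range (R + 1), ((if r ≤ R then t r ^ 2 else 0) -
        (if r + 1 ≤ R then t (r + 1) ^ 2 else 0)) *
        (G.cut U (posLevel U q lev r) (negLevel U q lev r) -
          f * G.inc U (posLevel U q lev r) (negLevel U q lev r)) := by
  set x := levelVec q lev t R with hx
  set T : ℕ → ℝ := fun r => if r ≤ R then t r ^ 2 else 0 with hT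
  have hT0 : ∀ r, 0 ≤ T r := fun r => by simp only [hT]; split_ifs <;> positivity
  have hTa : Antitone T := by
    intro a b hab
    simp only [hT]
    split_ifs with h1 h2
    · exact pow_le_pow_left₀ (ht0 _).le (ht hab) 2
    · omega
    · positivity
    · exact le_rfl
  have hxT : ∀ j, x j ^ 2 = T (lev j) := by
    intro j
    simp only [hx, hT, levelVec]
    split_ifs <;> ring
  set w : ℕ → ℝ := fun r => T r - T (r + 1) with hw
  have hdisj : ∀ r, Disjoint (posLevel U q lev r) (negLevel U q lev r) := by
    intro r
    rw [Finset.disjoint_left]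
    intro j hj hj'
    have h1 := (Finset.mem_filter.1 hj).2.2
    have h2 := (Finset.mem_filter.1 hj').2.2
    linarith
  have hs1 : ∀ s, ∑ r ∈ Finset.range (R + 1), w r * (if s ≤ r then 1 else 0) = T s :=
    fun s => sum_weights (t := t) s
  have hpair : ∀ j ∈ U, ∀ k ∈ U, (x j - x k) ^ 2 / 4 - 187 / 500 * (x j ^ 2 + x k ^ 2) ≤
      ∑ r ∈ Finset.range (R + 1), w r *
        (ind (posLevel U q lev r) j * ind (negLevel U q lev r) k +
          ind (negLevel U q lev r) j * ind (posLevel U q lev r) k +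
          (ind (posLevel U q lev r ∪ negLevel U q lev r) j +
            ind (posLevel U q lev r ∪ negLevel U q lev r) k -
            2 * (ind (posLevel U q lev r ∪ negLevel U q lev r) j *
              ind (posLevel U q lev r ∪ negLevel U q lev r) k)) / 2 -
          f * (ind (posLevel U q lev r ∪ negLevel U q lev r) j +
            ind (posLevel U q lev r ∪ negLevel U q lev r) k -
            ind (posLevel U q lev r ∪ negLevel U q lev r) j *
              ind (posLevel U q lev r ∪ negLevel U q lev r) k)) := by
    intro j hj k hk
    set o : ℝ := if x j * x k < 0 then 1 else 0 with ho
    have hterm : ∀ r ∈ Finset.range (R + 1), w r *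
        (ind (posLevel U q lev r) j * ind (negLevel U q lev r) k +
          ind (negLevel U q lev r) j * ind (posLevel U q lev r) k +
          (ind (posLevel U q lev r ∪ negLevel U q lev r) j +
            ind (posLevel U q lev r ∪ negLevel U q lev r) k -
            2 * (ind (posLevel U q lev r ∪ negLevel U q lev r) j *
              ind (posLevel U q lev r ∪ negLevel U q lev r) k)) / 2 -
          f * (ind (posLevel U q lev r ∪ negLevel U q lev r) j +
            ind (posLevel U q lev r ∪ negLevel U q lev r) k -
            ind (posLevel U q lev r ∪ negLevel U q lev r) j *
              ind (posLevel U q lev r ∪ negLevel U q lev r) k)) =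
        o * (w r * (if max (lev j) (lev k) ≤ r then 1 else 0)) +
          (w r * (if lev j ≤ r then 1 else 0) + w r * (if lev k ≤ r then 1 else 0) -
            2 * (w r * (if max (lev j) (lev k) ≤ r then 1 else 0))) / 2 -
          f * (w r * (if lev j ≤ r then 1 else 0) + w r * (if lev k ≤ r then 1 else 0) -
            w r * (if max (lev j) (lev k) ≤ r then 1 else 0)) := by
      intro r hr
      have hr' : r ≤ R := by have := Finset.mem_range.1 hr; omega
      simp only [ind_union_of_disjoint (hdisj r)]
      have hi : ∀ j ∈ U, (ind (posLevel U q lev r) j =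
          if 0 < q j then (if lev j ≤ r then 1 else 0) else 0) ∧
          (ind (negLevel U q lev r) j = if q j < 0 then (if lev j ≤ r then 1 else 0) else 0) := by
        intro j hj
        constructor
        · by_cases h1 : 0 < q j <;> by_cases h2 : lev j ≤ r <;> simp [ind, posLevel, hj, h1, h2]
        · by_cases h1 : q j < 0 <;> by_cases h2 : lev j ≤ r <;> simp [ind, negLevel, hj, h1, h2]
      rw [(hi j hj).1, (hi j hj).2, (hi k hk).1, (hi k hk).2]
      by_cases h1 : lev j ≤ r <;> by_cases h2 : lev k ≤ r
      · have hj0 := hq j hj (h1.trans hr')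
        have hk0 := hq k hk (h2.trans hr')
        have tj := ht0 (lev j)
        have tk := ht0 (lev k)
        have hxj : x j = if 0 < q j then t (lev j) else -t (lev j) := if_pos (h1.trans hr')
        have hxk : x k = if 0 < q k then t (lev k) else -t (lev k) := if_pos (h2.trans hr')
        rcases lt_or_gt_of_ne hj0 with hj1 | hj1 <;> rcases lt_or_gt_of_ne hk0 with hk1 | hk1
        · have : o = 0 := by
            rw [ho, if_neg]; rw [hxj, hxk, if_neg hj1.le.not_gt, if_neg hk1.le.not_gt]
            nlinarith [mul_pos tj tk]
          simp [h1, h2, hj1, hk1, hj1.le.not_gt, hk1.le.not_gt, this]; ring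
        · have : o = 1 := by
            rw [ho, if_pos]; rw [hxj, hxk, if_neg hj1.le.not_gt, if_pos hk1]
            nlinarith [mul_pos tj tk]
          simp [h1, h2, hj1, hk1, hj1.le.not_gt, hk1.le.not_gt, this]; ring
        · have : o = 1 := by
            rw [ho, if_pos]; rw [hxj, hxk, if_pos hj1, if_neg hk1.le.not_gt]
            nlinarith [mul_pos tj tk]
          simp [h1, h2, hj1, hk1, hj1.le.not_gt, hk1.le.not_gt, this]; ring
        · have : o = 0 := by
            rw [ho, if_neg]; rw [hxj, hxk, if_pos hj1, if_pos hk1]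
            nlinarith [mul_pos tj tk]
          simp [h1, h2, hj1, hk1, hj1.le.not_gt, hk1.le.not_gt, this]; ring
      · have hj0 := hq j hj (h1.trans hr')
        rcases lt_or_gt_of_ne hj0 with hj1 | hj1 <;>
          simp [h1, h2, hj1, hj1.le.not_gt] <;> ring
      · have hk0 := hq k hk (h2.trans hr')
        rcases lt_or_gt_of_ne hk0 with hj1 | hj1 <;>
          simp [h1, h2, hj1, hj1.le.not_gt] <;> ring
      · simp [h1, h2]
    rw [Finset.sum_congr rfl hterm]
    simp only [Finset.sum_sub_distrib, Finset.sum_add_distrib, ← Finset.mul_sum,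
      ← Finset.sum_div, hs1]
    -- The end with the higher level has the smaller absolute value and takes the role of `y`.
    rcases le_total (lev j) (lev k) with h | h
    · rw [max_eq_right h, ← hxT, ← hxT]
      exact rounding_pair hf (by rw [hxT, hxT]; exact hTa h)
    · rw [max_eq_left h, ← hxT, ← hxT]
      have := rounding_pair (x := x k) (y := x j) hf (by rw [hxT, hxT]; exact hTa h)
      rw [mul_comm (x k)] at this
      rw [ho]
      linarith
  have hA : ∀ r, posLevel U q lev r ⊆ U := fun r => Finset.filter_subset _ _
  have hB : ∀ r, negLevel U q lev r ⊆ U := fun r => Finset.filter_subset _ _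
  calc G.form U x / 4 - 187 / 500 * G.ip U x x
      = (∑ j ∈ U, ∑ k ∈ U, (G.mult j k : ℝ) *
          ((x j - x k) ^ 2 / 4 - 187 / 500 * (x j ^ 2 + x k ^ 2))) / 2 := by
        rw [form, ip_self_eq]
        simp only [Finset.mul_sum, Finset.sum_div, ← Finset.sum_sub_distrib]
        exact Finset.sum_congr rfl fun j _ => Finset.sum_congr rfl fun k _ => by ring
    _ ≤ (∑ j ∈ U, ∑ k ∈ U, (G.mult j k : ℝ) * ∑ r ∈ Finset.range (R + 1), w r *
        (ind (posLevel U q lev r) j * ind (negLevel U q lev r) k +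
          ind (negLevel U q lev r) j * ind (posLevel U q lev r) k +
          (ind (posLevel U q lev r ∪ negLevel U q lev r) j +
            ind (posLevel U q lev r ∪ negLevel U q lev r) k -
            2 * (ind (posLevel U q lev r ∪ negLevel U q lev r) j *
              ind (posLevel U q lev r ∪ negLevel U q lev r) k)) / 2 -
          f * (ind (posLevel U q lev r ∪ negLevel U q lev r) j +
            ind (posLevel U q lev r ∪ negLevel U q lev r) k -
            ind (posLevel U q lev r ∪ negLevel U q lev r) j *
              ind (posLevel U q lev r ∪ negLevel U q lev r) k))) / 2 := by
        refine div_le_div_of_nonneg_right ?_ (by norm_num)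
        exact Finset.sum_le_sum fun j hj => Finset.sum_le_sum fun k hk =>
          mul_le_mul_of_nonneg_left (hpair j hj k hk) (Nat.cast_nonneg _)
    _ = _ := by
        simp only [G.cut_sub_inc U (hA _) (hB _)]
        simp only [Finset.mul_sum, Finset.sum_div]
        conv_rhs => rw [Finset.sum_comm]
        refine Finset.sum_congr rfl fun j _ => ?_
        conv_rhs => rw [Finset.sum_comm]
        refine Finset.sum_congr rfl fun k _ => ?_
        exact Finset.sum_congr rfl fun r _ => by simp only [hw, hT]; ring

/-- For every edge this is `(a + b)² ≥ (49/50) a² - 49 b²`; the difference of the two sides is `(a +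
50 b)² / 50`. -/
theorem form_sub_ge (f g : V → ℝ) :
    49 / 50 * G.form U f - 49 * G.form U (fun j => g j - f j) ≤ G.form U g := by
  unfold form
  have : ∑ j ∈ U, ∑ k ∈ U, (G.mult j k : ℝ) * (49 / 50 * (f j - f k) ^ 2 -
      49 * ((g j - f j) - (g k - f k)) ^ 2) ≤ ∑ j ∈ U, ∑ k ∈ U, (G.mult j k : ℝ) * (g j - g k) ^ 2 := by
    refine Finset.sum_le_sum fun j _ => Finset.sum_le_sum fun k _ =>
      mul_le_mul_of_nonneg_left ?_ (Nat.cast_nonneg _)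
    nlinarith [sq_nonneg ((f j - f k) + 50 * ((g j - f j) - (g k - f k)))]
  simp only [mul_sub, Finset.sum_sub_distrib, mul_left_comm _ (49 / 50 : ℝ),
    mul_left_comm _ (49 : ℝ), ← Finset.mul_sum] at this
  linarith

theorem form_le (f : V → ℝ) : G.form U f ≤ 2 * G.ip U f f := by
  rw [form_eq_neg]
  linarith [G.ip_lazyOp_le U (s := -1) (by norm_num) f]

/-- If a vector has a large Rayleigh quotient, rounding it to a vector with nearby levels leaves
much to gain. -/
theorem levelVec_gain {q : V → ℝ} {lev : V → ℕ} {t : ℕ → ℝ} {R : ℕ} {β : ℝ}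
    (hray : 24 / 25 * G.ip U q q ≤ G.ip U q (G.lazyOp U (-1) q))
    (hlo : ∀ j ∈ U, lev j ≤ R → 99 / 100 * |q j| ≤ t (lev j))
    (hhi : ∀ j ∈ U, lev j ≤ R → t (lev j) ≤ 101 / 100 * |q j|)
    (hβ : ∀ j ∈ U, R < lev j → |q j| ≤ β) (hm : G.total U * β ^ 2 ≤ G.ip U q q / 10000) :
    G.ip U q q / 20 ≤ G.form U (levelVec q lev t R) / 4 -
        187 / 500 * G.ip U (levelVec q lev t R) (levelVec q lev t R) := by
  set x := levelVec q lev t R with hx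
  -- Up to level `R` rounding changes a value by at most one percent; above it the value, at most
  -- `β`, is dropped.
  have hpt : ∀ j ∈ U, (x j - q j) ^ 2 ≤ q j ^ 2 / 10000 + β ^ 2 ∧
      x j ^ 2 ≤ 10201 / 10000 * q j ^ 2 := by
    intro j hj
    by_cases h : lev j ≤ R
    · have h1 := hlo j hj h
      have h2 := hhi j hj h
      have h3 : |x j - q j| ≤ |q j| / 100 ∧ |x j| ≤ 101 / 100 * |q j| := by
        have hxj : x j = if 0 < q j then t (lev j) else -t (lev j) := if_pos h
        rw [hxj]
        split_ifs with hp
        · rw [abs_of_pos hp] at *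
          exact ⟨abs_le.2 ⟨by linarith, by linarith⟩, abs_le.2 ⟨by linarith, by linarith⟩⟩
        · rw [abs_of_nonpos (not_lt.1 hp)] at *
          have := not_lt.1 hp
          exact ⟨abs_le.2 ⟨by linarith, by linarith⟩, abs_le.2 ⟨by linarith, by linarith⟩⟩
      have e1 := pow_le_pow_left₀ (abs_nonneg _) h3.1 2
      have e2 := pow_le_pow_left₀ (abs_nonneg _) h3.2 2
      rw [sq_abs, div_pow, sq_abs] at e1
      rw [sq_abs, mul_pow, sq_abs] at e2
      constructor
      · nlinarith [sq_nonneg β]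
      · nlinarith
    · have hxj : x j = 0 := if_neg h
      have h1 := hβ j hj (not_le.1 h)
      have := pow_le_pow_left₀ (abs_nonneg _) h1 2
      rw [sq_abs] at this
      rw [hxj]
      constructor
      · nlinarith [sq_nonneg (q j)]
      · nlinarith [sq_nonneg (q j)]
  have h1 : G.ip U (fun j => x j - q j) (fun j => x j - q j) ≤ G.ip U q q / 5000 := by
    have : G.ip U (fun j => x j - q j) (fun j => x j - q j) ≤
        ∑ j ∈ U, (G.deg U j * q j * q j / 10000 + G.deg U j * β ^ 2) := by
      refine Finset.sum_le_sum fun j hj => ?_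
      have := mul_le_mul_of_nonneg_left (hpt j hj).1 (Nat.cast_nonneg (α := ℝ) (G.deg U j))
      nlinarith
    rw [Finset.sum_add_distrib, ← Finset.sum_div, ← Finset.sum_mul, ← cast_total] at this
    have e : ∑ j ∈ U, (G.deg U j : ℝ) * q j * q j = G.ip U q q := rfl
    linarith
  have h2 : G.ip U x x ≤ 10201 / 10000 * G.ip U q q := by
    unfold ip
    rw [Finset.mul_sum]
    refine Finset.sum_le_sum fun j hj => ?_
    have := mul_le_mul_of_nonneg_left (hpt j hj).2 (Nat.cast_nonneg (α := ℝ) (G.deg U j))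
    nlinarith
  -- In units of `‖q‖²`: the form of `q` contributes at least `0.98 · 0.48`, the rounding error
  -- costs at most `0.0049`, and the subtracted norm at most `0.374 · 1.0201`; more than `1/20` is
  -- left.
  have h3 := G.form_sub_ge U q x
  have h4 := G.form_le U fun j => x j - q j
  have h5 := G.form_eq_neg U q
  have h6 := G.ip_self_nonneg U q
  linarith

end MultiGraph

/-- One of the tripartitions given by the levels of a rounded vector is accepted by Find. -/
theorem exists_accepts {V : Type} [Fintype V] (G : MultiGraph V) (U : Finset V) (p : Params)
    {ε μ : ℝ} {q : V → ℝ} {lev : V → ℕ} {t : ℕ → ℝ} {R : ℕ} {β : ℝ}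
    (ht0 : ∀ r, 0 < t r) (ht : Antitone t)
    (hray : 24 / 25 * G.ip U q q ≤ G.ip U q (G.lazyOp U (-1) q))
    (hlo : ∀ j ∈ U, lev j ≤ R → 99 / 100 * |q j| ≤ t (lev j))
    (hhi : ∀ j ∈ U, lev j ≤ R → t (lev j) ≤ 101 / 100 * |q j|)
    (hβ : ∀ j ∈ U, R < lev j → |q j| ≤ β) (hm : G.total U * β ^ 2 ≤ G.ip U q q / 10000)
    (hf0 : 0 ≤ soto (p.sigma ε μ)) (hf : soto (p.sigma ε μ) ≤ 13 / 25) (hU : 0 < G.total U)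
    (hlg : 0 < G.lg) (hc : 0 ≤ p.sizeConst)
    (hR : 40 * ((R + 1) * p.sizeConst) < G.ip U q q * ((G.total U : ℝ) ^ (1 + μ) * G.lg)) :
    ∃ r ≤ R, Accepts G p U ε μ (t r) (MultiGraph.posLevel U q lev r, MultiGraph.negLevel U q lev r) := by
  by_contra! hcon
  have h1 := G.levelVec_gain U hray hlo hhi hβ hm
  have h2 := G.sum_levels_ge U (q := q) (lev := lev) (R := R) ht0 ht (fun j hj h h0 => by
    have := hhi j hj h
    rw [h0, abs_zero, mul_zero] at this
    exact absurd this (not_le.2 (ht0 _))) hf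
  set D : ℝ := (G.total U : ℝ) ^ (1 + μ) * G.lg with hD
  have hm0 : (0 : ℝ) < G.total U := by exact_mod_cast hU
  have hl0 : (0 : ℝ) < G.lg := by exact_mod_cast hlg
  have hD0 : 0 < D := mul_pos (Real.rpow_pos_of_pos hm0 _) hl0
  -- A refused level contributes at most `2 c / D`, where `c` is `sizeConst`. Either it cuts too
  -- little and contributes nothing positive, or it has too few vertices: its gain is at most twice
  -- the maximum degree times their number, its weight is at most `t_r²`, and the size condition
  -- bounds the product. By `hR` the sum over the levels is then smaller than the total gain.
  have h3 : ∑ r ∈ Finset.range (R + 1), ((if r ≤ R then t r ^ 2 else 0) -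
        (if r + 1 ≤ R then t (r + 1) ^ 2 else 0)) *
        (G.cut U (MultiGraph.posLevel U q lev r) (MultiGraph.negLevel U q lev r) -
          soto (p.sigma ε μ) * G.inc U (MultiGraph.posLevel U q lev r) (MultiGraph.negLevel U q lev r)) ≤
      ∑ r ∈ Finset.range (R + 1), 2 * (p.sizeConst / D) := by
    refine Finset.sum_le_sum fun r hr => ?_
    have hr' : r ≤ R := by have := Finset.mem_range.1 hr; omega
    rw [if_pos hr']
    set w : ℝ := t r ^ 2 - (if r + 1 ≤ R then t (r + 1) ^ 2 else 0) with hw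
    have hw0 : 0 ≤ w := by
      have := pow_le_pow_left₀ (ht0 (r + 1)).le (ht (Nat.le_succ r)) 2
      rw [hw]; split_ifs
      · linarith
      · have := sq_nonneg (t r); linarith
    have hw1 : w ≤ t r ^ 2 := by
      rw [hw]; split_ifs
      · have := sq_nonneg (t (r + 1)); linarith
      · linarith
    have hn := hcon r hr'
    unfold Accepts at hn
    rw [not_and_or] at hn
    have hc0 : 0 ≤ 2 * (p.sizeConst / D) := by positivity
    set A := MultiGraph.posLevel U q lev r
    set B := MultiGraph.negLevel U q lev r
    rcases hn with hn | hn
    · have := not_le.1 hn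
      refine le_trans ?_ hc0
      exact mul_nonpos_of_nonneg_of_nonpos hw0 (by linarith)
    · have hn := not_le.1 hn
      have hcut := G.cut_le_card U (A := A) (B := B)
      have hinc := mul_nonneg hf0 (G.inc_nonneg U A B)
      set K : ℝ := max (G.maxDeg : ℝ) 1 with hK
      have hK0 : 0 < K := lt_of_lt_of_le one_pos (le_max_right _ _)
      have e1 : G.cut U A B - soto (p.sigma ε μ) * G.inc U A B ≤ 2 * (K * (A ∪ B).card) := by
        have : (G.maxDeg : ℝ) * (A ∪ B).card ≤ K * (A ∪ B).card :=
          mul_le_mul_of_nonneg_right (le_max_left _ _) (Nat.cast_nonneg _)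
        linarith
      have htr := ht0 r
      have e2 : ((A ∪ B).card : ℝ) ≤ p.sizeConst / (K * t r ^ 2 * D) := by
        rw [hD]
        have := hn.le
        push_cast at this
        rw [← hK] at this
        rwa [← mul_assoc]
      calc w * (G.cut U A B - soto (p.sigma ε μ) * G.inc U A B)
          ≤ w * (2 * (K * (A ∪ B).card)) := mul_le_mul_of_nonneg_left e1 hw0
        _ ≤ t r ^ 2 * (2 * (K * (p.sizeConst / (K * t r ^ 2 * D)))) := by
            refine mul_le_mul hw1 ?_ (by positivity) (by positivity)
            gcongr
        _ = 2 * (p.sizeConst / D) := by field_simp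
  rw [Finset.sum_const, Finset.card_range, nsmul_eq_mul] at h3
  have h4 : G.ip U q q / 20 ≤ ((R + 1 : ℕ) : ℝ) * (2 * (p.sizeConst / D)) := by linarith
  push_cast at h4
  have h5 : ((R : ℝ) + 1) * (2 * (p.sizeConst / D)) = 2 * ((R + 1) * p.sizeConst) / D := by ring
  rw [h5, le_div_iff₀ hD0] at h4
  linarith

open RandAlg

/-! ### Random choices -/

/-- Finiteness is an explicit hypothesis here, for continuations given by a `match`, where it takes
a case distinction. -/
theorem RandAlg.E_bind_of {α β : Type} {x : RandAlg α} {f : α → RandAlg β} {g : β → ℝ}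
    (hx : Finitary x) (hf : ∀ a, Finitary (f a)) : E (x >>= f) g = E x fun a => E (f a) g :=
  E_bind x f g

theorem RandAlg.pr_bind_le_of {α β : Type} {x : RandAlg α} {f : α → RandAlg β} {Q : β → Prop}
    (hx : Finitary x) (hf : ∀ a, Finitary (f a)) (R : α → Prop) {c d : ℝ} (hR : pr x R ≤ c)
    (hd : 0 ≤ d) (h : ∀ a, ¬R a → pr (f a) Q ≤ d) : pr (x >>= f) Q ≤ c + d :=
  pr_bind_le R hR hd h

theorem RandAlg.E_choose_map {α β : Type} [Fintype α] [Fintype β] (μ : PMF α) (g : α → β)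
    (F : β → ℝ) : E (choose (PMF.map g μ)) F = E (choose μ) fun a => F (g a) := by
  rw [E_choose, E_choose]
  have := tsum_map μ (Set.toFinite _) g F
  rw [tsum_fintype] at this
  rw [this]
  refine Finset.sum_subset (Finset.subset_univ _) fun a _ ha => ?_
  have : μ a = 0 := by
    by_contra h
    exact ha ((Set.toFinite _).mem_toFinset.2 ((PMF.mem_support_iff _ _).2 h))
  simp [this]

theorem E_pick_of_eq_zero {α : Type} [Fintype α] {w : α → ℝ≥0} (h : ∑ a, w a = 0)
    (F : Option α → ℝ) : E (choose (pick w)) F = F none := by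
  unfold pick
  rw [dif_pos h, E_choose, Finset.sum_eq_single none]
  · simp
  · intro o _ ho
    simp [PMF.pure_apply, ho]
  · simp

theorem E_pick {α : Type} [Fintype α] {w : α → ℝ≥0} (h : ∑ a, w a ≠ 0)
    (F : Option α → ℝ) :
    E (choose (pick w)) F = (∑ a, (w a : ℝ) * F (some a)) / ∑ a, (w a : ℝ) := by
  unfold pick
  rw [dif_neg h, RandAlg.E_choose_map, E_choose, Finset.sum_div]
  refine Finset.sum_congr rfl fun a _ => ?_
  rw [PMF.normalize_apply, tsum_fintype, ← ENNReal.ofNNReal_finsetSum]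
  simp only [ENNReal.toReal_mul, ENNReal.toReal_inv, ENNReal.coe_toReal, NNReal.coe_sum]
  ring

section
variable {V : Type} [Fintype V] (G : MultiGraph V)

instance (U : Finset V) : Finitary (randomVertex G U) := by unfold randomVertex; infer_instance

instance (p : Params) (U : Finset V) : Finitary (startVertices G p U) := by
  unfold startVertices; infer_instance

instance finitary_step (U : Finset V) (s : V × Bool) : Finitary (step G U s) := by
  unfold step
  refine @instFinitaryBind _ _ _ _ _ fun b => ?_
  split_ifs
  · refine @instFinitaryBind _ _ _ _ _ fun o => ?_
    cases o <;> infer_instance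
  · infer_instance

instance (U : Finset V) (l : ℕ) (s : V × Bool) : Finitary (walk G U l s) := by
  induction l generalizing s with
  | zero => unfold walk; infer_instance
  | succ l ih => unfold walk; infer_instance

instance (U : Finset V) : Finitary (randomCut U) := by unfold randomCut; infer_instance

instance (p : Params) (U : Finset V) (ε μ α : ℝ) (i : V) (t : ℝ) (c : Finset V × Finset V) :
    Finitary (threshold G p U ε μ α i t c) := by unfold threshold; infer_instance

instance finitary_findRuns (p : Params) (U : Finset V) (ε μ α : ℝ) (ts : List ℝ)
    (runs : List (V × Finset V × Finset V)) : Finitary (findRuns G p U ε μ α ts runs) := by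
  induction ts generalizing runs with
  | nil => unfold findRuns; infer_instance
  | cons t ts ih =>
    unfold findRuns
    refine @instFinitaryBind _ _ _ _ _ fun runs' => ?_
    split <;> infer_instance

instance (p : Params) (U : Finset V) (ε μ α : ℝ) (P : List V) :
    Finitary (find G p U ε μ α P) := by unfold find; infer_instance

/-! ### Walks and the walk operator -/

variable (U : Finset V)

/-- A function of the vertex, multiplied by `s` at odd parity. -/
def parityFun (s : ℝ) (f : V → ℝ) (x : V × Bool) : ℝ := (if x.2 then s else 1) * f x.1

/-- A move flips the parity, which multiplies the signed observable by `s`; from odd to even this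
uses `s² = 1`. At a vertex of degree zero the walk stays, in agreement with the convention in
`lazyOp`. -/
theorem E_step {s : ℝ} (hs : s ^ 2 = 1) (f : V → ℝ) (x : V × Bool) :
    E (step G U x) (parityFun s f) = parityFun s (G.lazyOp U s f) x := by
  have hw : ∀ j, ((∑ k, if k ∈ U then (G.mult j k : ℝ≥0) else 0) : ℝ≥0) = (G.deg U j : ℝ≥0) := by
    intro j
    rw [Finset.sum_ite_mem, Finset.univ_inter, MultiGraph.deg]
    push_cast; rfl
  unfold step
  refine (E_bind_of inferInstance ?_).trans ?_
  · intro b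
    split_ifs
    · refine @instFinitaryBind _ _ _ _ _ fun o => ?_
      cases o <;> infer_instance
    · infer_instance
  rw [E_coin]
  simp only [if_true, Bool.false_eq_true, if_false]
  rw [E_pure, E_bind_of inferInstance (by intro o; cases o <;> infer_instance)]
  rcases Nat.eq_zero_or_pos (G.deg U x.1) with h0 | hpos
  · rw [E_pick_of_eq_zero (by rw [hw, h0]; simp)]
    dsimp only
    rw [E_pure]
    simp only [parityFun, MultiGraph.lazyOp, h0, if_true]
    ring
  · have hne : (G.deg U x.1 : ℝ) ≠ 0 := by exact_mod_cast hpos.ne'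
    have hw' : (∑ k, ((if k ∈ U then (G.mult x.1 k : ℝ≥0) else 0 : ℝ≥0) : ℝ)) = G.deg U x.1 := by
      have := congrArg (fun y : ℝ≥0 => (y : ℝ)) (hw x.1)
      push_cast at this
      simpa using this
    rw [E_pick (by rw [hw]; exact_mod_cast hpos.ne'), hw']
    dsimp only
    simp only [E_pure]
    have e : ∑ k, ((if k ∈ U then (G.mult x.1 k : ℝ≥0) else 0 : ℝ≥0) : ℝ) *
        parityFun s f (k, !x.2) = (if x.2 then s else 1) * (s * ∑ k ∈ U, G.mult x.1 k * f k) := by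
      rw [Finset.mul_sum, Finset.mul_sum, ← Finset.sum_filter_add_sum_filter_not Finset.univ (· ∈ U),
        add_eq_left.2]
      · rw [Finset.filter_mem_eq_inter, Finset.univ_inter]
        refine Finset.sum_congr rfl fun k hk => ?_
        rw [if_pos hk]
        cases hb : x.2
        · simp [parityFun]; ring
        · simp only [parityFun, Bool.not_true, Bool.false_eq_true, if_false, if_true,
            NNReal.coe_natCast]
          linear_combination (-(G.mult x.1 k : ℝ) * f k) * hs
      · exact Finset.sum_eq_zero fun k hk => by simp [(Finset.mem_filter.1 hk).2]
    rw [e]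
    simp only [parityFun, MultiGraph.lazyOp, hpos.ne', if_false]
    ring

theorem ens_walk_length (l : ℕ) (x : V × Bool) :
    Ens (walk G U l x) fun T _ => T.length = l + 1 := by
  induction l generalizing x with
  | zero => simp [walk]
  | succ l ih =>
    unfold walk
    refine Ens.bind (fun _ _ => True) Ens.true fun x' _ _ => ?_
    refine Ens.bind _ (ih x') fun T _ h => ?_
    simp [h]

/-- The default value `0` is never taken, because the trace has `l + 1` entries. -/
theorem E_walk {s : ℝ} (hs : s ^ 2 = 1) (f : V → ℝ) {i l : ℕ} (hi : i ≤ l) (x : V × Bool) :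
    E (walk G U l x) (fun T => (T[i]?).elim 0 (parityFun s f)) =
      parityFun s ((G.lazyOp U s)^[i] f) x := by
  induction i generalizing l x with
  | zero =>
    cases l with
    | zero => simp [walk]
    | succ l =>
      unfold walk
      simp only [E_bind, E_pure, List.getElem?_cons_zero, Option.elim_some, E_const,
        Function.iterate_zero, id]
  | succ i ih =>
    cases l with
    | zero => omega
    | succ l =>
      unfold walk
      simp only [E_bind, E_pure, List.getElem?_cons_succ, ih (Nat.le_of_succ_le_succ hi)]
      rw [E_step G U hs, Function.iterate_succ_apply']

/-- The signed distribution of the walk of length `l` from `i`, divided by degrees: even minus odd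
for `s = -1`, even plus odd for `s = 1`. -/
def walkDensity (s : ℝ) (l : ℕ) (i : V) : V → ℝ := (G.lazyOp U s)^[l] (G.pointMass U i)

/-- Self-adjointness moves the powers of the operator from the point mass at `i` to the indicator of
`j`; the result is an expectation over walks from `i`. -/
theorem deg_mul_walkDensity (s : ℝ) (l : ℕ) {i j : V} (hi : i ∈ U) (hd : G.deg U i ≠ 0)
    (hj : j ∈ U) : G.deg U j * walkDensity G U s l i j =
      (G.lazyOp U s)^[l] (fun k => if k = j then 1 else 0) i := by
  rw [← G.ip_pointMass U hi hd ((G.lazyOp U s)^[l] _), ← G.ip_iterate_comm, MultiGraph.ip, Finset.sum_eq_single j]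
  · simp [walkDensity]
  · intro k _ hk; simp [hk]
  · exact fun h => absurd hj h

theorem walkDensity_of_deg_eq_zero (s : ℝ) (l : ℕ) {i j : V} (hd : G.deg U i ≠ 0)
    (hj : G.deg U j = 0) : walkDensity G U s l i j = 0 := by
  unfold walkDensity
  induction l with
  | zero =>
    have : j ≠ i := by rintro rfl; exact hd hj
    simp [MultiGraph.pointMass, this]
  | succ l ih =>
    rw [Function.iterate_succ_apply', MultiGraph.lazyOp, if_pos hj, ih]

theorem pr_walk_vertex {i j : V} (hi : i ∈ U) (hd : G.deg U i ≠ 0) (hj : j ∈ U) {k l : ℕ}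
    (hk : k ≤ l) : pr (walk G U l (i, false)) (fun T => T[k]?.map Prod.fst = some j) =
      G.deg U j * walkDensity G U 1 k i j := by
  rw [deg_mul_walkDensity G U 1 k hi hd hj]
  have := E_walk G U (s := 1) (by norm_num) (fun k => if k = j then 1 else 0) hk (i, false)
  simp only [parityFun, if_false, Bool.false_eq_true, one_mul] at this
  rw [← this, pr]
  congr 1; ext T
  cases h : T[k]? <;> simp [parityFun]

theorem walk_last_eq {l : ℕ} {x : V × Bool} {T : List (V × Bool)} (hT : T.length = l + 1) :
    T[l]? = some (T.getLastD x) := by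
  have hne : T ≠ [] := by rintro rfl; simp at hT
  rw [List.getLastD_eq_getLast?, List.getLast?_eq_getElem?, hT, Nat.add_sub_cancel,
    List.getElem?_eq_getElem (by omega)]
  rfl

theorem pr_walk_last {i j : V} (hi : i ∈ U) (hd : G.deg U i ≠ 0) (hj : j ∈ U) (l : ℕ) {s : ℝ}
    (hs : s ^ 2 = 1) :
    pr (walk G U l (i, false)) (fun T => T.getLastD (i, false) = (j, false)) +
      s * pr (walk G U l (i, false)) (fun T => T.getLastD (i, false) = (j, true)) =
      G.deg U j * walkDensity G U s l i j := by
  rw [deg_mul_walkDensity G U s l hi hd hj]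
  have := E_walk G U hs (fun k => if k = j then 1 else 0) (le_refl l) (i, false)
  have e : parityFun s ((G.lazyOp U s)^[l] fun k => if k = j then 1 else 0) (i, false) =
    (G.lazyOp U s)^[l] (fun k => if k = j then 1 else 0) i := by simp [parityFun]
  rw [← e, ← this, pr, pr, ← E_mul_left, ← E_add]
  refine E_congr_of_ens ((ens_walk_length G U l (i, false)).mono fun T _ hT => ?_)
  rw [walk_last_eq (x := (i, false)) hT]
  simp only [Option.elim_some, parityFun]
  rcases h : T.getLastD (i, false) with ⟨k, b⟩
  by_cases hk : k = j <;> cases b <;> simp [hk]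

/-! ### The sampling error of the estimates -/

/-- Chernoff bounds for the even and for the odd endpoints, each allowed half of the error. Both
probabilities are at most `deg j · M`, so the relative deviation is `u = κ t / (2 M)`. The factor
`deg j ≥ 1` in the exponent is dropped. -/
theorem pr_estimate_le {i j : V} (hi : i ∈ U) (hd : G.deg U i ≠ 0) (hj : j ∈ U) (l w : ℕ)
    {M κ t : ℝ} (hw : 0 < w) (hM : walkDensity G U 1 l i j ≤ M) (ht : 0 < t) (htM : t ≤ M)
    (hκ : 0 < κ) (hκ1 : κ ≤ 2) :
    pr (repeated w (walk G U l (i, false))) (fun traces =>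
        κ * t < |estimate G U (traces.map fun T => T.getLastD (i, false)) j -
          walkDensity G U (-1) l i j|) ≤ 4 * Real.exp (-(w * (κ ^ 2 * t ^ 2) / (16 * M))) := by
  set q := walkDensity G U (-1) l i j with hq
  have hM0 : 0 < M := ht.trans_le htM
  rcases Nat.eq_zero_or_pos (G.deg U j) with h0 | hpos
  · rw [pr_eq_zero]
    · positivity
    · intro o _
      have e : estimate G U (o.1.map fun T => T.getLastD (i, false)) j = 0 := by
        simp [estimate, h0]
      rw [e, hq, walkDensity_of_deg_eq_zero G U _ l hd h0]
      simp only [sub_zero, abs_zero, not_lt]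
      positivity
  set x := walk G U l (i, false) with hx
  have hD : (1 : ℝ) ≤ G.deg U j := by exact_mod_cast hpos
  have hpe := pr_walk_last G U hi hd hj l (s := -1) (by norm_num)
  have hpo := pr_walk_last G U hi hd hj l (s := 1) (by norm_num)
  rw [← hx] at hpe hpo
  rw [← hq] at hpe
  set Qe : List (V × Bool) → Prop := fun T => T.getLastD (i, false) = (j, false) with hQe
  set Qo : List (V × Bool) → Prop := fun T => T.getLastD (i, false) = (j, true) with hQo
  have pe0 := pr_nonneg x Qe
  have po0 := pr_nonneg x Qo
  have hdM : (G.deg U j : ℝ) * walkDensity G U 1 l i j ≤ G.deg U j * M :=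
    mul_le_mul_of_nonneg_left hM (by linarith)
  set u : ℝ := κ * t / (2 * M) with hu
  have hu0 : 0 ≤ u := by positivity
  have hu1 : u ≤ 1 := by
    rw [hu, div_le_one (by positivity)]
    nlinarith
  have c1 := chernoff x Qe w (M := G.deg U j * M) (u := u) (by linarith) hu0 hu1
  have c2 := chernoff x Qo w (M := G.deg U j * M) (u := u) (by linarith) hu0 hu1
  have huM : u * (G.deg U j * M) = κ * t * G.deg U j / 2 := by rw [hu]; field_simp
  have hexp : Real.exp (-(w * u ^ 2 * (G.deg U j * M) / 4)) ≤
      Real.exp (-(w * (κ ^ 2 * t ^ 2) / (16 * M))) := by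
    refine Real.exp_le_exp.2 (neg_le_neg ?_)
    have : w * u ^ 2 * (G.deg U j * M) / 4 = w * (κ ^ 2 * t ^ 2) / (16 * M) * G.deg U j := by
      rw [hu]; field_simp; ring
    rw [this]
    exact le_mul_of_one_le_right (by positivity) hD
  rw [huM] at c1 c2
  have hw0 : (0 : ℝ) < w := by exact_mod_cast hw
  calc _ ≤ pr (repeated w x) (fun bs =>
        (w * (κ * t * G.deg U j / 2) ≤ |((bs.countP fun a => Qe a : ℕ) : ℝ) - w * pr x Qe|) ∨
        (w * (κ * t * G.deg U j / 2) ≤ |((bs.countP fun a => Qo a : ℕ) : ℝ) - w * pr x Qo|)) := by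
        refine pr_mono_of_ens ((ens_repeated_length x w).mono fun bs _ hlen h => ?_)
        by_contra! hcon
        obtain ⟨h1, h2⟩ := hcon
        refine absurd h (not_lt.2 ?_)
        have e : estimate G U (bs.map fun T => T.getLastD (i, false)) j =
            (((bs.countP fun a => Qe a : ℕ) : ℝ) - (bs.countP fun a => Qo a : ℕ)) /
              (G.deg U j * w) := by
          simp only [estimate, List.countP_map, List.length_map, hlen, hQe, hQo]
          rfl
        have hdw : (0 : ℝ) < G.deg U j * w := by positivity
        have hqe : q = (w * pr x Qe - w * pr x Qo) / (G.deg U j * w) := by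
          rw [eq_div_iff hdw.ne']
          linear_combination (-w : ℝ) * hpe
        rw [e, hqe, ← sub_div, abs_div, abs_of_pos hdw, div_le_iff₀ hdw]
        rw [abs_lt] at h1 h2
        rw [abs_le]
        constructor <;> nlinarith
    _ ≤ _ := by
        have h3 := (add_le_add c1 c2).trans (show _ ≤ 4 * Real.exp (-(w * (κ ^ 2 * t ^ 2) /
          (16 * M))) by linarith)
        refine (pr_or_le _ _ _).trans ?_
        convert h3

/-! ### Success of Find -/

/-- The state of a run of Find from a vertex with signed density `q` after `r` thresholds without
success and without large sampling errors. -/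
def RunInv (p : Params) (ε μ κ : ℝ) (q : V → ℝ) (r : ℕ) (c : Finset V × Finset V) : Prop :=
  ∃ lev : V → ℕ, (c.1 = U.filter fun j => lev j < r ∧ 0 < q j) ∧
    (c.2 = U.filter fun j => lev j < r ∧ q j < 0) ∧
    (∀ j ∈ U, lev j < r → (1 - κ) * (1 - p.gamma) ^ lev j ≤ |q j| ∧
      (1 - p.gamma) * |q j| ≤ (1 + κ) * (1 - p.gamma) ^ lev j) ∧
    (∀ j ∈ U, r ≤ lev j → (1 - p.gamma) * |q j| ≤ (1 + κ) * (1 - p.gamma) ^ r) ∧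
    ∀ r' < r, ¬Accepts G p U ε μ ((1 - p.gamma) ^ r')
      (MultiGraph.posLevel U q lev r', MultiGraph.negLevel U q lev r')

/-- The level of a vertex is the index of the threshold at which it was classified. Sampling errors
are smaller than the threshold, so the estimate of a newly classified vertex has the sign of `q`. A
vertex that was passed over at the previous threshold has `|q|` at most `(1 + κ)/(1 - γ)` times the
present one, which explains the factor `1 - γ` in the invariant. -/
theorem RunInv.succ {G : MultiGraph V} {U : Finset V} {p : Params} {ε μ κ : ℝ} {q : V → ℝ} {r : ℕ}
    {c : Finset V × Finset V} (h : RunInv G U p ε μ κ q r c) (hγ : p.gamma < 1) (hκ : κ < 1)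
    {est : V → ℝ} (hest : ∀ j ∈ U, |est j - q j| ≤ κ * (1 - p.gamma) ^ r)
    (hacc : ¬Accepts G p U ε μ ((1 - p.gamma) ^ r)
      (c.1 ∪ (U \ (c.1 ∪ c.2)).filter (fun j => (1 - p.gamma) ^ r < est j),
        c.2 ∪ (U \ (c.1 ∪ c.2)).filter (fun j => est j < -(1 - p.gamma) ^ r))) :
    RunInv G U p ε μ κ q (r + 1)
      (c.1 ∪ (U \ (c.1 ∪ c.2)).filter (fun j => (1 - p.gamma) ^ r < est j),
        c.2 ∪ (U \ (c.1 ∪ c.2)).filter (fun j => est j < -(1 - p.gamma) ^ r)) := by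
  obtain ⟨lev, h1, h2, h3, h4, h5⟩ := h
  have hγ0 : 0 < 1 - p.gamma := by linarith
  set t := (1 - p.gamma) ^ r with ht
  have ht0 : 0 < t := pow_pos hγ0 r
  have hold : ∀ j ∈ U, lev j < r → q j ≠ 0 := by
    intro j hj hl h0
    have := (h3 j hj hl).1
    rw [h0, abs_zero] at this
    have : 0 < (1 - κ) * (1 - p.gamma) ^ lev j := mul_pos (by linarith) (pow_pos hγ0 _)
    linarith
  have hmem : ∀ j ∈ U, (j ∉ c.1 ∧ j ∉ c.2) ↔ r ≤ lev j := by
    intro j hj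
    rw [h1, h2]
    simp only [Finset.mem_filter, hj, true_and]
    constructor
    · intro h
      by_contra! hl
      rcases lt_or_gt_of_ne (hold j hj hl) with h' | h'
      · exact h.2 ⟨hl, h'⟩
      · exact h.1 ⟨hl, h'⟩
    · intro h
      exact ⟨fun h' => by omega, fun h' => by omega⟩
  have hpos : ∀ j ∈ U, t < est j → 0 < q j := by
    intro j hj h
    have := (abs_le.1 (hest j hj)).2
    nlinarith
  have hneg : ∀ j ∈ U, est j < -t → q j < 0 := by
    intro j hj h
    have := (abs_le.1 (hest j hj)).1
    nlinarith
  -- A vertex that stays unclassified receives the provisional level `r + 1`; later only `r + 1 ≤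
  -- lev' j` matters for it.
  set lev' : V → ℕ := fun j => if lev j < r then lev j else if t < |est j| then r else r + 1
    with hlev'
  have e1 : (c.1 ∪ (U \ (c.1 ∪ c.2)).filter fun j => t < est j) =
      U.filter fun j => lev' j < r + 1 ∧ 0 < q j := by
    ext j
    by_cases hj : j ∈ U
    · have hm := hmem j hj
      simp only [Finset.mem_union, Finset.mem_filter, Finset.mem_sdiff, hj, true_and, not_or, hm]
      rw [h1]
      simp only [Finset.mem_filter, hj, true_and, hlev']
      by_cases hl : lev j < r
      · simp [hl, hl.not_ge, Nat.lt_succ_of_lt hl]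
      · simp only [hl, false_and, false_or, not_lt.1 hl, true_and, if_false]
        constructor
        · intro h
          refine ⟨?_, hpos j hj h⟩
          rw [if_pos (h.trans_le (le_abs_self _))]; omega
        · rintro ⟨h, hq⟩
          by_cases he : t < |est j|
          · rcases lt_abs.1 he with h' | h'
            · exact h'
            · have := hneg j hj (by linarith); linarith
          · rw [if_neg he] at h; omega
    · simp [hj, h1]
  have e2 : (c.2 ∪ (U \ (c.1 ∪ c.2)).filter fun j => est j < -t) =
      U.filter fun j => lev' j < r + 1 ∧ q j < 0 := by
    ext j
    by_cases hj : j ∈ U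
    · have hm := hmem j hj
      simp only [Finset.mem_union, Finset.mem_filter, Finset.mem_sdiff, hj, true_and, not_or, hm]
      rw [h2]
      simp only [Finset.mem_filter, hj, true_and, hlev']
      by_cases hl : lev j < r
      · simp [hl, hl.not_ge, Nat.lt_succ_of_lt hl]
      · simp only [hl, false_and, false_or, not_lt.1 hl, true_and, if_false]
        constructor
        · intro h
          refine ⟨?_, hneg j hj h⟩
          rw [if_pos (lt_abs.2 (Or.inr (by linarith)))]; omega
        · rintro ⟨h, hq⟩
          by_cases he : t < |est j|
          · rcases lt_abs.1 he with h' | h'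
            · have := hpos j hj h'; linarith
            · linarith
          · rw [if_neg he] at h; omega
    · simp [hj, h2]
  refine ⟨lev', e1, e2, ?_, ?_, ?_⟩
  · intro j hj hl
    simp only [hlev'] at hl ⊢
    by_cases h : lev j < r
    · simpa [h] using h3 j hj h
    · simp only [h, if_false] at hl ⊢
      by_cases he : t < |est j|
      · rw [if_pos he]
        refine ⟨?_, h4 j hj (not_lt.1 h)⟩
        have := abs_sub_abs_le_abs_sub (est j) (q j)
        have := hest j hj
        rw [← ht]; linarith
      · rw [if_neg he] at hl; omega
  · intro j hj hl
    simp only [hlev'] at hl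
    by_cases h : lev j < r
    · simp only [h, if_true] at hl; omega
    · simp only [h, if_false] at hl
      by_cases he : t < |est j|
      · rw [if_pos he] at hl; omega
      · have h6 := abs_sub_abs_le_abs_sub (q j) (est j)
        rw [abs_sub_comm] at h6
        have h7 := hest j hj
        rw [pow_succ, ← ht]
        have : |q j| ≤ (1 + κ) * t := by linarith [not_lt.1 he]
        nlinarith
  · intro r' hr'
    rcases Nat.lt_succ_iff_lt_or_eq.1 hr' with h | rfl
    · have : ∀ j, lev' j ≤ r' ↔ lev j ≤ r' := by
        intro j
        simp only [hlev']
        split_ifs <;> omega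
      have := h5 r' h
      simp only [MultiGraph.posLevel, MultiGraph.negLevel] at this ⊢
      simpa only [‹∀ j, lev' j ≤ r' ↔ lev j ≤ r'›] using this
    · rw [e1, e2] at hacc
      simp only [MultiGraph.posLevel, MultiGraph.negLevel]
      simpa only [Nat.lt_succ_iff] using hacc

theorem runInv_zero {p : Params} {ε μ κ : ℝ} {q : V → ℝ} (hγ : 0 ≤ p.gamma)
    (hκ : 0 ≤ κ) (hq : ∀ j ∈ U, |q j| ≤ 1) : RunInv G U p ε μ κ q 0 (∅, ∅) := by
  refine ⟨fun _ => 0, by simp, by simp, fun j _ h => absurd h (Nat.not_lt_zero _), ?_,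
    fun r h => absurd h (Nat.not_lt_zero r)⟩
  intro j hj _
  have := hq j hj
  have := abs_nonneg (q j)
  rw [pow_zero]
  nlinarith

/-- Unless a sampling error occurs, of probability `e` per threshold, the run from `i` succeeds or
keeps its invariant, and `hfin` forbids the invariant after the last threshold. The other runs can
only help, because any success ends the search. -/
theorem pr_findRuns_none_le {p : Params} {ε μ α κ e : ℝ} {q : V → ℝ} {i : V} {R : ℕ}
    (he : 0 ≤ e) (hfin : ∀ c, ¬RunInv G U p ε μ κ q (R + 1) c)
    (hstep : ∀ r ≤ R, ∀ c, RunInv G U p ε μ κ q r c →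
      pr (threshold G p U ε μ α i ((1 - p.gamma) ^ r) c) (fun c' =>
        ¬(Accepts G p U ε μ ((1 - p.gamma) ^ r) c' ∨ RunInv G U p ε μ κ q (r + 1) c')) ≤ e)
    (n r : ℕ) (hn : r + n = R + 1) (runs : List (V × Finset V × Finset V))
    (hruns : ∃ s ∈ runs, s.1 = i ∧ RunInv G U p ε μ κ q r s.2) :
    pr (findRuns G p U ε μ α ((List.range' r n).map fun r => (1 - p.gamma) ^ r) runs)
      (fun o => o = none) ≤ n * e := by
  induction n generalizing r runs with
  | zero =>
    obtain ⟨s, _, _, h⟩ := hruns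
    rw [show r = R + 1 by omega] at h
    exact absurd h (hfin _)
  | succ n ih =>
    rw [List.range'_succ, List.map_cons]
    unfold findRuns
    obtain ⟨s, hs, hsi, hinv⟩ := hruns
    have hcol := pr_collect_le (fun s : V × Finset V × Finset V => do
        let c ← threshold G p U ε μ α s.1 ((1 - p.gamma) ^ r) s.2
        tick (scanCost G U (c.1 ∪ c.2))
        pure (s.1, c))
      (fun s' => s'.1 = i ∧ (Accepts G p U ε μ ((1 - p.gamma) ^ r) s'.2 ∨
        RunInv G U p ε μ κ q (r + 1) s'.2)) (c := e) hs ?_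
    · refine (pr_bind_le_of inferInstance ?_ _ hcol (d := n * e) (by positivity) ?_).trans
        (le_of_eq ?_)
      · intro a; split <;> infer_instance
      rotate_left
      · push_cast; ring
      · intro runs' h
        push Not at h
        obtain ⟨s', hs', hi', h⟩ := h
        split
        · rw [pr_eq_zero (by simp)]; positivity
        · rename_i hnone
          have hna := List.find?_eq_none.1 hnone s' hs'
          rw [decide_eq_true_eq] at hna
          exact ih (r + 1) (by omega) runs' ⟨s', hs', hi', h.resolve_left hna⟩
    · unfold pr
      rw [E_bind]
      simp only [E_tick_bind, E_pure, hsi, true_and]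
      have h := hstep r (by omega) s.2 hinv
      unfold pr at h
      convert h

/-- The number of walks is proportional to `max α t / t²` precisely so that the Chernoff exponent
does not depend on `t`. The density is bounded by `C max α t`. -/
theorem pr_threshold_le {p : Params} {ε μ α κ : ℝ} {i : V} (hi : i ∈ U) (hd : G.deg U i ≠ 0)
    (hγ : p.gamma < 1) (hκ : 0 < κ) (hκ1 : κ < 1) {C : ℝ} (hC : 1 ≤ C)
    (hα : 0 < α) (hwc : 0 < p.walkConst) (hlg : 0 < G.lg)
    (hdens : ∀ j ∈ U, walkDensity G U 1 (p.len (G.total U) ε μ) i j ≤ C * α) (r : ℕ)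
    (c : Finset V × Finset V)
    (hc : RunInv G U p ε μ κ (walkDensity G U (-1) (p.len (G.total U) ε μ) i) r c) :
    pr (threshold G p U ε μ α i ((1 - p.gamma) ^ r) c) (fun c' =>
        ¬(Accepts G p U ε μ ((1 - p.gamma) ^ r) c' ∨
          RunInv G U p ε μ κ (walkDensity G U (-1) (p.len (G.total U) ε μ) i) (r + 1) c')) ≤
      U.card * (4 * Real.exp (-(p.walkConst * κ ^ 2 / (16 * C) * G.lg))) := by
  set t := (1 - p.gamma) ^ r with ht
  have ht0 : 0 < t := pow_pos (by linarith) r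
  set l := p.len (G.total U) ε μ with hl
  set q := walkDensity G U (-1) l i with hq
  set w := ⌈p.walkConst * G.lg * max α t / t ^ 2⌉₊ with hw
  have hl0 : (0 : ℝ) < G.lg := by exact_mod_cast hlg
  have hmx : 0 < max α t := lt_max_of_lt_left hα
  have hw0 : 0 < w := Nat.ceil_pos.2 (by positivity)
  set M := C * max α t with hM
  have hM0 : 0 < M := by positivity
  have hexp : Real.exp (-(w * (κ ^ 2 * t ^ 2) / (16 * M))) ≤
      Real.exp (-(p.walkConst * κ ^ 2 / (16 * C) * G.lg)) := by
    refine Real.exp_le_exp.2 (neg_le_neg ?_)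
    have h1 : p.walkConst * G.lg * max α t / t ^ 2 ≤ w := Nat.le_ceil _
    have h2 : p.walkConst * κ ^ 2 / (16 * C) * G.lg =
        (p.walkConst * G.lg * max α t / t ^ 2) * (κ ^ 2 * t ^ 2) / (16 * M) := by
      rw [hM]; field_simp
    rw [h2]
    gcongr
  have hest := pr_exists_le_card (repeated w (walk G U l (i, false))) U (fun j traces =>
      κ * t < |estimate G U (traces.map fun T => T.getLastD (i, false)) j - q j|)
      (c := 4 * Real.exp (-(p.walkConst * κ ^ 2 / (16 * C) * G.lg))) (fun j hj => by
    refine (pr_estimate_le G U hi hd hj l w hw0 (M := M) ?_ ht0 ?_ hκ (by linarith)).trans ?_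
    · exact (hdens j hj).trans (mul_le_mul_of_nonneg_left (le_max_left _ _) (by linarith))
    · exact (le_max_right α t).trans (le_mul_of_one_le_left hmx.le hC)
    · linarith)
  unfold threshold
  have := pr_bind_le (x := repeated w (walk G U l (i, false))) (f := fun traces => do
    tick (G.lg * w)
    let ends := traces.map fun T => T.getLastD (i, false)
    let new := U \ (c.1 ∪ c.2)
    pure (c.1 ∪ new.filter (fun j => t < estimate G U ends j),
      c.2 ∪ new.filter (fun j => estimate G U ends j < -t)))
    (Q := fun c' => ¬(Accepts G p U ε μ t c' ∨ RunInv G U p ε μ κ q (r + 1) c')) _ hest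
    (d := 0) le_rfl (fun traces h => by
      push Not at h
      rw [pr_eq_zero]
      refine ens_tick_bind ?_
      rw [ens_pure, not_not]
      by_cases ha : Accepts G p U ε μ t
        (c.1 ∪ (U \ (c.1 ∪ c.2)).filter (fun j => t < estimate G U (traces.map fun T =>
            T.getLastD (i, false)) j),
          c.2 ∪ (U \ (c.1 ∪ c.2)).filter (fun j => estimate G U (traces.map fun T =>
            T.getLastD (i, false)) j < -t))
      · exact Or.inl ha
      · exact Or.inr (hc.succ hγ hκ1 h ha))
  rwa [add_zero] at this

end

/-! ### The approximation ratio of a tripartition -/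

theorem soto_curve_eq (s : ℝ) : 4 * s ^ 2 - 8 * s + 5 = 1 + 4 * (1 - s) ^ 2 := by ring

/-- The square root is replaced by its tangent at `u = 2/3`, that is `s = 1/3`, where both sides
equal `1/2`. -/
theorem soto_curve_le {s : ℝ} (hs : s < 1) :
    (-1 + √(4 * s ^ 2 - 8 * s + 5)) / (2 * (1 - s)) ≤ 5 / 4 * (1 - s) / (2 - s) := by
  rw [soto_curve_eq]
  set u := 1 - s with hu
  have hu0 : 0 < u := by linarith
  have h1 : 8 / 5 * u + 3 / 5 ≤ √(1 + 4 * u ^ 2) :=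
    Real.le_sqrt_of_sq_le (by nlinarith [sq_nonneg (6 / 5 * u - 4 / 5)])
  have h2 : √(1 + 4 * u ^ 2) ^ 2 = 1 + 4 * u ^ 2 := Real.sq_sqrt (by positivity)
  rw [show 2 - s = 1 + u by linarith, div_le_div_iff₀ (by positivity) (by positivity)]
  set r := √(1 + 4 * u ^ 2)
  have h3 : (-1 + r) * (1 + r) = 4 * u ^ 2 := by linear_combination h2
  have h5 : 0 ≤ -1 + r := by
    have h4 : 1 ≤ r := Real.le_sqrt_of_sq_le (by nlinarith [sq_nonneg u])
    linarith
  have h4 : (-1 + r) * (8 / 5 * (1 + u)) ≤ 4 * u ^ 2 := by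
    rw [← h3]
    exact mul_le_mul_of_nonneg_left (by linarith) h5
  nlinarith

/-- Any single solution bounds the infimum, and every solution is at most `3/10`; without solutions
the infimum would be `0`. The exact value is irrelevant, because only arguments from `8/25` on
occur. -/
theorem sotoPoint_le : sotoPoint ≤ 3 / 10 := by
  unfold sotoPoint
  set S := {s : ℝ | 0 ≤ s ∧ s ≤ 1 / 3 ∧
    (-1 + √(4 * s ^ 2 - 8 * s + 5)) / (2 * (1 - s)) = 1 / (1 + 2 * √(s * (1 - s)))} with hS
  rcases S.eq_empty_or_nonempty with h | ⟨s, hs⟩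
  · rw [h, Real.sInf_empty]; norm_num
  refine (csInf_le ⟨0, fun x hx => hx.1⟩ hs).trans ?_
  by_contra! hlt
  obtain ⟨_, h1, h2⟩ := hs
  have h3 := soto_curve_le (s := s) (by linarith)
  rw [h2] at h3
  have hr0 := Real.sqrt_nonneg (s * (1 - s))
  rw [div_le_div_iff₀ (by positivity) (by linarith)] at h3
  have hsq : √(s * (1 - s)) ^ 2 = s * (1 - s) := Real.sq_sqrt (by nlinarith)
  set r := √(s * (1 - s))
  set u := 1 - s with hu
  have hs' : s = 1 - u := by linarith
  rw [hs'] at h3 hsq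
  have hu1 : 2 / 3 ≤ u := by linarith
  have hu2 : u ≤ 7 / 10 := by linarith
  -- The equation would force `u³ (1 - u) ≥ 0.1089`, but this function is at most `0.1029` for `2/3
  -- ≤ u ≤ 7/10`.
  have h4 : 4 - u ≤ 10 * (u * r) := by nlinarith
  have h5 : (33 / 10 : ℝ) ^ 2 ≤ (10 * (u * r)) ^ 2 := pow_le_pow_left₀ (by norm_num) (by linarith) 2
  have h6 : (10 * (u * r)) ^ 2 = 100 * (u ^ 3 * (1 - u)) := by
    rw [mul_pow, mul_pow, hsq]; ring
  rw [h6] at h5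
  have h7 : u ^ 3 ≤ (7 / 10) ^ 3 := pow_le_pow_left₀ (by linarith) hu2 3
  have h8 : u ^ 3 * (1 - u) ≤ 343 / 1000 * (1 / 3) := by
    have : 0 ≤ u ^ 3 := by positivity
    nlinarith
  nlinarith [mul_nonneg (sub_nonneg.2 hu1) (sub_nonneg.2 hu2), sq_nonneg u, sq_nonneg (u - 7 / 10)]

theorem soto_eq {s : ℝ} (h : 8 / 25 ≤ s) (h' : s ≤ 1 / 3) :
    soto s = (-1 + √(4 * s ^ 2 - 8 * s + 5)) / (2 * (1 - s)) := by
  unfold soto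
  rw [if_neg (not_lt.2 h'), if_pos]
  linarith [sotoPoint_le]

theorem soto_le {s : ℝ} (h : 8 / 25 ≤ s) : soto s ≤ 13 / 25 := by
  by_cases h' : 1 / 3 < s
  · rw [soto, if_pos h']; norm_num
  · rw [soto_eq h (not_lt.1 h')]
    refine (soto_curve_le (by linarith)).trans ?_
    rw [div_le_iff₀ (by linarith)]
    linarith

/-- With `c = 1 + 2 g` and `u = 1 - s` the claim is `1 + c u ≤ √(1 + 4 u²)`; squared and divided by
`u` it is the hypothesis `2 c ≤ (4 - c²) u`. -/
theorem le_soto_of {s g : ℝ} (h : 8 / 25 ≤ s) (h' : s ≤ 1 / 3)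
    (hs : 2 * (2 * (1 / 2 + g)) ≤ (4 - (2 * (1 / 2 + g)) ^ 2) * (1 - s)) : 1 / 2 + g ≤ soto s := by
  rw [soto_eq h h', soto_curve_eq]
  set u := 1 - s with hu
  have hu0 : 0 < u := by linarith
  rw [le_div_iff₀ (by linarith)]
  have : 1 + 2 * (1 / 2 + g) * u ≤ √(1 + 4 * u ^ 2) := by
    refine Real.le_sqrt_of_sq_le ?_
    nlinarith [mul_le_mul_of_nonneg_right hs hu0.le]
  linarith

theorem half_le_soto {s : ℝ} (h : 8 / 25 ≤ s) : 1 / 2 ≤ soto s := by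
  by_cases h' : 1 / 3 < s
  · rw [soto, if_pos h']
  · have := le_soto_of (g := 0) h (not_lt.1 h') (by norm_num; linarith)
    linarith

theorem soto_ge {s : ℝ} (h : 8 / 25 ≤ s) (h' : s ≤ 33 / 100) : 501 / 1000 ≤ soto s := by
  have := le_soto_of (g := 1 / 1000) h (by linarith) (by norm_num; linarith)
  linarith

/-! ### Constraints on the constants -/

/-- The constraints on the constants that do not depend on the accuracy parameters. -/
structure Params.Base (p : Params) : Prop where
  delta_pos : 0 < p.delta
  delta_le : p.delta ≤ 1 / 200
  gamma_pos : 0 < p.gamma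
  gamma_le : p.gamma ≤ 1 / 200
  gamma_le_delta : p.gamma ≤ p.delta / 300
  eta_eq : p.eta = 8 / 25
  tau_eq : p.tau = 1 / 2
  sizeConst_eq : p.sizeConst = p.gamma ^ 2 * p.delta ^ 2 / 1000
  walkConst_ge : 3840000 * (8 + 8 / p.gamma ^ 2) ≤ p.walkConst
  walkConst_ge' : 100 * (8 + 8 / p.delta ^ 3) ≤ p.walkConst
  startConst_ge : 48 / p.delta ≤ p.startConst

/-- Accuracy parameters for which Find is analyzed. -/
structure Params.Tame (p : Params) (ε μ : ℝ) : Prop where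
  eps_nonneg : 0 ≤ ε
  eps_lt : ε < 1
  mu_pos : 0 < μ
  mu_le : μ ≤ 1
  delta_le : p.delta ≤ μ / 200
  log_le : -Real.log (1 - ε) * (μ + 1) ≤ μ / 50

/-- This is the purpose of the large slack `η = 8/25`: the ratio demanded from a tripartition never
exceeds `13/25`, the hypothesis of `rounding_pair`. -/
theorem Params.sigma_ge {p : Params} (hp : p.Base) {ε μ : ℝ} (hε : 0 ≤ ε) (hμ : 0 < μ) :
    8 / 25 ≤ p.sigma ε μ := by
  unfold Params.sigma
  rw [hp.eta_eq]
  have : (max (1 - ε) 0) ^ (1 + 1 / μ) ≤ 1 :=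
    Real.rpow_le_one (le_max_right _ _) (max_le (by linarith) zero_le_one) (by positivity)
  linarith

/-- A ratio other than `1/2` means `σ ≤ 1/3`, hence `(17/25) (1 - ε)^{1 + 1/μ} ≥ 2/3`. The power is
then at least `50/51`, and its logarithm at least `-1/50`. -/
theorem Params.tame_of_soto {p : Params} (hp : p.Base) {ε μ : ℝ} (hε : 0 ≤ ε) (hμ : 0 < μ)
    (hμ1 : μ ≤ 1) (hδ : p.delta ≤ μ / 200) (h : soto (p.sigma ε μ) ≠ 1 / 2) : p.Tame ε μ := by
  have hσ : p.sigma ε μ ≤ 1 / 3 := by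
    by_contra! h'
    exact h (by rw [soto, if_pos h'])
  unfold Params.sigma at hσ
  rw [hp.eta_eq] at hσ
  have hpow : 50 / 51 ≤ (max (1 - ε) 0) ^ (1 + 1 / μ) := by linarith
  have hε1 : ε < 1 := by
    by_contra! h'
    rw [max_eq_right (by linarith), Real.zero_rpow (by positivity)] at hpow
    norm_num at hpow
  rw [max_eq_left (by linarith)] at hpow
  have h1 := Real.log_le_log (by norm_num) hpow
  rw [Real.log_rpow (by linarith)] at h1
  have h2 : -(1 / 50) ≤ Real.log (50 / 51) := by
    have := Real.one_sub_inv_le_log_of_pos (x := 50 / 51) (by norm_num)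
    norm_num at this ⊢
    linarith
  refine ⟨hε, hε1, hμ, hμ1, hδ, ?_⟩
  have h3 : μ * ((1 + 1 / μ) * Real.log (1 - ε)) = Real.log (1 - ε) * (μ + 1) := by
    field_simp
  nlinarith

namespace Params.Tame

variable {p : Params} {ε μ : ℝ}

theorem log_nonpos (h : p.Tame ε μ) : Real.log (1 - ε) ≤ 0 :=
  Real.log_nonpos (by linarith [h.eps_lt]) (by linarith [h.eps_nonneg])

theorem log_ge (h : p.Tame ε μ) : -(1 / 100) ≤ Real.log (1 - ε) := by
  have h1 := h.log_le
  have h2 := h.mu_pos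
  have h3 := h.mu_le
  have h4 := h.log_nonpos
  by_contra! h5
  nlinarith

theorem zeta_mul (h : p.Tame ε μ) : p.zeta ε μ * μ = 2 * (p.delta - Real.log (1 - ε)) := by
  unfold Params.zeta
  field_simp [h.mu_pos.ne']

theorem zeta_le (h : p.Tame ε μ) : p.zeta ε μ ≤ 1 / 20 := by
  have h0 := h.mu_pos
  unfold Params.zeta
  rw [div_le_iff₀ h0]
  nlinarith [h.log_le, h.delta_le, h.log_nonpos]

theorem zeta_ge (hp : p.Base) (h : p.Tame ε μ) : 2 * p.delta ≤ p.zeta ε μ := by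
  have h0 := h.mu_pos
  have := hp.delta_pos
  unfold Params.zeta
  rw [le_div_iff₀ h0]
  nlinarith [h.log_nonpos, h.mu_le]

theorem zeta_pos (hp : p.Base) (h : p.Tame ε μ) : 0 < p.zeta ε μ := by
  linarith [h.zeta_ge hp, hp.delta_pos]

variable {m : ℕ}

theorem log_pos (hp : p.Base) (hm : 0 < m) : 1 ≤ Real.log (4 * m / p.delta ^ 2) := by
  have h1 := hp.delta_pos
  have h2 := hp.delta_le
  have hm' : (1 : ℝ) ≤ m := by exact_mod_cast hm
  rw [Real.le_log_iff_exp_le (by positivity), le_div_iff₀ (by positivity)]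
  have := Real.exp_one_lt_d9
  nlinarith [Real.exp_pos 1]

theorem le_zeta_mul_len (hp : p.Base) (h : p.Tame ε μ) :
    Real.log (4 * m / p.delta ^ 2) ≤ p.zeta ε μ * p.len m ε μ := by
  have := Nat.le_ceil (Real.log (4 * m / p.delta ^ 2) / p.zeta ε μ)
  rw [div_le_iff₀ (h.zeta_pos hp)] at this
  rw [mul_comm (p.zeta ε μ)]
  exact this

theorem zeta_mul_len_le (hp : p.Base) (h : p.Tame ε μ) (hm : 0 < m) :
    p.zeta ε μ * p.len m ε μ ≤ Real.log (4 * m / p.delta ^ 2) + p.zeta ε μ := by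
  have hz := h.zeta_pos hp
  have := Nat.ceil_lt_add_one (a := Real.log (4 * m / p.delta ^ 2) / p.zeta ε μ)
    (div_nonneg (by linarith [log_pos hp hm]) hz.le)
  have h2 := mul_lt_mul_of_pos_left this hz
  rw [mul_add, mul_div_cancel₀ _ hz.ne', mul_one] at h2
  exact h2.le

theorem two_le_len (hp : p.Base) (h : p.Tame ε μ) (hm : 0 < m) : 2 ≤ p.len m ε μ := by
  have h1 := h.le_zeta_mul_len (m := m) hp
  have h2 := log_pos hp hm
  have h3 := h.zeta_le
  by_contra! h4
  have h5 : (p.len m ε μ : ℝ) ≤ 1 := by exact_mod_cast Nat.lt_succ_iff.1 h4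
  nlinarith [h.zeta_pos hp]

theorem exp_zeta_len_le (hp : p.Base) (h : p.Tame ε μ) (hm : 0 < m) :
    Real.exp (-(p.zeta ε μ * p.len m ε μ)) ≤ 1 / m := by
  have h1 := h.le_zeta_mul_len (m := m) hp
  have hm' : (0 : ℝ) < m := by exact_mod_cast hm
  have hd := hp.delta_pos
  have h2 : Real.log m ≤ Real.log (4 * m / p.delta ^ 2) := by
    refine Real.log_le_log hm' ?_
    rw [le_div_iff₀ (by positivity)]
    have : p.delta ^ 2 ≤ 1 := by nlinarith [hp.delta_le]
    nlinarith
  calc Real.exp (-(p.zeta ε μ * p.len m ε μ)) ≤ Real.exp (-Real.log m) :=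
        Real.exp_le_exp.2 (by linarith)
    _ = 1 / m := by rw [Real.exp_neg, Real.exp_log hm', one_div]

/-- The decay `(1 - ε) e ^ (-δ)` per step against which starting vertices are compared. -/
theorem rate_eq (h : p.Tame ε μ) :
    (1 - ε) * Real.exp (-p.delta) = Real.exp (-(p.zeta ε μ * μ / 2)) := by
  rw [h.zeta_mul, show -(2 * (p.delta - Real.log (1 - ε)) / 2) = Real.log (1 - ε) + -p.delta by ring,
    Real.exp_add, Real.exp_log (by linarith [h.eps_lt])]

/-- By `rate_eq` the power is `exp (-μ ζ ℓ)`, where `ζ ℓ` is `log (4 m / δ²)` up to rounding. The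
rounding costs at most a factor `e^{1/20} ≤ 5/4`, and `(4/δ²)^μ ≤ 4/δ²` since `μ ≤ 1`. -/
theorem rate_pow_ge (hp : p.Base) (h : p.Tame ε μ) (hm : 0 < m) :
    p.delta ^ 2 / 5 / (m : ℝ) ^ (1 + μ) ≤
      ((1 - ε) * Real.exp (-p.delta)) ^ (2 * p.len m ε μ) / m := by
  have hm' : (0 : ℝ) < m := by exact_mod_cast hm
  have hd := hp.delta_pos
  have h1 := h.zeta_mul_len_le hp hm
  have h2 := h.mu_pos
  have h3 := h.zeta_le
  rw [h.rate_eq, ← Real.exp_nat_mul, Real.rpow_add hm', Real.rpow_one, mul_comm (m : ℝ), ← div_div]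
  refine div_le_div_of_nonneg_right ?_ hm'.le
  have e : ((2 * p.len m ε μ : ℕ) : ℝ) * -(p.zeta ε μ * μ / 2) =
      -(μ * (p.zeta ε μ * p.len m ε μ)) := by push_cast; ring
  rw [e]
  have h4 : μ * (p.zeta ε μ * p.len m ε μ) ≤ μ * Real.log (4 * m / p.delta ^ 2) + 1 / 20 := by
    have := mul_le_mul_of_nonneg_left h1 h2.le
    nlinarith [h.mu_le]
  have h5 : Real.log (4 * m / p.delta ^ 2) = Real.log m - Real.log (p.delta ^ 2 / 4) := by
    rw [← Real.log_div hm'.ne' (by positivity)]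
    congr 1; field_simp
  have h6 : Real.log (p.delta ^ 2 / 4) ≤ 0 :=
    Real.log_nonpos (by positivity) (by nlinarith [hp.delta_le])
  have h7 : -(μ * Real.log m) + Real.log (p.delta ^ 2 / 4) - 1 / 20 ≤
      -(μ * (p.zeta ε μ * p.len m ε μ)) := by
    rw [h5] at h4
    nlinarith [h.mu_le]
  refine le_trans ?_ (Real.exp_le_exp.2 h7)
  rw [Real.exp_sub, Real.exp_add, Real.exp_log (by positivity), Real.exp_neg, mul_comm μ,
    Real.exp_mul, Real.exp_log hm', div_eq_mul_inv (p.delta ^ 2 / 5)]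
  have h8 : Real.exp (1 / 20) ≤ 5 / 4 := by
    have := Real.exp_bound_div_one_sub_of_interval' (x := 1 / 20) (by norm_num) (by norm_num)
    refine this.le.trans (by norm_num)
  rw [le_div_iff₀ (Real.exp_pos _)]
  have h9 : 0 < ((m : ℝ) ^ μ)⁻¹ := inv_pos.2 (Real.rpow_pos_of_pos hm' _)
  have h10 : 0 < p.delta ^ 2 * ((m : ℝ) ^ μ)⁻¹ := by positivity
  nlinarith

end Params.Tame

section
variable {V : Type} [Fintype V] (G : MultiGraph V) (U : Finset V)

theorem le_two_pow_lg : Fintype.card V + G.total Finset.univ + 2 ≤ 2 ^ G.lg :=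
  Nat.le_pow_clog (by norm_num) _

theorem one_le_lg : 1 ≤ G.lg := by
  by_contra! h
  have := le_two_pow_lg G
  rw [Nat.lt_one_iff.1 h] at this
  simp at this

theorem le_exp_lg : (Fintype.card V + G.total Finset.univ + 2 : ℝ) ≤ Real.exp G.lg := by
  have h : (Fintype.card V + G.total Finset.univ + 2 : ℝ) ≤ 2 ^ G.lg := by
    exact_mod_cast le_two_pow_lg G
  refine h.trans ?_
  rw [← mul_one (G.lg : ℝ), Real.exp_nat_mul]
  refine pow_le_pow_left₀ (by norm_num) ?_ _
  linarith [Real.add_one_le_exp 1]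

theorem total_le_total_univ : G.total U ≤ G.total Finset.univ := by
  unfold MultiGraph.total MultiGraph.vol MultiGraph.deg
  exact (Finset.sum_le_sum fun j _ => Finset.sum_le_sum_of_subset (Finset.subset_univ U)).trans
    (Finset.sum_le_sum_of_subset (Finset.subset_univ U))

theorem log_total_le (hU : 0 < G.total U) : Real.log (G.total U) ≤ G.lg := by
  rw [Real.log_le_iff_le_exp (by exact_mod_cast hU)]
  have h1 := le_exp_lg G
  have h2 : (G.total U : ℝ) ≤ G.total Finset.univ := by exact_mod_cast total_le_total_univ G U
  have h3 : (0 : ℝ) ≤ Fintype.card V := Nat.cast_nonneg _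
  linarith

/-- A vertex from which the signed walk of length `ℓ` keeps a large norm. -/
def GoodStart (p : Params) (ε μ : ℝ) (i : V) : Prop :=
  i ∈ U ∧ 0 < G.deg U i ∧
    ((1 - ε) * Real.exp (-p.delta)) ^ (2 * p.len (G.total U) ε μ) / G.total U ≤
      G.moment U (-1) (G.pointMass U i) (2 * p.len (G.total U) ε μ)

/-- `exists_large_moment` is applied to the set `B` of the vertices that are not good. If the good
ones had less than a fraction `δ/8` of the volume, some vertex of `B` would satisfy the bound with
`1 - ε - δ/8 ≥ (1 - ε) e^{-δ}`, so it would be good. -/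
theorem vol_goodStart_ge {p : Params} (hp : p.Base) {ε μ : ℝ} (h : p.Tame ε μ) (χ : V → Bool)
    (hχ : G.uncut χ U ≤ ε * G.total U) (hU : 0 < G.total U) :
    p.delta / 8 * G.total U ≤ G.vol U (U.filter fun i => GoodStart G U p ε μ i) := by
  by_contra! hlt
  have hd := hp.delta_pos
  have hd2 := hp.delta_le
  have hε : ε ≤ 1 / 50 := by
    have h1 := h.log_ge
    rw [Real.le_log_iff_exp_le (by linarith [h.eps_lt])] at h1
    linarith [Real.add_one_le_exp (-(1 / 100 : ℝ))]
  set B := U.filter fun i => ¬GoodStart G U p ε μ i with hB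
  have hBU : U \ B = U.filter fun i => GoodStart G U p ε μ i := by
    ext i; simp only [hB, Finset.mem_sdiff, Finset.mem_filter]; tauto
  obtain ⟨i, hi, hdi, hm⟩ := G.exists_large_moment U (Finset.filter_subset _ _ : B ⊆ U) χ hχ hU
    (θ := p.delta / 8) (by rw [hBU]; exact hlt.le) (by linarith) (by linarith)
    (p.len (G.total U) ε μ)
  refine (Finset.mem_filter.1 hi).2 ⟨(Finset.mem_filter.1 hi).1, hdi, le_trans ?_ hm⟩
  have hexp : Real.exp (-p.delta) ≤ 1 - p.delta / 2 := by
    have h1 := Real.abs_exp_sub_one_sub_id_le (x := -p.delta) (by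
      rw [abs_neg, abs_of_pos hd]; linarith)
    have h2 := (abs_le.1 h1).2
    nlinarith
  refine div_le_div_of_nonneg_right ?_ (Nat.cast_nonneg _)
  refine pow_le_pow_left₀ (mul_nonneg (by linarith) (Real.exp_pos _).le) ?_ _
  nlinarith

/-- Each random vertex is good with probability at least `δ/8`, and at least `(48/δ) lg` of them are
drawn. -/
theorem pr_startVertices_le {p : Params} (hp : p.Base) {ε μ : ℝ} (h : p.Tame ε μ) (χ : V → Bool)
    (hχ : G.uncut χ U ≤ ε * G.total U) (hU : 0 < G.total U) :
    pr (startVertices G p U) (fun P => ∀ i ∈ P, ¬GoodStart G U p ε μ i) ≤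
      Real.exp (-(6 * G.lg)) := by
  have hvol := vol_goodStart_ge G U hp h χ hχ hU
  have hd := hp.delta_pos
  have hm0 : (0 : ℝ) < G.total U := by exact_mod_cast hU
  set Q : Option V → Prop := fun o => ∀ i ∈ o, ¬GoodStart G U p ε μ i with hQ
  have hone : pr (randomVertex G U) Q ≤ 1 - p.delta / 8 := by
    have hw : (∑ j, if j ∈ U then (G.deg U j : ℝ≥0) else 0) = (G.total U : ℝ≥0) := by
      rw [Finset.sum_ite_mem, Finset.univ_inter, MultiGraph.total, MultiGraph.vol]
      push_cast; rfl
    have hw' : (∑ j, ((if j ∈ U then (G.deg U j : ℝ≥0) else 0 : ℝ≥0) : ℝ)) = G.total U := by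
      have := congrArg (fun y : ℝ≥0 => (y : ℝ)) hw
      push_cast at this
      simpa using this
    have : pr (randomVertex G U) (fun o => ¬Q o) = G.vol U (U.filter fun i => GoodStart G U p ε μ i) /
        G.total U := by
      unfold pr randomVertex
      rw [E_tick_bind, E_pick (by rw [hw]; exact_mod_cast hU.ne'), hw']
      congr 1
      rw [MultiGraph.cast_vol, Finset.sum_filter, ← Finset.sum_filter_add_sum_filter_not Finset.univ
        (· ∈ U), add_eq_left.2]
      · rw [Finset.filter_mem_eq_inter, Finset.univ_inter]
        refine Finset.sum_congr rfl fun k hk => ?_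
        simp [hQ, hk]
      · exact Finset.sum_eq_zero fun k hk => by simp [(Finset.mem_filter.1 hk).2]
    rw [pr_not] at this
    have h2 : p.delta / 8 ≤ G.vol U (U.filter fun i => GoodStart G U p ε μ i) / G.total U := by
      rw [le_div_iff₀ hm0]; exact hvol
    linarith
  have h1 : pr (startVertices G p U) (fun P => ∀ i ∈ P, ¬GoodStart G U p ε μ i) =
      pr (randomVertex G U) Q ^ ⌈p.startConst * G.lg⌉₊ := by
    rw [← pr_repeated_all]
    unfold pr startVertices
    rw [E_bind]
    congr 1; ext l
    rw [E_pure]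
    congr 1
    simp only [List.reduceOption_mem_iff, hQ, eq_iff_iff]
    constructor
    · rintro h _ ho i rfl; exact h i ho
    · intro h i hi; exact h _ hi i rfl
  rw [h1]
  have h2 : 1 - p.delta / 8 ≤ Real.exp (-(p.delta / 8)) := by
    linarith [Real.add_one_le_exp (-(p.delta / 8))]
  refine (pow_le_pow_left₀ (pr_nonneg _ _) (hone.trans h2) _).trans ?_
  rw [← Real.exp_nat_mul]
  refine Real.exp_le_exp.2 ?_
  have h3 : p.startConst * G.lg ≤ ⌈p.startConst * G.lg⌉₊ := Nat.le_ceil _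
  have h4 := hp.startConst_ge
  rw [div_le_iff₀ hd] at h4
  have h5 : (0 : ℝ) ≤ G.lg := Nat.cast_nonneg _
  nlinarith [mul_le_mul_of_nonneg_left h3 hd.le, mul_le_mul_of_nonneg_right h4 h5]

/-- The index of the last threshold. -/
def lastThreshold (p : Params) (m : ℕ) (μ : ℝ) : ℕ :=
  ⌊Real.log ((m : ℝ) ^ (1 + μ / 2) / p.gamma) / -Real.log (1 - p.gamma)⌋₊

theorem thresholds_eq (p : Params) (m : ℕ) (μ : ℝ) : thresholds p m μ =
    (List.range' 0 (lastThreshold p m μ + 1)).map fun r => (1 - p.gamma) ^ r := by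
  rw [thresholds, lastThreshold, List.range_eq_range']

theorem neg_log_ge {g : ℝ} (hg : g < 1) : g ≤ -Real.log (1 - g) := by
  have := Real.log_le_sub_one_of_pos (x := 1 - g) (by linarith)
  linarith

theorem pow_lastThreshold_le {p : Params} (hp : p.Base) {m : ℕ} (hm : 0 < m) (μ : ℝ) :
    (1 - p.gamma) ^ (lastThreshold p m μ + 1) ≤ p.gamma / (m : ℝ) ^ (1 + μ / 2) := by
  have hg := hp.gamma_pos
  have hg1 := hp.gamma_le
  have hm' : (0 : ℝ) < m := by exact_mod_cast hm
  have hl : 0 < -Real.log (1 - p.gamma) := hg.trans_le (neg_log_ge (by linarith))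
  have h1 := Nat.lt_floor_add_one
    (Real.log ((m : ℝ) ^ (1 + μ / 2) / p.gamma) / -Real.log (1 - p.gamma))
  rw [div_lt_iff₀ hl] at h1
  have hpos : 0 < (m : ℝ) ^ (1 + μ / 2) / p.gamma := div_pos (Real.rpow_pos_of_pos hm' _) hg
  rw [← inv_div, ← Real.exp_log (inv_pos.2 hpos), Real.log_inv,
    ← Real.exp_log (pow_pos (by linarith : 0 < 1 - p.gamma) _), Real.log_pow, Real.exp_le_exp]
  unfold lastThreshold
  push_cast
  linarith

theorem lastThreshold_le {p : Params} (hp : p.Base) {μ : ℝ} (hμ : 0 < μ) (hμ1 : μ ≤ 1)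
    (hU : 0 < G.total U) : (lastThreshold p (G.total U) μ + 1 : ℝ) ≤ 2 / p.gamma ^ 2 * G.lg := by
  have hg := hp.gamma_pos
  have hg1 := hp.gamma_le
  have hm1 : (1 : ℝ) ≤ G.total U := by exact_mod_cast hU
  have hm' : (0 : ℝ) < G.total U := by linarith
  have hlg : (1 : ℝ) ≤ G.lg := by exact_mod_cast one_le_lg G
  have hl := neg_log_ge (g := p.gamma) (by linarith)
  have hlm := log_total_le G U hU
  have hlm0 : 0 ≤ Real.log (G.total U) := Real.log_nonneg hm1
  have hlog : Real.log ((G.total U : ℝ) ^ (1 + μ / 2) / p.gamma) ≤ 3 / 2 * G.lg + 1 / p.gamma := by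
    rw [Real.log_div (Real.rpow_pos_of_pos hm' _).ne' hg.ne', Real.log_rpow hm']
    have := neg_log_ge (g := 1 - p.gamma) (by linarith)
    have h2 := Real.one_sub_inv_le_log_of_pos hg
    rw [← one_div] at h2
    nlinarith
  have hlog0 : 0 ≤ Real.log ((G.total U : ℝ) ^ (1 + μ / 2) / p.gamma) := by
    refine Real.log_nonneg ?_
    rw [le_div_iff₀ hg]
    have := Real.one_le_rpow hm1 (by linarith : 0 ≤ 1 + μ / 2)
    linarith
  have h1 : (lastThreshold p (G.total U) μ : ℝ) ≤ (3 / 2 * G.lg + 1 / p.gamma) / p.gamma := by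
    refine (Nat.floor_le (div_nonneg hlog0 (hg.le.trans hl))).trans ?_
    exact div_le_div₀ (hlog0.trans hlog) hlog hg hl
  have h2 : (3 / 2 * G.lg + 1 / p.gamma) / p.gamma + 1 =
      (3 / 2 * p.gamma * G.lg + 1 + p.gamma ^ 2) / p.gamma ^ 2 := by field_simp
  have h3 : (lastThreshold p (G.total U) μ + 1 : ℝ) ≤
      (3 / 2 * p.gamma * G.lg + 1 + p.gamma ^ 2) / p.gamma ^ 2 := by linarith
  refine h3.trans ?_
  have h4 : 0 < p.gamma ^ 2 := by positivity
  rw [div_mul_eq_mul_div (2 : ℝ) (p.gamma ^ 2), div_le_div_iff_of_pos_right h4]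
  nlinarith

theorem abs_walkDensity_le_one (l : ℕ) {i j : V} (hi : i ∈ U) (hd : G.deg U i ≠ 0) (hj : j ∈ U) :
    |walkDensity G U (-1) l i j| ≤ 1 := by
  rcases Nat.eq_zero_or_pos (G.deg U j) with h0 | hpos
  · rw [walkDensity_of_deg_eq_zero G U _ l hd h0]; simp
  have h := pr_walk_last G U hi hd hj l (s := -1) (by norm_num)
  have h1 := pr_nonneg (walk G U l (i, false)) fun T => T.getLastD (i, false) = (j, false)
  have h2 := pr_le_one (walk G U l (i, false)) fun T => T.getLastD (i, false) = (j, false)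
  have h3 := pr_nonneg (walk G U l (i, false)) fun T => T.getLastD (i, false) = (j, true)
  have h4 := pr_le_one (walk G U l (i, false)) fun T => T.getLastD (i, false) = (j, true)
  have hD : (1 : ℝ) ≤ G.deg U j := by exact_mod_cast hpos
  have h5 : |(G.deg U j : ℝ) * walkDensity G U (-1) l i j| ≤ 1 := by
    rw [← h, abs_le]; constructor <;> linarith
  rw [abs_mul, abs_of_pos (by linarith)] at h5
  nlinarith [abs_nonneg (walkDensity G U (-1) l i j)]

theorem walkDensity_le_one (l : ℕ) {i j : V} (hi : i ∈ U) (hd : G.deg U i ≠ 0) (hj : j ∈ U) :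
    walkDensity G U 1 l i j ≤ 1 := by
  rcases Nat.eq_zero_or_pos (G.deg U j) with h0 | hpos
  · rw [walkDensity_of_deg_eq_zero G U _ l hd h0]; simp
  have h := pr_walk_vertex G U hi hd hj (le_refl l)
  have h2 := pr_le_one (walk G U l (i, false)) fun T => T[l]?.map Prod.fst = some j
  have h3 := pr_nonneg (walk G U l (i, false)) fun T => T[l]?.map Prod.fst = some j
  have hD : (1 : ℝ) ≤ G.deg U j := by exact_mod_cast hpos
  nlinarith

/-- A run from a good vertex cannot pass all thresholds without success. -/
theorem not_runInv {p : Params} (hp : p.Base) {ε μ : ℝ} (h : p.Tame ε μ) {i : V}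
    (hi : GoodStart G U p ε μ i) (hU : 0 < G.total U) (c : Finset V × Finset V) :
    ¬RunInv G U p ε μ (1 / 200) (walkDensity G U (-1) (p.len (G.total U) ε μ) i)
      (lastThreshold p (G.total U) μ + 1) c := by
  rintro ⟨lev, -, -, h3, h4, h5⟩
  obtain ⟨hiU, hdi, hmom⟩ := hi
  set l := p.len (G.total U) ε μ with hl
  set R := lastThreshold p (G.total U) μ with hR
  set q := walkDensity G U (-1) l i with hq
  set m : ℝ := (G.total U : ℝ) with hm
  have hm0 : 0 < m := by rw [hm]; exact_mod_cast hU
  have hg := hp.gamma_pos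
  have hg1 := hp.gamma_le
  have hg2 := hp.gamma_le_delta
  have hd := hp.delta_pos
  have hl2 : 2 ≤ l := h.two_le_len hp hU
  have hqq : p.delta ^ 2 / 5 / m ^ (1 + μ) ≤ G.ip U q q := by
    have := (h.rate_pow_ge hp hU).trans hmom
    rwa [MultiGraph.moment_even] at this
  -- The last factor absorbs the division by `m` in the definition of a good start, because `e^{-ζℓ}
  -- ≤ 1/m`. Hence the moment is at least `X^{2ℓ}`, and `rayleigh_ge` applies with `X ≥ 24/25`.
  set X := (1 - ε) * Real.exp (-p.delta) * Real.exp (-(p.zeta ε μ / 2)) with hX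
  have hX1 : 24 / 25 ≤ X := by
    rw [hX, h.rate_eq, ← Real.exp_add]
    refine le_trans ?_ (Real.add_one_le_exp _)
    have := h.zeta_mul
    have := h.log_ge
    have := h.zeta_le
    have := hp.delta_le
    linarith
  have hray : 24 / 25 * G.ip U q q ≤ G.ip U q (G.lazyOp U (-1) q) := by
    refine (mul_le_mul_of_nonneg_right hX1 (G.ip_self_nonneg U q)).trans ?_
    refine G.rayleigh_ge U hiU hdi (by linarith) (by omega) (le_trans ?_ hmom)
    rw [hX, mul_pow, div_eq_mul_inv]
    refine mul_le_mul_of_nonneg_left ?_ (pow_nonneg (mul_nonneg (by linarith [h.eps_lt])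
      (Real.exp_pos _).le) _)
    rw [← Real.exp_nat_mul]
    refine le_trans (Real.exp_le_exp.2 (le_of_eq ?_))
      ((h.exp_zeta_len_le hp hU).trans_eq (one_div _))
    push_cast; ring
  have ht := pow_lastThreshold_le hp hU μ
  rw [← hR, ← hm] at ht
  obtain ⟨r, hr, hacc⟩ := exists_accepts G U p (ε := ε) (μ := μ) (q := q) (lev := lev)
    (t := fun r => (1 - p.gamma) ^ r) (R := R)
    -- `β` bounds `|q|` at the vertices left over by the last threshold; `51/50` exceeds `(1 +
    -- 1/200)/(1 - 1/200)`. Since `γ ≤ δ/300`, dropping these vertices is negligible compared with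
    -- `‖q‖²`.
    (β := 51 / 50 * (p.gamma / m ^ (1 + μ / 2))) (fun r => pow_pos (by linarith) r)
    (pow_right_anti₀ (by linarith) (by linarith)) hray
    (fun j hj hlev => by
      have := (h3 j hj (by omega)).2
      have := abs_nonneg (q j)
      nlinarith)
    (fun j hj hlev => by
      have := (h3 j hj (by omega)).1
      have := pow_pos (by linarith : 0 < 1 - p.gamma) (lev j)
      nlinarith)
    (fun j hj hlev => by
      have := h4 j hj (by omega)
      have := abs_nonneg (q j)
      nlinarith)
    (by
      refine le_trans ?_ (div_le_div_of_nonneg_right hqq (by norm_num))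
      have e2 : 0 < m ^ (1 + μ) := Real.rpow_pos_of_pos hm0 _
      have e3 : m * (51 / 50 * (p.gamma / m ^ (1 + μ / 2))) ^ 2 =
          (51 / 50) ^ 2 * p.gamma ^ 2 / m ^ (1 + μ) := by
        rw [mul_pow, div_pow p.gamma, ← Real.rpow_natCast (m ^ (1 + μ / 2)), ← Real.rpow_mul hm0.le]
        rw [show (1 + μ / 2) * ((2 : ℕ) : ℝ) = 1 + (1 + μ) by push_cast; ring,
          Real.rpow_add hm0, Real.rpow_one]
        field_simp
      rw [e3, div_div, mul_comm (m ^ (1 + μ)), ← div_div]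
      refine div_le_div_of_nonneg_right ?_ e2.le
      have : p.gamma ^ 2 ≤ (p.delta / 300) ^ 2 := pow_le_pow_left₀ hg.le hg2 2
      nlinarith)
    (by linarith [half_le_soto (p.sigma_ge hp h.eps_nonneg h.mu_pos)])
    (soto_le (p.sigma_ge hp h.eps_nonneg h.mu_pos)) hU (one_le_lg G)
    (by rw [hp.sizeConst_eq]; positivity)
    (by
      -- The factor `γ²` in `sizeConst` cancels the number of levels, at most `2 lg / γ²`. What
      -- remains is `(2/25) δ² lg` against `(1/5) δ² lg`.
      have h1 := lastThreshold_le G U hp h.mu_pos h.mu_le hU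
      rw [← hR] at h1
      have hlg : (1 : ℝ) ≤ G.lg := by exact_mod_cast one_le_lg G
      have h2 : 40 * ((R + 1) * p.sizeConst) ≤ 40 * (2 / p.gamma ^ 2 * G.lg * p.sizeConst) := by
        have : 0 ≤ p.sizeConst := by rw [hp.sizeConst_eq]; positivity
        gcongr
      have h3 : 40 * (2 / p.gamma ^ 2 * G.lg * p.sizeConst) = 2 / 25 * p.delta ^ 2 * G.lg := by
        rw [hp.sizeConst_eq]; field_simp; norm_num
      have e2 : 0 < m ^ (1 + μ) := Real.rpow_pos_of_pos hm0 _
      have h4 : p.delta ^ 2 / 5 ≤ G.ip U q q * m ^ (1 + μ) := by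
        rwa [div_le_iff₀ e2] at hqq
      have h5 : 0 < p.delta ^ 2 * G.lg := by positivity
      rw [← mul_assoc]
      have h6 := mul_le_mul_of_nonneg_right h4 (by linarith : (0 : ℝ) ≤ G.lg)
      linarith)
  exact h5 r (by omega) hacc

/-- Find succeeds with high probability if it is started from a good vertex whose walk spreads. -/
theorem pr_find_none_le {p : Params} (hp : p.Base) {ε μ α : ℝ} (h : p.Tame ε μ) {i : V}
    (hi : GoodStart G U p ε μ i) (hU : 0 < G.total U) (hα : 0 < α)
    (hdens : ∀ j ∈ U, walkDensity G U 1 (p.len (G.total U) ε μ) i j ≤ 6 * α) {P : List V}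
    (hiP : i ∈ P) :
    pr (find G p U ε μ α P) (fun o => o = none) ≤ Real.exp (-(6 * G.lg)) := by
  have hg := hp.gamma_pos
  have hg1 := hp.gamma_le
  have hdi : G.deg U i ≠ 0 := hi.2.1.ne'
  have hwc : 0 < p.walkConst := lt_of_lt_of_le (by positivity) hp.walkConst_ge
  unfold find
  rw [thresholds_eq]
  have hrun := pr_findRuns_none_le G U (p := p) (ε := ε) (μ := μ) (α := α) (κ := 1 / 200)
    (e := U.card * (4 * Real.exp (-(p.walkConst * (1 / 200) ^ 2 / (16 * 6) * G.lg))))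
    (q := walkDensity G U (-1) (p.len (G.total U) ε μ) i) (i := i)
    (R := lastThreshold p (G.total U) μ) (by positivity) (not_runInv G U hp h hi hU)
    (fun r _ c hc => pr_threshold_le G U hi.1 hdi (by linarith) (by norm_num) (by norm_num)
      (by norm_num) hα hwc (one_le_lg G) hdens r c hc)
    (lastThreshold p (G.total U) μ + 1) 0 (by omega) (P.map fun i => (i, ∅, ∅))
    ⟨(i, ∅, ∅), List.mem_map.2 ⟨i, hiP, rfl⟩, rfl, runInv_zero G U hg.le (by norm_num)
      fun j hj => abs_walkDensity_le_one G U _ hi.1 hdi hj⟩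
  refine hrun.trans ?_
  have hlg : (1 : ℝ) ≤ G.lg := by exact_mod_cast one_le_lg G
  have h1 := lastThreshold_le G U hp h.mu_pos h.mu_le hU
  have h2 : (U.card : ℝ) ≤ Real.exp G.lg := by
    have h1 := le_exp_lg G
    have h2 : (U.card : ℝ) ≤ Fintype.card V := by exact_mod_cast Finset.card_le_univ U
    have h3 : (0 : ℝ) ≤ G.total Finset.univ := Nat.cast_nonneg _
    linarith
  have h3 : (G.lg : ℝ) ≤ Real.exp G.lg := by linarith [Real.add_one_le_exp (G.lg : ℝ)]
  have h4 : 8 / p.gamma ^ 2 ≤ Real.exp (8 / p.gamma ^ 2 * G.lg) := by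
    have : 0 < 8 / p.gamma ^ 2 := by positivity
    have := Real.add_one_le_exp (8 / p.gamma ^ 2 * G.lg)
    nlinarith
  -- Here `3840000 = 16 · 6 · 200²`, so each estimate fails with probability at most `4 exp (-(8 +
  -- 8/γ²) lg)`. This pays for the number of thresholds, for the number of vertices and for the
  -- claimed `exp (-6 lg)`.
  have h5 := hp.walkConst_ge
  push_cast
  calc (lastThreshold p (G.total U) μ + 1 : ℝ) *
        (U.card * (4 * Real.exp (-(p.walkConst * (1 / 200) ^ 2 / (16 * 6) * G.lg))))
      ≤ (2 / p.gamma ^ 2 * G.lg) * (Real.exp G.lg * (4 *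
          Real.exp (-(p.walkConst * (1 / 200) ^ 2 / (16 * 6) * G.lg)))) := by gcongr
    _ = 8 / p.gamma ^ 2 * (G.lg * (Real.exp G.lg *
          Real.exp (-(p.walkConst * (1 / 200) ^ 2 / (16 * 6) * G.lg)))) := by ring
    _ ≤ Real.exp (8 / p.gamma ^ 2 * G.lg) * (Real.exp G.lg * (Real.exp G.lg *
          Real.exp (-(p.walkConst * (1 / 200) ^ 2 / (16 * 6) * G.lg)))) := by gcongr
    _ = Real.exp (8 / p.gamma ^ 2 * G.lg + (G.lg + (G.lg +
          -(p.walkConst * (1 / 200) ^ 2 / (16 * 6) * G.lg)))) := by simp only [Real.exp_add]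
    _ ≤ Real.exp (-(6 * G.lg)) := Real.exp_le_exp.2 (by nlinarith)

end

namespace MultiGraph

variable {V : Type} (G : MultiGraph V) (U : Finset V)

/-! ### Cheeger's inequality for functions with expanding level sets -/

/-- Induction on the number of vertices where `g` is positive. Subtracting the smallest positive
value `v` on `S = {g > 0}` leaves a function whose level sets are among the old ones. It lowers the
weighted sum by `v vol S` and the total variation by `2 v` times the boundary of `S`. -/
theorem coarea_le {Φ : ℝ} (g : V → ℝ) (hg : ∀ j ∈ U, 0 ≤ g j)
    (hΦ : ∀ s : ℝ, 0 ≤ s → Φ * G.vol U (U.filter fun j => s < g j) ≤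
      G.edges (U.filter fun j => s < g j) (U \ U.filter fun j => s < g j)) :
    2 * Φ * ∑ j ∈ U, G.deg U j * g j ≤ ∑ j ∈ U, ∑ k ∈ U, (G.mult j k : ℝ) * |g j - g k| := by
  generalize hn : (U.filter fun j => 0 < g j).card = n
  induction n using Nat.strong_induction_on generalizing g with
  | _ n ih =>
    set S := U.filter fun j => 0 < g j with hS
    have hSU : S ⊆ U := Finset.filter_subset _ _
    rcases S.eq_empty_or_nonempty with h0 | hne
    · have : ∀ j ∈ U, g j = 0 := by
        intro j hj
        by_contra h
        have : j ∈ S := Finset.mem_filter.2 ⟨hj, lt_of_le_of_ne (hg j hj) (Ne.symm h)⟩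
        rw [h0] at this
        simp at this
      rw [Finset.sum_eq_zero fun j hj => by rw [this j hj, mul_zero], mul_zero]
      positivity
    · obtain ⟨i, hi, hmin⟩ := S.exists_min_image g hne
      set v := g i with hv
      have hv0 : 0 < v := (Finset.mem_filter.1 hi).2
      have hnot : ∀ j ∈ U, j ∉ S → g j = 0 := by
        intro j hj h
        by_contra h'
        exact h (Finset.mem_filter.2 ⟨hj, lt_of_le_of_ne (hg j hj) (Ne.symm h')⟩)
      set g' : V → ℝ := fun j => g j - v * ind S j with hg'
      have hg'0 : ∀ j ∈ U, 0 ≤ g' j := by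
        intro j hj
        by_cases h : j ∈ S
        · have := hmin j h; simp only [hg', ind, h, if_true]; linarith
        · simp only [hg', ind, h, if_false, hnot j hj h]; simp
      have hlev : ∀ s : ℝ, 0 ≤ s → (U.filter fun j => s < g' j) = U.filter fun j => s + v < g j := by
        intro s hs
        refine Finset.filter_congr fun j hj => ?_
        by_cases h : j ∈ S
        · simp only [hg', ind, h, if_true]
          constructor <;> intro h <;> linarith
        · simp only [hg', ind, h, if_false, hnot j hj h]
          constructor <;> intro h <;> linarith
      have hcard : (U.filter fun j => 0 < g' j).card < n := by
        rw [← hn]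
        refine Finset.card_lt_card ⟨?_, ?_⟩
        · intro j hj
          rw [hlev 0 le_rfl] at hj
          have := (Finset.mem_filter.1 hj)
          exact Finset.mem_filter.2 ⟨this.1, by linarith [this.2]⟩
        · intro h
          have := (Finset.mem_filter.1 (h hi)).2
          simp [hg', ind, hi, hv] at this
      have h1 := ih _ hcard g' hg'0 (fun s hs => by
        rw [hlev s hs]; exact hΦ (s + v) (by linarith)) rfl
      have h2 := hΦ 0 le_rfl
      have e1 : ∑ j ∈ U, (G.deg U j : ℝ) * g j =
          ∑ j ∈ U, (G.deg U j : ℝ) * g' j + v * G.vol U S := by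
        have : (G.vol U S : ℝ) = ∑ j ∈ U, (G.deg U j : ℝ) * ind S j := by
          rw [cast_vol]
          simp only [ind, mul_ite, mul_one, mul_zero]
          rw [Finset.sum_ite_mem, Finset.inter_eq_right.2 hSU]
        rw [this, Finset.mul_sum, ← Finset.sum_add_distrib]
        exact Finset.sum_congr rfl fun j _ => by simp only [hg']; ring
      have e2 : ∑ j ∈ U, ∑ k ∈ U, (G.mult j k : ℝ) * |g j - g k| =
          ∑ j ∈ U, ∑ k ∈ U, (G.mult j k : ℝ) * |g' j - g' k| +
            2 * v * G.edges S (U \ S) := by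
        have a1 := G.cast_edges U hSU (Finset.sdiff_subset (s := U) (t := S))
        have a2 := G.cast_edges U (Finset.sdiff_subset (s := U) (t := S)) hSU
        rw [G.edges_comm _ S] at a2
        have : 2 * v * (G.edges S (U \ S) : ℝ) = v * G.edges S (U \ S) + v * G.edges S (U \ S) := by
          ring
        rw [this]
        nth_rewrite 1 [a1]
        rw [a2]
        simp only [Finset.mul_sum, ← Finset.sum_add_distrib]
        refine Finset.sum_congr rfl fun j hj => Finset.sum_congr rfl fun k hk => ?_
        rw [ind_sdiff U hj, ind_sdiff U hk]
        have pj := hg'0 j hj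
        have pk := hg'0 k hk
        by_cases h1 : j ∈ S <;> by_cases h2 : k ∈ S
        · simp [hg', ind, h1, h2]
        · have : |g j - g k| = |g' j - g' k| + v := by
            have hk0 := hnot k hk h2
            have ek : g' k = 0 := by simp [hg', ind, h2, hk0]
            have ej : g j = g' j + v := by simp [hg', ind, h1]
            rw [ek, hk0, ej, sub_zero, sub_zero, abs_of_nonneg pj, abs_of_nonneg (by linarith)]
          rw [this]; simp [ind, h1, h2]; ring
        · have : |g j - g k| = |g' j - g' k| + v := by
            have hk0 := hnot j hj h1
            have ek : g' j = 0 := by simp [hg', ind, h1, hk0]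
            have ej : g k = g' k + v := by simp [hg', ind, h2]
            rw [ek, hk0, ej, zero_sub, zero_sub, abs_neg, abs_neg, abs_of_nonneg pk,
              abs_of_nonneg (by linarith)]
          rw [this]; simp [ind, h1, h2]; ring
        · simp [hg', ind, h1, h2]
      rw [e1, e2]
      nlinarith

/-- `coarea_le` for `f²`, followed by Cauchy–Schwarz for `|f_j² - f_k²| = |f_j - f_k| |f_j + f_k|`.
The second factor is kept as `2N - F` instead of `2N`, with `N = ‖f‖²` and `F` the Dirichlet form,
because the contraction factor below requires the sharp form. -/
theorem cheeger {Φ : ℝ} (hΦ0 : 0 ≤ Φ) (f : V → ℝ) (hf : ∀ j ∈ U, 0 ≤ f j)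
    (hΦ : ∀ s : ℝ, 0 ≤ s → Φ * G.vol U (U.filter fun j => s < f j) ≤
      G.edges (U.filter fun j => s < f j) (U \ U.filter fun j => s < f j)) :
    (Φ * G.ip U f f) ^ 2 ≤ G.form U f * (2 * G.ip U f f - G.form U f) := by
  have h1 := G.coarea_le U (Φ := Φ) (fun j => f j ^ 2) (fun j _ => sq_nonneg _) (fun s hs => by
    have : (U.filter fun j => s < f j ^ 2) = U.filter fun j => √s < f j := by
      refine Finset.filter_congr fun j hj => ⟨fun h => ?_, fun h => ?_⟩
      · rw [← Real.sqrt_sq (hf j hj)]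
        exact Real.sqrt_lt_sqrt hs h
      · calc s = √s ^ 2 := (Real.sq_sqrt hs).symm
          _ < f j ^ 2 := pow_lt_pow_left₀ h (Real.sqrt_nonneg s) two_ne_zero
    rw [this]
    exact hΦ _ (Real.sqrt_nonneg s))
  have e1 : ∑ j ∈ U, (G.deg U j : ℝ) * f j ^ 2 = G.ip U f f :=
    Finset.sum_congr rfl fun j _ => by ring
  rw [e1] at h1
  set b := ∑ j ∈ U, ∑ k ∈ U, (G.mult j k : ℝ) * |f j ^ 2 - f k ^ 2| with hb
  have h2 : b ^ 2 ≤ (∑ j ∈ U, ∑ k ∈ U, (G.mult j k : ℝ) * (f j - f k) ^ 2) *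
      ∑ j ∈ U, ∑ k ∈ U, (G.mult j k : ℝ) * (f j + f k) ^ 2 := by
    refine sq_le_mul_of_forall_nonneg fun t => ?_
    have : 0 ≤ ∑ j ∈ U, ∑ k ∈ U, (G.mult j k : ℝ) * (|f j - f k| + t * |f j + f k|) ^ 2 := by
      positivity
    refine this.trans_eq ?_
    rw [hb]
    simp only [Finset.mul_sum, ← Finset.sum_add_distrib]
    refine Finset.sum_congr rfl fun j _ => Finset.sum_congr rfl fun k _ => ?_
    rw [sq_sub_sq, abs_mul, ← sq_abs (f j - f k), ← sq_abs (f j + f k)]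
    ring
  have e2 : ∑ j ∈ U, ∑ k ∈ U, (G.mult j k : ℝ) * (f j - f k) ^ 2 = 2 * G.form U f := by
    unfold form; ring
  have e3 : ∑ j ∈ U, ∑ k ∈ U, (G.mult j k : ℝ) * (f j + f k) ^ 2 =
      2 * (2 * G.ip U f f - G.form U f) := by
    rw [ip_self_eq, form]
    have : ∀ x y z : ℝ, x + y = 2 * z → x = 2 * (2 * (z / 2) - y / 2) := fun x y z h => by linarith
    refine this _ _ _ ?_
    simp only [Finset.mul_sum, ← Finset.sum_add_distrib]
    exact Finset.sum_congr rfl fun j _ => Finset.sum_congr rfl fun k _ => by ring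
  rw [e2, e3] at h2
  have h3 : (2 * Φ * G.ip U f f) ^ 2 ≤ b ^ 2 :=
    pow_le_pow_left₀ (by have := G.ip_self_nonneg U f; positivity) h1 2
  nlinarith

/-- Cheeger's inequality reads `(N - F)² ≤ (1 - Φ²) N²`, and `1 - Φ² = (2c² - 1)²`. Hence `⟨f, Lf⟩ =
N - F/2 ≤ c² N`, and `‖Lf‖² ≤ ⟨f, Lf⟩` because moments decrease. Only level sets of `f` itself have
to expand. -/
theorem ip_lazyOp_lazyOp_le {Φ c : ℝ} (hΦ0 : 0 ≤ Φ) (hc : 1 ≤ 2 * c ^ 2)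
    (hΦc : Φ ^ 2 = 4 * c ^ 2 * (1 - c ^ 2)) (f : V → ℝ) (hf : ∀ j ∈ U, 0 ≤ f j)
    (hΦ : ∀ s : ℝ, 0 ≤ s → Φ * G.vol U (U.filter fun j => s < f j) ≤
      G.edges (U.filter fun j => s < f j) (U \ U.filter fun j => s < f j)) :
    G.ip U (G.lazyOp U 1 f) (G.lazyOp U 1 f) ≤ c ^ 2 * G.ip U f f := by
  have h1 := G.cheeger U hΦ0 f hf hΦ
  have h2 := G.moment_succ_le U (s := 1) (by norm_num) f 1
  have h3 := G.moment_even U 1 f 1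
  have h4 := G.form_eq U f
  have hN := G.ip_self_nonneg U f
  simp only [Function.iterate_one, mul_one] at h3
  have e : G.moment U 1 f 1 = G.ip U f (G.lazyOp U 1 f) := rfl
  rw [show 1 + 1 = 2 from rfl, h3, e] at h2
  refine h2.trans ?_
  set N := G.ip U f f
  set F := G.form U f
  have h5 : (N - F) ^ 2 ≤ (N * (2 * c ^ 2 - 1)) ^ 2 := by
    rw [mul_pow, hΦc] at h1
    nlinarith
  have h6 := abs_le_of_sq_le_sq h5 (mul_nonneg hN (by linarith))
  linarith [(abs_le.1 h6).1, (abs_le.1 h6).2, mul_comm (c ^ 2) N]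

theorem lazyOp_mono {f g : V → ℝ} (h : ∀ j ∈ U, f j ≤ g j) {j : V} (hj : j ∈ U) :
    G.lazyOp U 1 f j ≤ G.lazyOp U 1 g j := by
  unfold lazyOp
  split_ifs
  · exact h j hj
  · have : ∑ k ∈ U, (G.mult j k : ℝ) * f k ≤ ∑ k ∈ U, (G.mult j k : ℝ) * g k :=
      Finset.sum_le_sum fun k hk => mul_le_mul_of_nonneg_left (h k hk) (Nat.cast_nonneg _)
    have h1 := h j hj
    gcongr

theorem lazyOp_const (c : ℝ) (j : V) : G.lazyOp U 1 (fun _ => c) j = c := by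
  unfold lazyOp
  split_ifs with h
  · rfl
  · have : (G.deg U j : ℝ) ≠ 0 := by exact_mod_cast h
    rw [← Finset.sum_mul, ← cast_deg, one_mul, mul_div_assoc, mul_div_cancel₀ _ this]
    ring

theorem lazyOp_smul (c : ℝ) (f : V → ℝ) (j : V) :
    G.lazyOp U 1 (fun j => c * f j) j = c * G.lazyOp U 1 f j := by
  have := congrFun (G.lazyOp_add_mul U 1 (fun _ => 0) f c) j
  simp only [zero_add, lazyOp_const] at this
  exact this

theorem ip_le_ip {f g : V → ℝ} (hf : ∀ j ∈ U, 0 ≤ f j) (h : ∀ j ∈ U, f j ≤ g j) :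
    G.ip U f f ≤ G.ip U g g := by
  refine Finset.sum_le_sum fun j hj => ?_
  rw [mul_assoc, mul_assoc]
  exact mul_le_mul_of_nonneg_left (mul_self_le_mul_self (hf j hj) (h j hj)) (Nat.cast_nonneg _)

/-- One step of the lazy walk reduces the excess over a threshold if the approximate level sets
expand. -/
theorem excess_step {Φ c u a α L : ℝ} (hΦ0 : 0 ≤ Φ) (hc : 1 ≤ 2 * c ^ 2)
    (hΦc : Φ ^ 2 = 4 * c ^ 2 * (1 - c ^ 2)) (hu0 : 0 ≤ u) (hu1 : u < 1) (hα : 0 ≤ α) (hL : 1 ≤ L)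
    (ha : a = α * (L * ((1 + 3 * u) / (1 - u)))) {ρ est : V → ℝ} (hρ : ∀ j ∈ U, 0 ≤ ρ j)
    (hest : ∀ j ∈ U, |est j - ρ j| ≤ u * max (ρ j) α)
    (hΦ : ∀ s : ℝ, α ≤ s → Φ * G.vol U (U.filter fun j => s < est j) ≤
      G.edges (U.filter fun j => s < est j) (U \ U.filter fun j => s < est j)) :
    G.ip U (fun j => max (G.lazyOp U 1 ρ j - a) 0) (fun j => max (G.lazyOp U 1 ρ j - a) 0) ≤
      (c * ((1 + u) / (1 - u))) ^ 2 *
        G.ip U (fun j => max (ρ j - α * L) 0) (fun j => max (ρ j - α * L) 0) := by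
  have h1u : 0 < 1 - u := by linarith
  -- Expansion is known only for level sets of `est`, so the decay is applied to `f = (est - s')⁺`.
  -- The level `s'` gives `(ρ - a)⁺ ≤ f / (1 - u)`, and the factor `1 + 3u` in `a` is what `f ≤ (1 +
  -- u)(ρ - αL)⁺` needs.
  set s' := (1 - u) * a - u * α with hs'
  have hs'e : s' = α * (L * (1 + 3 * u) - u) := by rw [hs', ha]; field_simp
  have huL : u ≤ u * L := le_mul_of_one_le_right hu0 hL
  have hs'α : α ≤ s' := by
    rw [hs'e]
    exact le_mul_of_one_le_right hα (by nlinarith)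
  have hmax : ∀ j ∈ U, u * max (ρ j) α ≤ u * ρ j + u * α := by
    intro j hj
    rw [← mul_add]
    exact mul_le_mul_of_nonneg_left (max_le (by linarith) (by linarith [hρ j hj])) hu0
  set f : V → ℝ := fun j => max (est j - s') 0 with hf
  have hf0 : ∀ j ∈ U, 0 ≤ f j := fun j _ => le_max_right _ _
  have hdecay := G.ip_lazyOp_lazyOp_le U hΦ0 hc hΦc f hf0 (fun s hs => by
    have : (U.filter fun j => s < f j) = U.filter fun j => s + s' < est j := by
      refine Finset.filter_congr fun j _ => ?_
      simp only [hf, lt_max_iff]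
      constructor
      · rintro (h | h) <;> linarith
      · intro h; left; linarith
    rw [this]
    exact hΦ _ (by linarith))
  -- The walk operator is monotone and fixes constants, so it commutes with the subtraction of `a`.
  have hup : ∀ j ∈ U, max (G.lazyOp U 1 ρ j - a) 0 ≤ 1 / (1 - u) * G.lazyOp U 1 f j := by
    intro j hj
    rw [← lazyOp_smul]
    have hle : ∀ k ∈ U, ρ k - a ≤ 1 / (1 - u) * f k := by
      intro k hk
      have h1 := (abs_le.1 (hest k hk)).1
      have h2 := hmax k hk
      have h3 : est k - s' ≤ f k := le_max_left _ _
      rw [one_div, inv_mul_eq_div, le_div_iff₀ h1u]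
      linarith
    refine max_le ?_ ?_
    · have h1 := G.lazyOp_mono U (f := fun k => ρ k + -1 * a) (g := fun k => 1 / (1 - u) * f k)
        (fun k hk => by linarith [hle k hk]) hj
      have h2 := congrFun (G.lazyOp_add_mul U 1 ρ (fun _ => a) (-1)) j
      simp only [lazyOp_const] at h2
      linarith
    · have h1 := G.lazyOp_mono U (f := fun _ => 0) (g := fun k => 1 / (1 - u) * f k)
        (fun k hk => mul_nonneg (by positivity) (hf0 k hk)) hj
      rwa [lazyOp_const] at h1
  have hlow : ∀ j ∈ U, f j ≤ (1 + u) * max (ρ j - α * L) 0 := by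
    intro j hj
    refine max_le ?_ (mul_nonneg (by linarith) (le_max_right _ _))
    have h1 := (abs_le.1 (hest j hj)).2
    have h2 := hmax j hj
    have h3 : (1 + u) * (ρ j - α * L) ≤ (1 + u) * max (ρ j - α * L) 0 :=
      mul_le_mul_of_nonneg_left (le_max_left _ _) (by linarith)
    refine le_trans ?_ h3
    rw [hs'e]
    nlinarith
  have i1 := G.ip_le_ip U (fun j _ => le_max_right _ _) hup
  have i2 := G.ip_le_ip U hf0 hlow
  have e1 : ∀ (k : ℝ) (g : V → ℝ), G.ip U (fun j => k * g j) (fun j => k * g j) =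
      k ^ 2 * G.ip U g g := by
    intro k g
    simp only [ip, Finset.mul_sum]
    exact Finset.sum_congr rfl fun _ _ => by ring
  rw [e1] at i1 i2
  refine i1.trans ?_
  rw [mul_pow, div_pow, div_pow, one_pow]
  have h5 : 0 < (1 - u) ^ 2 := by positivity
  rw [div_mul_eq_mul_div, one_mul, div_le_iff₀ h5]
  calc G.ip U (G.lazyOp U 1 f) (G.lazyOp U 1 f) ≤ c ^ 2 * G.ip U f f := hdecay
    _ ≤ c ^ 2 * ((1 + u) ^ 2 * G.ip U (fun j => max (ρ j - α * L) 0)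
        (fun j => max (ρ j - α * L) 0)) := mul_le_mul_of_nonneg_left i2 (sq_nonneg c)
    _ = _ := by field_simp

end MultiGraph

/-- A property inherited by all earlier entries selects an initial segment. In this way level sets
are recognized as top sets of a sweep order. -/
theorem filter_eq_take {α : Type} (P : α → Prop) (L : List α)
    (h : L.Pairwise fun x y => P y → P x) :
    L.filter (fun a => P a) = L.take (L.filter fun a => P a).length := by
  induction L with
  | nil => simp
  | cons a L ih =>
    rw [List.pairwise_cons] at h
    by_cases ha : P a
    · rw [List.filter_cons_of_pos (by simpa using ha), List.length_cons, List.take_succ_cons,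
        ← ih h.2]
    · have : (a :: L).filter (fun a => P a) = [] := by
        rw [List.filter_eq_nil_iff]
        intro b hb
        rcases List.mem_cons.1 hb with rfl | hb
        · simpa using ha
        · have := h.1 b hb
          simpa using fun hP => ha (this hP)
      rw [this]; simp

section
variable {V : Type} [Fintype V] (G : MultiGraph V) (U : Finset V)

/-- The excess of the density of a walk over a slowly growing threshold decays geometrically. -/
theorem excess_le {Φ c u α : ℝ} (hΦ0 : 0 ≤ Φ) (hc : 1 ≤ 2 * c ^ 2)
    (hΦc : Φ ^ 2 = 4 * c ^ 2 * (1 - c ^ 2)) (hu0 : 0 ≤ u) (hu1 : u < 1) (hα : 0 ≤ α) {i : V}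
    (hi : i ∈ U) (hd : 0 < G.deg U i) (n : ℕ) (est : ℕ → V → ℝ)
    (hest : ∀ l < n, ∀ j ∈ U, |est l j - walkDensity G U 1 l i j| ≤
      u * max (walkDensity G U 1 l i j) α)
    (hΦ : ∀ l < n, ∀ s : ℝ, α ≤ s → Φ * G.vol U (U.filter fun j => s < est l j) ≤
      G.edges (U.filter fun j => s < est l j) (U \ U.filter fun j => s < est l j)) :
    (∀ j ∈ U, 0 ≤ walkDensity G U 1 n i j) ∧
    G.ip U (fun j => max (walkDensity G U 1 n i j - α * ((1 + 3 * u) / (1 - u)) ^ n) 0)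
        (fun j => max (walkDensity G U 1 n i j - α * ((1 + 3 * u) / (1 - u)) ^ n) 0) ≤
      ((c * ((1 + u) / (1 - u))) ^ n) ^ 2 := by
  have hlam : 1 ≤ (1 + 3 * u) / (1 - u) := by
    rw [le_div_iff₀ (by linarith)]; linarith
  induction n with
  | zero =>
    have h0 : ∀ j, 0 ≤ walkDensity G U 1 0 i j := by
      intro j
      simp only [walkDensity, Function.iterate_zero, id, MultiGraph.pointMass]
      split_ifs <;> positivity
    refine ⟨fun j _ => h0 j, ?_⟩
    simp only [pow_zero, mul_one, one_pow]
    refine (G.ip_le_ip U (fun j _ => le_max_right _ _) (g := walkDensity G U 1 0 i) fun j _ =>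
      max_le (by linarith) (h0 j)).trans ?_
    show G.ip U (G.pointMass U i) (G.pointMass U i) ≤ 1
    rw [G.ip_pointMass U hi hd.ne']
    simp only [MultiGraph.pointMass, if_true]
    rw [div_le_one (by exact_mod_cast hd)]
    exact_mod_cast hd
  | succ n ih =>
    obtain ⟨h0, h1⟩ := ih (fun l hl => hest l (by omega)) (fun l hl => hΦ l (by omega))
    have e : walkDensity G U 1 (n + 1) i = G.lazyOp U 1 (walkDensity G U 1 n i) := by
      unfold walkDensity
      rw [Function.iterate_succ_apply']
    refine ⟨?_, ?_⟩
    · intro j hj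
      rw [e]
      have := G.lazyOp_mono U (f := fun _ => 0) h0 hj
      rwa [G.lazyOp_const] at this
    · have := G.excess_step U hΦ0 hc hΦc hu0 hu1 hα (one_le_pow₀ hlam : (1 : ℝ) ≤ _ ^ n)
        (a := α * ((1 + 3 * u) / (1 - u)) ^ (n + 1)) (by rw [pow_succ]) h0 (hest n (by omega))
        (hΦ n (by omega))
      rw [e]
      refine this.trans ?_
      rw [pow_succ (c * ((1 + u) / (1 - u))) n, mul_pow (_ ^ n), mul_comm]
      exact mul_le_mul_of_nonneg_right h1 (sq_nonneg _)

end

/-! ### CutOrBound: accuracy of visit counts, expansion of level sets, spreading of the walk -/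

section
variable {V : Type} [Fintype V] (G : MultiGraph V) (U : Finset V)

theorem len_le {p : Params} (hp : p.Base) {ε μ : ℝ} (h : p.Tame ε μ) (hU : 0 < G.total U) :
    (p.len (G.total U) ε μ : ℝ) ≤ 4 / p.delta ^ 3 * G.lg := by
  have h1 := h.zeta_mul_len_le hp hU
  have h2 := h.zeta_ge hp
  have hδ := hp.delta_pos
  have hm : (0 : ℝ) < G.total U := by exact_mod_cast hU
  have h3 := log_total_le G U hU
  have hlg : (1 : ℝ) ≤ G.lg := by exact_mod_cast one_le_lg G
  have h4 : Real.log (4 * G.total U / p.delta ^ 2) =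
      Real.log (G.total U) + Real.log (4 / p.delta ^ 2) := by
    rw [← Real.log_mul hm.ne' (by positivity)]; congr 1; ring
  have h5 : Real.log (4 / p.delta ^ 2) ≤ 4 / p.delta ^ 2 - 1 :=
    Real.log_le_sub_one_of_pos (by positivity)
  set A := 4 / p.delta ^ 2 with hA
  have hA1 : 1 ≤ A := by
    rw [hA, le_div_iff₀ (by positivity)]
    nlinarith [hp.delta_le]
  set l : ℝ := (p.len (G.total U) ε μ : ℝ) with hl
  have hz := h.zeta_pos hp
  have h6 : p.zeta ε μ * (l - 1) ≤ A * G.lg := by nlinarith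
  have h7 : 2 * p.delta * (l - 1) ≤ A * G.lg := by
    rcases le_total 1 l with h | h
    · exact (mul_le_mul_of_nonneg_right h2 (by linarith)).trans h6
    · nlinarith
  have e : 4 / p.delta ^ 3 * G.lg = A * G.lg / p.delta := by rw [hA]; field_simp
  rw [e, le_div_iff₀ hδ]
  nlinarith [hp.delta_le]

/-- The number of walks at `j` at time `l`, divided by the degree of `j` and the number of walks. -/
def visitDensity (w : ℕ) (traces : List (List (V × Bool))) (l : ℕ) (j : V) : ℝ :=
  (traces.countP fun T => T[l]?.map Prod.fst = some j : ℕ) / (G.deg U j : ℝ) / w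

/-- The relative error is only `1/(5ℓ)`, because errors accumulate over `ℓ` steps; hence the factor
`ℓ²` in the number of walks. For densities below `α` the error is measured relative to `α`. -/
theorem pr_visitDensity_le {p : Params} (hp : p.Base) {ε μ α : ℝ} (h : p.Tame ε μ) (hα : 0 < α)
    {i : V} (hi : i ∈ U) (hd : G.deg U i ≠ 0) (hU : 0 < G.total U) {l : ℕ}
    (hl : l = p.len (G.total U) ε μ) {w : ℕ} (hw : w = ⌈p.walkConst * l ^ 2 * G.lg / α⌉₊) :
    pr (repeated w (walk G U l (i, false))) (fun traces => ∃ x ∈ Finset.range l ×ˢ U,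
      1 / (5 * l) * max (walkDensity G U 1 x.1 i x.2) α <
        |visitDensity G U w traces x.1 x.2 - walkDensity G U 1 x.1 i x.2|) ≤
      Real.exp (-(6 * G.lg)) := by
  have hl2 : 2 ≤ l := hl ▸ h.two_le_len hp hU
  have hl2' : (2 : ℝ) ≤ l := by exact_mod_cast hl2
  have hlg : (1 : ℝ) ≤ G.lg := by exact_mod_cast one_le_lg G
  have hδ := hp.delta_pos
  have hwc : 0 < p.walkConst := lt_of_lt_of_le (by positivity) hp.walkConst_ge'
  have hw1 : p.walkConst * l ^ 2 * G.lg / α ≤ w := hw ▸ Nat.le_ceil _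
  have hw0 : (0 : ℝ) < w := lt_of_lt_of_le (by positivity) hw1
  set u : ℝ := 1 / (5 * l) with hu
  have hu0 : 0 < u := by positivity
  have hu1 : u ≤ 1 := by
    rw [hu, div_le_one (by positivity)]; linarith
  have key : ∀ x ∈ Finset.range l ×ˢ U, pr (repeated w (walk G U l (i, false))) (fun traces =>
      u * max (walkDensity G U 1 x.1 i x.2) α <
        |visitDensity G U w traces x.1 x.2 - walkDensity G U 1 x.1 i x.2|) ≤
      2 * Real.exp (-((8 + 8 / p.delta ^ 3) * G.lg)) := by
    rintro ⟨k, j⟩ hx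
    obtain ⟨hk, hj⟩ := Finset.mem_product.1 hx
    simp only at hj hk ⊢
    rw [Finset.mem_range] at hk
    set ρ := walkDensity G U 1 k i j with hρ
    have hM0 : 0 < max ρ α := lt_max_of_lt_right hα
    by_cases hdj : G.deg U j = 0
    · have : ρ = 0 := walkDensity_of_deg_eq_zero G U 1 k hd hdj
      rw [pr_eq_zero]
      · positivity
      · refine Ens.true.mono fun traces _ _ => ?_
        simp only [visitDensity, hdj, this, Nat.cast_zero, div_zero, zero_div, sub_zero, abs_zero,
          not_lt]
        positivity
    · have hdj' : (1 : ℝ) ≤ G.deg U j := by exact_mod_cast Nat.one_le_iff_ne_zero.2 hdj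
      have hpr := pr_walk_vertex G U hi hd hj (k := k) (l := l) hk.le
      have hc := chernoff (walk G U l (i, false)) (fun T => T[k]?.map Prod.fst = some j) w
        (M := G.deg U j * max ρ α) (u := u) (by
          rw [hpr]; exact mul_le_mul_of_nonneg_left (le_max_left _ _) (by positivity)) hu0.le hu1
      refine (pr_mono _ fun traces ht => ?_).trans (hc.trans ?_)
      · rw [hpr]
        have e : visitDensity G U w traces k j - ρ =
            (((traces.countP fun T => T[k]?.map Prod.fst = some j : ℕ) : ℝ) -
              w * (G.deg U j * ρ)) / (w * G.deg U j) := by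
          unfold visitDensity
          field_simp
        rw [e, abs_div, abs_of_pos (by positivity : (0 : ℝ) < w * G.deg U j),
          lt_div_iff₀ (by positivity)] at ht
        calc (w : ℝ) * (u * (G.deg U j * max ρ α)) = u * max ρ α * (w * G.deg U j) := by ring
          _ ≤ _ := ht.le
          _ = _ := by congr!
      · refine mul_le_mul_of_nonneg_left (Real.exp_le_exp.2 (neg_le_neg ?_)) (by norm_num)
        have h1 : α ≤ G.deg U j * max ρ α :=
          (le_max_right _ _).trans (le_mul_of_one_le_left hM0.le hdj')
        have h2 : p.walkConst * l ^ 2 * G.lg / α * u ^ 2 * α / 4 ≤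
            w * u ^ 2 * (G.deg U j * max ρ α) / 4 := by gcongr
        refine le_trans ?_ h2
        have e : p.walkConst * l ^ 2 * G.lg / α * u ^ 2 * α / 4 = p.walkConst / 100 * G.lg := by
          rw [hu]; field_simp; norm_num
        rw [e]
        exact mul_le_mul_of_nonneg_right (by linarith [hp.walkConst_ge']) (by linarith)
  refine (pr_exists_le_card _ _ _ key).trans ?_
  have hcard : (U.card : ℝ) ≤ Real.exp G.lg := by
    have h1 : (U.card : ℝ) ≤ Fintype.card V := by exact_mod_cast Finset.card_le_univ U
    have h2 := le_exp_lg G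
    have h3 : (0 : ℝ) ≤ G.total Finset.univ := Nat.cast_nonneg _
    linarith
  have hlen : (2 * l : ℝ) ≤ Real.exp (8 / p.delta ^ 3 * G.lg) := by
    have h1 := len_le G U hp h hU
    rw [← hl] at h1
    have h2 := Real.add_one_le_exp (8 / p.delta ^ 3 * G.lg)
    have h3 : 8 / p.delta ^ 3 * G.lg = 2 * (4 / p.delta ^ 3 * G.lg) := by ring
    linarith
  rw [Finset.card_product, Finset.card_range, Nat.cast_mul]
  calc (l : ℝ) * U.card * (2 * Real.exp (-((8 + 8 / p.delta ^ 3) * G.lg)))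
      = (2 * l) * U.card * Real.exp (-((8 + 8 / p.delta ^ 3) * G.lg)) := by ring
    _ ≤ Real.exp (8 / p.delta ^ 3 * G.lg) * Real.exp G.lg *
        Real.exp (-((8 + 8 / p.delta ^ 3) * G.lg)) := by gcongr
    _ = Real.exp (-(7 * G.lg)) := by rw [← Real.exp_add, ← Real.exp_add]; congr 1; ring
    _ ≤ _ := Real.exp_le_exp.2 (by linarith)

theorem sum_countP_le (traces : List (List (V × Bool))) (l : ℕ) :
    ∑ j ∈ U, (traces.countP fun T => T[l]?.map Prod.fst = some j) ≤ traces.length := by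
  induction traces with
  | nil => simp
  | cons T Ts ih =>
    simp only [List.countP_cons, Finset.sum_add_distrib, List.length_cons]
    refine add_le_add ih ?_
    rcases T[l]?.map Prod.fst with _ | v
    · simp
    · simp only [Option.some.injEq, decide_eq_true_eq]
      rw [Finset.sum_ite_eq]
      split_ifs <;> omega

theorem vol_add_vol_sdiff {S : Finset V} (hS : S ⊆ U) :
    G.vol U S + G.vol U (U \ S) = G.total U := by
  unfold MultiGraph.vol MultiGraph.total MultiGraph.vol
  rw [add_comm]
  exact Finset.sum_sdiff hS

/-- If no top set of the sweep order at time `l` has low conductance, then all level sets above the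
probability bound expand. -/
theorem levelSet_expands {w b l : ℕ} {α φ : ℝ} (hα : 0 < α) (hw : 0 < w) 
    (hb : 1 / α ≤ b) (hm : 2 / α ≤ G.total U) {traces : List (List (V × Bool))}
    (hlen : traces.length = w)
    (hnone : ∀ k < b, ¬G.LowConductance U φ ((sweepOrder G U traces l).take (k + 1)).toFinset)
    {s : ℝ} (hs : α ≤ s) :
    2 * φ * G.vol U (U.filter fun j => s < visitDensity G U w traces l j) ≤
      G.edges (U.filter fun j => s < visitDensity G U w traces l j)
        (U \ U.filter fun j => s < visitDensity G U w traces l j) := by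
  set P : V → Prop := fun j => s < visitDensity G U w traces l j with hP
  set S := U.filter P with hS
  have hSU : S ⊆ U := Finset.filter_subset _ _
  have hw' : (0 : ℝ) < w := by exact_mod_cast hw
  have hdeg : ∀ j ∈ S, 0 < G.deg U j := by
    intro j hj
    by_contra h0
    have h1 := (Finset.mem_filter.1 hj).2
    have : G.deg U j = 0 := by omega
    simp only [hP, visitDensity, this, Nat.cast_zero, div_zero, zero_div] at h1
    linarith
  -- A vertex `j` of the level set holds at least a fraction `α deg j` of the walks, and each walk
  -- is at one vertex at time `l`. So the level set has volume, and therefore cardinality, at most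
  -- `1/α ≤ b`, and it is one of the top sets that were tested.
  have hvol : α * G.vol U S ≤ 1 := by
    rw [MultiGraph.cast_vol, Finset.mul_sum]
    calc ∑ j ∈ S, α * (G.deg U j : ℝ)
        ≤ ∑ j ∈ S, ((traces.countP fun T => T[l]?.map Prod.fst = some j : ℕ) : ℝ) / w := by
          refine Finset.sum_le_sum fun j hj => ?_
          have h1 := hdeg j hj
          have h1' : (0 : ℝ) < G.deg U j := by exact_mod_cast h1
          have h2 : α ≤ visitDensity G U w traces l j := hs.trans (Finset.mem_filter.1 hj).2.le
          unfold visitDensity at h2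
          rw [div_right_comm, le_div_iff₀ h1'] at h2
          exact h2
      _ ≤ ∑ j ∈ U, ((traces.countP fun T => T[l]?.map Prod.fst = some j : ℕ) : ℝ) / w :=
          Finset.sum_le_sum_of_subset_of_nonneg hSU fun _ _ _ => by positivity
      _ ≤ 1 := by
          rw [← Finset.sum_div, div_le_one hw', ← hlen]
          exact_mod_cast sum_countP_le U traces l
  have hvol' : (G.vol U S : ℝ) ≤ 1 / α := by
    rw [le_div_iff₀ hα, mul_comm]; exact hvol
  have hcard : S.card ≤ G.vol U S := by
    rw [Finset.card_eq_sum_ones]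
    exact Finset.sum_le_sum fun j hj => hdeg j hj
  rcases Nat.eq_zero_or_pos S.card with h0 | hpos
  · rw [Finset.card_eq_zero.1 h0]
    simp [MultiGraph.vol]
  have hcb : S.card ≤ b := by
    have : (S.card : ℝ) ≤ b := le_trans (by exact_mod_cast hcard) (hvol'.trans hb)
    exact_mod_cast this
  set L := sweepOrder G U traces l with hL
  set ratio : V → ℝ := fun j =>
    (traces.countP fun T => T[l]?.map Prod.fst = some j : ℕ) / (G.deg U j : ℝ) with hratio
  have hperm : L.Perm (U.filter fun j => 0 < G.deg U j).toList := by
    rw [hL]; exact List.mergeSort_perm _ _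
  have hpair : L.Pairwise fun x y => P y → P x := by
    have h1 : L.Pairwise fun x y => decide (ratio y ≤ ratio x) = true := by
      rw [hL]
      refine List.pairwise_mergeSort (le := fun j k => decide (ratio k ≤ ratio j)) ?_ ?_ _
      · intro a b c h1 h2
        simp only [decide_eq_true_eq] at *
        exact h2.trans h1
      · intro a b
        simp only [Bool.or_eq_true, decide_eq_true_eq]
        exact le_total _ _
    refine h1.imp fun {x y} hxy hy => ?_
    rw [decide_eq_true_eq] at hxy
    exact lt_of_lt_of_le hy (div_le_div_of_nonneg_right hxy hw'.le)
  have hfilter := filter_eq_take P L hpair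
  have hset : (L.filter fun a => P a).toFinset = S := by
    ext j
    simp only [List.mem_toFinset, List.mem_filter, hperm.mem_iff, Finset.mem_toList,
      Finset.mem_filter, decide_eq_true_eq, hS]
    constructor
    · rintro ⟨⟨h1, -⟩, h2⟩; exact ⟨h1, h2⟩
    · rintro ⟨h1, h2⟩; exact ⟨⟨h1, hdeg j (Finset.mem_filter.2 ⟨h1, h2⟩)⟩, h2⟩
  have hnd : (L.filter fun a => P a).Nodup :=
    (hperm.nodup_iff.2 (Finset.nodup_toList _)).filter _
  have hlenS : (L.filter fun a => P a).length = S.card := by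
    rw [← hset, List.toFinset_card_of_nodup hnd]
  rw [hlenS] at hfilter
  have hno := hnone (S.card - 1) (by omega)
  rw [Nat.sub_add_cancel hpos, ← hfilter, hset] at hno
  unfold MultiGraph.LowConductance at hno
  rw [not_lt] at hno
  -- By `2/α ≤ m` the level set has at most half of the volume, so it is the smaller side in the
  -- conductance.
  have hhalf : G.vol U S ≤ G.vol U (U \ S) := by
    have h1 := vol_add_vol_sdiff G U hSU
    have h2 : (2 * G.vol U S : ℝ) ≤ G.total U := by
      refine le_trans ?_ hm
      rw [show 2 / α = 2 * (1 / α) by ring]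
      linarith
    have h3 : 2 * G.vol U S ≤ G.total U := by exact_mod_cast h2
    omega
  rw [min_eq_left hhalf] at hno
  refine le_trans (le_of_eq ?_) hno
  push_cast
  ring

theorem Params.Base.alpha_eq {p : Params} (hp : p.Base) (m : ℕ) : p.alpha m = 1 / √(m : ℝ) := by
  unfold Params.alpha
  rw [hp.tau_eq, Real.rpow_neg (Nat.cast_nonneg _), Real.sqrt_eq_rpow, one_div, one_div]

instance (p : Params) (U : Finset V) (i : V) : Finitary (cutOrBound G p U i) := by
  unfold cutOrBound; infer_instance

/-- Two contributions of at most `3α` each. The threshold has grown to `α ((1 + 3u)/(1 - u))^ℓ ≤ e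
α`, as `u ℓ = 1/5`. The excess is at most `(c (1 + u)/(1 - u))^ℓ`, where `c^{2ℓ} = e^{-ζℓ} ≤ 1/m =
α²` because `τ = 1/2`. -/
theorem density_le_of_expands {p : Params} (hp : p.Base) (h : p.Tame p.eps₁ p.mu₁) {i : V}
    (hi : i ∈ U) (hd : G.deg U i ≠ 0) (hU : 0 < G.total U) {l : ℕ}
    (hl : l = p.len (G.total U) p.eps₁ p.mu₁) {est : ℕ → V → ℝ}
    (hest : ∀ k < l, ∀ j ∈ U, |est k j - walkDensity G U 1 k i j| ≤
      1 / (5 * l) * max (walkDensity G U 1 k i j) (p.alpha (G.total U)))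
    (hexp : ∀ k < l, ∀ s : ℝ, p.alpha (G.total U) ≤ s →
      2 * p.phi * G.vol U (U.filter fun j => s < est k j) ≤
        G.edges (U.filter fun j => s < est k j) (U \ U.filter fun j => s < est k j)) :
    ∀ j ∈ U, walkDensity G U 1 l i j ≤ 6 * p.alpha (G.total U) := by
  set α := p.alpha (G.total U) with hα
  have hm : (0 : ℝ) < G.total U := by exact_mod_cast hU
  have hα' := hp.alpha_eq (G.total U)
  rw [← hα] at hα'
  have hα0 : 0 < α := by rw [hα']; positivity
  have hl2 : 2 ≤ l := hl ▸ h.two_le_len hp hU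
  have hl2' : (2 : ℝ) ≤ l := by exact_mod_cast hl2
  set ζ := p.zeta p.eps₁ p.mu₁ with hζ
  have hz := h.zeta_pos hp
  have hz' := h.zeta_le
  set c := Real.exp (-(ζ * p.tau)) with hc
  have hphi : p.phi = c * √(1 - c ^ 2) := rfl
  have hc1 : c ≤ 1 := Real.exp_le_one_iff.2 (by rw [hp.tau_eq]; linarith)
  have hc2 : 39 / 40 ≤ c := by
    have := Real.add_one_le_exp (-(ζ * p.tau))
    rw [hp.tau_eq] at this
    rw [hc, hp.tau_eq]; linarith
  have hq : √(1 - c ^ 2) ^ 2 = 1 - c ^ 2 := Real.sq_sqrt (by nlinarith)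
  set u : ℝ := 1 / (5 * l) with hu
  have hu0 : 0 < u := by positivity
  have hu1 : u ≤ 1 / 10 := by
    rw [hu, div_le_div_iff₀ (by positivity) (by norm_num)]; linarith
  have h1u : 0 < 1 - u := by linarith
  obtain ⟨h0, h1⟩ := excess_le G U (Φ := 2 * p.phi) (c := c) (u := u) (α := α)
    (by rw [hphi]; positivity) (by nlinarith) (by rw [hphi]; linear_combination 4 * c ^ 2 * hq)
    hu0.le (by linarith) hα0.le hi (Nat.pos_of_ne_zero hd) l est hest hexp
  have hul : u * l = 1 / 5 := by rw [hu]; field_simp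
  have hlam : ((1 + 3 * u) / (1 - u)) ^ l ≤ 3 := by
    have h2 : (1 + 3 * u) / (1 - u) ≤ Real.exp (5 * u) := by
      refine le_trans ?_ (Real.add_one_le_exp (5 * u))
      rw [div_le_iff₀ h1u]; nlinarith
    calc ((1 + 3 * u) / (1 - u)) ^ l ≤ Real.exp (5 * u) ^ l :=
          pow_le_pow_left₀ (by positivity) h2 _
      _ = Real.exp 1 := by rw [← Real.exp_nat_mul]; congr 1; linarith
      _ ≤ 3 := Real.exp_one_lt_three.le
  have hrate : (c * ((1 + u) / (1 - u))) ^ l ≤ 3 * α := by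
    rw [mul_pow, mul_comm]
    refine mul_le_mul ?_ ?_ (by positivity) (by norm_num)
    · refine le_trans (pow_le_pow_left₀ (by positivity) ?_ _) hlam
      gcongr; linarith
    · have h3 := h.exp_zeta_len_le hp hU
      rw [← hl, ← hζ] at h3
      have h4 : (c ^ l) ^ 2 = Real.exp (-(ζ * l)) := by
        rw [hc, ← Real.exp_nat_mul, ← Real.exp_nat_mul, hp.tau_eq]; congr 1; push_cast; ring
      refine abs_le_of_sq_le_sq' ?_ hα0.le |>.2
      rw [h4, hα', div_pow, one_pow, Real.sq_sqrt hm.le]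
      exact h3
  intro j hj
  by_cases hdj : G.deg U j = 0
  · rw [walkDensity_of_deg_eq_zero G U 1 l hd hdj]; positivity
  · have hdj' : (1 : ℝ) ≤ G.deg U j := by exact_mod_cast Nat.one_le_iff_ne_zero.2 hdj
    set h : V → ℝ := fun j => max (walkDensity G U 1 l i j - α * ((1 + 3 * u) / (1 - u)) ^ l) 0
      with hh
    have h2 : h j ^ 2 ≤ ((c * ((1 + u) / (1 - u))) ^ l) ^ 2 := by
      refine le_trans ?_ h1
      have h3 : (G.deg U j : ℝ) * h j * h j ≤ ∑ j ∈ U, (G.deg U j : ℝ) * h j * h j :=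
        Finset.single_le_sum (f := fun j => (G.deg U j : ℝ) * h j * h j)
          (fun k _ => by rw [mul_assoc]; exact mul_nonneg (Nat.cast_nonneg _) (mul_self_nonneg _)) hj
      refine le_trans ?_ h3
      nlinarith [mul_self_nonneg (h j)]
    have h3 := (abs_le_of_sq_le_sq' h2 (by positivity)).2
    have h4 : walkDensity G U 1 l i j - α * ((1 + 3 * u) / (1 - u)) ^ l ≤ h j := le_max_left _ _
    nlinarith

theorem phi_bounds {p : Params} (hp : p.Base) (h : p.Tame p.eps₁ p.mu₁) :
    0 < p.phi ∧ 2 * p.phi ≤ 9 / 20 := by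
  have hz := h.zeta_pos hp
  have hz' := h.zeta_le
  set ζ := p.zeta p.eps₁ p.mu₁ with hζ
  set c := Real.exp (-(ζ * p.tau)) with hc
  have hphi : p.phi = c * √(1 - c ^ 2) := rfl
  have hc1 : c < 1 := by
    rw [hc, Real.exp_lt_one_iff, hp.tau_eq]; linarith
  have hc2 : 39 / 40 ≤ c := by
    have := Real.add_one_le_exp (-(ζ * p.tau))
    rw [hp.tau_eq] at this
    rw [hc, hp.tau_eq]; linarith
  have hq : √(1 - c ^ 2) ≤ 9 / 40 := Real.sqrt_le_iff.2 ⟨by norm_num, by nlinarith⟩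
  have hq0 : 0 < √(1 - c ^ 2) := Real.sqrt_pos.2 (by nlinarith)
  rw [hphi]
  exact ⟨by positivity, by nlinarith⟩

/-- The contrapositive of `density_le_of_expands`: if the visit counts are accurate and no tested
set has low conductance, all relevant level sets expand and the walk spreads. -/
theorem pr_cutOrBound_none_le {p : Params} (hp : p.Base) (h : p.Tame p.eps₁ p.mu₁) {i : V}
    (hi : i ∈ U) (hd : G.deg U i ≠ 0) (hU : 0 < G.total U)
    (hdens : ¬∀ j ∈ U, walkDensity G U 1 (p.len (G.total U) p.eps₁ p.mu₁) i j ≤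
      6 * p.alpha (G.total U)) :
    pr (cutOrBound G p U i) (fun o => o = none) ≤ Real.exp (-(6 * G.lg)) := by
  set α := p.alpha (G.total U) with hα
  have hm : (0 : ℝ) < G.total U := by exact_mod_cast hU
  have hα' := hp.alpha_eq (G.total U)
  rw [← hα] at hα'
  have hα0 : 0 < α := by rw [hα']; positivity
  set l := p.len (G.total U) p.eps₁ p.mu₁ with hl
  have hl2 : 2 ≤ l := h.two_le_len hp hU
  have hl2' : (2 : ℝ) ≤ l := by exact_mod_cast hl2
  have hlg : (1 : ℝ) ≤ G.lg := by exact_mod_cast one_le_lg G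
  have hwc : 0 < p.walkConst :=
    lt_of_lt_of_le (by have := hp.delta_pos; positivity) hp.walkConst_ge'
  obtain ⟨hφ0, hφ1⟩ := phi_bounds hp h
  -- Otherwise `√m < 2`, so `6α > 1` and the density bound would hold trivially.
  have hm4 : 2 / α ≤ G.total U := by
    by_contra! hlt
    refine hdens fun j hj => (walkDensity_le_one G U _ hi hd hj).trans ?_
    have : 1 / 3 ≤ α := by
      rw [hα', div_div_eq_mul_div, div_one] at hlt
      have h1 : √(G.total U : ℝ) * √(G.total U : ℝ) = G.total U :=
        Real.mul_self_sqrt hm.le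
      have h2 : 0 < √(G.total U : ℝ) := Real.sqrt_pos.2 hm
      rw [hα', div_le_div_iff₀ (by norm_num) h2]
      nlinarith
    linarith
  have hR := pr_visitDensity_le G U hp h hα0 hi hd hU (l := l) hl rfl
  unfold cutOrBound
  simp only
  rw [← hl, ← hα]
  set w := ⌈p.walkConst * l ^ 2 * G.lg / α⌉₊ with hw
  have hw0 : 0 < w := Nat.ceil_pos.2 (by positivity)
  rw [← add_zero (Real.exp _)]
  have hlenEns := ens_repeated_length (walk G U l (i, false)) w
  -- The wrong number of traces, an event of probability zero, is included among the bad outcomes so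
  -- that the right number is known afterwards.
  refine pr_bind_le_of inferInstance (by intro; infer_instance) (fun traces =>
      (¬traces.length = w) ∨ ∃ x ∈ Finset.range l ×ˢ U,
      1 / (5 * l) * max (walkDensity G U 1 x.1 i x.2) α <
        |visitDensity G U w traces x.1 x.2 - walkDensity G U 1 x.1 i x.2|) ?_ le_rfl ?_
  · refine (pr_or_le _ _ _).trans ?_
    rw [pr_eq_zero (hlenEns.mono fun a k h => not_not.2 h), zero_add]
    exact hR
  · intro traces ht
    rw [not_or, not_not] at ht
    obtain ⟨hlen, hgood⟩ := ht
    refine le_of_eq (pr_eq_zero ?_)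
    refine ens_tick_bind (f := fun _ => pure _) (ens_pure.2 ?_)
    intro hnone
    rw [List.find?_eq_none] at hnone
    refine hdens (density_le_of_expands G U hp h hi hd hU hl (est := visitDensity G U w traces)
      (fun k hk j hj => ?_) fun k hk s hs => ?_)
    · by_contra! hlt
      exact hgood ⟨(k, j), Finset.mem_product.2 ⟨Finset.mem_range.2 hk, hj⟩, hlt⟩
    · refine levelSet_expands G U (b := ⌈l / (2 * (1 - 2 * p.phi) * α)⌉₊) hα0 hw0
        (le_trans ?_ (Nat.le_ceil _)) hm4 hlen (fun k' hk' => ?_) hs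
      · rw [div_le_div_iff₀ hα0 (mul_pos (by linarith) hα0)]
        nlinarith
      · have := hnone ((sweepOrder G U traces k).take (k' + 1)).toFinset (by
          rw [List.mem_flatMap]
          exact ⟨k, List.mem_range.2 (by omega), List.mem_map.2 ⟨k', List.mem_range.2 hk', rfl⟩⟩)
        simpa using this

theorem pr_firstSome_none_le {α β : Type} {f : α → RandAlg (Option β)} (hf : ∀ a, Finitary (f a))
    {a : α} {l : List α} (ha : a ∈ l) :
    pr (firstSome f l) (fun o => o = none) ≤ pr (f a) (fun o => o = none) := by
  induction l with
  | nil => simp at ha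
  | cons b l ih =>
    rw [firstSome]
    by_cases hb : a = b
    · subst hb
      rw [← add_zero (pr (f a) _)]
      refine pr_bind_le_of inferInstance (by intro o; cases o <;> infer_instance)
        (fun o => o = none) le_rfl le_rfl ?_
      rintro (_ | o) ho
      · exact absurd rfl ho
      · exact (pr_eq_zero (ens_pure.2 (by simp))).le
    · rw [← zero_add (pr (f a) _)]
      refine pr_bind_le_of inferInstance (by intro o; cases o <;> infer_instance)
        (fun _ => False) ?_ (pr_nonneg _ _) ?_
      · exact (pr_eq_zero (Ens.true.mono fun _ _ _ h => h)).le
      · rintro (_ | o) -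
        · exact ih ((List.mem_cons.1 ha).resolve_left hb)
        · rw [pr_eq_zero (ens_pure.2 (by simp))]
          exact pr_nonneg _ _

end

/-! ### Edge counts when a classified set is removed; random cuts -/

namespace MultiGraph

variable {V : Type} (G : MultiGraph V) (U : Finset V)

theorem edges_union_left {A B : Finset V} (h : Disjoint A B) (C : Finset V) :
    G.edges (A ∪ B) C = G.edges A C + G.edges B C :=
  Finset.sum_union h

theorem edges_union_right {A B : Finset V} (h : Disjoint A B) (C : Finset V) :
    G.edges C (A ∪ B) = G.edges C A + G.edges C B := by
  rw [edges_comm, edges_union_left G h, edges_comm _ A, edges_comm _ B]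

theorem total_eq_edges : G.total U = G.edges U U := rfl

theorem total_eq_add_inc {A B : Finset V} (h : A ∪ B ⊆ U) :
    (G.total U : ℝ) = G.total (U \ (A ∪ B)) + 2 * G.inc U A B := by
  have hd : Disjoint (A ∪ B) (U \ (A ∪ B)) := Finset.disjoint_sdiff
  have e : U = (A ∪ B) ∪ (U \ (A ∪ B)) := (Finset.union_sdiff_of_subset h).symm
  have h1 : G.total U = G.edges (A ∪ B) (A ∪ B) + G.edges (A ∪ B) (U \ (A ∪ B)) +
      (G.edges (A ∪ B) (U \ (A ∪ B)) + G.edges (U \ (A ∪ B)) (U \ (A ∪ B))) := by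
    rw [total_eq_edges]
    conv_lhs => rw [e]
    rw [edges_union_left G hd, edges_union_right G hd, edges_union_right G hd,
      edges_comm G (U \ (A ∪ B)) (A ∪ B)]
  rw [h1, total_eq_edges]
  unfold inc cross
  push_cast
  ring

/-- On average over the coin flip, an edge that leaves `A ∪ B` is cut with probability one half
whatever is decided about its other end. So the contribution of the classified set does not depend
on `L`, and the recursion is additive in expectation. -/
theorem avg_cut_union {A B L : Finset V} (hAB : Disjoint A B) (h : A ∪ B ⊆ U)
    (hL : L ⊆ U \ (A ∪ B)) :
    ((G.edges (A ∪ L) (U \ (A ∪ L)) : ℝ) + G.edges (B ∪ L) (U \ (B ∪ L))) / 2 =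
      G.cut U A B + G.edges L ((U \ (A ∪ B)) \ L) := by
  set C := (U \ (A ∪ B)) \ L with hC
  have hmem : ∀ x, x ∈ L → x ∈ U ∧ x ∉ A ∧ x ∉ B := by
    intro x hx
    have := hL hx
    simp only [Finset.mem_sdiff, Finset.mem_union, not_or] at this
    exact this
  have hdis : ∀ x, x ∈ A → x ∉ B := fun x hA hB => Finset.disjoint_left.1 hAB hA hB
  have hAU : ∀ x, x ∈ A → x ∈ U := fun x hx => h (Finset.mem_union_left _ hx)
  have hBU : ∀ x, x ∈ B → x ∈ U := fun x hx => h (Finset.mem_union_right _ hx)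
  have e1 : U \ (A ∪ L) = B ∪ C := by
    ext x
    simp only [hC, Finset.mem_sdiff, Finset.mem_union]
    have := hmem x; have := hdis x; have := hBU x
    tauto
  have e2 : U \ (B ∪ L) = A ∪ C := by
    ext x
    simp only [hC, Finset.mem_sdiff, Finset.mem_union]
    have := hmem x; have := hdis x; have := hAU x
    tauto
  have e3 : U \ (A ∪ B) = L ∪ C := (Finset.union_sdiff_of_subset hL).symm
  have d1 : Disjoint A L := Finset.disjoint_left.2 fun x hx hx' => (hmem x hx').2.1 hx
  have d2 : Disjoint B L := Finset.disjoint_left.2 fun x hx hx' => (hmem x hx').2.2 hx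
  have d3 : Disjoint B C := Finset.disjoint_left.2 fun x hx hx' => by
    simp only [hC, Finset.mem_sdiff, Finset.mem_union] at hx'; tauto
  have d4 : Disjoint A C := Finset.disjoint_left.2 fun x hx hx' => by
    simp only [hC, Finset.mem_sdiff, Finset.mem_union] at hx'; tauto
  have d5 : Disjoint L C := Finset.disjoint_sdiff
  unfold cut cross
  rw [e1, e2, e3, edges_union_left G d1, edges_union_left G d2, edges_union_right G d3,
    edges_union_right G d4, edges_union_right G d3, edges_union_right G d4,
    edges_union_left G hAB, edges_union_right G d5, edges_union_right G d5,
    edges_comm G B A, edges_comm G L A, edges_comm G L B]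
  push_cast
  ring

theorem uncut_add_le (χ : V → Bool) {S : Finset V} (hS : S ⊆ U) :
    G.uncut χ S + G.uncut χ (U \ S) ≤ G.uncut χ U := by
  unfold uncut
  have hd : Disjoint S (U \ S) := Finset.disjoint_sdiff
  conv_rhs => rw [← Finset.union_sdiff_of_subset hS, Finset.sum_union hd]
  refine add_le_add (Finset.sum_le_sum fun j _ => ?_) (Finset.sum_le_sum fun j _ => ?_)
  · refine Finset.sum_le_sum_of_subset_of_nonneg Finset.subset_union_left fun _ _ _ => ?_
    positivity
  · refine Finset.sum_le_sum_of_subset_of_nonneg Finset.subset_union_right fun _ _ _ => ?_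
    positivity

theorem uncut_mono (χ : V → Bool) {S : Finset V} (hS : S ⊆ U) : G.uncut χ S ≤ G.uncut χ U :=
  le_trans (by linarith [G.uncut_nonneg (U := U \ S) χ]) (G.uncut_add_le U χ hS)

theorem total_mono {S : Finset V} (hS : S ⊆ U) : G.total S ≤ G.total U := by
  unfold total vol deg
  exact (Finset.sum_le_sum fun j _ => Finset.sum_le_sum_of_subset hS).trans
    (Finset.sum_le_sum_of_subset hS)

/-- Toggling the membership of `j` is an involution on the subsets that exchanges those separating
`j` from `k` with the others. -/
theorem sum_powerset_ind {j k : V} (hj : j ∈ U) (hjk : j ≠ k) :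
    ∑ L ∈ U.powerset, (ind L j * (1 - ind L k) + ind L k * (1 - ind L j)) =
      (2 : ℝ) ^ U.card / 2 := by
  set x : Finset V → ℝ := fun L => ind L j * (1 - ind L k) + ind L k * (1 - ind L j) with hx
  have h1 : ∑ L ∈ U.powerset, x L = ∑ L ∈ U.powerset, (1 - x L) := by
    refine Finset.sum_nbij' (fun L => symmDiff L {j}) (fun L => symmDiff L {j}) ?_ ?_ ?_ ?_ ?_
    · intro L hL
      rw [Finset.mem_powerset] at hL ⊢
      intro a ha
      rw [Finset.mem_symmDiff, Finset.mem_singleton] at ha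
      rcases ha with ha | ha
      · exact hL ha.1
      · rw [ha.1]; exact hj
    · intro L hL
      rw [Finset.mem_powerset] at hL ⊢
      intro a ha
      rw [Finset.mem_symmDiff, Finset.mem_singleton] at ha
      rcases ha with ha | ha
      · exact hL ha.1
      · rw [ha.1]; exact hj
    · intro L _; simp
    · intro L _; simp
    · intro L _
      have e1 : ind (symmDiff L {j}) j = 1 - ind L j := by
        by_cases h : j ∈ L <;> simp [ind, Finset.mem_symmDiff, h]
      have e2 : ind (symmDiff L {j}) k = ind L k := by
        by_cases h : k ∈ L <;> simp [ind, Finset.mem_symmDiff, h, hjk.symm]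
      have s1 : ind L j * ind L j = ind L j := by by_cases h : j ∈ L <;> simp [ind, h]
      simp only [hx, e1, e2]
      by_cases h1 : j ∈ L <;> by_cases h2 : k ∈ L <;> simp [ind, h1, h2]
  rw [Finset.sum_sub_distrib, Finset.sum_const, Finset.card_powerset, nsmul_eq_mul, mul_one] at h1
  push_cast at h1
  linarith

theorem sum_powerset_cut :
    ∑ L ∈ U.powerset, (G.edges L (U \ L) : ℝ) = 2 ^ U.card * (G.total U / 4) := by
  have h1 : ∑ L ∈ U.powerset, (G.edges L (U \ L) : ℝ) = ∑ j ∈ U, ∑ k ∈ U, (G.mult j k : ℝ) *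
      ∑ L ∈ U.powerset, ind L j * (1 - ind L k) := by
    simp only [Finset.mul_sum]
    rw [Finset.sum_congr rfl fun L hL => G.cast_edges U (Finset.mem_powerset.1 hL)
      (Finset.sdiff_subset (s := U) (t := L)), Finset.sum_comm]
    refine Finset.sum_congr rfl fun j _ => ?_
    rw [Finset.sum_comm]
    refine Finset.sum_congr rfl fun k hk => Finset.sum_congr rfl fun L _ => ?_
    rw [ind_sdiff U hk]
  have h2 := G.sum_mult_comm U fun j k => ∑ L ∈ U.powerset, ind L j * (1 - ind L k)
  have h3 : ∑ j ∈ U, ∑ k ∈ U, (G.mult j k : ℝ) * (∑ L ∈ U.powerset, ind L j * (1 - ind L k)) +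
      ∑ j ∈ U, ∑ k ∈ U, (G.mult j k : ℝ) * (∑ L ∈ U.powerset, ind L k * (1 - ind L j)) =
      2 ^ U.card / 2 * G.total U := by
    rw [← G.sum_mult_eq_total U]
    simp only [← Finset.sum_add_distrib, ← mul_add, Finset.mul_sum (a := (2 : ℝ) ^ U.card / 2)]
    refine Finset.sum_congr rfl fun j hj => Finset.sum_congr rfl fun k _ => ?_
    by_cases hjk : j = k
    · subst hjk; simp [G.loopless]
    · rw [sum_powerset_ind U hj hjk]; ring
  rw [h1]
  linarith

end MultiGraph

section
variable {V : Type} [Fintype V] (G : MultiGraph V) (U : Finset V)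

theorem ens_randomCut : Ens (randomCut U) fun L _ => L ⊆ U := by
  refine ens_tick_bind (f := fun _ => choose _) (ens_choose.2 fun L hL => ?_)
  exact Finset.mem_powerset.1 ((PMF.mem_support_uniformOfFinset_iff
    (Finset.powerset_nonempty U) L).1 hL)

theorem E_randomCut : E (randomCut U) (fun L => (G.edges L (U \ L) : ℝ)) = G.total U / 4 := by
  unfold randomCut
  rw [E_tick_bind, E_choose]
  have h1 : ∀ (h : U.powerset.Nonempty) (L : Finset V),
      (PMF.uniformOfFinset U.powerset h L).toReal *
        (G.edges L (U \ L) : ℝ) =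
      if L ∈ U.powerset then ((2 : ℝ) ^ U.card)⁻¹ * (G.edges L (U \ L) : ℝ) else 0 := by
    intro h L
    rw [PMF.uniformOfFinset_apply]
    split_ifs
    · rw [Finset.card_powerset, ENNReal.toReal_inv]; simp
    · simp
  refine (Finset.sum_congr rfl fun L _ => h1 _ L).trans ?_
  rw [Finset.sum_ite_mem, Finset.univ_inter, ← Finset.mul_sum,
    G.sum_powerset_cut]
  field_simp

/-! ### Outputs of Find -/

theorem ens_threshold {p : Params} {ε μ α t : ℝ} (ht : 0 < t) {i : V} {c : Finset V × Finset V}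
    (hc : c.1 ⊆ U ∧ c.2 ⊆ U ∧ Disjoint c.1 c.2) :
    Ens (threshold G p U ε μ α i t c) fun c' _ => c'.1 ⊆ U ∧ c'.2 ⊆ U ∧ Disjoint c'.1 c'.2 := by
  unfold threshold
  refine Ens.bind (fun _ _ => True) Ens.true fun traces _ _ => ?_
  refine ens_tick_bind (f := fun _ => pure _) (ens_pure.2 ?_)
  obtain ⟨h1, h2, h3⟩ := hc
  refine ⟨Finset.union_subset h1 ?_, Finset.union_subset h2 ?_, ?_⟩
  · exact (Finset.filter_subset _ _).trans Finset.sdiff_subset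
  · exact (Finset.filter_subset _ _).trans Finset.sdiff_subset
  · rw [Finset.disjoint_left] at h3 ⊢
    intro x hx hx'
    simp only [Finset.mem_union, Finset.mem_filter, Finset.mem_sdiff, not_or] at hx hx'
    rcases hx with hx | hx <;> rcases hx' with hx' | hx'
    · exact h3 hx hx'
    · exact hx'.1.2.1 hx
    · exact hx.1.2.2 hx'
    · linarith [hx.2, hx'.2]

theorem ens_findRuns {p : Params} {ε μ α : ℝ} {ts : List ℝ} (hts : ∀ t ∈ ts, 0 < t)
    {runs : List (V × Finset V × Finset V)}
    (hr : ∀ s ∈ runs, s.2.1 ⊆ U ∧ s.2.2 ⊆ U ∧ Disjoint s.2.1 s.2.2) :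
    Ens (findRuns G p U ε μ α ts runs) fun o _ => ∀ c ∈ o,
      (c.1 ⊆ U ∧ c.2 ⊆ U ∧ Disjoint c.1 c.2) ∧ ∃ t ∈ ts, Accepts G p U ε μ t c := by
  induction ts generalizing runs with
  | nil => exact ens_pure.2 (by simp)
  | cons t ts ih =>
    have ht := hts t (by simp)
    refine Ens.bind (fun runs' _ => ∀ s ∈ runs', s.2.1 ⊆ U ∧ s.2.2 ⊆ U ∧ Disjoint s.2.1 s.2.2)
      ?_ fun runs' _ hr' => ?_
    · have h1 := ens_collect_forall (f := fun s : V × Finset V × Finset V => do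
        let c ← threshold G p U ε μ α s.1 t s.2
        tick (scanCost G U (c.1 ∪ c.2))
        pure (s.1, c)) (P := fun _ s => s.2.1 ⊆ U ∧ s.2.2 ⊆ U ∧ Disjoint s.2.1 s.2.2)
        (l := runs) fun s hs => by
          refine Ens.bind _ (ens_threshold G U ht (hr s hs)) fun c _ hc => ?_
          exact ens_tick_bind (f := fun _ => pure _) (ens_pure.2 hc)
      exact h1.mono fun bs _ h s hs => (h s hs).choose_spec.2
    · rcases hfind : runs'.find? (fun s => decide (Accepts G p U ε μ t s.2)) with _ | s
      · simp only [hfind]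
        refine (ih (fun t' h => hts t' (by simp [h])) hr').mono fun o _ h c hc => ?_
        obtain ⟨h1, t', ht', h2⟩ := h c hc
        exact ⟨h1, t', by simp [ht'], h2⟩
      · simp only [hfind]
        refine ens_pure.2 fun c hc => ?_
        obtain rfl : s.2 = c := by simpa using hc
        have h1 := List.find?_some hfind
        exact ⟨hr' s (List.mem_of_find?_eq_some hfind), t, by simp, by simpa using h1⟩

/-- Every success makes progress, which ends the recursions and leaves at least one vertex to charge
costs to. -/
theorem Accepts.nonempty {G : MultiGraph V} {U : Finset V} {p : Params} {ε μ t : ℝ}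
    {c : Finset V × Finset V} (h : Accepts G p U ε μ t c) (hs : 0 < p.sizeConst) (ht : 0 < t)
    (hU : 0 < G.total U) : (c.1 ∪ c.2).Nonempty := by
  have h1 := h.2
  have hm : (0 : ℝ) < G.total U := by exact_mod_cast hU
  have hlg : (0 : ℝ) < G.lg := by exact_mod_cast one_le_lg G
  have hd : (0 : ℝ) < ((max G.maxDeg 1 : ℕ) : ℝ) := by exact_mod_cast lt_max_of_lt_right one_pos
  have h2 : (0 : ℝ) < ((c.1 ∪ c.2).card : ℝ) := by
    refine lt_of_lt_of_le ?_ h1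
    push_cast at hd ⊢
    positivity
  rw [← Finset.card_pos]
  exact_mod_cast h2

theorem Params.Base.sizeConst_pos {p : Params} (hp : p.Base) : 0 < p.sizeConst := by
  have h1 := hp.gamma_pos
  have h2 := hp.delta_pos
  rw [hp.sizeConst_eq]; positivity

theorem ens_find {p : Params} (hp : p.Base) {ε μ α : ℝ} (hU : 0 < G.total U) {P : List V} :
    Ens (find G p U ε μ α P) fun o _ => ∀ c ∈ o, c.1 ∪ c.2 ⊆ U ∧ Disjoint c.1 c.2 ∧
      (c.1 ∪ c.2).Nonempty ∧ soto (p.sigma ε μ) * G.inc U c.1 c.2 ≤ G.cut U c.1 c.2 := by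
  have hts : ∀ t ∈ thresholds p (G.total U) μ, 0 < t := by
    intro t ht
    obtain ⟨r, -, rfl⟩ := List.mem_map.1 ht
    exact pow_pos (by linarith [hp.gamma_le]) r
  refine (ens_findRuns G U hts ?_).mono fun o _ h c hc => ?_
  · intro s hs
    obtain ⟨i, -, rfl⟩ := List.mem_map.1 hs
    simp
  · obtain ⟨⟨h1, h2, h3⟩, t, ht, h4⟩ := h c hc
    exact ⟨Finset.union_subset h1 h2, h3, h4.nonempty hp.sizeConst_pos (hts t ht) hU, h4.1⟩

/-! ### Simple -/

/-- By Bernoulli's inequality `(1 - ε)^{1 + 1/μ} ≥ 1 - (1 + 1/μ) ε ≥ 99/100`, hence `σ ≤ 1 -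
(17/25)(99/100) < 33/100`. -/
theorem soto_sigma_ge {p : Params} (hp : p.Base) {ε μ : ℝ} (hε : 0 ≤ ε) (hμ : 0 < μ) (hμ1 : μ ≤ 1)
    (h : ε ≤ μ / 200) : 501 / 1000 ≤ soto (p.sigma ε μ) := by
  refine soto_ge (Params.sigma_ge hp hε hμ) ?_
  unfold Params.sigma
  have hmax : max (1 - ε) 0 = 1 + -ε := by rw [max_eq_left (by linarith)]; ring
  have hq : 1 ≤ 1 + 1 / μ := by have := one_div_pos.2 hμ; linarith
  have h1 := one_add_mul_self_le_rpow_one_add (s := -ε) (by linarith) hq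
  have h2 : (1 + 1 / μ) * ε ≤ 1 / 100 := by
    have : (1 + 1 / μ) * ε = ε * (μ + 1) / μ := by field_simp
    rw [this, div_le_iff₀ hμ]
    nlinarith
  rw [hmax, hp.eta_eq]
  nlinarith

end

section
variable {V : Type} [Fintype V] (G : MultiGraph V) (U : Finset V)

instance finitary_simpleRec (p : Params) (μ : ℝ) (n : ℕ) (U : Finset V) (ε : ℝ) :
    Finitary (simpleRec G p μ n U ε) := by
  induction n generalizing U ε with
  | zero => rw [simpleRec]; infer_instance
  | succ n ih =>
    rw [simpleRec]
    split_ifs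
    · infer_instance
    · refine @instFinitaryBind _ _ _ _ _ fun P => ?_
      refine @instFinitaryBind _ _ _ _ _ fun o => ?_
      cases o <;> infer_instance

instance (p : Params) (μ : ℝ) (U : Finset V) (ε : ℝ) : Finitary (simple G p μ U ε) := by
  unfold simple
  refine @instFinitaryBind _ _ _ _ _ fun _ => ?_
  refine @instFinitaryBind _ _ _ _ _ fun r => ?_
  split_ifs <;> infer_instance

instance (p : Params) (μ : ℝ) (U : Finset V) : Finitary (simple' G p μ U) := by
  unfold simple'; infer_instance

theorem flip_bind_E {α β : Type} (a b : α) (f : α → RandAlg β) [∀ a, Finitary (f a)] (g : β → ℝ) :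
    E (RandAlg.flip a b >>= f) g = (E (f a) g + E (f b) g) / 2 := by
  rw [E_bind, E_flip]

theorem E_avg {α : Type} (x : RandAlg α) [Finitary x] (f g : α → ℝ) :
    (E x f + E x g) / 2 = E x fun a => (f a + g a) / 2 := by
  rw [← E_add, div_eq_mul_inv, ← E_mul_right]
  simp only [div_eq_mul_inv]

theorem ens_flip {α : Type} (a b : α) {P : α → ℕ → Prop} (ha : P a 1) (hb : P b 1) :
    Ens (RandAlg.flip a b) P := by
  unfold RandAlg.flip
  refine Ens.bind (fun _ k => k = 1) (ens_choose.2 fun _ _ => rfl) ?_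
  rintro c _ rfl
  refine ens_pure.2 ?_
  cases c <;> simpa

theorem ens_simpleRec {p : Params} (hp : p.Base) {μ : ℝ} (n : ℕ) (U : Finset V) (ε : ℝ) :
    Ens (simpleRec G p μ n U ε) fun r _ => r.1 ⊆ U := by
  induction n generalizing U ε with
  | zero => exact ens_pure.2 (by simp)
  | succ n ih =>
    rw [simpleRec]
    split_ifs with h
    · exact Ens.bind _ (ens_randomCut U) fun L _ hL => ens_pure.2 hL
    · rw [not_or] at h
      refine Ens.bind _ Ens.true fun P _ _ => ?_
      refine Ens.bind _ (ens_find G U hp (Nat.pos_of_ne_zero h.1)) fun o _ ho => ?_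
      rcases o with _ | ⟨A, B⟩
      · exact ens_pure.2 (by simp)
      · obtain ⟨hAB, -⟩ := ho (A, B) rfl
        simp only at hAB
        refine Ens.bind (fun L _ => L ⊆ U) (ens_flip A B ?_ ?_) fun L _ hL => ?_
        · exact Finset.subset_union_left.trans hAB
        · exact Finset.subset_union_right.trans hAB
        · refine ens_tick_bind (f := fun _ => _ >>= _) (Ens.bind _ (ih _ _) fun r _ hr => ?_)
          exact ens_pure.2 (Finset.union_subset hL (hr.trans Finset.sdiff_subset))

theorem ens_simple {p : Params} (hp : p.Base) {μ ε : ℝ} :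
    Ens (simple G p μ U ε) fun L _ => L ⊆ U := by
  unfold simple
  refine ens_tick_bind (f := fun _ => _ >>= _) (Ens.bind _ (ens_simpleRec G hp _ U ε) ?_)
  intro r _ hr
  split_ifs
  · exact ens_pure.2 hr
  · exact (ens_randomCut U).mono fun _ _ h => h

/-- What the recursion of Simple gains over a random cut, on the event that it succeeds. -/
theorem E_simpleRec_gain {p : Params} (hp : p.Base) {μ : ℝ} (hμ : 0 < μ) {g h D : ℝ} (hg : 0 ≤ g)
    (hg1 : g ≤ 1 / 1000) (hh : 0 ≤ h) (n : ℕ) (U : Finset V) (ε : ℝ) (hn : U.card < n)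
    (hε : 0 ≤ ε) (hD : ε * G.total U ≤ D)
    (hsoto : ∀ U' ⊆ U, h < G.total U' / 2 → ∀ ε', 0 ≤ ε' → ε' * G.total U' ≤ D →
      501 / 1000 ≤ soto (p.sigma ε' μ)) :
    0 ≤ E (simpleRec G p μ n U ε) fun r => if r.2 then
      (G.edges r.1 (U \ r.1) : ℝ) - G.total U / 4 - g * max (G.total U / 2 - h) 0 else 0 := by
  induction n generalizing U ε with
  | zero => omega
  | succ n ih =>
    rw [simpleRec]
    split_ifs with hc
    · have hz : max ((G.total U : ℝ) / 2 - h) 0 = 0 := by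
        refine max_eq_right ?_
        rcases hc with h0 | h0
        · rw [h0]; simpa using hh
        · by_contra! hlt
          have := hsoto U subset_rfl (by linarith) ε hε hD
          rw [h0] at this
          norm_num at this
      rw [E_bind]
      simp only [E_pure, if_true, hz, mul_zero, sub_zero]
      rw [E_sub, E_const, E_randomCut]
      simp
    · rw [not_or] at hc
      have hU : 0 < G.total U := Nat.pos_of_ne_zero hc.1
      rw [E_bind_of inferInstance (by
        intro P; refine @instFinitaryBind _ _ _ _ _ fun o => ?_; cases o <;> infer_instance)]
      refine E_nonneg _ fun P => ?_
      rw [E_bind_of inferInstance (by intro o; cases o <;> infer_instance)]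
      refine le_E_of_ens ((ens_find G U hp hU).mono fun o _ ho => ?_)
      rcases o with _ | ⟨A, B⟩
      · simp
      · obtain ⟨hAB, hd, hne, hcut⟩ := ho (A, B) rfl
        simp only at hAB hd hne hcut ⊢
        set U' := U \ (A ∪ B) with hU'
        have hU'U : U' ⊆ U := Finset.sdiff_subset
        have hcard : U'.card < U.card := Finset.card_lt_card
          (Finset.sdiff_ssubset hAB hne)
        set ε' := ε * G.total U / G.total U' with hε'
        have hε'0 : 0 ≤ ε' := by positivity
        -- Rescaling leaves the product of `ε` and the total degree unchanged; if no edge is left,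
        -- the product is zero.
        have hD' : ε' * G.total U' ≤ D := by
          by_cases h0 : (G.total U' : ℝ) = 0
          · rw [h0, mul_zero]
            exact le_trans (by positivity) hD
          · rw [hε', div_mul_cancel₀ _ h0]; exact hD
        have hIH := ih U' ε' (by omega) hε'0 hD' fun U'' hU'' => hsoto U'' (hU''.trans hU'U)
        rw [flip_bind_E]
        simp only [E_tick_bind]
        simp only [E_bind, E_pure]
        rw [E_avg]
        refine hIH.trans (E_mono_of_ens ((ens_simpleRec G hp n U' ε').mono fun r _ hr => ?_))
        have htot := G.total_eq_add_inc U hAB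
        have hinc := G.inc_nonneg U A B
        have havg := G.avg_cut_union U hd hAB hr
        by_cases hok : r.2 = true
        · simp only [hok, if_true]
          have h2 : (1 : ℝ) / 2 * G.inc U A B ≤ G.cut U A B :=
            (mul_le_mul_of_nonneg_right (half_le_soto (Params.sigma_ge hp hε hμ)) hinc).trans hcut
          rw [← hU'] at htot havg
          -- While more than `h` edges remain, the tripartition gains at least `1/1000` of its
          -- incident edges, which covers the decrease of the extra term; afterwards that term is
          -- zero.
          have key : g * max ((G.total U : ℝ) / 2 - h) 0 ≤
              g * max ((G.total U' : ℝ) / 2 - h) 0 + (G.cut U A B - G.inc U A B / 2) := by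
            by_cases hlt : h < G.total U / 2
            · have h3 := hsoto U subset_rfl hlt ε hε hD
              have h4 : (501 : ℝ) / 1000 * G.inc U A B ≤ G.cut U A B :=
                (mul_le_mul_of_nonneg_right h3 hinc).trans hcut
              have h5 : max ((G.total U : ℝ) / 2 - h) 0 ≤
                  max ((G.total U' : ℝ) / 2 - h) 0 + G.inc U A B := by
                refine max_le ?_ ?_
                · have := le_max_left ((G.total U' : ℝ) / 2 - h) 0
                  linarith
                · have := le_max_right ((G.total U' : ℝ) / 2 - h) 0
                  linarith
              have h6 := mul_le_mul_of_nonneg_left h5 hg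
              have h7 : g * G.inc U A B ≤ 1 / 1000 * G.inc U A B :=
                mul_le_mul_of_nonneg_right hg1 hinc
              rw [mul_add] at h6
              linarith
            · rw [max_eq_right (by linarith : (G.total U : ℝ) / 2 - h ≤ 0), mul_zero]
              have : 0 ≤ g * max ((G.total U' : ℝ) / 2 - h) 0 :=
                mul_nonneg hg (le_max_right _ _)
              linarith
          linarith
        · simp [hok]

/-- Every round removes a vertex, so there are at most `|U|` rounds. A round fails if no starting
vertex is good or if Find fails from a good one, each with probability at most `exp (-6 lg)`. With
`α = 1` the density condition of Find holds automatically. -/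
theorem pr_simpleRec_fails_le {p : Params} (hp : p.Base) {μ : ℝ} (hμ : 0 < μ) (hμ1 : μ ≤ 1)
    (hδ : p.delta ≤ μ / 200) (χ : V → Bool) (n : ℕ) (U : Finset V) (ε : ℝ) (hn : U.card < n)
    (hε : 0 ≤ ε) (hχ : G.uncut χ U ≤ ε * G.total U) :
    pr (simpleRec G p μ n U ε) (fun r => r.2 = false) ≤
      U.card * (2 * Real.exp (-(6 * G.lg))) := by
  induction n generalizing U ε with
  | zero => omega
  | succ n ih =>
    rw [simpleRec]
    split_ifs with hc
    · rw [pr_eq_zero]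
      · positivity
      · exact Ens.bind _ Ens.true fun L _ _ => ens_pure.2 (by simp)
    · rw [not_or] at hc
      have hU : 0 < G.total U := Nat.pos_of_ne_zero hc.1
      have ht := Params.tame_of_soto hp hε hμ hμ1 hδ hc.2
      have hcard1 : 1 ≤ U.card := by
        rw [Nat.one_le_iff_ne_zero, Ne, Finset.card_eq_zero]
        rintro rfl
        simp [MultiGraph.total, MultiGraph.vol] at hU
      set e := Real.exp (-(6 * G.lg : ℝ)) with he
      have he0 : 0 ≤ e := (Real.exp_pos _).le
      have hcard1' : (1 : ℝ) ≤ U.card := by exact_mod_cast hcard1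
      have hgoal : (U.card : ℝ) * (2 * e) = e + (e + (U.card - 1) * (2 * e)) := by ring
      rw [hgoal]
      have hrest : 0 ≤ ((U.card : ℝ) - 1) * (2 * e) := mul_nonneg (by linarith) (by linarith)
      refine pr_bind_le_of inferInstance (by
        intro P; refine @instFinitaryBind _ _ _ _ _ fun o => ?_; cases o <;> infer_instance)
        (fun P => ∀ i ∈ P, ¬GoodStart G U p ε μ i) (pr_startVertices_le G U hp ht χ hχ hU)
        (by linarith) fun P hP => ?_
      push Not at hP
      obtain ⟨i, hiP, hi⟩ := hP
      have hfind := pr_find_none_le G U hp ht hi hU one_pos (fun j hj =>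
        (walkDensity_le_one G U _ hi.1 hi.2.1.ne' hj).trans (by norm_num)) hiP
      refine pr_bind_le_of inferInstance (by intro o; cases o <;> infer_instance)
        (fun o => o = none ∨ ¬∀ c ∈ o, c.1 ∪ c.2 ⊆ U ∧ Disjoint c.1 c.2 ∧
          (c.1 ∪ c.2).Nonempty ∧ soto (p.sigma ε μ) * G.inc U c.1 c.2 ≤ G.cut U c.1 c.2)
        ?_ hrest ?_
      · refine (pr_or_le _ _ _).trans ?_
        rw [pr_eq_zero ((ens_find G U hp hU).mono fun o _ ho => not_not.2 ho), add_zero]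
        exact hfind
      · intro o ho
        rw [not_or, not_not] at ho
        rcases o with _ | ⟨A, B⟩
        · exact absurd rfl ho.1
        · obtain ⟨hAB, hd, hne, hcut⟩ := ho.2 (A, B) rfl
          simp only at hAB hd hne hcut ⊢
          set U' := U \ (A ∪ B) with hU'
          have hU'U : U' ⊆ U := Finset.sdiff_subset
          have hcard : U'.card < U.card := Finset.card_lt_card (Finset.sdiff_ssubset hAB hne)
          set ε' := ε * G.total U / G.total U' with hε'
          have hε'0 : 0 ≤ ε' := by positivity
          have hχ' : G.uncut χ U' ≤ ε' * G.total U' := by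
            by_cases h0 : (G.total U' : ℝ) = 0
            · rw [h0, mul_zero]
              refine le_trans ?_ h0.le
              rw [← G.sum_mult_eq_total]
              refine Finset.sum_le_sum fun j _ => Finset.sum_le_sum fun k _ => ?_
              split_ifs <;> simp
            -- The reference cut `χ` misses no more edges in the smaller subgraph, so it certifies
            -- the rescaled `ε'`.
            · rw [hε', div_mul_cancel₀ _ h0]; exact (G.uncut_mono U χ hU'U).trans hχ
          have hIH := ih U' ε' (by omega) hε'0 hχ'
          have hle : (U'.card : ℝ) * (2 * e) ≤ ((U.card : ℝ) - 1) * (2 * e) := by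
            have : (U'.card : ℝ) + 1 ≤ U.card := by exact_mod_cast hcard
            exact mul_le_mul_of_nonneg_right (by linarith) (by linarith)
          refine le_trans ?_ (hIH.trans hle)
          rw [← zero_add (pr (simpleRec G p μ n U' ε') _)]
          refine pr_bind_le (fun _ => False) (pr_eq_zero (Ens.true.mono fun _ _ _ h => h)).le
            (pr_nonneg _ _) fun L _ => ?_
          rw [← zero_add (pr (simpleRec G p μ n U' ε') _)]
          refine pr_bind_le (fun _ => False) (pr_eq_zero (Ens.true.mono fun _ _ _ h => h)).le
            (pr_nonneg _ _) fun _ _ => ?_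
          rw [← add_zero (pr (simpleRec G p μ n U' ε') _)]
          refine pr_bind_le (fun r => r.2 = false) le_rfl le_rfl fun r hr => ?_
          refine le_of_eq (pr_eq_zero ?_)
          exact ens_pure.2 hr

end

/-- The choice of the constants of Balance. -/
structure Params.Good (p : Params) : Prop extends p.Base where
  mu₁_pos : 0 < p.mu₁
  mu₁_le : p.mu₁ ≤ 1
  mu₂_pos : 0 < p.mu₂
  mu₂_le : p.mu₂ ≤ 1
  delta_le₁ : p.delta ≤ p.mu₁ / 200
  delta_le₂ : p.delta ≤ p.mu₂ / 200
  eps₁_pos : 0 < p.eps₁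
  eps₁_le : p.eps₁ ≤ p.mu₁ / 400
  gamma_le₁ : p.gamma ≤ p.eps₁
  gamma_le₂ : p.gamma ≤ p.mu₂ / 400

namespace Params.Good

variable {p : Params}

theorem soto_ge (hp : p.Good) : 501 / 1000 ≤ soto (p.sigma p.eps₁ p.mu₁) :=
  soto_sigma_ge hp.toBase hp.eps₁_pos.le hp.mu₁_pos hp.mu₁_le
    (by linarith [hp.eps₁_le, hp.mu₁_pos])

theorem tame (hp : p.Good) : p.Tame p.eps₁ p.mu₁ :=
  Params.tame_of_soto hp.toBase hp.eps₁_pos.le hp.mu₁_pos hp.mu₁_le hp.delta_le₁ (by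
    have := hp.soto_ge; intro h; rw [h] at this; norm_num at this)

end Params.Good

section
variable {V : Type} [Fintype V] (G : MultiGraph V) (U : Finset V)

/-- A failed recursion is replaced by a random cut, which is worth a quarter of the total degree. So
failure loses no more than the extra gain. -/
theorem E_simple_ge {p : Params} (hp : p.Base) {μ : ℝ} (hμ : 0 < μ) {g h D : ℝ} (hg : 0 ≤ g)
    (hg1 : g ≤ 1 / 1000) (hh : 0 ≤ h) (ε : ℝ) (hε : 0 ≤ ε) (hD : ε * G.total U ≤ D)
    (hsoto : ∀ U' ⊆ U, h < G.total U' / 2 → ∀ ε', 0 ≤ ε' → ε' * G.total U' ≤ D →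
      501 / 1000 ≤ soto (p.sigma ε' μ)) :
    G.total U / 4 + g * max (G.total U / 2 - h) 0 *
        (1 - pr (simpleRec G p μ (U.card + 1) U ε) fun r => r.2 = false) ≤
      E (simple G p μ U ε) fun L => (G.edges L (U \ L) : ℝ) := by
  have h1 := E_simpleRec_gain G hp hμ hg hg1 hh (U.card + 1) U ε (by omega) hε hD hsoto
  unfold simple
  rw [E_bind_of inferInstance (by
    intro _; refine @instFinitaryBind _ _ _ _ _ fun r => ?_; split_ifs <;> infer_instance)]
  rw [E_congr_of_ens (g := fun _ => E (do
    let r ← simpleRec G p μ (U.card + 1) U ε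
    if r.2 then pure r.1 else randomCut U) fun L => (G.edges L (U \ L) : ℝ))
    (Ens.true.mono fun _ _ _ => rfl), E_const,
    E_bind_of inferInstance (by intro r; split_ifs <;> infer_instance)]
  set X := g * max ((G.total U : ℝ) / 2 - h) 0 with hX
  rw [← pr_not]
  unfold pr
  rw [← E_mul_left, ← E_const (simpleRec G p μ (U.card + 1) U ε) ((G.total U : ℝ) / 4), ← E_add]
  have h2 := E_sub (simpleRec G p μ (U.card + 1) U ε)
    (fun r => E (if r.2 then pure r.1 else randomCut U) fun L => (G.edges L (U \ L) : ℝ))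
    (fun r => G.total U / 4 + X * if ¬r.2 = false then 1 else 0)
  refine sub_nonneg.1 (h1.trans_eq (Eq.trans ?_ (h2.trans (by congr!))))
  refine E_congr_of_ens (Ens.true.mono fun r _ _ => ?_)
  rcases r with ⟨L, _ | _⟩
  · simp [E_randomCut]
  · simp; ring

theorem E_le_E_collect {α β : Type} {f : α → RandAlg β} (hf : ∀ a, Finitary (f a)) {k : β → ℝ}
    {a : α} {l : List α} (ha : a ∈ l) {F : List β → ℝ} (hF : ∀ bs, ∀ b ∈ bs, k b ≤ F bs) :
    E (f a) k ≤ E (collect f l) F := by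
  suffices h : ∀ F : List β → ℝ, (∀ bs, ∀ b ∈ bs, k b ≤ F bs) → E (f a) k ≤ E (collect f l) F
    from h F hF
  clear hF F
  induction l with
  | nil => simp at ha
  | cons c l ih =>
    intro F hF
    rw [collect]
    simp only [E_bind, E_pure]
    by_cases hc : a = c
    · subst hc
      exact E_mono _ fun b => le_E_of_ens (Ens.true.mono fun bs _ _ => hF _ _ (by simp))
    · refine le_E_of_ens (Ens.true.mono fun b _ _ => ?_)
      exact ih ((List.mem_cons.1 ha).resolve_left hc) (fun bs => F (b :: bs))
        fun bs b' hb' => hF _ _ (by simp [hb'])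

/-- The index `r = 1` in Simple' is the parameter `ε = γ`. The maximum over the cuts is at least the
cut for this index, and no other index is needed. -/
theorem E_simple_le_E_simple' {p : Params} (hp : p.Base) (μ : ℝ) :
    E (simple G p μ U p.gamma) (fun L => (G.edges L (U \ L) : ℝ)) ≤
      E (simple' G p μ U) fun L => (G.edges L (U \ L) : ℝ) := by
  have hγ := hp.gamma_pos
  have hγ1 := hp.gamma_le
  unfold simple'
  rw [E_bind]
  simp only [E_pure]
  have hmem : 1 ∈ List.range (⌊Real.log 2 / -Real.log (1 - p.gamma)⌋₊ + 1) := by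
    rw [List.mem_range]
    have hpos : 0 < -Real.log (1 - p.gamma) := lt_of_lt_of_le hγ (neg_log_ge (by linarith))
    have : 1 ≤ ⌊Real.log 2 / -Real.log (1 - p.gamma)⌋₊ := by
      refine Nat.le_floor ?_
      rw [Nat.cast_one, le_div_iff₀ hpos, one_mul, ← Real.log_inv]
      refine Real.log_le_log (by rw [inv_pos]; linarith) ?_
      rw [inv_le_comm₀ (by linarith) (by norm_num)]
      linarith
    omega
  refine le_trans (le_of_eq ?_) (E_le_E_collect (by intro; infer_instance)
    (k := fun L => (G.edges L (U \ L) : ℝ)) hmem fun cuts L hL => ?_)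
  · simp only [E_bind, E_pure, pow_one, sub_sub_cancel, E_const]
  · rcases hA : cuts.argmax fun L => G.edges L (U \ L) with _ | M
    · rw [List.argmax_eq_none] at hA
      simp [hA] at hL
    · have := List.le_of_mem_argmax hL (f := fun L => G.edges L (U \ L)) (m := M) hA
      simp only [Option.getD_some]
      exact_mod_cast this

theorem ens_simple' {p : Params} (hp : p.Base) {μ : ℝ} :
    Ens (simple' G p μ U) fun L _ => L ⊆ U := by
  unfold simple'
  refine Ens.bind (fun cuts _ => ∀ L ∈ cuts, L ⊆ U) ?_ fun cuts _ hcuts => ens_pure.2 ?_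
  · have h1 := ens_collect_forall (f := fun r : ℕ => do
      let L ← simple G p μ U (1 - (1 - p.gamma) ^ r)
      tick (scanCost G U U)
      pure L) (P := fun _ L => L ⊆ U)
      (l := List.range (⌊Real.log 2 / -Real.log (1 - p.gamma)⌋₊ + 1)) fun r _ => by
        refine Ens.bind _ (ens_simple G U hp) fun L _ hL => ?_
        exact ens_tick_bind (f := fun _ => pure _) (ens_pure.2 hL)
    exact h1.mono fun bs _ h L hL => (h L hL).choose_spec.2
  · rcases hA : cuts.argmax fun L => G.edges L (U \ L) with _ | M
    · simp
    · exact hcuts M (List.argmax_mem hA)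

theorem card_mul_exp_le : (U.card : ℝ) * (2 * Real.exp (-(6 * G.lg))) ≤ 1 / 8 := by
  have hlg : (1 : ℝ) ≤ G.lg := by exact_mod_cast one_le_lg G
  have hcard : (U.card : ℝ) ≤ Real.exp G.lg := by
    have h1 : (U.card : ℝ) ≤ Fintype.card V := by exact_mod_cast Finset.card_le_univ U
    have h2 := le_exp_lg G
    have h3 : (0 : ℝ) ≤ G.total Finset.univ := Nat.cast_nonneg _
    linarith
  have h5 : Real.exp (-5) ≤ 1 / 16 := by
    rw [Real.exp_neg, inv_le_comm₀ (Real.exp_pos _) (by norm_num)]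
    have h2 : (2 : ℝ) ≤ Real.exp 1 := by linarith [Real.add_one_le_exp 1]
    have h3 : Real.exp 5 = Real.exp 1 ^ 5 := by rw [← Real.exp_nat_mul]; norm_num
    rw [h3]
    calc ((1 : ℝ) / 16)⁻¹ ≤ 2 ^ 5 := by norm_num
      _ ≤ _ := pow_le_pow_left₀ (by norm_num) h2 5
  calc (U.card : ℝ) * (2 * Real.exp (-(6 * G.lg)))
      ≤ Real.exp G.lg * (2 * Real.exp (-(6 * G.lg))) :=
        mul_le_mul_of_nonneg_right hcard (by positivity)
    _ = 2 * Real.exp (-(5 * G.lg)) := by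
        rw [mul_left_comm, ← Real.exp_add]; congr 2; ring
    _ ≤ 2 * Real.exp (-5) := by gcongr; linarith
    _ ≤ 1 / 8 := by linarith

/-- Simple' is never worse than a random cut in expectation. -/
theorem E_simple'_ge {p : Params} (hp : p.Base) {μ : ℝ} (hμ : 0 < μ) :
    (G.total U : ℝ) / 4 ≤ E (simple' G p μ U) fun L => (G.edges L (U \ L) : ℝ) := by
  refine le_trans ?_ (E_simple_le_E_simple' G U hp μ)
  -- For this `h` the condition on the ratios is vacuous, since a subgraph does not have more than
  -- `h` edges.
  have := E_simple_ge G U hp hμ (g := 0) le_rfl (by norm_num) (h := G.total U) (by positivity)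
    p.gamma hp.gamma_pos.le le_rfl (fun U' hU' hlt => by
      have h1 : (G.total U' : ℝ) ≤ G.total U := by exact_mod_cast G.total_mono U hU'
      have h2 : (0 : ℝ) ≤ G.total U' := Nat.cast_nonneg _
      linarith)
  simpa using this

/-- Simple' improves on a random cut if almost all edges can be cut. -/
theorem E_simple'_gain {p : Params} (hp : p.Base) {μ : ℝ} (hμ : 0 < μ) (hμ1 : μ ≤ 1)
    (hδ : p.delta ≤ μ / 200) (hγ : p.gamma ≤ μ / 400) (χ : V → Bool)
    (hχ : G.uncut χ U ≤ p.gamma * G.total U) :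
    (G.total U : ℝ) / 4 + G.total U / 8000 ≤
      E (simple' G p μ U) fun L => (G.edges L (U \ L) : ℝ) := by
  refine le_trans ?_ (E_simple_le_E_simple' G U hp μ)
  have hm : (0 : ℝ) ≤ G.total U := Nat.cast_nonneg _
  -- The recursion is followed until half of the edges are classified, so that `ε` at most doubles,
  -- to `2γ ≤ μ/200`. The gain is `total/4000` on success, which has probability at least one half.
  have h1 := E_simple_ge G U hp hμ (g := 1 / 1000) (by norm_num) le_rfl (h := G.total U / 4)
    (by positivity) p.gamma hp.gamma_pos.le le_rfl (fun U' hU' hlt ε' hε' hD => by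
      refine soto_sigma_ge hp hε' hμ hμ1 ?_
      have h2 : (0 : ℝ) < G.total U' := by linarith
      have h3 : ε' * G.total U' ≤ 2 * p.gamma * G.total U' := by nlinarith [hp.gamma_pos]
      have h4 := le_of_mul_le_mul_right h3 h2
      linarith)
  have h2 := pr_simpleRec_fails_le G hp hμ hμ1 hδ χ (U.card + 1) U p.gamma (by omega)
    hp.gamma_pos.le hχ
  have h3 := card_mul_exp_le G U
  have e : max ((G.total U : ℝ) / 2 - G.total U / 4) 0 = G.total U / 4 := by
    rw [max_eq_left (by linarith)]; ring
  rw [e] at h1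
  refine le_trans ?_ h1
  have : (1 : ℝ) / 2 ≤
      1 - pr (simpleRec G p μ (U.card + 1) U p.gamma) fun r => r.2 = false := by linarith
  nlinarith

/-! ### Balance -/

instance finitary_balanceRec (p : Params) (n : ℕ) (U : Finset V) :
    Finitary (balanceRec G p n U) := by
  induction n generalizing U with
  | zero => rw [balanceRec]; infer_instance
  | succ n ih =>
    rw [balanceRec]
    split_ifs
    · infer_instance
    · refine @instFinitaryBind _ _ _ _ _ fun P => ?_
      refine @instFinitaryBind _ _ _ _ _ fun o => ?_
      rcases o with _ | S
      · refine @instFinitaryBind _ _ _ _ _ fun o => ?_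
        cases o <;> infer_instance
      · infer_instance

instance (p : Params) : Finitary (balance G p) := by
  unfold balance; infer_instance

theorem ens_cutOrBound (p : Params) (i : V) :
    Ens (cutOrBound G p U i) fun o _ => ∀ S ∈ o, S ⊆ U ∧ S.Nonempty ∧ G.LowConductance U p.phi S := by
  unfold cutOrBound
  refine Ens.bind _ Ens.true fun traces _ _ => ?_
  refine ens_tick_bind (f := fun _ => pure _) (ens_pure.2 fun S hS => ?_)
  have hS' := Option.mem_def.1 hS
  have h1 := List.find?_some hS'
  have h2 := List.mem_of_find?_eq_some hS'
  have h3 : G.LowConductance U p.phi S := by simpa using h1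
  refine ⟨?_, ?_, h3⟩
  · obtain ⟨l, -, h4⟩ := List.mem_flatMap.1 h2
    obtain ⟨k, -, rfl⟩ := List.mem_map.1 h4
    intro j hj
    have h5 := List.mem_of_mem_take (List.mem_toFinset.1 hj)
    unfold sweepOrder at h5
    rw [(List.mergeSort_perm _ _).mem_iff, Finset.mem_toList] at h5
    exact (Finset.mem_filter.1 h5).1
  · rw [Finset.nonempty_iff_ne_empty]
    rintro rfl
    simp [MultiGraph.LowConductance, MultiGraph.vol, MultiGraph.edges] at h3

theorem ens_firstSome {α β : Type} {f : α → RandAlg (Option β)} {Q : β → Prop}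
    (h : ∀ a, Ens (f a) fun o _ => ∀ b ∈ o, Q b) (l : List α) :
    Ens (firstSome f l) fun o _ => ∀ b ∈ o, Q b := by
  induction l with
  | nil => exact ens_pure.2 (by simp)
  | cons a l ih =>
    rw [firstSome]
    refine Ens.bind _ (h a) fun o _ ho => ?_
    rcases o with _ | b
    · exact ih.mono fun _ _ h => h
    · exact ens_pure.2 (by simpa using ho)

theorem ens_balanceRec {p : Params} (hp : p.Good) (n : ℕ) (U : Finset V) :
    Ens (balanceRec G p n U) fun L _ => L ⊆ U := by
  induction n generalizing U with
  | zero => exact ens_pure.2 (by simp)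
  | succ n ih =>
    rw [balanceRec]
    split_ifs with h
    · exact ens_randomCut U
    · refine Ens.bind _ Ens.true fun P _ _ => ?_
      refine Ens.bind _ (ens_firstSome (ens_cutOrBound G U p) P) fun o _ ho => ?_
      rcases o with _ | S
      · refine Ens.bind _ (ens_find G U hp.toBase (Nat.pos_of_ne_zero h)) fun o _ ho => ?_
        rcases o with _ | ⟨A, B⟩
        · exact (ens_randomCut U).mono fun _ _ h => h
        · obtain ⟨hAB, -⟩ := ho (A, B) rfl
          simp only at hAB
          refine Ens.bind (fun L _ => L ⊆ U) (ens_flip A B ?_ ?_) fun L _ hL => ?_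
          · exact Finset.subset_union_left.trans hAB
          · exact Finset.subset_union_right.trans hAB
          · refine ens_tick_bind (f := fun _ => _ >>= _) (Ens.bind _ (ih _) fun r _ hr => ?_)
            exact ens_pure.2 (Finset.union_subset hL (hr.trans Finset.sdiff_subset))
      · have hS := (ho S rfl).1
        refine Ens.bind _ (ens_simple' G S hp.toBase) fun L₀ _ hL₀ => ?_
        refine Ens.bind (fun L _ => L ⊆ U) (ens_flip L₀ (S \ L₀) ?_ ?_) fun L _ hL => ?_
        · exact hL₀.trans hS
        · exact Finset.sdiff_subset.trans hS
        · refine ens_tick_bind (f := fun _ => _ >>= _) (Ens.bind _ (ih _) fun r _ hr => ?_)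
          exact ens_pure.2 (Finset.union_subset hL (hr.trans Finset.sdiff_subset))

end

/-! ### The approximation factor of Balance -/

section
variable {V : Type} [Fintype V] (G : MultiGraph V) (U : Finset V)

/-- A lower bound for the expected size of the cut that Balance finds in `G[U]`. -/
def balanceBound (p : Params) (χ : V → Bool) (U : Finset V) : ℝ :=
  G.total U / 4 + 1 / 12000 * max ((G.total U : ℝ) / 2 - G.total Finset.univ / 4) 0 -
    1 / (8000 * p.gamma) * G.uncut χ U -
    U.card * (2 * Real.exp (-(6 * G.lg)) * (1 / 12000 * (G.total Finset.univ / 2)))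

theorem balanceBound_le {p : Params} (hγ : 0 < p.gamma) (χ : V → Bool) :
    balanceBound G p χ U ≤
      G.total U / 4 + 1 / 12000 * max ((G.total U : ℝ) / 2 - G.total Finset.univ / 4) 0 := by
  unfold balanceBound
  have h1 := G.uncut_nonneg (U := U) χ
  have h2 : 0 ≤ 1 / (8000 * p.gamma) * G.uncut χ U := by positivity
  have h3 : 0 ≤ (U.card : ℝ) *
      (2 * Real.exp (-(6 * G.lg)) * (1 / 12000 * (G.total Finset.univ / 2))) := by positivity
  linarith

/-- Classifying `A ∪ B` with a sufficient gain preserves the bound. -/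
theorem balanceBound_step {p : Params} (hγ : 0 < p.gamma) (χ : V → Bool) {A B : Finset V}
    (h : A ∪ B ⊆ U) (hne : (A ∪ B).Nonempty) {c : ℝ}
    (hc : (1 / 2 + 1 / 12000) * G.inc U A B ≤
      c + 1 / (8000 * p.gamma) * G.uncut χ (A ∪ B)) :
    balanceBound G p χ U + 2 * Real.exp (-(6 * G.lg)) * (1 / 12000 * (G.total Finset.univ / 2)) ≤
      c + balanceBound G p χ (U \ (A ∪ B)) := by
  unfold balanceBound
  have h1 := G.total_eq_add_inc U h
  have h2 := G.uncut_add_le U χ h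
  have hinc := G.inc_nonneg U A B
  have h0 := G.uncut_nonneg (U := A ∪ B) χ
  set U' := U \ (A ∪ B) with hU'
  have hcard : (U'.card : ℝ) + 1 ≤ U.card := by
    have := Finset.card_lt_card (Finset.sdiff_ssubset h hne)
    exact_mod_cast this
  set X := 2 * Real.exp (-(6 * G.lg)) * (1 / 12000 * ((G.total Finset.univ : ℝ) / 2)) with hX
  have hX0 : 0 ≤ X := by positivity
  set K := 1 / (8000 * p.gamma) with hK
  have hK0 : 0 ≤ K := by positivity
  have h3 : K * G.uncut χ (A ∪ B) + K * G.uncut χ U' ≤ K * G.uncut χ U := by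
    rw [← mul_add]; exact mul_le_mul_of_nonneg_left h2 hK0
  -- At least one vertex disappears, which releases one summand `X`, the provision for failure in
  -- the current round.
  have h4 : ((U'.card : ℝ) + 1) * X ≤ U.card * X := mul_le_mul_of_nonneg_right hcard hX0
  have h5 : max ((G.total U : ℝ) / 2 - G.total Finset.univ / 4) 0 ≤
      max ((G.total U' : ℝ) / 2 - G.total Finset.univ / 4) 0 + G.inc U A B := by
    refine max_le ?_ ?_
    · have := le_max_left ((G.total U' : ℝ) / 2 - G.total Finset.univ / 4) 0
      linarith
    · have := le_max_right ((G.total U' : ℝ) / 2 - G.total Finset.univ / 4) 0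
      linarith
  linarith

/-- The boundary is at most `9/20` of the volume, hence at most `9/11` of the total degree inside. A
gain of `total/8000` inside the set is therefore at least `1/12000` of all incident edges. -/
theorem lowConductance_inc {φ : ℝ} (hφ : 2 * φ ≤ 9 / 20) {A B : Finset V} (h : A ∪ B ⊆ U)
    (hlow : G.LowConductance U φ (A ∪ B)) : G.inc U A B ≤ 3 / 2 * G.total (A ∪ B) := by
  unfold MultiGraph.LowConductance at hlow
  set S := A ∪ B with hS
  have h1 : (G.vol U S : ℝ) = G.total S + G.cross U A B := by
    have : G.vol U S = G.edges S U := rfl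
    rw [this, MultiGraph.total_eq_edges, MultiGraph.cross, ← hS]
    conv_lhs => rw [← Finset.union_sdiff_of_subset h]
    rw [G.edges_union_right Finset.disjoint_sdiff]
    push_cast; ring
  have h2 : (G.cross U A B : ℝ) ≤ 9 / 20 * G.vol U S := by
    have h3 : ((2 * min (G.vol U S) (G.vol U (U \ S)) : ℕ) : ℝ) ≤ 2 * G.vol U S := by
      exact_mod_cast Nat.mul_le_mul_left 2 (min_le_left _ _)
    have h4 : (0 : ℝ) ≤ ((2 * min (G.vol U S) (G.vol U (U \ S)) : ℕ) : ℝ) := Nat.cast_nonneg _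
    have h5 : (G.cross U A B : ℝ) = G.edges S (U \ S) := rfl
    rw [h5]
    rcases le_total 0 φ with h6 | h6
    · nlinarith
    · nlinarith
  have h3 : G.inc U A B = (G.total S : ℝ) / 2 + G.cross U A B := rfl
  rw [h3]
  linarith

/-- A potential argument: each kind of round increases the expected value of the final cut by at
least the decrease of `balanceBound`, apart from the failure probability of the round, for which the
bound contains a provision per vertex. -/
theorem E_balanceRec_ge {p : Params} (hp : p.Good) (χ : V → Bool)
    (hχ : 2 * G.uncut χ Finset.univ ≤ p.eps₁ * G.total Finset.univ) (n : ℕ) (U : Finset V)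
    (hn : U.card < n) :
    balanceBound G p χ U ≤ E (balanceRec G p n U) fun L => (G.edges L (U \ L) : ℝ) := by
  have hγ := hp.gamma_pos
  have hφ := phi_bounds hp.toBase hp.tame
  -- The terms of the bound: the value of a random cut; a bonus of `1/12000` of the edges for as
  -- long as more than half of all edges remain; a charge for the edges missed by `χ`, paying for
  -- sets of low conductance on which `χ` is bad; the provision for failures.
  induction n generalizing U with
  | zero => omega
  | succ n ih =>
    rw [balanceRec]
    split_ifs with hc
    · rw [E_randomCut]
      refine (balanceBound_le G U hγ χ).trans ?_
      rw [max_eq_right]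
      · simp
      · rw [hc]
        have : (0 : ℝ) ≤ G.total Finset.univ := Nat.cast_nonneg _
        simp only [Nat.cast_zero, zero_div, zero_sub]; linarith
    · have hU : 0 < G.total U := Nat.pos_of_ne_zero hc
      have hU' : (0 : ℝ) < G.total U := by exact_mod_cast hU
      set e := Real.exp (-(6 * G.lg : ℝ)) with he
      have he0 : 0 ≤ e := (Real.exp_pos _).le
      set X : ℝ := 1 / 12000 * max ((G.total U : ℝ) / 2 - G.total Finset.univ / 4) 0 with hX
      have hX0 : 0 ≤ X := mul_nonneg (by norm_num) (le_max_right _ _)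
      set Y : ℝ := 1 / 12000 * (G.total Finset.univ / 2) with hY
      have hXY : X ≤ Y := by
        refine mul_le_mul_of_nonneg_left (max_le ?_ (by positivity)) (by norm_num)
        have h1 : (G.total U : ℝ) ≤ G.total Finset.univ := by
          exact_mod_cast total_le_total_univ G U
        have : (0 : ℝ) ≤ G.total Finset.univ := Nat.cast_nonneg _
        linarith
      have hB := balanceBound_le G U hγ χ
      have hB' : balanceBound G p χ U + 2 * e * Y ≤ G.total U / 4 + X := by
        unfold balanceBound
        have h1 := G.uncut_nonneg (U := U) χ
        have h2 : 0 ≤ 1 / (8000 * p.gamma) * G.uncut χ U := by positivity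
        have hc1 : (1 : ℝ) ≤ U.card := by
          have : 0 < U.card := by
            rw [Nat.pos_iff_ne_zero, Ne, Finset.card_eq_zero]
            rintro rfl
            simp [MultiGraph.total, MultiGraph.vol] at hc
          exact_mod_cast this
        have h3 : 1 * (2 * e * Y) ≤ U.card * (2 * e * Y) :=
          mul_le_mul_of_nonneg_right hc1 (by positivity)
        rw [← he, ← hX, ← hY]
        linarith
      -- the value of the remaining computation for given starting vertices
      set failP : List V → ℝ := fun P =>
        pr (firstSome (cutOrBound G p U) P) (fun o => o = none) *
          pr (find G p U p.eps₁ p.mu₁ (p.alpha (G.total U)) P) (fun o => o = none) with hfailP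
      have hmain : ∀ P, balanceBound G p χ U + 2 * e * Y - X * failP P ≤
          E (do
            match ← firstSome (cutOrBound G p U) P with
            | some S =>
              let L₀ ← simple' G p p.mu₂ S
              let L ← RandAlg.flip L₀ (S \ L₀)
              tick (scanCost G U S)
              let L' ← balanceRec G p n (U \ S)
              pure (L ∪ L')
            | none =>
              match ← find G p U p.eps₁ p.mu₁ (p.alpha (G.total U)) P with
              | none => randomCut U
              | some (A, B) =>
                let L ← RandAlg.flip A B
                tick (scanCost G U (A ∪ B))
                let L' ← balanceRec G p n (U \ (A ∪ B))
                pure (L ∪ L')) fun L => (G.edges L (U \ L) : ℝ) := by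
        intro P
        rw [E_bind_of inferInstance (by
          rintro (_ | S)
          · refine @instFinitaryBind _ _ _ _ _ fun o => ?_
            cases o <;> infer_instance
          · infer_instance)]
        have hstep : ∀ o : Option (Finset V),
            (∀ S ∈ o, S ⊆ U ∧ S.Nonempty ∧ G.LowConductance U p.phi S) →
            balanceBound G p χ U + (2 : ℝ) * e * Y - X * ((if o = none then (1 : ℝ) else 0) *
              pr (find G p U p.eps₁ p.mu₁ (p.alpha (G.total U)) P) (fun o => o = none)) ≤
            E (match o with
              | some S => do
                let L₀ ← simple' G p p.mu₂ S
                let L ← RandAlg.flip L₀ (S \ L₀)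
                tick (scanCost G U S)
                let L' ← balanceRec G p n (U \ S)
                pure (L ∪ L')
              | none => do
                match ← find G p U p.eps₁ p.mu₁ (p.alpha (G.total U)) P with
                | none => randomCut U
                | some (A, B) =>
                  let L ← RandAlg.flip A B
                  tick (scanCost G U (A ∪ B))
                  let L' ← balanceRec G p n (U \ (A ∪ B))
                  pure (L ∪ L')) fun L => (G.edges L (U \ L) : ℝ) := by
          rintro (_ | S) hS
          · simp only [if_true, one_mul]
            rw [E_bind_of inferInstance (by intro o; cases o <;> infer_instance)]
            have : balanceBound G p χ U + 2 * e * Y - X *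
                pr (find G p U p.eps₁ p.mu₁ (p.alpha (G.total U)) P) (fun o => o = none) =
                E (find G p U p.eps₁ p.mu₁ (p.alpha (G.total U)) P) fun o =>
                  balanceBound G p χ U + 2 * e * Y - X * if o = none then 1 else 0 := by
              rw [E_sub, E_const, E_mul_left]
              unfold pr
              congr!
            rw [this]
            refine E_mono_of_ens ((ens_find G U hp.toBase hU).mono fun o _ ho => ?_)
            rcases o with _ | ⟨A, B⟩
            · simp only [if_true, mul_one, E_randomCut]
              linarith
            · obtain ⟨hAB, hd, hne, hcut⟩ := ho (A, B) rfl
              simp only [reduceCtorEq, if_false, mul_zero, sub_zero] at hAB hd hne hcut ⊢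
              have hcard : (U \ (A ∪ B)).card < U.card :=
                Finset.card_lt_card (Finset.sdiff_ssubset hAB hne)
              have hinc := G.inc_nonneg U A B
              have h1 := balanceBound_step G U hγ χ hAB hne (c := G.cut U A B) (by
                have h2 := mul_le_mul_of_nonneg_right hp.soto_ge hinc
                have h3 := G.uncut_nonneg (U := A ∪ B) χ
                have h4 : 0 ≤ 1 / (8000 * p.gamma) * G.uncut χ (A ∪ B) := by positivity
                linarith)
              refine h1.trans ?_
              rw [flip_bind_E]
              simp only [E_tick_bind]
              simp only [E_bind, E_pure]
              rw [E_avg]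
              rw [E_congr_of_ens ((ens_balanceRec G hp n (U \ (A ∪ B))).mono fun L _ hL =>
                G.avg_cut_union U hd hAB hL), E_add, E_const]
              linarith [ih (U \ (A ∪ B)) (by omega)]
          · obtain ⟨hSU, hne, hlow⟩ := hS S rfl
            simp only [reduceCtorEq, if_false, zero_mul, mul_zero, sub_zero]
            have hcard : (U \ S).card < U.card :=
              Finset.card_lt_card (Finset.sdiff_ssubset hSU hne)
            have hS0 : S ∪ ∅ = S := Finset.union_empty S
            have hle := lowConductance_inc G U hφ.2 (A := S) (B := ∅) (by rwa [hS0])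
              (by rwa [hS0])
            have hinc := G.inc_nonneg U S ∅
            rw [hS0] at hle
            set c : ℝ := E (simple' G p p.mu₂ S) (fun L => (G.edges L (S \ L) : ℝ)) +
              G.cross U S ∅ / 2 with hcdef
            have hinceq : G.inc U S ∅ = G.total S / 2 + G.cross U S ∅ := by
              unfold MultiGraph.inc
              rw [hS0, ← MultiGraph.total_eq_edges]
            have h1 := balanceBound_step G U hγ χ (A := S) (B := ∅) (by rwa [hS0])
              (by rwa [hS0]) (c := c) (by
                rw [hS0]
                have h3 := G.uncut_nonneg (U := S) χ
                have h4 : 0 ≤ 1 / (8000 * p.gamma) * G.uncut χ S := by positivity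
                -- If `χ` is almost perfect inside `S`, Simple' gains `total/8000` there. Otherwise
                -- the edges of `S` that `χ` misses, weighted by `1/(8000 γ)`, account for the same
                -- amount.
                by_cases hu : G.uncut χ S ≤ p.gamma * G.total S
                · have h5 := E_simple'_gain G S hp.toBase hp.mu₂_pos hp.mu₂_le hp.delta_le₂
                    hp.gamma_le₂ χ hu
                  linarith
                · have h5 := E_simple'_ge G S hp.toBase hp.mu₂_pos
                  have h6 : (G.total S : ℝ) / 8000 ≤ 1 / (8000 * p.gamma) * G.uncut χ S := by
                    rw [one_div_mul_eq_div, div_le_div_iff₀ (by norm_num) (by positivity)]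
                    nlinarith
                  linarith)
            refine h1.trans ?_
            rw [hS0, E_bind]
            have h2 : c + balanceBound G p χ (U \ S) ≤ E (simple' G p p.mu₂ S) fun L =>
                (G.edges L (S \ L) : ℝ) + (G.cross U S ∅ / 2 + balanceBound G p χ (U \ S)) := by
              rw [E_add, E_const, hcdef]
              linarith
            refine h2.trans (E_mono_of_ens ((ens_simple' G S hp.toBase).mono fun L₀ _ hL₀ => ?_))
            have hu : L₀ ∪ (S \ L₀) = S := Finset.union_sdiff_of_subset hL₀
            have hd : Disjoint L₀ (S \ L₀) := Finset.disjoint_sdiff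
            rw [flip_bind_E]
            simp only [E_tick_bind]
            simp only [E_bind, E_pure]
            rw [E_avg]
            rw [E_congr_of_ens (g := fun L => G.cut U L₀ (S \ L₀) +
              (G.edges L ((U \ S) \ L) : ℝ)) ((ens_balanceRec G hp n (U \ S)).mono fun L _ hL => by
                have := G.avg_cut_union U hd (by rwa [hu]) (L := L) (by rwa [hu])
                rwa [hu] at this), E_add, E_const]
            have hcut : G.cut U L₀ (S \ L₀) = G.edges L₀ (S \ L₀) + G.cross U S ∅ / 2 := by
              unfold MultiGraph.cut MultiGraph.cross
              rw [hu, hS0]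
            rw [hcut]
            linarith [ih (U \ S) (by omega)]
        refine le_trans ?_ (E_mono_of_ens ((ens_firstSome (ens_cutOrBound G U p) P).mono
          fun o _ ho => hstep o ho))
        rw [E_sub, E_const, E_mul_left, E_mul_right]
        refine le_of_eq ?_
        simp only [hfailP]
        congr 3
        unfold pr
        congr!
      rw [E_bind_of inferInstance (by
        intro P; refine @instFinitaryBind _ _ _ _ _ fun o => ?_
        rcases o with _ | S
        · refine @instFinitaryBind _ _ _ _ _ fun o => ?_
          cases o <;> infer_instance
        · infer_instance)]
      refine le_trans ?_ (E_mono _ hmain)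
      rw [E_sub, E_const, E_mul_left]
      suffices h : X * E (startVertices G p U) failP ≤ 2 * e * Y by linarith
      -- With at most half of the edges left there is no bonus to lose, so failure does no harm.
      -- Otherwise `χ` misses at most a fraction `ε₁` of the edges of `G[U]`, and good starting
      -- vertices exist.
      rcases le_or_gt ((G.total U : ℝ) / 2 - G.total Finset.univ / 4) 0 with hsmall | hbig
      · rw [hX, max_eq_right hsmall, mul_zero, zero_mul]
        positivity
      have hχU : G.uncut χ U ≤ p.eps₁ * G.total U := by
        have h1 := G.uncut_mono Finset.univ χ (Finset.subset_univ U)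
        nlinarith [hp.eps₁_pos]
      have hstart := pr_startVertices_le G U hp.toBase hp.tame χ hχU hU
      have hfail : E (startVertices G p U) failP ≤ 2 * e := by
        refine (E_mono _ (g := fun P => (if ∀ i ∈ P, ¬GoodStart G U p p.eps₁ p.mu₁ i then 1 else 0)
          + e) fun P => ?_).trans ?_
        · have a0 := pr_nonneg (firstSome (cutOrBound G p U) P) (fun o => o = none)
          have a1 := pr_le_one (firstSome (cutOrBound G p U) P) (fun o => o = none)
          have b0 := pr_nonneg (find G p U p.eps₁ p.mu₁ (p.alpha (G.total U)) P)
            (fun o => o = none)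
          have b1 := pr_le_one (find G p U p.eps₁ p.mu₁ (p.alpha (G.total U)) P)
            (fun o => o = none)
          by_cases hP : ∀ i ∈ P, ¬GoodStart G U p p.eps₁ p.mu₁ i
          · rw [if_pos hP]
            have : failP P ≤ 1 := mul_le_one₀ a1 b0 b1
            linarith
          · rw [if_neg hP, zero_add]
            push Not at hP
            obtain ⟨i, hiP, hi⟩ := hP
            -- The dichotomy of the algorithm: either the walk from the good vertex spreads and Find
            -- succeeds, or CutOrBound finds a set.
            by_cases hdens : ∀ j ∈ U, walkDensity G U 1 (p.len (G.total U) p.eps₁ p.mu₁) i j ≤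
                6 * p.alpha (G.total U)
            · have h1 := pr_find_none_le G U hp.toBase hp.tame hi hU
                (Real.rpow_pos_of_pos hU' _) hdens hiP
              exact (mul_le_of_le_one_left b0 a1).trans h1
            · have h1 := pr_cutOrBound_none_le G U hp.toBase hp.tame hi.1 hi.2.1.ne' hU hdens
              have h2 := pr_firstSome_none_le (f := cutOrBound G p U)
                (by intro; infer_instance) hiP
              exact (mul_le_of_le_one_right a0 b1).trans (h2.trans h1)
        · rw [E_add, E_const]
          have : E (startVertices G p U)
              (fun P => if ∀ i ∈ P, ¬GoodStart G U p p.eps₁ p.mu₁ i then 1 else 0) ≤ e := by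
            refine le_trans (le_of_eq ?_) hstart
            unfold pr
            congr!
          linarith
      calc X * E (startVertices G p U) failP ≤ X * (2 * e) := mul_le_mul_of_nonneg_left hfail hX0
        _ ≤ Y * (2 * e) := mul_le_mul_of_nonneg_right hXY (by positivity)
        _ = 2 * e * Y := by ring

/-- Let `T` be twice the number of edges. If the optimum is less than a fraction `1 - γ/12` of the
edges, the random cut exceeds half of it by a constant factor. Otherwise the optimal cut serves as
`χ`, and the bonus `T/48000` exceeds the charge, at most `T/96000`, plus the provision for failures,
at most `T/192000`. -/
theorem E_balance_ge {p : Params} (hp : p.Good) :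
    (1 / 2 + p.gamma / 1000) * G.toWGraph.maxCut ≤
      E (balance G p) fun L => (G.edges L Lᶜ : ℝ) := by
  have hγ := hp.gamma_pos
  have hγ1 := hp.gamma_le
  have hcutW : ∀ L, G.toWGraph.cutWeight L = G.edges L Lᶜ := by
    intro L
    simp [WGraph.cutWeight, MultiGraph.toWGraph, MultiGraph.edges]
  obtain ⟨L, -, hL⟩ := Finset.exists_mem_eq_sup' (s := (Finset.univ : Finset (Finset V)))
    ⟨∅, Finset.mem_univ _⟩ G.toWGraph.cutWeight
  have hmax : G.toWGraph.maxCut = G.edges L Lᶜ := by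
    unfold WGraph.maxCut; rw [hL, hcutW]
  have hLc : ∀ L : Finset V, Finset.univ \ L = Lᶜ := fun L => (Finset.compl_eq_univ_sdiff L).symm
  set M : ℝ := (G.edges L Lᶜ : ℝ) with hM
  have hM0 : 0 ≤ M := Nat.cast_nonneg _
  set T : ℝ := (G.total Finset.univ : ℝ) with hT
  set χ : V → Bool := fun v => decide (v ∈ L) with hχdef
  have huncut : G.uncut χ Finset.univ = T - 2 * M := by
    have h1 := G.cast_edges Finset.univ (Finset.subset_univ L) (Finset.subset_univ Lᶜ)
    have h2 := G.cast_edges Finset.univ (Finset.subset_univ Lᶜ) (Finset.subset_univ L)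
    rw [G.edges_comm Lᶜ L] at h2
    have h3 := G.sum_mult_eq_total Finset.univ
    have : G.uncut χ Finset.univ + (M + M) = T := by
      nth_rewrite 1 [hM]
      rw [h1, hM, h2, hT, ← h3]
      unfold MultiGraph.uncut
      simp only [← Finset.sum_add_distrib]
      refine Finset.sum_congr rfl fun j _ => Finset.sum_congr rfl fun k _ => ?_
      by_cases hj : j ∈ L <;> by_cases hk : k ∈ L <;> simp [χ, MultiGraph.ind, hj, hk]
    linarith
  have hge1 : E (balanceRec G p (Fintype.card V + 1) Finset.univ)
      (fun L => (G.edges L Lᶜ : ℝ)) ≤ E (balance G p) fun L => (G.edges L Lᶜ : ℝ) := by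
    unfold balance
    simp only [E_bind, E_pure, E_const]
    refine E_mono _ fun L => le_E_of_ens (Ens.true.mono fun L₀ _ _ => ?_)
    split_ifs with h
    · exact le_rfl
    · exact_mod_cast (not_le.1 h).le
  have hge2 : T / 4 ≤ E (balance G p) fun L => (G.edges L Lᶜ : ℝ) := by
    unfold balance
    simp only [E_bind, E_pure, E_const]
    refine le_E_of_ens (Ens.true.mono fun L _ _ => ?_)
    rw [hT, ← E_randomCut]
    simp only [hLc]
    refine E_mono _ fun L₀ => ?_
    split_ifs with h
    · exact_mod_cast h
    · exact le_rfl
  rw [hmax]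
  by_cases hsmall : 2 * M < (1 - p.gamma / 12) * T
  · refine le_trans ?_ hge2
    have hT0 : 0 ≤ T := Nat.cast_nonneg _
    have h1 : (1 + p.gamma / 500) * (2 * M) ≤ (1 + p.gamma / 500) * ((1 - p.gamma / 12) * T) :=
      mul_le_mul_of_nonneg_left hsmall.le (by linarith)
    have h2 : (1 + p.gamma / 500) * (1 - p.gamma / 12) ≤ 1 := by nlinarith
    have h3 := mul_le_mul_of_nonneg_right h2 hT0
    linarith
  · rw [not_lt] at hsmall
    have h1 := E_balanceRec_ge G hp χ (by
      rw [huncut]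
      have := hp.gamma_le₁
      have hT0 : 0 ≤ T := Nat.cast_nonneg _
      nlinarith) (Fintype.card V + 1) Finset.univ (by rw [Finset.card_univ]; omega)
    simp only [hLc] at h1
    refine le_trans ?_ (h1.trans hge1)
    unfold balanceBound
    rw [huncut, ← hT]
    have hT0 : 0 ≤ T := Nat.cast_nonneg _
    have h2 := card_mul_exp_le G (Finset.univ : Finset V)
    rw [max_eq_left (by linarith)]
    have h3 : 1 / (8000 * p.gamma) * (T - 2 * M) ≤ T / 96000 := by
      rw [one_div_mul_eq_div, div_le_iff₀ (by positivity)]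
      nlinarith
    have h4 : (Finset.univ : Finset V).card * (2 * Real.exp (-(6 * G.lg)) * (1 / 12000 * (T / 2))) ≤
        1 / 8 * (1 / 12000 * (T / 2)) := by
      rw [← mul_assoc]
      exact mul_le_mul_of_nonneg_right h2 (by positivity)
    have h5 : 2 * M ≤ T := by linarith [G.uncut_nonneg (U := Finset.univ) χ]
    nlinarith

end

/-! ### Running times, up to powers of a common scale -/

/-- A number that bounds the constants, the maximum degree and the logarithm of the size. -/
structure Scale {V : Type} [Fintype V] (G : MultiGraph V) (p : Params) (Λ : ℝ) : Prop where
  ten_le : 10 ≤ Λ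
  lg_le : (G.lg : ℝ) ≤ Λ
  deg_le : (G.maxDeg : ℝ) ≤ Λ
  walk_le : p.walkConst ≤ Λ
  start_le : p.startConst ≤ Λ
  delta_le : 4 / p.delta ^ 3 ≤ Λ
  gamma_le : 2 / p.gamma ^ 2 ≤ Λ
  size_le : 1 / p.sizeConst ≤ Λ

theorem ten_mul_pow_le {Λ : ℝ} (h : 10 ≤ Λ) (i : ℕ) : 10 * Λ ^ i ≤ Λ ^ (i + 1) := by
  rw [pow_succ, mul_comm]
  exact mul_le_mul_of_nonneg_left h (by positivity)

theorem ens_collect_cost {α β : Type} {f : α → RandAlg β} {c : ℝ} {l : List α}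
    (h : ∀ a ∈ l, Ens (f a) fun _ k => (k : ℝ) ≤ c) :
    Ens (collect f l) fun _ k => (k : ℝ) ≤ l.length * c := by
  induction l with
  | nil => exact ens_pure.2 (by simp)
  | cons a l ih =>
    refine Ens.bind _ (h a (by simp)) fun b k hk => ?_
    refine Ens.bind _ (ih fun a' ha' => h a' (by simp [ha'])) fun bs j hj => ens_pure.2 ?_
    push_cast [List.length_cons]
    linarith

theorem ens_repeated_cost {α : Type} {x : RandAlg α} {c : ℝ} (w : ℕ)
    (h : Ens x fun _ k => (k : ℝ) ≤ c) : Ens (repeated w x) fun _ k => (k : ℝ) ≤ w * c := by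
  have := ens_collect_cost (f := fun _ : ℕ => x) (l := List.range w) fun _ _ => h
  rwa [List.length_range] at this

theorem ens_firstSome_cost {α β : Type} {f : α → RandAlg (Option β)} {c : ℝ} (hc : 0 ≤ c)
    (h : ∀ a, Ens (f a) fun _ k => (k : ℝ) ≤ c) (l : List α) :
    Ens (firstSome f l) fun _ k => (k : ℝ) ≤ l.length * c := by
  induction l with
  | nil => exact ens_pure.2 (by simp)
  | cons a l ih =>
    rw [firstSome]
    refine Ens.bind _ (h a) fun o k hk => ?_
    have e : ((a :: l).length : ℝ) * c = c + l.length * c := by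
      push_cast [List.length_cons]; ring
    rw [e]
    rcases o with _ | b
    · exact ih.mono fun _ j hj => by push_cast; linarith
    · refine ens_pure.2 ?_
      rw [add_zero]
      have : (0 : ℝ) ≤ l.length * c := by positivity
      linarith

section
variable {V : Type} [Fintype V] (G : MultiGraph V) (U : Finset V)

theorem ens_randomVertex_cost : Ens (randomVertex G U) fun _ k => (k : ℝ) ≤ G.lg + 1 :=
  ens_tick_bind (f := fun _ => choose _) (ens_choose.2 fun _ _ => by push_cast; exact le_rfl)

theorem ens_startVertices_cost {p : Params} {Λ : ℝ} (hΛ : Scale G p Λ) :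
    Ens (startVertices G p U) fun P k => (k : ℝ) ≤ Λ ^ 5 ∧ (P.length : ℝ) ≤ Λ ^ 3 := by
  have h10 := hΛ.ten_le
  have hlg : (1 : ℝ) ≤ G.lg := by exact_mod_cast one_le_lg G
  have hs : ((⌈p.startConst * G.lg⌉₊ : ℕ) : ℝ) ≤ Λ ^ 3 := by
    rcases le_or_gt (p.startConst * G.lg) 0 with h | h
    · rw [Nat.ceil_eq_zero.2 h]; simp; positivity
    · refine (Nat.ceil_lt_add_one h.le).le.trans ?_
      have h1 : p.startConst * G.lg ≤ Λ * Λ := by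
        refine mul_le_mul hΛ.start_le hΛ.lg_le (by positivity) (by linarith)
      nlinarith [ten_mul_pow_le h10 2]
  unfold startVertices
  refine Ens.bind _ ((ens_repeated_cost _ (ens_randomVertex_cost G U)).and
    (ens_repeated_length _ _)) fun l k hk => ens_pure.2 ⟨?_, ?_⟩
  · push_cast
    refine (add_zero (k : ℝ)).le.trans (hk.1.trans ?_)
    calc ((⌈p.startConst * G.lg⌉₊ : ℕ) : ℝ) * (G.lg + 1) ≤ Λ ^ 3 * Λ ^ 2 := by
          refine mul_le_mul hs ?_ (by positivity) (by positivity)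
          nlinarith [hΛ.lg_le]
      _ = Λ ^ 5 := by ring
  · refine le_trans ?_ hs
    rw [← hk.2]
    exact_mod_cast List.reduceOption_length_le l

theorem ens_step_cost (s : V × Bool) : Ens (step G U s) fun _ k => (k : ℝ) ≤ 2 := by
  unfold step
  refine Ens.bind (fun _ k => k = 1) (ens_choose.2 fun _ _ => rfl) ?_
  rintro c _ rfl
  cases c
  · exact ens_pure.2 (by norm_num)
  · refine Ens.bind (fun _ k => k = 1) (ens_choose.2 fun _ _ => rfl) ?_
    rintro (_ | k) _ rfl
    · exact ens_pure.2 (by norm_num)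
    · exact ens_pure.2 (by norm_num)

theorem ens_walk_cost (l : ℕ) (s : V × Bool) :
    Ens (walk G U l s) fun _ k => (k : ℝ) ≤ 2 * l := by
  induction l generalizing s with
  | zero => exact ens_pure.2 (by simp)
  | succ l ih =>
    refine Ens.bind _ (ens_step_cost G U s) fun s' k hk => ?_
    refine Ens.bind _ (ih s') fun r j hj => ens_pure.2 ?_
    push_cast
    linarith

theorem ens_randomCut_cost : Ens (randomCut U) fun _ k => (k : ℝ) ≤ U.card + 1 :=
  ens_tick_bind (f := fun _ => choose _) (ens_choose.2 fun _ _ => by push_cast; exact le_rfl)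

theorem deg_le_maxDeg (j : V) : G.deg U j ≤ G.maxDeg :=
  (Finset.sum_le_sum_of_subset (Finset.subset_univ U)).trans
    (Finset.le_sup (f := G.deg Finset.univ) (Finset.mem_univ j))

theorem vol_le_card {p : Params} {Λ : ℝ} (hΛ : Scale G p Λ) (S : Finset V) :
    (G.vol U S : ℝ) ≤ Λ * S.card := by
  rw [MultiGraph.cast_vol, mul_comm, ← nsmul_eq_mul]
  refine Finset.sum_le_card_nsmul _ _ _ fun j _ => le_trans ?_ hΛ.deg_le
  exact_mod_cast deg_le_maxDeg G U j

theorem scanCost_le {p : Params} {Λ : ℝ} (hΛ : Scale G p Λ) (S : Finset V) {x : ℝ}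
    (hx : 1 ≤ x) (hS : (S.card : ℝ) ≤ x) : (scanCost G U S : ℝ) ≤ Λ ^ 3 * x := by
  have h10 := hΛ.ten_le
  have h1 := vol_le_card G U hΛ S
  have h2 := hΛ.lg_le
  unfold scanCost
  push_cast
  have h3 : (G.vol U S + S.card + 1 : ℝ) ≤ Λ ^ 2 * x := by
    have : Λ * S.card ≤ Λ * x := mul_le_mul_of_nonneg_left hS (by linarith)
    have h4 : 10 * (Λ * x) ≤ Λ * (Λ * x) := mul_le_mul_of_nonneg_right h10 (by positivity)
    nlinarith
  calc (G.lg : ℝ) * (G.vol U S + S.card + 1) ≤ Λ * (Λ ^ 2 * x) :=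
        mul_le_mul h2 h3 (by positivity) (by linarith)
    _ = Λ ^ 3 * x := by ring

/-- A threshold search classifies at most as many vertices as it makes walks. -/
theorem ens_threshold_cost {p : Params} {ε μ α t : ℝ} (ht : 0 < t) (i : V)
    (c : Finset V × Finset V) :
    Ens (threshold G p U ε μ α i t c) fun c' k =>
      (k : ℝ) ≤ ⌈p.walkConst * G.lg * max α t / t ^ 2⌉₊ *
        (2 * p.len (G.total U) ε μ + G.lg) ∧
      (c'.1 ∪ c'.2).card ≤ (c.1 ∪ c.2).card + ⌈p.walkConst * G.lg * max α t / t ^ 2⌉₊ := by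
  unfold threshold
  set w := ⌈p.walkConst * G.lg * max α t / t ^ 2⌉₊
  refine Ens.bind _ ((ens_repeated_cost w (ens_walk_cost G U _ (i, false))).and
    (ens_repeated_length _ w)) fun traces k hk => ?_
  refine ens_tick_bind (f := fun _ => pure _) (ens_pure.2 ⟨?_, ?_⟩)
  · push_cast
    linarith [hk.1]
  · set ends := traces.map fun T => T.getLastD (i, false) with hends
    have hsub : (c.1 ∪ (U \ (c.1 ∪ c.2)).filter (fun j => t < estimate G U ends j)) ∪
        (c.2 ∪ (U \ (c.1 ∪ c.2)).filter (fun j => estimate G U ends j < -t)) ⊆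
        (c.1 ∪ c.2) ∪ (ends.map Prod.fst).toFinset := by
      -- A vertex at which no walk ends has estimate zero and is not classified, so the newly
      -- classified vertices are among the endpoints.
      have hz : ∀ j, j ∉ (ends.map Prod.fst).toFinset → estimate G U ends j = 0 := by
        intro j hj
        rw [List.mem_toFinset, List.mem_map] at hj
        have h0 : ∀ b, (ends.countP fun s => s = (j, b)) = 0 := by
          intro b
          rw [List.countP_eq_zero]
          intro s hs h
          exact hj ⟨s, hs, by rw [of_decide_eq_true h]⟩
        simp [estimate, h0]
      intro j hj
      by_contra hn
      rw [Finset.mem_union, not_or] at hn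
      have h0 := hz j hn.2
      have h1 := hn.1
      simp only [Finset.mem_union, Finset.mem_filter, h0, not_or] at hj h1
      rcases hj with (hj | hj) | (hj | hj)
      · exact h1.1 hj
      · linarith [hj.2]
      · exact h1.2 hj
      · linarith [hj.2]
    refine (Finset.card_le_card hsub).trans ((Finset.card_union_le _ _).trans ?_)
    refine Nat.add_le_add_left ((List.toFinset_card_le _).trans ?_) _
    rw [List.length_map, hends, List.length_map, hk.2]

/-- The cost of a threshold search, up to powers of the scale. -/
def thresholdWork (α t : ℝ) : ℝ := α / t ^ 2 + 1 / t

theorem thresholdWork_anti {α s t : ℝ} (hα : 0 ≤ α) (hs : 0 < s) (hst : s ≤ t) :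
    thresholdWork α t ≤ thresholdWork α s := by
  unfold thresholdWork
  gcongr

theorem one_le_thresholdWork {α t : ℝ} (hα : 0 ≤ α) (ht : 0 < t) (ht1 : t ≤ 1) :
    1 ≤ thresholdWork α t := by
  unfold thresholdWork
  have h1 : 1 ≤ 1 / t := by rw [le_div_iff₀ ht]; linarith
  have h2 : 0 ≤ α / t ^ 2 := by positivity
  linarith

theorem numWalks_le {p : Params} {Λ : ℝ} (hΛ : Scale G p Λ) (hw : 0 ≤ p.walkConst) {α t : ℝ}
    (hα : 0 ≤ α) (ht : 0 < t) (ht1 : t ≤ 1) :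
    ((⌈p.walkConst * G.lg * max α t / t ^ 2⌉₊ : ℕ) : ℝ) ≤ Λ ^ 3 * thresholdWork α t := by
  have h10 := hΛ.ten_le
  have h1 := one_le_thresholdWork hα ht ht1
  have hm : 0 ≤ max α t := hα.trans (le_max_left _ _)
  refine (Nat.ceil_lt_add_one (by positivity)).le.trans ?_
  have h2 : p.walkConst * G.lg ≤ Λ * Λ :=
    mul_le_mul hΛ.walk_le hΛ.lg_le (by positivity) (by linarith)
  have h3 : max α t / t ^ 2 ≤ thresholdWork α t := by
    unfold thresholdWork
    have : 1 / t = t / t ^ 2 := by field_simp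
    rw [this, ← add_div]
    exact div_le_div_of_nonneg_right (max_le (by linarith) (by linarith)) (by positivity)
  have h4 : p.walkConst * G.lg * max α t / t ^ 2 ≤ Λ * Λ * thresholdWork α t := by
    rw [mul_div_assoc]
    exact mul_le_mul h2 h3 (by positivity) (by positivity)
  have h5 : 10 * (Λ * Λ * thresholdWork α t) ≤ Λ * (Λ * Λ * thresholdWork α t) :=
    mul_le_mul_of_nonneg_right h10 (by positivity)
  have h6 : 1 * 1 ≤ Λ * Λ * thresholdWork α t :=
    mul_le_mul (by nlinarith) h1 (by norm_num) (by positivity)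
  nlinarith

/-- The cost of the parallel runs of Find. -/
theorem ens_findRuns_cost {p : Params} (hp : p.Base) {Λ : ℝ} (hΛ : Scale G p Λ) {ε μ α : ℝ}
    (hα : 0 ≤ α) {R : ℕ} (hR : (R + 1 : ℝ) ≤ Λ ^ 2)
    (hl : (p.len (G.total U) ε μ : ℝ) ≤ Λ ^ 2) (n r : ℕ) (hn : r + n = R + 1)
    (runs : List (V × Finset V × Finset V)) (hlen : (runs.length : ℝ) ≤ Λ ^ 3)
    (hruns : ∀ s ∈ runs, ((s.2.1 ∪ s.2.2).card : ℝ) ≤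
      r * (Λ ^ 3 * thresholdWork α ((1 - p.gamma) ^ r))) :
    Ens (findRuns G p U ε μ α ((List.range' r n).map fun r => (1 - p.gamma) ^ r) runs)
      fun o k => (o = none → (k : ℝ) ≤ n * (Λ ^ 12 * thresholdWork α ((1 - p.gamma) ^ R))) ∧
        ∀ c ∈ o, ∃ r', (r' ≤ R ∧ r ≤ r') ∧ Accepts G p U ε μ ((1 - p.gamma) ^ r') c ∧
          (k : ℝ) ≤ n * (Λ ^ 12 * thresholdWork α ((1 - p.gamma) ^ r')) := by
  have h10 := hΛ.ten_le
  have hγ := hp.gamma_pos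
  have hγ1 := hp.gamma_le
  have hpos : ∀ r : ℕ, 0 < (1 - p.gamma) ^ r := fun r => pow_pos (by linarith) r
  have hle1 : ∀ r : ℕ, (1 - p.gamma) ^ r ≤ 1 := fun r => pow_le_one₀ (by linarith) (by linarith)
  have hmono : ∀ a b : ℕ, a ≤ b → thresholdWork α ((1 - p.gamma) ^ a) ≤
      thresholdWork α ((1 - p.gamma) ^ b) := fun a b hab =>
    thresholdWork_anti hα (hpos b) (pow_le_pow_of_le_one (by linarith) (by linarith) hab)
  have hwc : 0 ≤ p.walkConst :=
    le_trans (by have := hp.delta_pos; positivity) hp.walkConst_ge'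
  -- The work per threshold increases as the threshold decreases, so each of the remaining
  -- thresholds is charged with the work at the last one that is visited.
  induction n generalizing r runs with
  | zero =>
    exact ens_pure.2 ⟨fun _ => by simp, by simp⟩
  | succ n ih =>
    rw [List.range'_succ, List.map_cons, findRuns]
    set t := (1 - p.gamma) ^ r with ht
    set W := thresholdWork α t with hW
    have hW1 : 1 ≤ W := one_le_thresholdWork hα (hpos r) (hle1 r)
    set w := ⌈p.walkConst * G.lg * max α t / t ^ 2⌉₊ with hw
    have hwW : (w : ℝ) ≤ Λ ^ 3 * W := numWalks_le G hΛ hwc hα (hpos r) (hle1 r)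
    have hrR : (r + 1 : ℝ) ≤ Λ ^ 2 := by
      refine le_trans ?_ hR
      have : r ≤ R := by omega
      exact_mod_cast Nat.succ_le_succ this
    have hrun : ∀ s ∈ runs, Ens (do
        let c ← threshold G p U ε μ α s.1 t s.2
        tick (scanCost G U (c.1 ∪ c.2))
        pure (s.1, c)) fun s' k => (k : ℝ) ≤ Λ ^ 9 * W ∧
          ((s'.2.1 ∪ s'.2.2).card : ℝ) ≤ (r + 1) * (Λ ^ 3 * W) := by
      intro s hs
      refine Ens.bind _ (ens_threshold_cost G U (hpos r) s.1 s.2) fun c k hk => ?_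
      refine ens_tick_bind (f := fun _ => pure _) (ens_pure.2 ?_)
      have hcard : ((c.1 ∪ c.2).card : ℝ) ≤ (r + 1) * (Λ ^ 3 * W) := by
        have h1 : ((c.1 ∪ c.2).card : ℝ) ≤ (s.2.1 ∪ s.2.2).card + w := by exact_mod_cast hk.2
        have h2 := hruns s hs
        linarith
      refine ⟨?_, hcard⟩
      have h2 : ((c.1 ∪ c.2).card : ℝ) ≤ Λ ^ 2 * (Λ ^ 3 * W) :=
        hcard.trans (mul_le_mul_of_nonneg_right hrR (by positivity))
      have h3 := scanCost_le G U hΛ (c.1 ∪ c.2) (x := Λ ^ 2 * (Λ ^ 3 * W)) (by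
        have : 1 ≤ Λ ^ 2 * Λ ^ 3 := by
          rw [← pow_add]; exact one_le_pow₀ (by linarith)
        nlinarith) h2
      have h4 : (k : ℝ) ≤ Λ ^ 3 * W * Λ ^ 4 := by
        refine hk.1.trans (mul_le_mul hwW ?_ (by positivity) (by positivity))
        have := ten_mul_pow_le h10 2
        have h5 := ten_mul_pow_le h10 3
        have h6 := hΛ.lg_le
        nlinarith
      have h7 : 10 * (Λ ^ 7 * W) ≤ Λ ^ 8 * W := by
        rw [← mul_assoc]; exact mul_le_mul_of_nonneg_right (ten_mul_pow_le h10 7) (by linarith)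
      have e1 : Λ ^ 3 * W * Λ ^ 4 = Λ ^ 7 * W := by ring
      have e2 : Λ ^ 3 * (Λ ^ 2 * (Λ ^ 3 * W)) = Λ ^ 8 * W := by ring
      push_cast
      rw [e1] at h4
      rw [e2] at h3
      have h8 : 10 * (Λ ^ 8 * W) ≤ Λ ^ 9 * W := by
        rw [← mul_assoc]; exact mul_le_mul_of_nonneg_right (ten_mul_pow_le h10 8) (by linarith)
      have h9 : 0 ≤ Λ ^ 7 * W := by positivity
      linarith
    refine Ens.bind _ ((ens_collect_cost fun s hs => (hrun s hs).mono fun _ _ h => h.1).and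
      ((ens_collect_length _ runs).and (ens_collect_forall (P := fun _ s' =>
        ((s'.2.1 ∪ s'.2.2).card : ℝ) ≤ (r + 1) * (Λ ^ 3 * W)) fun s hs =>
          (hrun s hs).mono fun _ _ h => h.2))) fun runs' k hk => ?_
    obtain ⟨hk1, hk2, hk3⟩ := hk
    have hk4 : (k : ℝ) ≤ Λ ^ 12 * W := by
      refine hk1.trans ?_
      calc (runs.length : ℝ) * (Λ ^ 9 * W) ≤ Λ ^ 3 * (Λ ^ 9 * W) :=
            mul_le_mul_of_nonneg_right hlen (by positivity)
        _ = Λ ^ 12 * W := by ring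
    have hrest : 0 ≤ (n : ℝ) * (Λ ^ 12 * W) := by positivity
    rcases hfind : runs'.find? (fun s => decide (Accepts G p U ε μ t s.2)) with _ | s
    · simp only [hfind]
      have hnext := ih (r + 1) (by omega) runs' (by rw [hk2]; exact hlen) (by
        intro s hs
        obtain ⟨_, _, h⟩ := hk3 s hs
        refine h.trans ?_
        push_cast
        refine mul_le_mul_of_nonneg_left (mul_le_mul_of_nonneg_left (hmono r (r + 1) (by omega))
          (by positivity)) (by positivity))
      refine hnext.mono fun o j hj => ⟨fun ho => ?_, fun c hc => ?_⟩
      · have h1 := hj.1 ho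
        have h2 : Λ ^ 12 * W ≤ Λ ^ 12 * thresholdWork α ((1 - p.gamma) ^ R) :=
          mul_le_mul_of_nonneg_left (hmono r R (by omega)) (by positivity)
        push_cast
        linarith
      · obtain ⟨r', hr', hacc, h1⟩ := hj.2 c hc
        refine ⟨r', ⟨hr'.1, by omega⟩, hacc, ?_⟩
        have h2 : Λ ^ 12 * W ≤ Λ ^ 12 * thresholdWork α ((1 - p.gamma) ^ r') :=
          mul_le_mul_of_nonneg_left (hmono r r' (by omega)) (by positivity)
        push_cast
        linarith
    · simp only [hfind]
      refine ens_pure.2 ⟨by simp, fun c hc => ⟨r, ⟨by omega, le_rfl⟩, ?_, ?_⟩⟩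
      · obtain rfl : s.2 = c := by simpa using hc
        simpa using List.find?_some hfind
      · push_cast
        linarith

theorem le_pow_lastThreshold {p : Params} (hp : p.Base) {m : ℕ} (hm : 0 < m) (μ : ℝ)
    (hμ : 0 ≤ μ) :
    p.gamma / (m : ℝ) ^ (1 + μ / 2) ≤ (1 - p.gamma) ^ lastThreshold p m μ := by
  have hγ := hp.gamma_pos
  have hγ1 := hp.gamma_le
  have hm1 : (1 : ℝ) ≤ m := by exact_mod_cast hm
  have hx : 1 ≤ (m : ℝ) ^ (1 + μ / 2) := Real.one_le_rpow hm1 (by linarith)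
  have hL : 0 < -Real.log (1 - p.gamma) := lt_of_lt_of_le hγ (neg_log_ge (by linarith))
  have hfloor : (lastThreshold p m μ : ℝ) ≤
      Real.log ((m : ℝ) ^ (1 + μ / 2) / p.gamma) / -Real.log (1 - p.gamma) := by
    refine Nat.floor_le (div_nonneg (Real.log_nonneg ?_) hL.le)
    rw [le_div_iff₀ hγ]; linarith
  rw [le_div_iff₀ hL] at hfloor
  rw [← Real.log_le_log_iff (by positivity) (pow_pos (by linarith) _), Real.log_pow, ← inv_div,
    Real.log_inv]
  linarith

/-- The cost of Find, in terms of the number of vertices that it classifies. -/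
theorem ens_find_cost {p : Params} (hp : p.Base) {Λ : ℝ} (hΛ : Scale G p Λ) {ε μ α : ℝ}
    (ht : p.Tame ε μ) (hα : 0 < α) (hU : 0 < G.total U) {P : List V}
    (hP : (P.length : ℝ) ≤ Λ ^ 3) :
    Ens (find G p U ε μ α P) fun o k =>
      (o = none → (k : ℝ) ≤ Λ ^ 15 *
        (α * (G.total U : ℝ) ^ (2 + μ) + (G.total U : ℝ) ^ (1 + μ / 2))) ∧
      ∀ c ∈ o, (k : ℝ) ≤ Λ ^ 18 * (((c.1 ∪ c.2).card : ℝ) *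
        (α * (G.total U : ℝ) ^ (1 + μ) + 1 / α)) := by
  have h10 := hΛ.ten_le
  have hm : (0 : ℝ) < G.total U := by exact_mod_cast hU
  have hγ := hp.gamma_pos
  have hγ1 := hp.gamma_le
  have hpos : ∀ r : ℕ, 0 < (1 - p.gamma) ^ r := fun r => pow_pos (by linarith) r
  have hlg : (1 : ℝ) ≤ G.lg := by exact_mod_cast one_le_lg G
  set R := lastThreshold p (G.total U) μ with hRdef
  have hR : (R + 1 : ℝ) ≤ Λ ^ 2 := by
    refine (lastThreshold_le G U hp ht.mu_pos ht.mu_le hU).trans ?_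
    rw [pow_two Λ]
    exact mul_le_mul hΛ.gamma_le hΛ.lg_le (by positivity) (by linarith)
  have hl : (p.len (G.total U) ε μ : ℝ) ≤ Λ ^ 2 := by
    refine (len_le G U hp ht hU).trans ?_
    rw [pow_two]
    exact mul_le_mul hΛ.delta_le hΛ.lg_le (by positivity) (by linarith)
  unfold find
  rw [thresholds_eq]
  refine (ens_findRuns_cost G U hp hΛ hα.le hR hl (R + 1) 0 (by omega) _ (by simpa using hP) ?_).mono
    fun o k hk => ⟨fun ho => ?_, fun c hc => ?_⟩
  · intro s hs
    obtain ⟨i, -, rfl⟩ := List.mem_map.1 hs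
    simp
  · have h1 := hk.1 ho
    -- A failed search goes down to the last threshold, about `γ / m^{1 + μ/2}`; this determines its
    -- cost.
    have hlast : p.gamma / (G.total U : ℝ) ^ (1 + μ / 2) ≤ (1 - p.gamma) ^ R :=
      le_pow_lastThreshold hp hU μ ht.mu_pos.le
    have hx : 0 < (G.total U : ℝ) ^ (1 + μ / 2) := Real.rpow_pos_of_pos hm _
    have h2 := thresholdWork_anti hα.le (div_pos hγ hx) hlast
    have e1 : thresholdWork α (p.gamma / (G.total U : ℝ) ^ (1 + μ / 2)) =
        α * (G.total U : ℝ) ^ (2 + μ) / p.gamma ^ 2 + (G.total U : ℝ) ^ (1 + μ / 2) / p.gamma := by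
      have : (G.total U : ℝ) ^ (2 + μ) = ((G.total U : ℝ) ^ (1 + μ / 2)) ^ 2 := by
        rw [← Real.rpow_mul_natCast hm.le]; congr 1; push_cast; ring
      rw [this]
      unfold thresholdWork
      field_simp
    have hg2 : 1 / p.gamma ^ 2 ≤ Λ := by
      refine le_trans ?_ hΛ.gamma_le
      gcongr; norm_num
    have hg1 : 1 / p.gamma ≤ Λ := by
      refine le_trans ?_ hg2
      refine one_div_le_one_div_of_le (by positivity) ?_
      nlinarith
    have h3 : thresholdWork α (p.gamma / (G.total U : ℝ) ^ (1 + μ / 2)) ≤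
        Λ * (α * (G.total U : ℝ) ^ (2 + μ) + (G.total U : ℝ) ^ (1 + μ / 2)) := by
      rw [e1, div_eq_mul_one_div, div_eq_mul_one_div (_ ^ (1 + μ / 2)), mul_add, mul_comm Λ,
        mul_comm Λ]
      exact add_le_add (mul_le_mul_of_nonneg_left hg2 (by positivity))
        (mul_le_mul_of_nonneg_left hg1 hx.le)
    refine h1.trans ?_
    have h4 := h2.trans h3
    push_cast
    calc (R + 1 : ℝ) * (Λ ^ 12 * thresholdWork α ((1 - p.gamma) ^ R))
        ≤ Λ ^ 2 * (Λ ^ 12 * (Λ * (α * (G.total U : ℝ) ^ (2 + μ) +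
            (G.total U : ℝ) ^ (1 + μ / 2)))) := by
          refine mul_le_mul hR (mul_le_mul_of_nonneg_left h4 (by positivity)) ?_ (by positivity)
          have := one_le_thresholdWork hα.le (hpos R) (pow_le_one₀ (by linarith) (by linarith))
          positivity
      _ = _ := by ring
  · obtain ⟨r, hr, hacc, hk'⟩ := hk.2 c hc
    set t := (1 - p.gamma) ^ r with ht'
    have ht0 : 0 < t := hpos r
    have hcard : (1 : ℝ) ≤ ((c.1 ∪ c.2).card : ℝ) := by
      have := (hacc.nonempty hp.sizeConst_pos ht0 hU).card_pos
      exact_mod_cast this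
    have hx : 0 < (G.total U : ℝ) ^ (1 + μ) := Real.rpow_pos_of_pos hm _
    have hsz := hp.sizeConst_pos
    set n : ℝ := ((c.1 ∪ c.2).card : ℝ) with hn
    have hD : (0 : ℝ) < max (G.maxDeg : ℝ) 1 := lt_max_of_lt_right one_pos
    -- The size condition of the acceptance test, read backwards: small thresholds are paid for by
    -- many classified vertices.
    have hinv : 1 / t ^ 2 ≤ Λ ^ 3 * (n * (G.total U : ℝ) ^ (1 + μ)) := by
      have h1 := hacc.2
      push_cast at h1
      rw [div_le_iff₀ (by positivity)] at h1
      have h2 : max (G.maxDeg : ℝ) 1 ≤ Λ := max_le hΛ.deg_le (by linarith)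
      have h3 : max (G.maxDeg : ℝ) 1 * G.lg ≤ Λ * Λ :=
        mul_le_mul h2 hΛ.lg_le (by positivity) (by linarith)
      have h4 : p.sizeConst ≤ (n * (G.total U : ℝ) ^ (1 + μ) * t ^ 2) * (Λ * Λ) := by
        refine h1.trans (le_trans (le_of_eq ?_) (mul_le_mul_of_nonneg_left h3
          (by positivity : 0 ≤ n * (G.total U : ℝ) ^ (1 + μ) * t ^ 2)))
        ring
      have h5 : 1 ≤ Λ * p.sizeConst := by
        have := hΛ.size_le
        rwa [div_le_iff₀ hsz] at this
      rw [div_le_iff₀ (by positivity)]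
      calc (1 : ℝ) ≤ Λ * p.sizeConst := h5
        _ ≤ Λ * ((n * (G.total U : ℝ) ^ (1 + μ) * t ^ 2) * (Λ * Λ)) :=
            mul_le_mul_of_nonneg_left h4 (by linarith)
        _ = _ := by ring
    have hW : thresholdWork α t ≤ Λ ^ 4 * (n * (α * (G.total U : ℝ) ^ (1 + μ) + 1 / α)) := by
      -- One of the two terms suffices: the first if `t ≤ α`, the second if `t ≥ α`.
      have h1 : 1 / t ≤ α / t ^ 2 + 1 / α := by
        have : α / t ^ 2 + 1 / α - 1 / t = ((α / t - 1 / 2) ^ 2 + 3 / 4) / α := by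
          field_simp; ring
        have h2 : 0 ≤ ((α / t - 1 / 2) ^ 2 + 3 / 4) / α := by positivity
        linarith
      have h2 : α / t ^ 2 ≤ α * (Λ ^ 3 * (n * (G.total U : ℝ) ^ (1 + μ))) := by
        rw [div_eq_mul_one_div]; exact mul_le_mul_of_nonneg_left hinv hα.le
      have h3 := ten_mul_pow_le h10 3
      have h4 : 0 ≤ n * (α * (G.total U : ℝ) ^ (1 + μ)) := by positivity
      have h5 : 10 * Λ ^ 3 * (n * (α * (G.total U : ℝ) ^ (1 + μ))) ≤
          Λ ^ 4 * (n * (α * (G.total U : ℝ) ^ (1 + μ))) := mul_le_mul_of_nonneg_right h3 h4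
      have h6 : 1 * (1 / α) ≤ Λ ^ 4 * n * (1 / α) := by
        refine mul_le_mul_of_nonneg_right ?_ (by positivity)
        have : 1 ≤ Λ ^ 4 := one_le_pow₀ (by linarith)
        nlinarith
      have h7 : 0 ≤ Λ ^ 3 * (n * (α * (G.total U : ℝ) ^ (1 + μ))) := by positivity
      unfold thresholdWork
      nlinarith
    refine hk'.trans ?_
    push_cast
    calc (R + 1 : ℝ) * (Λ ^ 12 * thresholdWork α t)
        ≤ Λ ^ 2 * (Λ ^ 12 * (Λ ^ 4 * (n * (α * (G.total U : ℝ) ^ (1 + μ) + 1 / α)))) := by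
          refine mul_le_mul hR (mul_le_mul_of_nonneg_left hW (by positivity)) ?_ (by positivity)
          have := one_le_thresholdWork hα.le ht0 (pow_le_one₀ (by linarith) (by linarith))
          positivity
      _ = _ := by ring

end

section
variable {V : Type} [Fintype V] (G : MultiGraph V) (U : Finset V)

theorem ens_flip_cost {α : Type} (a b : α) {P : α → Prop} (ha : P a) (hb : P b) :
    Ens (RandAlg.flip a b) fun c k => k = 1 ∧ P c :=
  ens_flip a b ⟨rfl, ha⟩ ⟨rfl, hb⟩

theorem card_sdiff_cast {U S : Finset V} (h : S ⊆ U) :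
    (U.card : ℝ) = (U \ S).card + S.card := by
  rw [← Finset.card_sdiff_add_card_eq_card h]; push_cast; ring

theorem hundred_mul_pow_le {Λ : ℝ} (h10 : 10 ≤ Λ) (i : ℕ) : 100 * Λ ^ i ≤ Λ ^ (i + 2) := by
  have h1 : (100 : ℝ) ≤ Λ ^ 2 := by nlinarith
  rw [pow_add, mul_comm]
  exact mul_le_mul_of_nonneg_left h1 (by positivity)

/-- An amortized bound: every classified vertex pays `Λ^20 M^{1+μ}`, and the last term covers a
failed Find, which ends the recursion and so occurs at most once. -/
theorem ens_simpleRec_cost {p : Params} (hp : p.Base) {Λ : ℝ} (hΛ : Scale G p Λ) {μ : ℝ}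
    (hμ : 0 < μ) (hμ1 : μ ≤ 1) (hδ : p.delta ≤ μ / 200) {M : ℝ} (hM : 1 ≤ M) (n : ℕ) (U : Finset V)
    (ε : ℝ) (hε : 0 ≤ ε) (hUM : (G.total U : ℝ) ≤ M) :
    Ens (simpleRec G p μ n U ε) fun _ k =>
      (k : ℝ) ≤ U.card * (Λ ^ 20 * M ^ (1 + μ)) + Λ ^ 16 * M ^ (2 + μ) := by
  have h10 := hΛ.ten_le
  have hM1 : 1 ≤ M ^ (1 + μ) := Real.one_le_rpow hM (by linarith)
  have hM2 : 1 ≤ M ^ (2 + μ) := Real.one_le_rpow hM (by linarith)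
  have hL : ∀ i, 1 ≤ Λ ^ i := fun i => one_le_pow₀ (by linarith)
  induction n generalizing U ε with
  | zero => exact ens_pure.2 (by simp only [Nat.cast_zero]; positivity)
  | succ n ih =>
    rw [simpleRec]
    split_ifs with hc
    · refine Ens.bind _ (ens_randomCut_cost U) fun L k hk => ens_pure.2 ?_
      rw [add_zero]
      refine hk.trans (add_le_add ?_ ?_)
      · refine le_mul_of_one_le_right (by positivity) ?_
        nlinarith [hL 20]
      · nlinarith [hL 16]
    · rw [not_or] at hc
      have hU : 0 < G.total U := Nat.pos_of_ne_zero hc.1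
      have ht := Params.tame_of_soto hp hε hμ hμ1 hδ hc.2
      have hm : (0 : ℝ) ≤ G.total U := Nat.cast_nonneg _
      refine Ens.bind _ (ens_startVertices_cost G U hΛ) fun P k₁ hk₁ => ?_
      refine Ens.bind _ ((ens_find_cost G U hp hΛ ht one_pos hU hk₁.2).and (ens_find G U hp hU))
        fun o k₂ hk₂ => ?_
      obtain ⟨⟨hnone, hsome⟩, hout⟩ := hk₂
      have e1 : (G.total U : ℝ) ^ (1 + μ) ≤ M ^ (1 + μ) :=
        Real.rpow_le_rpow hm hUM (by linarith)
      have e2 : (G.total U : ℝ) ^ (2 + μ) ≤ M ^ (2 + μ) :=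
        Real.rpow_le_rpow hm hUM (by linarith)
      have e3 : (G.total U : ℝ) ^ (1 + μ / 2) ≤ M ^ (2 + μ) :=
        (Real.rpow_le_rpow hm hUM (by linarith)).trans
          (Real.rpow_le_rpow_of_exponent_le hM (by linarith))
      have t15 := ten_mul_pow_le h10 15
      have t5 : Λ ^ 5 ≤ Λ ^ 15 := pow_le_pow_right₀ (by linarith) (by norm_num)
      rcases o with _ | ⟨A, B⟩
      · refine ens_pure.2 ?_
        have h1 := hnone rfl
        rw [one_mul] at h1
        have h2 : Λ ^ 15 * ((G.total U : ℝ) ^ (2 + μ) + (G.total U : ℝ) ^ (1 + μ / 2)) ≤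
            Λ ^ 15 * (M ^ (2 + μ) + M ^ (2 + μ)) :=
          mul_le_mul_of_nonneg_left (add_le_add e2 e3) (by positivity)
        have h3 : 10 * Λ ^ 15 * M ^ (2 + μ) ≤ Λ ^ 16 * M ^ (2 + μ) :=
          mul_le_mul_of_nonneg_right t15 (by positivity)
        have h4 : Λ ^ 15 * 1 ≤ Λ ^ 15 * M ^ (2 + μ) :=
          mul_le_mul_of_nonneg_left hM2 (by positivity)
        have h5 : 0 ≤ (U.card : ℝ) * (Λ ^ 20 * M ^ (1 + μ)) := by positivity
        push_cast
        linarith [hk₁.1]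
      · obtain ⟨hAB, -, hne, -⟩ := hout (A, B) rfl
        have h1 := hsome (A, B) rfl
        simp only at hAB hne h1 ⊢
        set c : ℝ := ((A ∪ B).card : ℝ) with hcdef
        have hc1 : 1 ≤ c := Nat.one_le_cast.2 hne.card_pos
        set U' := U \ (A ∪ B) with hU'
        have hcard : (U.card : ℝ) = U'.card + c := card_sdiff_cast hAB
        refine Ens.bind _ (ens_flip_cost A B (P := fun _ => True) trivial trivial)
          fun L k₃ hk₃ => ?_
        refine ens_tick_bind (f := fun _ => _ >>= _) (Ens.bind _
          (ih U' (ε * G.total U / G.total U') (by positivity)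
            (le_trans (by exact_mod_cast G.total_mono U Finset.sdiff_subset) hUM))
          fun r k₄ hk₄ => ens_pure.2 ?_)
        have hscan := scanCost_le G U hΛ (A ∪ B) hc1 le_rfl
        rw [hk₃.1]
        push_cast
        have h2 : Λ ^ 18 * (c * (1 * (G.total U : ℝ) ^ (1 + μ) + 1 / 1)) ≤
            Λ ^ 18 * (c * (M ^ (1 + μ) + M ^ (1 + μ))) := by
          refine mul_le_mul_of_nonneg_left (mul_le_mul_of_nonneg_left ?_ (by positivity))
            (by positivity)
          linarith
        have hcM : 1 ≤ c * M ^ (1 + μ) := by nlinarith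
        have h3 : Λ ^ 18 * 1 ≤ Λ ^ 18 * (c * M ^ (1 + μ)) :=
          mul_le_mul_of_nonneg_left hcM (by positivity)
        have h4 : Λ ^ 3 * c ≤ Λ ^ 18 * (c * M ^ (1 + μ)) := by
          refine mul_le_mul (pow_le_pow_right₀ (by linarith) (by norm_num))
            (le_mul_of_one_le_right (by linarith) hM1) (by positivity) (by positivity)
        have h5 : Λ ^ 5 ≤ Λ ^ 18 := pow_le_pow_right₀ (by linarith) (by norm_num)
        have h6 : 100 * Λ ^ 18 * (c * M ^ (1 + μ)) ≤ Λ ^ 20 * (c * M ^ (1 + μ)) := by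
          refine mul_le_mul_of_nonneg_right ?_ (by positivity)
          exact hundred_mul_pow_le h10 18
        have h7 : 1 ≤ Λ ^ 18 := hL 18
        have h8 : (U.card : ℝ) * (Λ ^ 20 * M ^ (1 + μ)) =
            U'.card * (Λ ^ 20 * M ^ (1 + μ)) + Λ ^ 20 * (c * M ^ (1 + μ)) := by
          rw [hcard]; ring
        linarith [hk₁.1]

theorem ens_simple_cost {p : Params} (hp : p.Base) {Λ : ℝ} (hΛ : Scale G p Λ) {μ : ℝ}
    (hμ : 0 < μ) (hμ1 : μ ≤ 1) (hδ : p.delta ≤ μ / 200) {N : ℝ} (hN : 1 ≤ N) (U : Finset V)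
    (hUN : (U.card : ℝ) ≤ N) (ε : ℝ) (hε : 0 ≤ ε) :
    Ens (simple G p μ U ε) fun _ k => (k : ℝ) ≤ Λ ^ 24 * (N * N ^ (1 + μ)) := by
  have h10 := hΛ.ten_le
  have hΛ0 : 0 < Λ := by linarith
  have hN0 : 0 < N := by linarith
  have hL : ∀ i, 1 ≤ Λ ^ i := fun i => one_le_pow₀ (by linarith)
  have hN1 : 1 ≤ N ^ (1 + μ) := Real.one_le_rpow hN (by linarith)
  have htot : (G.total U : ℝ) ≤ Λ * N :=
    (vol_le_card G U hΛ U).trans (mul_le_mul_of_nonneg_left hUN hΛ0.le)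
  have hM : 1 ≤ Λ * N := by nlinarith
  have e1 : (Λ * N) ^ (1 + μ) ≤ Λ ^ 2 * N ^ (1 + μ) := by
    rw [Real.mul_rpow hΛ0.le hN0.le]
    refine mul_le_mul_of_nonneg_right ?_ (by positivity)
    rw [← Real.rpow_natCast]
    exact Real.rpow_le_rpow_of_exponent_le (by linarith) (by push_cast; linarith)
  have e2 : (Λ * N) ^ (2 + μ) ≤ Λ ^ 3 * (N * N ^ (1 + μ)) := by
    rw [Real.mul_rpow hΛ0.le hN0.le]
    have : N ^ (2 + μ) = N * N ^ (1 + μ) := by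
      rw [← Real.rpow_one_add' hN0.le (by linarith)]; congr 1; ring
    rw [this]
    refine mul_le_mul_of_nonneg_right ?_ (by positivity)
    rw [← Real.rpow_natCast]
    exact Real.rpow_le_rpow_of_exponent_le (by linarith) (by push_cast; linarith)
  have hscan := scanCost_le G U hΛ U hN hUN
  set X := N * N ^ (1 + μ) with hX
  have hNX : N ≤ X := le_mul_of_one_le_right hN0.le hN1
  unfold simple
  refine ens_tick_bind (f := fun _ => _ >>= _) (Ens.bind _
    (ens_simpleRec_cost G hp hΛ hμ hμ1 hδ hM (U.card + 1) U ε hε htot) fun r k hk => ?_)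
  have h1 : (U.card : ℝ) * (Λ ^ 20 * (Λ * N) ^ (1 + μ)) ≤ N * (Λ ^ 20 * (Λ ^ 2 * N ^ (1 + μ))) :=
    mul_le_mul hUN (mul_le_mul_of_nonneg_left e1 (by positivity)) (by positivity) hN0.le
  have h2 : Λ ^ 16 * (Λ * N) ^ (2 + μ) ≤ Λ ^ 16 * (Λ ^ 3 * X) :=
    mul_le_mul_of_nonneg_left e2 (by positivity)
  have e3 : N * (Λ ^ 20 * (Λ ^ 2 * N ^ (1 + μ))) = Λ ^ 22 * X := by rw [hX]; ring
  have e4 : Λ ^ 16 * (Λ ^ 3 * X) ≤ Λ ^ 22 * X := by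
    rw [← mul_assoc, ← pow_add]
    exact mul_le_mul_of_nonneg_right (pow_le_pow_right₀ (by linarith) (by norm_num)) (by positivity)
  have e5 : Λ ^ 3 * N ≤ Λ ^ 22 * X :=
    mul_le_mul (pow_le_pow_right₀ (by linarith) (by norm_num)) hNX hN0.le (by positivity)
  have e6 : N + 1 ≤ 2 * (Λ ^ 22 * X) := by nlinarith [hL 22]
  have e7 : 100 * Λ ^ 22 * X ≤ Λ ^ 24 * X := by
    refine mul_le_mul_of_nonneg_right ?_ (by positivity)
    exact hundred_mul_pow_le h10 22
  split_ifs
  · refine ens_pure.2 ?_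
    push_cast
    linarith
  · refine (ens_randomCut_cost U).mono fun _ j hj => ?_
    push_cast
    linarith

theorem ens_simple'_cost {p : Params} (hp : p.Base) {Λ : ℝ} (hΛ : Scale G p Λ) {μ : ℝ}
    (hμ : 0 < μ) (hμ1 : μ ≤ 1) (hδ : p.delta ≤ μ / 200) {N : ℝ} (hN : 1 ≤ N) (U : Finset V)
    (hUN : (U.card : ℝ) ≤ N) :
    Ens (simple' G p μ U) fun _ k => (k : ℝ) ≤ Λ ^ 27 * (N * N ^ (1 + μ)) := by
  have h10 := hΛ.ten_le
  have hN0 : 0 < N := by linarith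
  have hγ := hp.gamma_pos
  have hγ1 := hp.gamma_le
  have hN1 : 1 ≤ N ^ (1 + μ) := Real.one_le_rpow hN (by linarith)
  set X := N * N ^ (1 + μ) with hX
  have hNX : N ≤ X := le_mul_of_one_le_right hN0.le hN1
  unfold simple'
  refine Ens.bind _ (ens_collect_cost (c := Λ ^ 25 * X) fun r _ => ?_) fun cuts k hk =>
    ens_pure.2 ?_
  · refine Ens.bind _ (ens_simple_cost G hp hΛ hμ hμ1 hδ hN U hUN (1 - (1 - p.gamma) ^ r)
      (sub_nonneg.2 (pow_le_one₀ (by linarith) (by linarith)))) fun L k hk => ?_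
    refine ens_tick_bind (f := fun _ => pure _) (ens_pure.2 ?_)
    have hscan := scanCost_le G U hΛ U hN hUN
    have e5 : Λ ^ 3 * N ≤ Λ ^ 24 * X :=
      mul_le_mul (pow_le_pow_right₀ (by linarith) (by norm_num)) hNX hN0.le (by positivity)
    have e7 : 10 * Λ ^ 24 * X ≤ Λ ^ 25 * X :=
      mul_le_mul_of_nonneg_right (ten_mul_pow_le h10 24) (by positivity)
    have e8 : 0 ≤ Λ ^ 24 * X := by positivity
    push_cast
    linarith
  · rw [add_zero]
    refine hk.trans ?_
    rw [List.length_range]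
    have hcount : ((⌊Real.log 2 / -Real.log (1 - p.gamma)⌋₊ + 1 : ℕ) : ℝ) ≤ Λ ^ 2 := by
      have hL : p.gamma ≤ -Real.log (1 - p.gamma) := neg_log_ge (by linarith)
      have hl2 : Real.log 2 ≤ 1 := by
        have := Real.log_le_sub_one_of_pos (show (0 : ℝ) < 2 by norm_num)
        linarith
      have h0 : 0 ≤ Real.log 2 := Real.log_nonneg (by norm_num)
      push_cast
      have h1 : (⌊Real.log 2 / -Real.log (1 - p.gamma)⌋₊ : ℝ) ≤ 1 / p.gamma :=
        (Nat.floor_le (div_nonneg h0 (by linarith))).trans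
          (div_le_div₀ (by norm_num) hl2 hγ hL)
      have h2 : 1 / p.gamma ≤ Λ := by
        refine le_trans ?_ hΛ.gamma_le
        rw [div_le_div_iff₀ hγ (by positivity)]
        nlinarith
      nlinarith
    calc _ ≤ Λ ^ 2 * (Λ ^ 25 * X) := mul_le_mul_of_nonneg_right hcount (by positivity)
      _ = Λ ^ 27 * X := by ring

/-- With `α = m^{-1/2}` both the number of walks and the size of the tested sets are `√m` up to
powers of the scale. The bound on `|S|` is what makes the call of Simple' affordable. -/
theorem ens_cutOrBound_cost {p : Params} (hp : p.Good) {Λ : ℝ} (hΛ : Scale G p Λ) (hU : 0 < G.total U)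
    (i : V) : Ens (cutOrBound G p U i) fun o k => (k : ℝ) ≤ Λ ^ 13 * √(G.total U : ℝ) ∧
      ∀ S ∈ o, (S.card : ℝ) ≤ Λ ^ 3 * √(G.total U : ℝ) := by
  have h10 := hΛ.ten_le
  have hL : ∀ i, 1 ≤ Λ ^ i := fun i => one_le_pow₀ (by linarith)
  have hm : (1 : ℝ) ≤ G.total U := by exact_mod_cast hU
  set s := √(G.total U : ℝ) with hs
  have hs1 : 1 ≤ s := Real.one_le_sqrt.2 hm
  have hα := hp.toBase.alpha_eq (G.total U)
  rw [← hs] at hα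
  have hlg : (1 : ℝ) ≤ G.lg := by exact_mod_cast one_le_lg G
  have hwc : 0 ≤ p.walkConst :=
    le_trans (by have := hp.delta_pos; positivity) hp.walkConst_ge'
  obtain ⟨hφ0, hφ1⟩ := phi_bounds hp.toBase hp.tame
  have hl : (p.len (G.total U) p.eps₁ p.mu₁ : ℝ) ≤ Λ ^ 2 := by
    refine (len_le G U hp.toBase hp.tame hU).trans ?_
    rw [pow_two Λ]
    exact mul_le_mul hΛ.delta_le hΛ.lg_le (by positivity) (by linarith)
  unfold cutOrBound
  simp only
  rw [hα]
  set ℓ := p.len (G.total U) p.eps₁ p.mu₁ with hℓ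
  have hℓ0 : (0 : ℝ) ≤ ℓ := Nat.cast_nonneg _
  set w := ⌈p.walkConst * ℓ ^ 2 * G.lg / (1 / s)⌉₊ with hw
  set b := ⌈ℓ / (2 * (1 - 2 * p.phi) * (1 / s))⌉₊ with hb
  have hb' : (b : ℝ) ≤ Λ ^ 3 * s := by
    have h0 : 0 < 1 - 2 * p.phi := by linarith
    refine (Nat.ceil_lt_add_one (by positivity)).le.trans ?_
    have h1 : (ℓ : ℝ) / (2 * (1 - 2 * p.phi) * (1 / s)) ≤ Λ ^ 2 * s := by
      rw [div_le_iff₀ (by positivity)]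
      have : Λ ^ 2 * s * (2 * (1 - 2 * p.phi) * (1 / s)) = Λ ^ 2 * (2 * (1 - 2 * p.phi)) := by
        field_simp
      rw [this]
      refine hl.trans (le_mul_of_one_le_right (by positivity) (by linarith))
    have h2 : 10 * Λ ^ 2 * s ≤ Λ ^ 3 * s :=
      mul_le_mul_of_nonneg_right (ten_mul_pow_le h10 2) (by positivity)
    have h3 : 1 ≤ Λ ^ 2 * s := by nlinarith [hL 2]
    linarith
  have hw' : (w : ℝ) ≤ Λ ^ 7 * s := by
    refine (Nat.ceil_lt_add_one (by positivity)).le.trans ?_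
    have h1 : p.walkConst * ℓ ^ 2 * G.lg / (1 / s) ≤ Λ ^ 6 * s := by
      rw [div_div_eq_mul_div, div_one]
      refine mul_le_mul_of_nonneg_right ?_ (by positivity)
      calc p.walkConst * (ℓ : ℝ) ^ 2 * G.lg ≤ Λ * (Λ ^ 2) ^ 2 * Λ := by
            refine mul_le_mul (mul_le_mul hΛ.walk_le (pow_le_pow_left₀ hℓ0 hl 2) (by positivity)
              (by linarith)) hΛ.lg_le (by positivity) (by positivity)
        _ = Λ ^ 6 := by ring
    have h2 : 10 * Λ ^ 6 * s ≤ Λ ^ 7 * s :=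
      mul_le_mul_of_nonneg_right (ten_mul_pow_le h10 6) (by positivity)
    have h3 : 1 ≤ Λ ^ 6 * s := by nlinarith [hL 6]
    linarith
  refine Ens.bind _ (ens_repeated_cost w (ens_walk_cost G U ℓ (i, false))) fun traces k hk => ?_
  refine ens_tick_bind (f := fun _ => pure _) (ens_pure.2 ⟨?_, fun S hS => ?_⟩)
  · have h1 : (k : ℝ) ≤ Λ ^ 7 * s * (2 * Λ ^ 2) :=
      hk.trans (mul_le_mul hw' (by linarith) (by positivity) (by positivity))
    have h2 : (G.lg : ℝ) * (ℓ + 1) * (w + b * (G.maxDeg + 1)) ≤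
        Λ * (2 * Λ ^ 2) * (Λ ^ 7 * s + Λ ^ 3 * s * (2 * Λ)) := by
      refine mul_le_mul (mul_le_mul hΛ.lg_le ?_ (by positivity) (by linarith))
        (add_le_add hw' (mul_le_mul hb' ?_ (by positivity) (by positivity))) (by positivity)
        (by positivity)
      · linarith [hL 2]
      · linarith [hΛ.deg_le]
    have e1 : Λ * (2 * Λ ^ 2) * (Λ ^ 7 * s + Λ ^ 3 * s * (2 * Λ)) =
        2 * (Λ ^ 10 * s) + 4 * (Λ ^ 7 * s) := by ring
    have e2 : Λ ^ 7 * s * (2 * Λ ^ 2) = 2 * (Λ ^ 9 * s) := by ring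
    have hmono : ∀ i ≤ 12, Λ ^ i * s ≤ Λ ^ 12 * s := fun i hi =>
      mul_le_mul_of_nonneg_right (pow_le_pow_right₀ (by linarith) hi) (by positivity)
    have e3 : 10 * Λ ^ 12 * s ≤ Λ ^ 13 * s :=
      mul_le_mul_of_nonneg_right (ten_mul_pow_le h10 12) (by positivity)
    push_cast
    linarith [hmono 10 (by norm_num), hmono 7 (by norm_num), hmono 9 (by norm_num)]
  · have h2 := List.mem_of_find?_eq_some (Option.mem_def.1 hS)
    obtain ⟨l, -, h4⟩ := List.mem_flatMap.1 h2
    obtain ⟨k', hk', rfl⟩ := List.mem_map.1 h4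
    refine le_trans ?_ hb'
    have h5 : ((sweepOrder G U traces l).take (k' + 1)).toFinset.card ≤ b :=
      (List.toFinset_card_le _).trans ((List.length_take_le _ _).trans (List.mem_range.1 hk'))
    exact_mod_cast h5

-- Every classified vertex pays `M^{1/2+μ}` up to the scale. Find costs `α m^{1+μ₁} + 1/α` per
-- vertex, Simple' costs `|S|^{1+μ₂}` per vertex with `|S| ≤ Λ³ √m`, and the starting vertices and
-- CutOrBound cost about `√m` in a round that classifies at least one vertex. The last term pays for
-- a single failed Find, of cost `α m^{2+μ₁} = m^{3/2+μ₁}`. The choice `τ = 1/2` balances these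
-- terms.
set_option maxHeartbeats 800000 in
theorem ens_balanceRec_cost {p : Params} (hp : p.Good) {Λ : ℝ} (hΛ : Scale G p Λ) {μ M : ℝ}
    (hμ₁ : p.mu₁ ≤ μ) (hμ₂ : p.mu₂ ≤ μ) (hM : 1 ≤ M) (n : ℕ) (U : Finset V)
    (hUM : (G.total U : ℝ) ≤ M) :
    Ens (balanceRec G p n U) fun _ k =>
      (k : ℝ) ≤ U.card * (Λ ^ 36 * M ^ (1 / 2 + μ)) + Λ ^ 18 * M ^ (3 / 2 + μ) := by
  have h10 := hΛ.ten_le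
  have hμ0 : 0 < μ := lt_of_lt_of_le hp.mu₁_pos hμ₁
  have hM0 : 0 < M := by linarith
  have hM1 : 1 ≤ M ^ (1 / 2 + μ) := Real.one_le_rpow hM (by linarith)
  have hM2 : 1 ≤ M ^ (3 / 2 + μ) := Real.one_le_rpow hM (by linarith)
  have hL : ∀ i, 1 ≤ Λ ^ i := fun i => one_le_pow₀ (by linarith)
  induction n generalizing U with
  | zero => exact ens_pure.2 (by simp only [Nat.cast_zero]; positivity)
  | succ n ih =>
    have hcut : (U.card : ℝ) ≤ U.card * (Λ ^ 36 * M ^ (1 / 2 + μ)) := by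
      refine le_mul_of_one_le_right (by positivity) ?_
      nlinarith [hL 36]
    rw [balanceRec]
    split_ifs with hc
    · refine (ens_randomCut_cost U).mono fun _ k hk => hk.trans (add_le_add hcut ?_)
      nlinarith [hL 18]
    · have hU : 0 < G.total U := Nat.pos_of_ne_zero hc
      have hm1 : (1 : ℝ) ≤ G.total U := by exact_mod_cast hU
      have hm : (0 : ℝ) < G.total U := by linarith
      have hsqrt : √(G.total U : ℝ) ≤ M ^ (1 / 2 + μ) := by
        rw [Real.sqrt_eq_rpow]
        exact (Real.rpow_le_rpow hm.le hUM (by norm_num)).trans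
          (Real.rpow_le_rpow_of_exponent_le hM (by linarith))
      have hsqrt1 : 1 ≤ √(G.total U : ℝ) := Real.one_le_sqrt.2 hm1
      refine Ens.bind _ (ens_startVertices_cost G U hΛ) fun P k₁ hk₁ => ?_
      refine Ens.bind _ ((ens_firstSome_cost (c := Λ ^ 13 * √(G.total U : ℝ)) (by positivity)
        (fun i => (ens_cutOrBound_cost G U hp hΛ hU i).mono fun _ _ h => h.1) P).and
        (ens_firstSome (fun i => ((ens_cutOrBound_cost G U hp hΛ hU i).and
          (ens_cutOrBound G U p i)).mono (fun o _ h S hS => And.intro (h.1.2 S hS) (h.2 S hS)))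
          P)) fun o k₂ hk₂ => ?_
      obtain ⟨hk₂, hout⟩ := hk₂
      have hk₂' : (k₂ : ℝ) ≤ Λ ^ 16 * M ^ (1 / 2 + μ) := by
        refine hk₂.trans ?_
        calc (P.length : ℝ) * (Λ ^ 13 * √(G.total U : ℝ)) ≤
            Λ ^ 3 * (Λ ^ 13 * M ^ (1 / 2 + μ)) :=
              mul_le_mul hk₁.2 (mul_le_mul_of_nonneg_left hsqrt (by positivity)) (by positivity)
                (by positivity)
          _ = _ := by ring
      have hk₁' : (k₁ : ℝ) ≤ Λ ^ 16 * M ^ (1 / 2 + μ) := by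
        refine hk₁.1.trans ?_
        have : Λ ^ 5 ≤ Λ ^ 16 := pow_le_pow_right₀ (by linarith) (by norm_num)
        nlinarith [hL 16]
      have t16 : 10 * Λ ^ 16 * M ^ (1 / 2 + μ) ≤ Λ ^ 17 * M ^ (1 / 2 + μ) :=
        mul_le_mul_of_nonneg_right (ten_mul_pow_le h10 16) (by positivity)
      have hmonoL : ∀ i ≤ 34, Λ ^ i ≤ Λ ^ 34 := fun i hi => pow_le_pow_right₀ (by linarith) hi
      rcases o with _ | S
      · refine Ens.bind _ ((ens_find_cost G U hp.toBase hΛ hp.tame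
          (by rw [hp.toBase.alpha_eq]; positivity) hU hk₁.2).and (ens_find G U hp.toBase hU))
          fun o k₃ hk₃ => ?_
        obtain ⟨⟨hnone, hsome⟩, hout'⟩ := hk₃
        have ea : ∀ x : ℝ, p.alpha (G.total U) * (G.total U : ℝ) ^ x =
            (G.total U : ℝ) ^ (x - 1 / 2) := by
          intro x
          unfold Params.alpha
          rw [hp.tau_eq, ← Real.rpow_add hm]; congr 1; ring
        have ea' : 1 / p.alpha (G.total U) = √(G.total U : ℝ) := by
          rw [hp.toBase.alpha_eq, one_div_one_div]
        rcases o with _ | ⟨A, B⟩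
        · refine (ens_randomCut_cost U).mono fun _ k₄ hk₄ => ?_
          have h1 := hnone rfl
          rw [ea] at h1
          have h2 : (G.total U : ℝ) ^ (2 + p.mu₁ - 1 / 2) ≤ M ^ (3 / 2 + μ) :=
            (Real.rpow_le_rpow hm.le hUM (by linarith [hp.mu₁_pos])).trans
              (Real.rpow_le_rpow_of_exponent_le hM (by linarith))
          have h3 : (G.total U : ℝ) ^ (1 + p.mu₁ / 2) ≤ M ^ (3 / 2 + μ) :=
            (Real.rpow_le_rpow hm.le hUM (by linarith [hp.mu₁_pos])).trans
              (Real.rpow_le_rpow_of_exponent_le hM (by linarith [hp.mu₁_pos]))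
          have h4 : Λ ^ 15 * ((G.total U : ℝ) ^ (2 + p.mu₁ - 1 / 2) +
              (G.total U : ℝ) ^ (1 + p.mu₁ / 2)) ≤ Λ ^ 15 * (M ^ (3 / 2 + μ) + M ^ (3 / 2 + μ)) :=
            mul_le_mul_of_nonneg_left (add_le_add h2 h3) (by positivity)
          have h5 : M ^ (1 / 2 + μ) ≤ M ^ (3 / 2 + μ) :=
            Real.rpow_le_rpow_of_exponent_le hM (by linarith)
          have h6 : Λ ^ 17 * M ^ (1 / 2 + μ) ≤ Λ ^ 17 * M ^ (3 / 2 + μ) :=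
            mul_le_mul_of_nonneg_left h5 (by positivity)
          have h7 : 10 * Λ ^ 17 * M ^ (3 / 2 + μ) ≤ Λ ^ 18 * M ^ (3 / 2 + μ) :=
            mul_le_mul_of_nonneg_right (ten_mul_pow_le h10 17) (by positivity)
          have h8 : Λ ^ 15 * M ^ (3 / 2 + μ) ≤ Λ ^ 17 * M ^ (3 / 2 + μ) :=
            mul_le_mul_of_nonneg_right (pow_le_pow_right₀ (by linarith) (by norm_num))
              (by positivity)
          have h9 : 1 ≤ Λ ^ 17 * M ^ (3 / 2 + μ) := by nlinarith [hL 17]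
          have h0 : 0 ≤ Λ ^ 16 * M ^ (1 / 2 + μ) := by positivity
          push_cast
          linarith
        · obtain ⟨hAB, -, hne, -⟩ := hout' (A, B) rfl
          have h1 := hsome (A, B) rfl
          simp only at hAB hne h1 ⊢
          set c : ℝ := ((A ∪ B).card : ℝ) with hcdef
          have hc1 : 1 ≤ c := Nat.one_le_cast.2 hne.card_pos
          have hcard : (U.card : ℝ) = (U \ (A ∪ B)).card + c := card_sdiff_cast hAB
          refine Ens.bind _ (ens_flip_cost A B (P := fun _ => True) trivial trivial)
            fun L k₄ hk₄ => ?_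
          refine ens_tick_bind (f := fun _ => _ >>= _) (Ens.bind _ (ih (U \ (A ∪ B))
              (le_trans (by exact_mod_cast G.total_mono U Finset.sdiff_subset) hUM))
            fun r k₅ hk₅ => ens_pure.2 ?_)
          have hscan := scanCost_le G U hΛ (A ∪ B) hc1 le_rfl
          rw [ea, ea'] at h1
          have h2 : (G.total U : ℝ) ^ (1 + p.mu₁ - 1 / 2) ≤ M ^ (1 / 2 + μ) :=
            (Real.rpow_le_rpow hm.le hUM (by linarith [hp.mu₁_pos])).trans
              (Real.rpow_le_rpow_of_exponent_le hM (by linarith))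
          have h3 : Λ ^ 18 * (c * ((G.total U : ℝ) ^ (1 + p.mu₁ - 1 / 2) + √(G.total U : ℝ))) ≤
              Λ ^ 18 * (c * (M ^ (1 / 2 + μ) + M ^ (1 / 2 + μ))) :=
            mul_le_mul_of_nonneg_left (mul_le_mul_of_nonneg_left (add_le_add h2 hsqrt)
              (by positivity)) (by positivity)
          set Y := M ^ (1 / 2 + μ) with hY
          have hcY : Y ≤ c * Y := le_mul_of_one_le_left (by positivity) hc1
          have hmono : ∀ i ≤ 34, Λ ^ i * (c * Y) ≤ Λ ^ 34 * (c * Y) := fun i hi =>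
            mul_le_mul_of_nonneg_right (hmonoL i hi) (by positivity)
          have h4 : Λ ^ 16 * Y ≤ Λ ^ 16 * (c * Y) :=
            mul_le_mul_of_nonneg_left hcY (by positivity)
          have h5 : Λ ^ 3 * c ≤ Λ ^ 3 * (c * Y) :=
            mul_le_mul_of_nonneg_left (le_mul_of_one_le_right (by linarith) hM1) (by positivity)
          have h6 : 1 ≤ Λ ^ 34 * (c * Y) := by
            exact one_le_mul_of_one_le_of_one_le (hL 34) (hM1.trans hcY)
          have h7 : 100 * Λ ^ 34 * (c * Y) ≤ Λ ^ 36 * (c * Y) := by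
            refine mul_le_mul_of_nonneg_right ?_ (by positivity)
            exact hundred_mul_pow_le h10 34
          have h8 : (U.card : ℝ) * (Λ ^ 36 * Y) =
              (U \ (A ∪ B)).card * (Λ ^ 36 * Y) + Λ ^ 36 * (c * Y) := by rw [hcard]; ring
          rw [hk₄.1]
          push_cast
          linarith [hmono 16 (by norm_num), hmono 18 (by norm_num), hmono 3 (by norm_num)]
      · obtain ⟨hcardS, hSU, hne, -⟩ := hout S rfl
        set c : ℝ := (S.card : ℝ) with hcdef
        have hc1 : 1 ≤ c := Nat.one_le_cast.2 hne.card_pos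
        have hcard : (U.card : ℝ) = (U \ S).card + c := card_sdiff_cast hSU
        refine Ens.bind _ (ens_simple'_cost G hp.toBase hΛ hp.mu₂_pos hp.mu₂_le hp.delta_le₂
          (N := c) hc1 S le_rfl) fun L₀ k₃ hk₃ => ?_
        refine Ens.bind _ (ens_flip_cost L₀ (S \ L₀) (P := fun _ => True) trivial trivial)
          fun L k₄ hk₄ => ?_
        refine ens_tick_bind (f := fun _ => _ >>= _) (Ens.bind _ (ih (U \ S)
            (le_trans (by exact_mod_cast G.total_mono U Finset.sdiff_subset) hUM))
          fun r k₅ hk₅ => ens_pure.2 ?_)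
        have hscan := scanCost_le G U hΛ S hc1 le_rfl
        set Y := M ^ (1 / 2 + μ) with hY
        -- From `c ≤ Λ³ √m`: the scale contributes at most `Λ⁶` since `μ₂ ≤ 1`, and `m^{(1+μ₂)/2} ≤
        -- M^{1/2+μ}`.
        have hpow : c ^ (1 + p.mu₂) ≤ Λ ^ 6 * Y := by
          calc c ^ (1 + p.mu₂) ≤ (Λ ^ 3 * √(G.total U : ℝ)) ^ (1 + p.mu₂) :=
                Real.rpow_le_rpow (by linarith) hcardS (by linarith [hp.mu₂_pos])
            _ = (Λ ^ 3) ^ (1 + p.mu₂) * (√(G.total U : ℝ)) ^ (1 + p.mu₂) :=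
                Real.mul_rpow (by positivity) (by positivity)
            _ ≤ Λ ^ 6 * Y := by
                refine mul_le_mul ?_ ?_ (by positivity) (by positivity)
                · have : Λ ^ 6 = (Λ ^ 3) ^ (2 : ℝ) := by
                    rw [show (2 : ℝ) = ((2 : ℕ) : ℝ) by norm_num, Real.rpow_natCast, ← pow_mul]
                  rw [this]
                  exact Real.rpow_le_rpow_of_exponent_le (hL 3) (by linarith [hp.mu₂_le])
                · rw [Real.sqrt_eq_rpow, ← Real.rpow_mul hm.le]
                  exact (Real.rpow_le_rpow hm.le hUM (by linarith [hp.mu₂_pos])).trans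
                    (Real.rpow_le_rpow_of_exponent_le hM (by linarith))
        have h3 : Λ ^ 27 * (c * c ^ (1 + p.mu₂)) ≤ Λ ^ 33 * (c * Y) := by
          calc Λ ^ 27 * (c * c ^ (1 + p.mu₂)) ≤ Λ ^ 27 * (c * (Λ ^ 6 * Y)) :=
                mul_le_mul_of_nonneg_left (mul_le_mul_of_nonneg_left hpow (by linarith))
                  (by positivity)
            _ = _ := by ring
        have hcY : Y ≤ c * Y := le_mul_of_one_le_left (by positivity) hc1
        have hmono : ∀ i ≤ 34, Λ ^ i * (c * Y) ≤ Λ ^ 34 * (c * Y) := fun i hi =>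
          mul_le_mul_of_nonneg_right (hmonoL i hi) (by positivity)
        have h4 : Λ ^ 16 * Y ≤ Λ ^ 16 * (c * Y) :=
          mul_le_mul_of_nonneg_left hcY (by positivity)
        have h5 : Λ ^ 3 * c ≤ Λ ^ 3 * (c * Y) :=
          mul_le_mul_of_nonneg_left (le_mul_of_one_le_right (by linarith) hM1) (by positivity)
        have h6 : 1 ≤ Λ ^ 34 * (c * Y) := by
          exact one_le_mul_of_one_le_of_one_le (hL 34) (hM1.trans hcY)
        have h7 : 100 * Λ ^ 34 * (c * Y) ≤ Λ ^ 36 * (c * Y) := by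
          refine mul_le_mul_of_nonneg_right ?_ (by positivity)
          exact hundred_mul_pow_le h10 34
        have h8 : (U.card : ℝ) * (Λ ^ 36 * Y) =
            (U \ S).card * (Λ ^ 36 * Y) + Λ ^ 36 * (c * Y) := by rw [hcard]; ring
        rw [hk₄.1]
        push_cast
        linarith [hmono 16 (by norm_num), hmono 33 (by norm_num), hmono 3 (by norm_num)]

/-- The running time of Balance. -/
theorem ens_balance_cost {p : Params} (hp : p.Good) {Λ : ℝ} (hΛ : Scale G p Λ) {μ N : ℝ}
    (hμ₁ : p.mu₁ ≤ μ) (hμ₂ : p.mu₂ ≤ μ) (hμ1 : μ ≤ 1) (hN : 1 ≤ N)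
    (hV : (Fintype.card V : ℝ) ≤ N) :
    Ens (balance G p) fun _ k => (k : ℝ) ≤ Λ ^ 42 * N ^ (3 / 2 + μ) := by
  have h10 := hΛ.ten_le
  have hμ0 : 0 < μ := lt_of_lt_of_le hp.mu₁_pos hμ₁
  have hΛ0 : 0 < Λ := by linarith
  have hN0 : 0 < N := by linarith
  have hL : ∀ i, 1 ≤ Λ ^ i := fun i => one_le_pow₀ (by linarith)
  set M := Λ * N with hM
  have hM1 : 1 ≤ M := by nlinarith
  have hNM : N ≤ M := by nlinarith
  have hcard : ((Finset.univ : Finset V).card : ℝ) ≤ N := by rwa [Finset.card_univ]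
  have htot : (G.total Finset.univ : ℝ) ≤ M :=
    (vol_le_card G _ hΛ _).trans (mul_le_mul_of_nonneg_left hcard hΛ0.le)
  have hscan := scanCost_le G Finset.univ hΛ Finset.univ hN hcard
  set X := M ^ (3 / 2 + μ) with hX
  have hMX : M ≤ X := by
    calc M = M ^ (1 : ℝ) := (Real.rpow_one M).symm
      _ ≤ X := Real.rpow_le_rpow_of_exponent_le hM1 (by linarith)
  have hXeq : M * M ^ (1 / 2 + μ) = X := by
    rw [← Real.rpow_one_add' (by linarith) (by linarith)]; congr 1; ring
  have hXN : X ≤ Λ ^ 3 * N ^ (3 / 2 + μ) := by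
    rw [hX, hM, Real.mul_rpow hΛ0.le hN0.le]
    refine mul_le_mul_of_nonneg_right ?_ (by positivity)
    rw [← Real.rpow_natCast]
    exact Real.rpow_le_rpow_of_exponent_le (by linarith) (by push_cast; linarith)
  unfold balance
  refine ens_tick_bind (f := fun _ => _ >>= _) (Ens.bind _ (ens_balanceRec_cost G hp hΛ hμ₁ hμ₂ hM1
    (Fintype.card V + 1) Finset.univ htot) fun L k₁ hk₁ => ?_)
  refine Ens.bind _ (ens_randomCut_cost Finset.univ) fun L₀ k₂ hk₂ => ?_
  refine ens_tick_bind (f := fun _ => pure _) (ens_pure.2 ?_)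
  have h1 : ((Finset.univ : Finset V).card : ℝ) * (Λ ^ 36 * M ^ (1 / 2 + μ)) ≤ Λ ^ 36 * X := by
    rw [← hXeq, mul_left_comm]
    exact mul_le_mul_of_nonneg_left (mul_le_mul_of_nonneg_right (hcard.trans hNM) (by positivity))
      (by positivity)
  have hX1 : 1 ≤ X := hM1.trans hMX
  have h2 : Λ ^ 18 * X ≤ Λ ^ 36 * X :=
    mul_le_mul_of_nonneg_right (pow_le_pow_right₀ (by linarith) (by norm_num)) (by positivity)
  have h3 : Λ ^ 3 * N ≤ Λ ^ 36 * X :=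
    mul_le_mul (pow_le_pow_right₀ (by linarith) (by norm_num)) (hNM.trans hMX) (by positivity)
      (by positivity)
  have h4 : 1 ≤ Λ ^ 36 * X := by nlinarith [hL 36]
  have h5 : N ≤ Λ ^ 36 * X := by nlinarith [hL 3]
  have h6 : 100 * Λ ^ 36 * X ≤ Λ ^ 38 * X := by
    refine mul_le_mul_of_nonneg_right ?_ (by positivity)
    exact hundred_mul_pow_le h10 36
  have h7 : Λ ^ 38 * X ≤ Λ ^ 42 * N ^ (3 / 2 + μ) := by
    calc Λ ^ 38 * X ≤ Λ ^ 38 * (Λ ^ 3 * N ^ (3 / 2 + μ)) :=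
          mul_le_mul_of_nonneg_left hXN (by positivity)
      _ = Λ ^ 41 * N ^ (3 / 2 + μ) := by ring
      _ ≤ _ := mul_le_mul_of_nonneg_right (pow_le_pow_right₀ (by linarith) (by norm_num))
          (by positivity)
  push_cast
  linarith

end

/-! ### From powers of the scale to powers of the logarithm -/

theorem clog_two_le {x : ℕ} (hx : 1 ≤ x) : (Nat.clog 2 x : ℝ) ≤ 3 / 2 * Real.log x + 1 := by
  have h1 : (Nat.clog 2 x : ℝ) ≤ Real.logb 2 x + 1 := by
    have := Real.natCeil_logb_natCast 2 x
    rw [← this]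
    exact (Nat.ceil_lt_add_one (Real.logb_nonneg (by norm_num) (by exact_mod_cast hx))).le
  have h2 : Real.logb 2 x ≤ 3 / 2 * Real.log x := by
    rw [Real.logb, div_le_iff₀ (Real.log_pos (by norm_num))]
    have := Real.log_two_gt_d9
    have h0 : 0 ≤ Real.log x := Real.log_nonneg (by exact_mod_cast hx)
    nlinarith
  linarith

section
variable {V : Type} [Fintype V] (G : MultiGraph V)

theorem lg_le_log {N D : ℝ} (hN : 2 ≤ N) (hV : (Fintype.card V : ℝ) ≤ N)
    (hD : (G.maxDeg : ℝ) ≤ D) : (G.lg : ℝ) ≤ 3 / 2 * Real.log N + 3 / 2 * D + 3 := by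
  have hD0 : 0 ≤ D := le_trans (Nat.cast_nonneg _) hD
  have htot : (G.total Finset.univ : ℝ) ≤ N * D := by
    rw [G.cast_total]
    calc ∑ j, (G.deg Finset.univ j : ℝ) ≤ ∑ _j : V, D := Finset.sum_le_sum fun j _ =>
          le_trans (by exact_mod_cast deg_le_maxDeg G _ j) hD
      _ = Fintype.card V * D := by rw [Finset.sum_const, Finset.card_univ, nsmul_eq_mul]
      _ ≤ N * D := mul_le_mul_of_nonneg_right hV hD0
  unfold MultiGraph.lg
  refine (clog_two_le (by omega)).trans ?_
  have h1 : ((Fintype.card V + G.total Finset.univ + 2 : ℕ) : ℝ) ≤ N * (D + 2) := by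
    push_cast; nlinarith
  have h2 : Real.log ((Fintype.card V + G.total Finset.univ + 2 : ℕ) : ℝ) ≤
      Real.log N + (D + 1) := by
    refine (Real.log_le_log (by positivity) h1).trans ?_
    rw [Real.log_mul (by linarith) (by linarith)]
    have := Real.log_le_sub_one_of_pos (show 0 < D + 2 by linarith)
    linarith
  linarith

/-- A bound on the constants. -/
def Params.size (p : Params) : ℝ :=
  10 + |p.walkConst| + |p.startConst| + |4 / p.delta ^ 3| + |2 / p.gamma ^ 2| + |1 / p.sizeConst|

theorem scale_of_deg_le (p : Params) {N D : ℝ} (hN : 2 ≤ N) (hV : (Fintype.card V : ℝ) ≤ N)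
    (hD : (G.maxDeg : ℝ) ≤ D) : Scale G p (p.size + 2 * Real.log N + 2 * D) := by
  have hD0 : 0 ≤ D := le_trans (Nat.cast_nonneg _) hD
  have hl : 0 ≤ Real.log N := Real.log_nonneg (by linarith)
  have h1 := abs_nonneg p.walkConst
  have h2 := abs_nonneg p.startConst
  have h3 := abs_nonneg (4 / p.delta ^ 3)
  have h4 := abs_nonneg (2 / p.gamma ^ 2)
  have h5 := abs_nonneg (1 / p.sizeConst)
  have g1 := le_abs_self p.walkConst
  have g2 := le_abs_self p.startConst
  have g3 := le_abs_self (4 / p.delta ^ 3)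
  have g4 := le_abs_self (2 / p.gamma ^ 2)
  have g5 := le_abs_self (1 / p.sizeConst)
  have hlg := lg_le_log G hN hV hD
  unfold Params.size
  constructor <;> linarith

/-- The running time of Balance on graphs of polylogarithmic degree. -/
theorem exists_ens_balance_cost {p : Params} (hp : p.Good) {μ : ℝ} (hμ₁ : p.mu₁ ≤ μ)
    (hμ₂ : p.mu₂ ≤ μ) (hμ1 : μ ≤ 1) (A : ℝ) (k : ℕ) : ∃ (C : ℝ) (K : ℕ), 0 ≤ C ∧
    ∀ (V : Type) [Fintype V] (G : MultiGraph V) (N : ℝ), 2 ≤ N → (Fintype.card V : ℝ) ≤ N →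
      (G.maxDeg : ℝ) ≤ A * Real.log N ^ k →
        Ens (balance G p) fun _ t => (t : ℝ) ≤ C * N ^ (3 / 2 + μ) * Real.log N ^ K := by
  have hs0 : 0 ≤ p.size := by unfold Params.size; positivity
  set B := p.size * 2 ^ (k + 1) + 2 * 2 ^ k + 2 * |A| * 2 with hB
  have hB0 : 0 ≤ B := by positivity
  obtain ⟨q, hq⟩ : ∃ q : ℕ, q = 42 := ⟨_, rfl⟩
  refine ⟨B ^ q, (k + 1) * q, by positivity, fun V _ G N hN hV hD => ?_⟩
  have hsc := scale_of_deg_le G p hN hV hD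
  have hcost := ens_balance_cost G hp hsc hμ₁ hμ₂ hμ1 (by linarith) hV
  rw [← hq] at hcost
  refine hcost.mono fun _ t ht => ht.trans ?_
  set L := Real.log N with hL
  -- As `2 log N ≥ 1`, constants and lower powers of the logarithm are absorbed by multiplication
  -- with powers of `2 log N`.
  have hL2 : 1 ≤ 2 * L := by
    have h1 := Real.log_two_gt_d9
    have h2 : Real.log 2 ≤ L := Real.log_le_log (by norm_num) hN
    linarith
  have hL0 : 0 ≤ L := by linarith
  have hle : p.size + 2 * L + 2 * (A * L ^ k) ≤ B * L ^ (k + 1) := by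
    have e1 : p.size ≤ p.size * 2 ^ (k + 1) * L ^ (k + 1) := by
      rw [mul_assoc, ← mul_pow]
      exact le_mul_of_one_le_right hs0 (one_le_pow₀ hL2)
    have e2 : 2 * L ≤ 2 * 2 ^ k * L ^ (k + 1) := by
      have : 2 * 2 ^ k * L ^ (k + 1) = 2 * L * (2 * L) ^ k := by rw [mul_pow]; ring
      rw [this]
      exact le_mul_of_one_le_right (by linarith) (one_le_pow₀ hL2)
    have e3 : 2 * (A * L ^ k) ≤ 2 * |A| * 2 * L ^ (k + 1) := by
      have : 2 * |A| * 2 * L ^ (k + 1) = 2 * (|A| * L ^ k) * (2 * L) := by ring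
      rw [this]
      refine le_trans ?_ (le_mul_of_one_le_right (by positivity) hL2)
      have := mul_le_mul_of_nonneg_right (le_abs_self A) (pow_nonneg hL0 k)
      linarith
    rw [hB]; linarith
  have hpow : (p.size + 2 * L + 2 * (A * L ^ k)) ^ q ≤ B ^ q * L ^ ((k + 1) * q) := by
    rw [pow_mul, ← mul_pow]
    exact pow_le_pow_left₀ (by linarith [hsc.ten_le]) hle q
  calc _ ≤ B ^ q * L ^ ((k + 1) * q) * N ^ (3 / 2 + μ) :=
        mul_le_mul_of_nonneg_right hpow (Real.rpow_nonneg (by linarith) _)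
    _ = _ := by ring

end

open MultiGraph (ind)

/-! ### Cuts of weighted graphs -/

namespace WGraph

section
variable {V : Type} [Fintype V] (W : WGraph V)

theorem cutWeight_le_maxCut (L : Finset V) : W.cutWeight L ≤ W.maxCut :=
  Finset.le_sup' W.cutWeight (Finset.mem_univ L)

theorem exists_cutWeight_eq_maxCut : ∃ L, W.cutWeight L = W.maxCut := by
  obtain ⟨L, -, hL⟩ := Finset.exists_mem_eq_sup' (s := (Finset.univ : Finset (Finset V)))
    ⟨∅, Finset.mem_univ _⟩ W.cutWeight
  exact ⟨L, hL.symm⟩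

/-- The sum of the degrees. -/
def volume : ℝ≥0 := ∑ v, W.deg v

theorem cast_volume : (W.volume : ℝ) = ∑ u, ∑ v, (W.weight u v : ℝ) := by
  unfold volume WGraph.deg
  push_cast
  rfl

theorem cutWeight_eq (L : Finset V) :
    W.cutWeight L = ∑ u, ∑ v, (W.weight u v : ℝ) * (ind L u * (1 - ind L v)) := by
  unfold cutWeight
  rw [← Finset.sum_subset (Finset.subset_univ L)]
  · refine Finset.sum_congr rfl fun u hu => ?_
    rw [← Finset.sum_subset (Finset.subset_univ Lᶜ)]
    · refine Finset.sum_congr rfl fun v hv => ?_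
      rw [Finset.mem_compl] at hv
      simp [ind, hu, hv]
    · intro v _ hv
      rw [Finset.mem_compl, not_not] at hv
      simp [ind, hv]
  · intro u _ hu
    simp [ind, hu]

theorem cutWeight_nonneg (L : Finset V) : 0 ≤ W.cutWeight L :=
  Finset.sum_nonneg fun _ _ => Finset.sum_nonneg fun _ _ => NNReal.coe_nonneg _

theorem maxCut_nonneg : 0 ≤ W.maxCut := (W.cutWeight_nonneg ∅).trans (W.cutWeight_le_maxCut ∅)

theorem sum_weight_comm (F : V → V → ℝ) :
    ∑ u, ∑ v, (W.weight u v : ℝ) * F u v = ∑ u, ∑ v, (W.weight u v : ℝ) * F v u := by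
  rw [Finset.sum_comm]
  simp only [W.symm]

/-- Twice a cut: both orientations of the edges. -/
theorem two_mul_cutWeight (L : Finset V) : 2 * W.cutWeight L =
    ∑ u, ∑ v, (W.weight u v : ℝ) * (ind L u * (1 - ind L v) + ind L v * (1 - ind L u)) := by
  simp only [mul_add, Finset.sum_add_distrib]
  rw [← W.sum_weight_comm fun u v => ind L u * (1 - ind L v), ← W.cutWeight_eq]
  ring

/-- The average over all cuts: half of them separate a given edge, and the volume is twice the total
weight. This converts additive errors proportional to the volume into relative errors. -/
theorem volume_le_maxCut : (W.volume : ℝ) / 4 ≤ W.maxCut := by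
  have h1 : ∑ L : Finset V, 2 * W.cutWeight L = 2 ^ Fintype.card V / 2 * W.volume := by
    simp only [W.two_mul_cutWeight]
    rw [Finset.sum_comm, W.cast_volume, Finset.mul_sum]
    refine Finset.sum_congr rfl fun u _ => ?_
    rw [Finset.sum_comm, Finset.mul_sum]
    refine Finset.sum_congr rfl fun v _ => ?_
    rw [← Finset.mul_sum]
    by_cases huv : u = v
    · subst huv; simp [W.loopless]
    · have := MultiGraph.sum_powerset_ind Finset.univ (Finset.mem_univ u) huv
      rw [Finset.powerset_univ, Finset.card_univ] at this
      rw [this]; ring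
  have h2 : ∑ L : Finset V, 2 * W.cutWeight L ≤ ∑ _L : Finset V, 2 * W.maxCut :=
    Finset.sum_le_sum fun L _ => mul_le_mul_of_nonneg_left (W.cutWeight_le_maxCut L) (by norm_num)
  rw [Finset.sum_const, Finset.card_univ, Fintype.card_finset, nsmul_eq_mul, h1] at h2
  push_cast at h2
  have h3 : (0 : ℝ) < 2 ^ Fintype.card V := by positivity
  have h4 : (2 : ℝ) ^ Fintype.card V * (W.volume / 4) ≤ 2 ^ Fintype.card V * W.maxCut := by
    linarith
  exact le_of_mul_le_mul_left h4 h3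

theorem maxCut_eq_zero (h : W.volume = 0) : W.maxCut = 0 := by
  obtain ⟨L, hL⟩ := W.exists_cutWeight_eq_maxCut
  have hw : ∀ u v, W.weight u v = 0 := by
    intro u v
    have h1 := (Finset.sum_eq_zero_iff.1 h) u (Finset.mem_univ _)
    exact (Finset.sum_eq_zero_iff.1 h1) v (Finset.mem_univ _)
  rw [← hL, W.cutWeight_eq]
  simp [hw]

theorem copyCount_pos {v : V} (h : 0 < W.deg v) : 0 < W.copyCount v := by
  unfold copyCount
  rw [Nat.ceil_pos]
  have h1 : 0 < Fintype.card V := Fintype.card_pos_iff.2 ⟨v⟩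
  have h2 : 0 < ∑ u, W.deg u := lt_of_lt_of_le h
    (Finset.single_le_sum (fun _ _ => zero_le) (Finset.mem_univ v))
  have h3 : (0 : ℝ) < Fintype.card V := by exact_mod_cast h1
  have h4 : (0 : ℝ) < W.deg v := by exact_mod_cast h
  have h5 : (0 : ℝ) < ((∑ u, W.deg u : ℝ≥0) : ℝ) := by exact_mod_cast h2
  push_cast at h5
  positivity

/-- The exact shares add up to at most `n`, and rounding up adds at most one per vertex. -/
theorem card_copy_le : Fintype.card W.Copy ≤ 2 * Fintype.card V := by
  rw [Fintype.card_sigma]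
  simp only [Fintype.card_fin]
  have h : ((∑ v, W.copyCount v : ℕ) : ℝ) ≤ 2 * Fintype.card V := by
    have hD : (0 : ℝ) ≤ ∑ u, (W.deg u : ℝ) := Finset.sum_nonneg fun _ _ => NNReal.coe_nonneg _
    have hc : ∀ v, (W.copyCount v : ℝ) ≤ Fintype.card V * W.deg v / ∑ u, (W.deg u : ℝ) + 1 := by
      intro v
      have h0 : 0 ≤ Fintype.card V * W.deg v / ∑ u, (W.deg u : ℝ) := by positivity
      have h1 := (Nat.ceil_lt_add_one h0).le
      unfold copyCount
      push_cast
      exact h1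
    push_cast
    calc ∑ v, (W.copyCount v : ℝ) ≤
          ∑ v, ((Fintype.card V * W.deg v / ∑ u, (W.deg u : ℝ)) + 1) :=
          Finset.sum_le_sum fun v _ => hc v
      _ = Fintype.card V * ((∑ v, (W.deg v : ℝ)) / ∑ u, (W.deg u : ℝ)) + Fintype.card V := by
          rw [Finset.sum_add_distrib, ← Finset.sum_div, ← Finset.mul_sum, mul_div_assoc]
          simp
      _ ≤ Fintype.card V * 1 + Fintype.card V := by
          refine add_le_add (mul_le_mul_of_nonneg_left (div_self_le_one _) (by positivity)) le_rfl
      _ = _ := by ring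
  exact_mod_cast h

theorem deg_pos_of_weight {u v : V} (h : W.weight u v ≠ 0) : 0 < W.deg u :=
  lt_of_lt_of_le (pos_iff_ne_zero.2 h)
    (Finset.single_le_sum (f := W.weight u) (fun _ _ => zero_le) (Finset.mem_univ v))

/-- The average of a function over the copies of a vertex. -/
def copyAvg (a : W.Copy → ℝ) (v : V) : ℝ := (∑ i, a ⟨v, i⟩) / W.copyCount v

end

end WGraph

/-! ### Random edges and copies -/

section
variable {V : Type} [Fintype V] (W : WGraph V)

instance (v : V) : Finitary (randomCopy W v) := by unfold randomCopy; infer_instance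

instance : Finitary (randomEdge W) := by
  unfold randomEdge
  refine @instFinitaryBind _ _ _ _ _ fun _ => ?_
  refine @instFinitaryBind _ _ _ _ _ fun o => ?_
  rcases o with _ | u
  · infer_instance
  · refine @instFinitaryBind _ _ _ _ _ fun o => ?_
    rcases o with _ | v <;> infer_instance

theorem finitary_copies (u v : V) : Finitary (do
    match ← randomCopy W u, ← randomCopy W v with
    | some x, some y => pure (some (x, y))
    | _, _ => pure none : RandAlg (Option (W.Copy × W.Copy))) := by
  refine @instFinitaryBind _ _ _ _ _ fun o => ?_
  refine @instFinitaryBind _ _ _ _ _ fun o' => ?_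
  rcases o with _ | x <;> rcases o' with _ | y <;> infer_instance

instance : Finitary (randomCopyEdge W) := by
  unfold randomCopyEdge
  refine @instFinitaryBind _ _ _ _ _ fun o => ?_
  rcases o with _ | ⟨u, v⟩
  · infer_instance
  · exact finitary_copies W u v

/-- The degree of the first vertex cancels, so every ordered pair is drawn with probability
proportional to its weight. -/
theorem E_randomEdge (hD : W.volume ≠ 0) (F : Option (V × V) → ℝ) :
    E (randomEdge W) F = (∑ u, ∑ v, (W.weight u v : ℝ) * F (some (u, v))) / W.volume := by
  unfold randomEdge
  have hfin : ∀ o : Option V, Finitary (match o with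
      | none => pure none
      | some u => do
        match ← choose (pick (W.weight u)) with
        | none => pure none
        | some v => pure (some (u, v)) : RandAlg (Option (V × V))) := by
    intro o
    rcases o with _ | u
    · infer_instance
    · refine @instFinitaryBind _ _ _ _ _ fun o => ?_
      cases o <;> infer_instance
  have : ∀ _ : Unit, Finitary (choose (pick W.deg) >>= fun o : Option V => (match o with
      | none => pure none
      | some u => do
        match ← choose (pick (W.weight u)) with
        | none => pure none
        | some v => pure (some (u, v)) : RandAlg (Option (V × V)))) :=
    fun _ => @instFinitaryBind _ _ _ _ inferInstance hfin
  refine (@E_tick_bind _ _ _ this F).trans ?_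
  refine (E_bind_of inferInstance hfin).trans ?_
  rw [E_pick (by exact hD)]
  unfold WGraph.volume
  push_cast
  congr 1
  refine Finset.sum_congr rfl fun u _ => ?_
  refine (congrArg _ (E_bind_of inferInstance fun o => by cases o <;> infer_instance)).trans ?_
  by_cases hu : ∑ v, W.weight u v = 0
  · have hw : ∀ v, W.weight u v = 0 := fun v => (Finset.sum_eq_zero_iff.1 hu) v (Finset.mem_univ _)
    simp [WGraph.deg, hw]
  · rw [E_pick hu]
    have : (W.deg u : ℝ) = ∑ v, (W.weight u v : ℝ) := by unfold WGraph.deg; push_cast; rfl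
    rw [this, mul_div_cancel₀]
    · simp
    · rw [← this]; exact_mod_cast hu

theorem E_randomCopy {v : V} (hv : 0 < W.copyCount v) (F : Option W.Copy → ℝ) :
    E (randomCopy W v) F = W.copyAvg (fun x => F (some x)) v := by
  unfold randomCopy
  have h1 : ∀ f : W.Copy → ℝ, ∑ x : W.Copy, ((if x.1 = v then (1 : ℝ≥0) else 0 : ℝ≥0) : ℝ) * f x =
      ∑ i, f ⟨v, i⟩ := by
    intro f
    rw [Fintype.sum_sigma, Finset.sum_eq_single v]
    · simp
    · intro u _ hu; simp [hu]
    · simp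
  have h2 : ((∑ x : W.Copy, (if x.1 = v then (1 : ℝ≥0) else 0 : ℝ≥0) : ℝ≥0) : ℝ) =
      W.copyCount v := by
    have := h1 fun _ => 1
    push_cast at this ⊢
    simpa using this
  have h3 : ∑ x : W.Copy, (if x.1 = v then (1 : ℝ≥0) else 0 : ℝ≥0) ≠ 0 := by
    intro h
    rw [h] at h2
    have : (W.copyCount v : ℝ) ≠ 0 := by exact_mod_cast hv.ne'
    exact this (by simpa using h2.symm)
  rw [E_pick h3, h1]
  push_cast at h2
  unfold WGraph.copyAvg
  rw [← h2]

/-- Products of functions of the two ends suffice: the indicator of separation is a sum of such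
products, and the indicator of incidence is bounded by one. The two copies are independent, so each
factor is averaged separately. -/
theorem E_randomCopyEdge (hD : W.volume ≠ 0) (a b : W.Copy → ℝ) :
    E (randomCopyEdge W) (fun o => o.elim 0 fun e => a e.1 * b e.2) =
      (∑ u, ∑ v, (W.weight u v : ℝ) * (W.copyAvg a u * W.copyAvg b v)) / W.volume := by
  unfold randomCopyEdge
  rw [E_bind_of inferInstance (by
    intro o
    rcases o with _ | ⟨u, v⟩
    · infer_instance
    · exact finitary_copies W u v), E_randomEdge W hD]
  congr 1
  refine Finset.sum_congr rfl fun u _ => Finset.sum_congr rfl fun v _ => ?_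
  by_cases hw : W.weight u v = 0
  · simp [hw]
  congr 1
  have hu := W.copyCount_pos (W.deg_pos_of_weight hw)
  have hv := W.copyCount_pos (W.deg_pos_of_weight (u := v) (v := u) (by rwa [W.symm]))
  simp only
  rw [E_bind_of inferInstance (by
    intro o
    refine @instFinitaryBind _ _ _ _ _ fun o' => ?_
    rcases o with _ | x <;> rcases o' with _ | y <;> infer_instance), E_randomCopy W hu]
  have h1 : ∀ x : W.Copy, E (randomCopy W v >>= fun o' => (match some x, o' with
      | some x, some y => pure (some (x, y))
      | _, _ => pure none : RandAlg (Option (W.Copy × W.Copy))))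
      (fun o => o.elim 0 fun e => a e.1 * b e.2) = a x * W.copyAvg b v := by
    intro x
    rw [E_bind_of inferInstance (by intro o'; rcases o' with _ | y <;> infer_instance),
      E_randomCopy W hv]
    unfold WGraph.copyAvg
    simp only [E_pure, Option.elim_some]
    rw [← Finset.mul_sum, mul_div_assoc]
  refine (congrArg (· / (W.copyCount u : ℝ)) (Finset.sum_congr rfl fun i _ => h1 ⟨u, i⟩)).trans ?_
  unfold WGraph.copyAvg
  rw [← Finset.sum_mul]
  ring

end

/-! ### The multigraph with a given list of edges -/

/-- An edge has one endpoint on either side. -/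
def Separates {X : Type} (S : Finset X) (e : X × X) : Prop := ¬(e.1 ∈ S ↔ e.2 ∈ S)

section
variable {X : Type}

theorem ofEdges_cons (e : X × X) (es : List (X × X)) {x y : X} (h : x ≠ y) :
    (MultiGraph.ofEdges (e :: es)).mult x y =
      (MultiGraph.ofEdges es).mult x y + if e = (x, y) ∨ e = (y, x) then 1 else 0 := by
  simp only [MultiGraph.ofEdges, if_neg h, List.countP_cons, decide_eq_true_eq]

theorem edges_ofEdges [Fintype X] (es : List (X × X)) (S : Finset X) :
    (MultiGraph.ofEdges es).edges S Sᶜ = es.countP fun e => Separates S e := by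
  induction es with
  | nil => simp [MultiGraph.edges, MultiGraph.ofEdges]
  | cons e es ih =>
    rw [List.countP_cons, ← ih]
    unfold MultiGraph.edges
    have h1 : ∀ x ∈ S, ∀ y ∈ Sᶜ, (MultiGraph.ofEdges (e :: es)).mult x y =
        (MultiGraph.ofEdges es).mult x y +
          ((if e.1 = x then 1 else 0) * (if e.2 = y then 1 else 0) +
            (if e.2 = x then 1 else 0) * (if e.1 = y then 1 else 0)) := by
      intro x hx y hy
      have hxy : x ≠ y := by rintro rfl; exact Finset.mem_compl.1 hy hx
      rw [ofEdges_cons _ _ hxy]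
      congr 1
      obtain ⟨p, q⟩ := e
      simp only [Prod.mk.injEq]
      by_cases h1 : p = x <;> by_cases h2 : q = y <;> by_cases h3 : p = y <;>
        by_cases h4 : q = x <;> simp_all
    rw [Finset.sum_congr rfl fun x hx => Finset.sum_congr rfl fun y hy => h1 x hx y hy]
    simp only [Finset.sum_add_distrib, ← Finset.mul_sum, Finset.sum_ite_eq, ← Finset.sum_mul]
    congr 1
    by_cases h1 : e.1 ∈ S <;> by_cases h2 : e.2 ∈ S <;> simp [Separates, h1, h2]

/-- Only an inequality, because a pair with equal ends counts on the right but gives no edge. -/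
theorem deg_ofEdges_le [Fintype X] (es : List (X × X)) (x : X) :
    (MultiGraph.ofEdges es).deg Finset.univ x ≤ es.countP fun e => e.1 = x ∨ e.2 = x := by
  induction es with
  | nil => simp [MultiGraph.deg, MultiGraph.ofEdges]
  | cons e es ih =>
    rw [List.countP_cons]
    refine le_trans ?_ (add_le_add ih le_rfl)
    unfold MultiGraph.deg
    -- The new pair can join `x` to no vertex but its other end.
    have h1 : ∀ y, (MultiGraph.ofEdges (e :: es)).mult x y ≤
        (MultiGraph.ofEdges es).mult x y +
          (if y = (if e.1 = x then e.2 else e.1) then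
            (if e.1 = x ∨ e.2 = x then 1 else 0) else 0) := by
      intro y
      by_cases hxy : x = y
      · subst hxy; rw [(MultiGraph.ofEdges (e :: es)).loopless]; exact Nat.zero_le _
      rw [ofEdges_cons _ _ hxy]
      refine add_le_add le_rfl ?_
      obtain ⟨p, q⟩ := e
      simp only [Prod.mk.injEq]
      by_cases h1 : p = x <;> by_cases h2 : q = y <;> by_cases h3 : p = y <;>
        by_cases h4 : q = x <;> simp_all
    refine (Finset.sum_le_sum fun y _ => h1 y).trans ?_
    rw [Finset.sum_add_distrib, Finset.sum_ite_eq']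
    simp

theorem countP_reduceOption (es : List (Option X)) (Q : X → Prop) :
    (es.reduceOption.countP fun e => Q e) = es.countP fun o => ∃ e ∈ o, Q e := by
  induction es with
  | nil => rfl
  | cons o es ih =>
    rcases o with _ | e
    · rw [List.reduceOption_cons_of_none, ih, List.countP_cons]; simp
    · rw [List.reduceOption_cons_of_some, List.countP_cons, ih, List.countP_cons]; simp

end

/-! ### Cuts of the copies and the random cuts of the vertices that they induce -/

section
variable {V : Type} [Fintype V] (W : WGraph V)

namespace WGraph

/-- The expected weight that is cut if every vertex goes to the side of a random copy. -/
def blurCut (S : Finset W.Copy) : ℝ :=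
  ∑ u, ∑ v, (W.weight u v : ℝ) * (W.copyAvg (ind S) u * (1 - W.copyAvg (ind S) v))

theorem copyAvg_one {v : V} (hv : 0 < W.copyCount v) : W.copyAvg (fun _ => 1) v = 1 := by
  unfold copyAvg
  have : (W.copyCount v : ℝ) ≠ 0 := by exact_mod_cast hv.ne'
  simp [this]

theorem copyAvg_one_sub {v : V} (hv : 0 < W.copyCount v) (a : W.Copy → ℝ) :
    W.copyAvg (fun x => 1 - a x) v = 1 - W.copyAvg a v := by
  have : (W.copyCount v : ℝ) ≠ 0 := by exact_mod_cast hv.ne'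
  unfold copyAvg
  rw [Finset.sum_sub_distrib, sub_div]
  simp [this]

theorem copyCount_pos_of_weight {u v : V} (h : W.weight u v ≠ 0) :
    0 < W.copyCount u ∧ 0 < W.copyCount v :=
  ⟨W.copyCount_pos (W.deg_pos_of_weight h),
    W.copyCount_pos (W.deg_pos_of_weight (u := v) (v := u) (by rwa [W.symm]))⟩

theorem sum_weight_congr {F F' : V → V → ℝ} (h : ∀ u v, W.weight u v ≠ 0 → F u v = F' u v) :
    ∑ u, ∑ v, (W.weight u v : ℝ) * F u v = ∑ u, ∑ v, (W.weight u v : ℝ) * F' u v := by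
  refine Finset.sum_congr rfl fun u _ => Finset.sum_congr rfl fun v _ => ?_
  by_cases hw : W.weight u v = 0
  · simp [hw]
  · rw [h u v hw]

theorem blurCut_lift (L : Finset V) :
    W.blurCut (Finset.univ.filter fun x => x.1 ∈ L) = W.cutWeight L := by
  rw [W.cutWeight_eq]
  have h1 : ∀ v, 0 < W.copyCount v →
      W.copyAvg (ind (Finset.univ.filter fun x : W.Copy => x.1 ∈ L)) v = ind L v := by
    intro v hv
    have : (W.copyCount v : ℝ) ≠ 0 := by exact_mod_cast hv.ne'
    by_cases h : v ∈ L <;> simp [copyAvg, ind, h, this]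
  refine W.sum_weight_congr fun u v hw => ?_
  rw [h1 u (W.copyCount_pos_of_weight hw).1, h1 v (W.copyCount_pos_of_weight hw).2]

end WGraph

/-- Edges are drawn as ordered pairs, and both orientations contribute equally; hence the factor
two. The sample thus estimates exactly the quantity that the final rounding achieves. -/
theorem pr_copyEdge_separates (hD : W.volume ≠ 0) (S : Finset W.Copy) :
    pr (randomCopyEdge W) (fun o => ∃ e ∈ o, Separates S e) = 2 * W.blurCut S / W.volume := by
  have h1 : ∀ o : Option (W.Copy × W.Copy), @ite ℝ (∃ e ∈ o, Separates S e) (Classical.propDecidable _) 1 0 =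
      (o.elim 0 fun e => ind S e.1 * (1 - ind S e.2)) +
        o.elim 0 fun e => (1 - ind S e.1) * ind S e.2 := by
    intro o
    rcases o with _ | e
    · simp
    · by_cases h1 : e.1 ∈ S <;> by_cases h2 : e.2 ∈ S <;> simp [Separates, ind, h1, h2]
  unfold pr
  refine (congrArg (E _) (funext h1)).trans ?_
  rw [E_add, E_randomCopyEdge W hD (ind S) (fun x => 1 - ind S x),
    E_randomCopyEdge W hD (fun x => 1 - ind S x) (ind S), ← add_div]
  congr 1
  rw [two_mul]
  unfold WGraph.blurCut
  congr 1
  · refine W.sum_weight_congr fun u v hw => ?_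
    rw [W.copyAvg_one_sub (W.copyCount_pos_of_weight hw).2]
  · rw [W.sum_weight_comm]
    refine W.sum_weight_congr fun u v hw => ?_
    rw [W.copyAvg_one_sub (W.copyCount_pos_of_weight hw).2, mul_comm]

/-- The number of copies is proportional to the degree, rounded up, so each copy carries at most
`volume/n` of the degree; there are two ends. -/
theorem pr_copyEdge_incident (hD : W.volume ≠ 0) (z : W.Copy) :
    pr (randomCopyEdge W) (fun o => ∃ e ∈ o, e.1 = z ∨ e.2 = z) ≤ 2 / Fintype.card V := by
  have hn : (0 : ℝ) < Fintype.card V := by exact_mod_cast Fintype.card_pos_iff.2 ⟨z.1⟩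
  have hD0 : (0 : ℝ) < W.volume := by exact_mod_cast pos_iff_ne_zero.2 hD
  have hk : (0 : ℝ) < W.copyCount z.1 := by exact_mod_cast Fin.pos z.2
  set a : W.Copy → ℝ := fun x => if x = z then 1 else 0 with ha
  have h1 : ∀ o : Option (W.Copy × W.Copy), @ite ℝ (∃ e ∈ o, e.1 = z ∨ e.2 = z) (Classical.propDecidable _) 1 0 ≤
      (o.elim 0 fun e => a e.1 * 1) + o.elim 0 fun e => 1 * a e.2 := by
    intro o
    rcases o with _ | e
    · simp
    · by_cases h1 : e.1 = z <;> by_cases h2 : e.2 = z <;> simp [ha, h1, h2]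
  unfold pr
  refine (E_mono (randomCopyEdge W) h1).trans ?_
  rw [E_add, E_randomCopyEdge W hD a fun _ => 1, E_randomCopyEdge W hD (fun _ => 1) a]
  have h2 : ∑ u, ∑ v, (W.weight u v : ℝ) * (W.copyAvg (fun _ => 1) u * W.copyAvg a v) =
      ∑ u, ∑ v, (W.weight u v : ℝ) * (W.copyAvg a u * W.copyAvg (fun _ => 1) v) := by
    rw [W.sum_weight_comm]
    refine W.sum_weight_congr fun u v _ => mul_comm _ _
  have h3 : ∑ u, ∑ v, (W.weight u v : ℝ) * (W.copyAvg a u * W.copyAvg (fun _ => 1) v) =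
      W.deg z.1 / W.copyCount z.1 := by
    have h4 : ∑ u, ∑ v, (W.weight u v : ℝ) * (W.copyAvg a u * W.copyAvg (fun _ => 1) v) =
        ∑ u, ∑ v, (W.weight u v : ℝ) * W.copyAvg a u :=
      W.sum_weight_congr fun u v hw => by
        rw [W.copyAvg_one (W.copyCount_pos_of_weight hw).2, mul_one]
    have h5 : ∀ u, W.copyAvg a u = if u = z.1 then 1 / (W.copyCount z.1 : ℝ) else 0 := by
      intro u
      obtain ⟨z₁, z₂⟩ := z
      unfold WGraph.copyAvg
      split_ifs with h
      · subst h
        congr 1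
        rw [Finset.sum_eq_single z₂]
        · simp [ha]
        · intro i _ hi; simp [ha, hi]
        · simp
      · rw [Finset.sum_eq_zero, zero_div]
        intro i _
        simp only [ha]
        rw [if_neg]
        intro h'
        exact h (congrArg Sigma.fst h')
    rw [h4]
    simp only [← Finset.sum_mul, h5]
    rw [Finset.sum_eq_single z.1]
    · unfold WGraph.deg
      push_cast
      rw [if_pos rfl, mul_one_div]
    · intro u _ hu; simp [hu]
    · simp
  rw [h2, h3, ← add_div]
  have h6 : Fintype.card V * (W.deg z.1 : ℝ) / W.volume ≤ W.copyCount z.1 := by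
    unfold WGraph.copyCount WGraph.volume
    push_cast
    exact Nat.le_ceil _
  rw [div_le_iff₀ hD0] at h6
  rw [← two_mul, div_le_div_iff₀ hD0 hn]
  have h7 : (W.deg z.1 : ℝ) / W.copyCount z.1 * Fintype.card V ≤ W.volume := by
    rw [div_mul_eq_mul_div, div_le_iff₀ hk]
    linarith
  linarith

/-! ### Sides of random copies -/

theorem ens_collect_fst {f : V → RandAlg (Option W.Copy)} (l : List V) :
    Ens (collect (fun v => do
      let x ← f v
      pure (v, x)) l) fun bs _ => bs.map Prod.fst = l := by
  induction l with
  | nil => exact ens_pure.2 rfl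
  | cons a l ih =>
    refine Ens.bind (fun b _ => b.1 = a) ?_ fun b k hb => ?_
    · exact Ens.bind (fun _ _ => True) Ens.true fun x _ _ => ens_pure.2 rfl
    · refine Ens.bind _ ih fun bs j hbs => ens_pure.2 ?_
      rw [List.map_cons, hb, hbs]

theorem prod_map_ite_of_nodup {α β : Type} {bs : List (α × β)} (hbs : (bs.map Prod.fst).Nodup)
    {u : α} {o : β} (h : (u, o) ∈ bs) (g : β → ℝ) :
    (bs.map fun b => if b.1 = u then g b.2 else 1).prod = g o := by
  induction bs with
  | nil => simp at h
  | cons b bs ih =>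
    rw [List.map_cons, List.nodup_cons] at hbs
    rw [List.map_cons, List.prod_cons]
    by_cases hb : b.1 = u
    · have h1 : ∀ b' ∈ bs, b'.1 ≠ u := by
        intro b' hb' e
        exact hbs.1 (by rw [hb, ← e]; exact List.mem_map_of_mem hb')
      have h2 : (bs.map fun b => if b.1 = u then g b.2 else 1).prod = 1 := by
        apply List.prod_eq_one
        intro x hx
        obtain ⟨b', hb', rfl⟩ := List.mem_map.1 hx
        rw [if_neg (h1 b' hb')]
      rw [if_pos hb, h2, mul_one]
      rcases List.mem_cons.1 h with h | h
      · rw [← h]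
      · exact absurd rfl (h1 _ h)
    · rw [if_neg hb, one_mul]
      rcases List.mem_cons.1 h with h | h
      · exact absurd (by rw [← h]) hb
      · exact ih hbs.2 h

/-- The sides of different vertices are independent. The indicator of `u` inside and `v` outside is
written as a product over all vertices, with trivial factors except at `u` and `v`, so that
`E_collect_prod` applies. A pair of positive weight has `u ≠ v`. -/
theorem E_sides (L : Finset W.Copy) :
    E (collect (fun v => do
      let x ← randomCopy W v
      pure (v, x)) (Finset.univ : Finset V).toList)
      (fun sides => W.cutWeight (Finset.univ.filter fun v => ∃ x ∈ L, (v, some x) ∈ sides)) =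
      W.blurCut L := by
  simp only [W.cutWeight_eq]
  rw [E_sum]
  unfold WGraph.blurCut
  refine Finset.sum_congr rfl fun u _ => ?_
  rw [E_sum]
  refine Finset.sum_congr rfl fun v _ => ?_
  rw [E_mul_left]
  by_cases hw : W.weight u v = 0
  · simp [hw]
  congr 1
  obtain ⟨hu, hv⟩ := W.copyCount_pos_of_weight hw
  have huv : u ≠ v := by rintro rfl; exact hw (W.loopless u)
  set q : Option W.Copy → ℝ := fun o => if ∃ x ∈ L, o = some x then 1 else 0 with hq
  set k : V × Option W.Copy → ℝ := fun b =>
    (if b.1 = u then q b.2 else 1) * (if b.1 = v then 1 - q b.2 else 1) with hk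
  have hprod : Ens (collect (fun v => do
      let x ← randomCopy W v
      pure (v, x)) (Finset.univ : Finset V).toList) fun sides _ =>
      ind (Finset.univ.filter fun v => ∃ x ∈ L, (v, some x) ∈ sides) u *
        (1 - ind (Finset.univ.filter fun v => ∃ x ∈ L, (v, some x) ∈ sides) v) =
      (sides.map k).prod := by
    refine (ens_collect_fst W _).mono fun sides _ hs => ?_
    have hnd : (sides.map Prod.fst).Nodup := by rw [hs]; exact Finset.nodup_toList _
    have hmem : ∀ a, ∃ o, (a, o) ∈ sides := by
      intro a
      have : a ∈ sides.map Prod.fst := by rw [hs]; simp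
      obtain ⟨b, hb, rfl⟩ := List.mem_map.1 this
      exact ⟨b.2, hb⟩
    have hind : ∀ a o, (a, o) ∈ sides →
        ind (Finset.univ.filter fun v => ∃ x ∈ L, (v, some x) ∈ sides) a = q o := by
      intro a o hao
      simp only [ind, hq, Finset.mem_filter, Finset.mem_univ, true_and]
      have : (∃ x ∈ L, (a, some x) ∈ sides) ↔ ∃ x ∈ L, o = some x := by
        constructor
        · rintro ⟨x, hx, hx'⟩
          have := List.inj_on_of_nodup_map hnd hao hx' rfl
          exact ⟨x, hx, congrArg Prod.snd this⟩
        · rintro ⟨x, hx, rfl⟩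
          exact ⟨x, hx, hao⟩
      simp only [this]
    obtain ⟨o, ho⟩ := hmem u
    obtain ⟨o', ho'⟩ := hmem v
    rw [hind u o ho, hind v o' ho', hk, List.prod_map_mul, prod_map_ite_of_nodup hnd ho q,
      prod_map_ite_of_nodup hnd ho' fun o => 1 - q o]
  have hqavg : ∀ a, 0 < W.copyCount a → E (randomCopy W a) q = W.copyAvg (ind L) a := by
    intro a ha
    rw [E_randomCopy W ha]
    congr 1
    funext x
    have : (∃ y ∈ L, some x = some y) ↔ x ∈ L :=
      ⟨fun ⟨y, hy, e⟩ => Option.some.inj e ▸ hy, fun h => ⟨x, h, rfl⟩⟩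
    simp only [hq, ind, this]
    congr
  rw [E_congr_of_ens hprod, E_collect_prod _ (fun a =>
    (if a = u then W.copyAvg (ind L) u else 1) * (if a = v then 1 - W.copyAvg (ind L) v else 1))]
  · rw [Finset.prod_map_toList, Finset.prod_mul_distrib, Finset.prod_ite_eq', Finset.prod_ite_eq']
    simp
  · intro a _
    rw [E_bind]
    simp only [E_pure, hk]
    by_cases hau : a = u
    · subst hau
      simp only [if_pos, if_neg huv, mul_one]
      exact hqavg a hu
    · by_cases hav : a = v
      · subst hav
        simp only [if_pos, if_neg hau, one_mul]
        rw [E_sub, E_one, hqavg a hv]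
      · simp only [if_neg hau, if_neg hav, mul_one]
        exact E_one _

end

/-! ### Random sampling to small degree, repetition and selection -/

/-- The relative gain of Balance over a random cut. -/
def Params.gain (p : Params) : ℝ := p.gamma / 1000

/-- The precision of the samples. -/
def Params.tol (p : Params) : ℝ := p.gain / 16

/-- Constants for which the reduction to small degree is analyzed. -/
structure Params.Sampling (p : Params) : Prop extends p.Good where
  sampleConst_ge : 4 * (2 + 32 / p.gain) / p.tol ^ 2 ≤ p.sampleConst
  degConst_ge : 4 * (p.sampleConst + 1) ≤ p.degConst
  repConst_ge : 8 * (2 + 16 / p.tol ^ 2) / p.tol ^ 2 ≤ p.repConst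

namespace Params.Sampling

variable {p : Params}

theorem gain_pos (hp : p.Sampling) : 0 < p.gain := div_pos hp.gamma_pos (by norm_num)

theorem gain_le (hp : p.Sampling) : p.gain ≤ 1 / 1000 := by
  have := hp.gamma_le
  unfold Params.gain
  linarith

theorem tol_pos (hp : p.Sampling) : 0 < p.tol := div_pos hp.gain_pos (by norm_num)

theorem gain_eq (_ : p.Sampling) : p.gain = 16 * p.tol := by unfold Params.tol; ring

theorem tol_le (hp : p.Sampling) : p.tol ≤ 1 := by linarith [hp.gain_le, hp.gain_eq, hp.tol_pos]

theorem sampleConst_sq (hp : p.Sampling) : 2 + 32 / p.gain ≤ p.sampleConst * p.tol ^ 2 / 4 := by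
  have h := hp.sampleConst_ge
  rw [div_le_iff₀ (pow_pos hp.tol_pos 2)] at h
  linarith

theorem sampleConst_half (hp : p.Sampling) : 2 + 32 / p.gain ≤ p.sampleConst / 2 := by
  have h := hp.sampleConst_sq
  have h0 : 0 < 2 + 32 / p.gain := by have := hp.gain_pos; positivity
  have h1 : p.tol ^ 2 ≤ 1 := pow_le_one₀ hp.tol_pos.le hp.tol_le
  have h2 : 0 < p.tol ^ 2 := pow_pos hp.tol_pos 2
  have h3 : 0 ≤ p.sampleConst := by
    by_contra! h4
    nlinarith
  nlinarith

theorem sampleConst_pos (hp : p.Sampling) : 0 < p.sampleConst := by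
  have h := hp.sampleConst_half
  have h0 : 0 < 2 + 32 / p.gain := by have := hp.gain_pos; positivity
  linarith

end Params.Sampling

theorem exp_neg_le_one_div {x : ℝ} (hx : 0 < x) : Real.exp (-x) ≤ 1 / x := by
  rw [Real.exp_neg, ← one_div]
  exact one_div_le_one_div_of_le hx (by linarith [Real.add_one_le_exp x])

section
variable {X : Type} [Fintype X]

theorem toWGraph_cutWeight (G : MultiGraph X) (S : Finset X) :
    G.toWGraph.cutWeight S = G.edges S Sᶜ := by
  simp [WGraph.cutWeight, MultiGraph.toWGraph, MultiGraph.edges]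

theorem E_balance_cutWeight_ge (G : MultiGraph X) {p : Params} (hp : p.Good) :
    (1 / 2 + p.gamma / 1000) * G.toWGraph.maxCut ≤ E (balance G p) G.toWGraph.cutWeight := by
  rw [funext (toWGraph_cutWeight G)]
  exact E_balance_ge G hp

theorem cutWeight_ofEdges (es : List (Option (X × X))) (S : Finset X) :
    (MultiGraph.ofEdges es.reduceOption).toWGraph.cutWeight S =
      (es.countP fun o => ∃ e ∈ o, Separates S e : ℕ) := by
  rw [toWGraph_cutWeight, edges_ofEdges, countP_reduceOption]

theorem deg_ofEdges_reduceOption_le (es : List (Option (X × X))) (x : X) :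
    (MultiGraph.ofEdges es.reduceOption).deg Finset.univ x ≤
      es.countP fun o => ∃ e ∈ o, e.1 = x ∨ e.2 = x :=
  (deg_ofEdges_le _ x).trans_eq (by
    convert countP_reduceOption es fun e => e.1 = x ∨ e.2 = x)

end

section
variable {V : Type} [Fintype V] (W : WGraph V)

theorem one_le_logSize : 1 ≤ logSize V := Nat.clog_pos (by norm_num) (by omega)

theorem card_le_exp_logSize : (Fintype.card V : ℝ) ≤ Real.exp (logSize V) := by
  have h1 : Fintype.card V ≤ 2 ^ logSize V := by
    have := Nat.le_pow_clog (b := 2) (by norm_num) (Fintype.card V + 2)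
    unfold logSize
    omega
  calc (Fintype.card V : ℝ) ≤ 2 ^ logSize V := by exact_mod_cast h1
    _ ≤ Real.exp 1 ^ logSize V :=
        pow_le_pow_left₀ (by norm_num) (by linarith [Real.add_one_le_exp (1 : ℝ)]) _
    _ = Real.exp (logSize V) := by rw [← Real.exp_nat_mul, mul_one]

/-- All cuts of the copies have about the expected size in the sample, and the sample has small
degrees. -/
def GoodSample (p : Params) (es : List (Option (W.Copy × W.Copy))) : Prop :=
  (∀ S : Finset W.Copy, |((es.countP fun o => ∃ e ∈ o, Separates S e : ℕ) : ℝ) -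
      ⌈p.sampleConst * Fintype.card V⌉₊ *
        pr (randomCopyEdge W) (fun o => ∃ e ∈ o, Separates S e)| ≤
      ⌈p.sampleConst * Fintype.card V⌉₊ * p.tol) ∧
    ∀ z : W.Copy, ((es.countP fun o => ∃ e ∈ o, e.1 = z ∨ e.2 = z : ℕ) : ℝ) ≤
      p.degConst * logSize V

/-- Two union bounds: at most `2^{2n}` cuts against a Chernoff exponent linear in `n`, and at most
`2n` copies against an exponent proportional to `logSize V`. A constant failure probability is
enough, because repetition takes care of the rest. -/
theorem pr_not_goodSample_le {p : Params} (hp : p.Sampling) (hD : W.volume ≠ 0) :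
    pr (repeated ⌈p.sampleConst * Fintype.card V⌉₊ (randomCopyEdge W))
      (fun es => ¬GoodSample W p es) ≤ p.gain / 8 := by
  have hg := hp.gain_pos
  have hs := hp.sampleConst_pos
  have hne : Nonempty V := by
    by_contra h
    rw [not_nonempty_iff] at h
    exact hD (by simp [WGraph.volume])
  have hn : (1 : ℝ) ≤ Fintype.card V := by exact_mod_cast Fintype.card_pos
  set n : ℝ := (Fintype.card V : ℝ) with hndef
  set w := ⌈p.sampleConst * n⌉₊ with hw
  have hw0 : p.sampleConst * n ≤ w := Nat.le_ceil _
  have hw1 : (w : ℝ) ≤ p.sampleConst * n + 1 := (Nat.ceil_lt_add_one (by positivity)).le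
  have hlS : (1 : ℝ) ≤ logSize V := by exact_mod_cast one_le_logSize (V := V)
  have hnS : n ≤ Real.exp (logSize V) := card_le_exp_logSize
  have hcopy : (Fintype.card W.Copy : ℝ) ≤ 2 * n := by rw [hndef]; exact_mod_cast W.card_copy_le
  have hexp : Real.exp (-(32 / p.gain)) ≤ p.gain / 32 :=
    (exp_neg_le_one_div (by positivity)).trans (by rw [one_div_div])
  set x := repeated w (randomCopyEdge W) with hx
  have hA : pr x (fun es => ∃ S ∈ (Finset.univ : Finset (Finset W.Copy)),
      (w : ℝ) * (p.tol * 1) ≤ |((es.countP fun o => ∃ e ∈ o, Separates S e : ℕ) : ℝ) -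
        w * pr (randomCopyEdge W) (fun o => ∃ e ∈ o, Separates S e)|) ≤ p.gain / 16 := by
    refine (pr_exists_le_card x _ _ (c := 2 * Real.exp (-(w * p.tol ^ 2 * 1 / 4)))
      fun S _ => ?_).trans ?_
    · convert chernoff (randomCopyEdge W) (fun o => ∃ e ∈ o, Separates S e) w
        (M := 1) (pr_le_one _ _) hp.tol_pos.le hp.tol_le
    · rw [Finset.card_univ, Fintype.card_finset]
      push_cast
      have h1 : (2 : ℝ) ^ Fintype.card W.Copy ≤ Real.exp (2 * n) := by
        calc (2 : ℝ) ^ Fintype.card W.Copy ≤ Real.exp 1 ^ Fintype.card W.Copy :=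
              pow_le_pow_left₀ (by norm_num) (by linarith [Real.add_one_le_exp (1 : ℝ)]) _
          _ = Real.exp (Fintype.card W.Copy) := by rw [← Real.exp_nat_mul, mul_one]
          _ ≤ _ := Real.exp_le_exp.2 hcopy
      have h2 : (2 + 32 / p.gain) * n ≤ w * p.tol ^ 2 * 1 / 4 := by
        have h3 := mul_le_mul_of_nonneg_right hp.sampleConst_sq (by linarith : 0 ≤ n)
        have h4 := mul_le_mul_of_nonneg_right hw0 (pow_nonneg hp.tol_pos.le 2)
        linarith
      have h5 : 32 / p.gain ≤ 32 / p.gain * n := le_mul_of_one_le_right (by positivity) hn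
      calc (2 : ℝ) ^ Fintype.card W.Copy * (2 * Real.exp (-(w * p.tol ^ 2 * 1 / 4))) ≤
            Real.exp (2 * n) * (2 * Real.exp (-((2 + 32 / p.gain) * n))) := by
            refine mul_le_mul h1 ?_ (by positivity) (by positivity)
            exact mul_le_mul_of_nonneg_left (Real.exp_le_exp.2 (neg_le_neg h2)) (by norm_num)
        _ = 2 * Real.exp (-(32 / p.gain * n)) := by
            rw [mul_left_comm, ← Real.exp_add]; congr 2; ring
        _ ≤ 2 * Real.exp (-(32 / p.gain)) :=
            mul_le_mul_of_nonneg_left (Real.exp_le_exp.2 (neg_le_neg h5)) (by norm_num)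
        _ ≤ _ := by linarith
  -- The true probability is at most `2/n`. The larger bound is used to obtain an exponent of order
  -- `logSize V`, at the price of logarithmic degrees.
  set M : ℝ := 2 * logSize V / n with hM
  have hn0 : 0 < n := by linarith
  have hpM : ∀ z : W.Copy,
      pr (randomCopyEdge W) (fun o => ∃ e ∈ o, e.1 = z ∨ e.2 = z) ≤ M := fun z =>
    (pr_copyEdge_incident W hD z).trans (div_le_div_of_nonneg_right (by linarith) hn0.le)
  have hB : pr x (fun es => ∃ z ∈ (Finset.univ : Finset W.Copy),
      (w : ℝ) * (pr (randomCopyEdge W) (fun o => ∃ e ∈ o, e.1 = z ∨ e.2 = z) + 1 * M) ≤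
        (es.countP fun o => ∃ e ∈ o, e.1 = z ∨ e.2 = z : ℕ)) ≤ p.gain / 16 := by
    refine (pr_exists_le_card x _ _ (c := Real.exp (-(w * 1 ^ 2 * M / 4)))
      fun z _ => ?_).trans ?_
    · convert chernoff_upper (randomCopyEdge W) (fun o => ∃ e ∈ o, e.1 = z ∨ e.2 = z) w
        (M := M) (hpM z) zero_le_one le_rfl
    · rw [Finset.card_univ]
      have h1 : (2 + 32 / p.gain) * logSize V ≤ w * 1 ^ 2 * M / 4 := by
        have h2 : p.sampleConst * n * M ≤ w * M := mul_le_mul_of_nonneg_right hw0 (by positivity)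
        have h3 : p.sampleConst * n * M = 2 * (p.sampleConst * logSize V) := by
          rw [hM]; field_simp
        have h4 := mul_le_mul_of_nonneg_right hp.sampleConst_half (by linarith : (0 : ℝ) ≤ logSize V)
        linarith
      have h5 : 32 / p.gain ≤ 32 / p.gain * logSize V := le_mul_of_one_le_right (by positivity) hlS
      calc (Fintype.card W.Copy : ℝ) * Real.exp (-(w * 1 ^ 2 * M / 4)) ≤
            (2 * Real.exp (logSize V)) * Real.exp (-((2 + 32 / p.gain) * logSize V)) :=
            mul_le_mul (by linarith) (Real.exp_le_exp.2 (neg_le_neg h1)) (by positivity)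
              (by positivity)
        _ = 2 * Real.exp (-(logSize V + 32 / p.gain * logSize V)) := by
            rw [mul_assoc, ← Real.exp_add]; congr 2; ring
        _ ≤ 2 * Real.exp (-(32 / p.gain)) :=
            mul_le_mul_of_nonneg_left (Real.exp_le_exp.2 (by linarith)) (by norm_num)
        _ ≤ _ := by linarith
  refine (pr_mono x fun es hes => ?_).trans ((pr_or_le x _ _).trans
    ((add_le_add hA hB).trans (by linarith)))
  by_contra hcon
  rw [not_or] at hcon
  obtain ⟨hc1, hc2⟩ := hcon
  push Not at hc1 hc2
  refine hes ⟨fun S => ?_, fun z => ?_⟩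
  · have := hc1 S (Finset.mem_univ _)
    rw [mul_one] at this
    exact this.le
  · refine (hc2 z (Finset.mem_univ _)).le.trans ?_
    have h1 : (w : ℝ) * (pr (randomCopyEdge W) (fun o => ∃ e ∈ o, e.1 = z ∨ e.2 = z) + 1 * M) ≤
        (p.sampleConst * n + n) * (2 * M) :=
      mul_le_mul (by linarith) (by linarith [hpM z])
        (by have := pr_nonneg (randomCopyEdge W) (fun o => ∃ e ∈ o, e.1 = z ∨ e.2 = z)
            positivity) (by positivity)
    have h2 : (p.sampleConst * n + n) * (2 * M) = 4 * (p.sampleConst + 1) * logSize V := by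
      rw [hM]; field_simp; ring
    rw [h2] at h1
    exact h1.trans (mul_le_mul_of_nonneg_right hp.degConst_ge (by linarith))

/-- The part of the reduction that follows the choice of the random edges. -/
def balanceSample (p : Params) (es : List (Option (W.Copy × W.Copy))) : RandAlg (Finset V) := do
  let H := MultiGraph.ofEdges es.reduceOption
  tick (logSize V * (Fintype.card V + es.length))
  if (H.maxDeg : ℝ) ≤ p.degConst * logSize V then
    let L ← balance H p
    let sides ← collect (fun v => do
      let x ← randomCopy W v
      pure (v, x)) Finset.univ.toList
    pure (Finset.univ.filter fun v => ∃ x ∈ L, (v, some x) ∈ sides)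
  else randomCut Finset.univ

theorem reduceAndBalance_eq (p : Params) : reduceAndBalance W p = (do
    tick (logSize V * (Fintype.card V + 1))
    let es ← repeated ⌈p.sampleConst * Fintype.card V⌉₊ (randomCopyEdge W)
    balanceSample W p es) := rfl

instance (p : Params) (es : List (Option (W.Copy × W.Copy))) :
    Finitary (balanceSample W p es) := by
  unfold balanceSample
  refine @instFinitaryBind _ _ _ _ _ fun _ => ?_
  split_ifs <;> infer_instance

instance (p : Params) : Finitary (reduceAndBalance W p) := by
  rw [reduceAndBalance_eq]; infer_instance

/-- Markov's inequality for `M - f`: a function bounded above whose expectation is large is not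
often small. -/
theorem pr_lt_le {α : Type} (x : RandAlg α) [Finitary x] {f : α → ℝ} {M a : ℝ}
    (hf : ∀ y, f y ≤ M) : (M - a) * pr x (fun y => f y < a) ≤ M - E x f := by
  have h : E x f ≤ E x fun y => M - (M - a) * (if f y < a then 1 else 0) := by
    refine E_mono x fun y => ?_
    split_ifs with h
    · linarith
    · linarith [hf y]
  rw [E_sub, E_const, E_mul_left] at h
  unfold pr
  linarith

/-- In a good sample all cuts `S` at once have size `w · 2 blurCut S / volume` up to `w · tol`.
Uniformity is needed, since the output of Balance depends on the sample. The guarantee of Balance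
carries over with a loss of at most `4 tol · maxCut`, a quarter of the gain. -/
theorem E_balanceSample_ge {p : Params} (hp : p.Sampling) (hD : W.volume ≠ 0)
    {es : List (Option (W.Copy × W.Copy))} (hes : GoodSample W p es) :
    (1 / 2 + 3 / 4 * p.gain) * W.maxCut ≤ E (balanceSample W p es) W.cutWeight := by
  have hg := hp.gain_pos
  have hg1 := hp.gain_le
  have hD0 : (0 : ℝ) < W.volume := by exact_mod_cast pos_iff_ne_zero.2 hD
  have hn : 0 < Fintype.card V := by
    rw [Fintype.card_pos_iff]
    by_contra h
    rw [not_nonempty_iff] at h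
    exact hD (by simp [WGraph.volume])
  set w : ℝ := (⌈p.sampleConst * Fintype.card V⌉₊ : ℝ) with hw
  have hw0 : 0 < w := by
    have : 0 < ⌈p.sampleConst * Fintype.card V⌉₊ := by
      rw [Nat.ceil_pos]
      have := hp.sampleConst_pos
      have : (0 : ℝ) < Fintype.card V := by exact_mod_cast hn
      positivity
    rw [hw]; exact_mod_cast this
  set H := MultiGraph.ofEdges es.reduceOption with hH
  have hedges : ∀ S : Finset W.Copy,
      |H.toWGraph.cutWeight S - w * (2 * W.blurCut S / W.volume)| ≤ w * p.tol := by
    intro S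
    rw [← pr_copyEdge_separates W hD, hH, cutWeight_ofEdges]
    convert hes.1 S
  have hdeg : (H.maxDeg : ℝ) ≤ p.degConst * logSize V := by
    have h0 : 0 ≤ p.degConst * logSize V :=
      mul_nonneg (by linarith [hp.degConst_ge, hp.sampleConst_pos]) (Nat.cast_nonneg _)
    have : H.maxDeg ≤ ⌊p.degConst * logSize V⌋₊ := by
      refine Finset.sup_le fun z _ => (deg_ofEdges_reduceOption_le _ z).trans (Nat.le_floor ?_)
      refine le_trans (le_of_eq ?_) (hes.2 z)
      congr!
    exact (Nat.cast_le.2 this).trans (Nat.floor_le h0)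
  obtain ⟨L, hL⟩ := W.exists_cutWeight_eq_maxCut
  have hmax : w * (2 * W.maxCut / W.volume) - w * p.tol ≤ H.toWGraph.maxCut := by
    set S : Finset W.Copy := Finset.univ.filter fun x => x.1 ∈ L with hS
    have h1 := abs_le.1 (hedges S)
    rw [hS, W.blurCut_lift, hL, ← hS] at h1
    have h2 := H.toWGraph.cutWeight_le_maxCut S
    linarith
  have hbal := E_balance_cutWeight_ge H hp.toGood
  have hblur : ∀ S : Finset W.Copy,
      W.volume / 2 * (H.toWGraph.cutWeight S / w - p.tol) ≤ W.blurCut S := by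
    intro S
    have h1 := (abs_le.1 (hedges S)).2
    have h2 : H.toWGraph.cutWeight S / w - p.tol ≤ 2 * W.blurCut S / W.volume := by
      rw [sub_le_iff_le_add, div_le_iff₀ hw0]
      linarith
    rw [le_div_iff₀ hD0] at h2
    linarith
  have hE : E (balanceSample W p es) W.cutWeight = E (balance H p) W.blurCut := by
    unfold balanceSample
    simp only
    rw [← hH, if_pos hdeg, E_tick_bind, E_bind]
    congr 1
    funext L
    rw [E_bind]
    simp only [E_pure]
    exact E_sides W L
  rw [hE]
  refine le_trans ?_ (E_mono (balance H p) hblur)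
  have h1 : E (balance H p) (fun S => W.volume / 2 * (H.toWGraph.cutWeight S / w - p.tol)) =
      W.volume / 2 * (E (balance H p) H.toWGraph.cutWeight / w - p.tol) := by
    rw [E_mul_left, E_sub, E_const]
    simp only [div_eq_mul_inv]
    rw [E_mul_right]
  rw [h1]
  have h2 : (1 / 2 + p.gain) * (2 * W.maxCut / W.volume - p.tol) ≤
      E (balance H p) H.toWGraph.cutWeight / w := by
    rw [le_div_iff₀ hw0]
    refine le_trans ?_ hbal
    have : (1 / 2 + p.gain) * (w * (2 * W.maxCut / W.volume) - w * p.tol) ≤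
        (1 / 2 + p.gain) * H.toWGraph.maxCut := mul_le_mul_of_nonneg_left hmax (by linarith)
    have e : (1 / 2 + p.gamma / 1000) = 1 / 2 + p.gain := rfl
    rw [e]
    linarith
  have h3 : W.volume / 2 * ((1 / 2 + p.gain) * (2 * W.maxCut / W.volume - p.tol) - p.tol) ≤
      W.volume / 2 * (E (balance H p) H.toWGraph.cutWeight / w - p.tol) :=
    mul_le_mul_of_nonneg_left (by linarith) (by positivity)
  refine le_trans ?_ h3
  have h4 : W.volume / 2 * ((1 / 2 + p.gain) * (2 * W.maxCut / W.volume - p.tol) - p.tol) =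
      (1 / 2 + p.gain) * W.maxCut - W.volume / 4 * (2 * p.tol * (3 / 2 + p.gain)) := by
    field_simp
    ring
  rw [h4]
  have h5 : W.volume / 4 * (2 * p.tol * (3 / 2 + p.gain)) ≤ W.maxCut * (4 * p.tol) := by
    refine mul_le_mul W.volume_le_maxCut ?_ (by have := hp.tol_pos; positivity) W.maxCut_nonneg
    nlinarith [hp.tol_pos]
  have h6 : W.maxCut * (4 * p.tol) = W.maxCut * p.gain / 4 := by rw [hp.gain_eq]; ring
  linarith

/-- No cut exceeds the optimum, so an expectation of `1/2 + 3 gain/4` of it forces `1/2 + gain/2`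
with probability at least `gain/4`. A bad sample takes away at most `gain/8`. -/
theorem pr_reduceAndBalance_lt_le {p : Params} (hp : p.Sampling) (hD : W.volume ≠ 0) :
    pr (reduceAndBalance W p) (fun L => W.cutWeight L < (1 / 2 + p.gain / 2) * W.maxCut) ≤
      1 - p.gain / 8 := by
  have hg := hp.gain_pos
  have hg1 := hp.gain_le
  have hM : 0 < W.maxCut := by
    have hD0 : (0 : ℝ) < W.volume := by exact_mod_cast pos_iff_ne_zero.2 hD
    linarith [W.volume_le_maxCut]
  rw [reduceAndBalance_eq]
  have h1 : ∀ es, ¬¬GoodSample W p es → pr (balanceSample W p es)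
      (fun L => W.cutWeight L < (1 / 2 + p.gain / 2) * W.maxCut) ≤ 1 - p.gain / 4 := by
    intro es hes
    have h2 := E_balanceSample_ge W hp hD (not_not.1 hes)
    have h3 := pr_lt_le (balanceSample W p es) (f := W.cutWeight) (M := W.maxCut)
      (a := (1 / 2 + p.gain / 2) * W.maxCut) W.cutWeight_le_maxCut
    set q := pr (balanceSample W p es)
      (fun L => W.cutWeight L < (1 / 2 + p.gain / 2) * W.maxCut)
    have h4 : W.maxCut * ((1 / 2 - p.gain / 2) * q) ≤
        W.maxCut * (1 / 2 - 3 / 4 * p.gain) := by linarith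
    have h5 := le_of_mul_le_mul_left h4 hM
    nlinarith
  have h2 := pr_bind_le (x := repeated ⌈p.sampleConst * Fintype.card V⌉₊ (randomCopyEdge W))
    (f := balanceSample W p) (Q := fun L => W.cutWeight L < (1 / 2 + p.gain / 2) * W.maxCut)
    _ (pr_not_goodSample_le W hp hD) (by linarith) h1
  have h3 : pr (do
      tick (logSize V * (Fintype.card V + 1))
      let es ← repeated ⌈p.sampleConst * Fintype.card V⌉₊ (randomCopyEdge W)
      balanceSample W p es)
      (fun L => W.cutWeight L < (1 / 2 + p.gain / 2) * W.maxCut) = pr (do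
      let es ← repeated ⌈p.sampleConst * Fintype.card V⌉₊ (randomCopyEdge W)
      balanceSample W p es)
      (fun L => W.cutWeight L < (1 / 2 + p.gain / 2) * W.maxCut) := by
    unfold pr
    rw [E_tick_bind]
  rw [h3]
  exact h2.trans (by linarith)

end

theorem Params.Sampling.repConst_sq {p : Params} (hp : p.Sampling) :
    2 + 16 / p.tol ^ 2 ≤ p.repConst * p.tol ^ 2 / 8 := by
  have h := hp.repConst_ge
  rw [div_le_iff₀ (pow_pos hp.tol_pos 2)] at h
  linarith

theorem Params.Sampling.repConst_pos {p : Params} (hp : p.Sampling) : 0 < p.repConst := by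
  have h := hp.repConst_sq
  have h0 : 0 < 2 + 16 / p.tol ^ 2 := by have := hp.tol_pos; positivity
  have h1 : 0 < p.tol ^ 2 := pow_pos hp.tol_pos 2
  by_contra! h2
  nlinarith

theorem Params.Sampling.repConst_gain {p : Params} (hp : p.Sampling) :
    2 ≤ p.repConst * p.gain / 8 := by
  have h := hp.repConst_sq
  have h1 : p.tol ^ 2 ≤ p.gain := by
    have := hp.tol_pos
    have := hp.tol_le
    rw [hp.gain_eq]; nlinarith
  have h2 : p.repConst * p.tol ^ 2 ≤ p.repConst * p.gain :=
    mul_le_mul_of_nonneg_left h1 hp.repConst_pos.le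
  have h3 : 0 ≤ 16 / p.tol ^ 2 := by positivity
  linarith

section
variable {V : Type} [Fintype V] (W : WGraph V)

theorem pr_randomEdge_separates (hD : W.volume ≠ 0) (L : Finset V) :
    pr (randomEdge W) (fun o => ∃ e ∈ o, Separates L e) = 2 * W.cutWeight L / W.volume := by
  unfold pr
  rw [E_randomEdge W hD, W.two_mul_cutWeight]
  congr 1
  refine W.sum_weight_congr fun u v _ => ?_
  by_cases h1 : u ∈ L <;> by_cases h2 : v ∈ L <;> simp [Separates, ind, h1, h2]

instance (p : Params) : Finitary (approxMaxCut W p) := by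
  unfold approxMaxCut; infer_instance

theorem exp_neg_two_logSize_le (hn : 0 < Fintype.card V) :
    Real.exp (-(2 * logSize V)) ≤ 1 / Fintype.card V / 2 := by
  have hn0 : (0 : ℝ) < Fintype.card V := by exact_mod_cast hn
  have h1 : (1 : ℝ) ≤ logSize V := by exact_mod_cast one_le_logSize (V := V)
  have h2 : 2 * (Fintype.card V : ℝ) ≤ Real.exp (2 * logSize V) := by
    rw [two_mul (logSize V : ℝ), Real.exp_add]
    exact mul_le_mul (by linarith [Real.add_one_le_exp (logSize V : ℝ)]) card_le_exp_logSize
      hn0.le (Real.exp_pos _).le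
  rw [Real.exp_neg, div_div, ← one_div]
  exact one_div_le_one_div_of_le (by positivity) (by linarith)

/-- Two failures, each of probability at most `1/(2n)`: none of the `r` cuts is good, or the fresh
edges misjudge one of these cuts by more than `tol`. Otherwise the selected cut loses at most `tol ·
volume ≤ 4 tol · maxCut`, a quarter of the gain, against the good one. -/
theorem pr_approxMaxCut_lt_le {p : Params} (hp : p.Sampling) (hD : W.volume ≠ 0) :
    pr (approxMaxCut W p) (fun L => W.cutWeight L < (1 / 2 + p.gain / 4) * W.maxCut) ≤
      1 / Fintype.card V := by
  have hg := hp.gain_pos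
  have hg1 := hp.gain_le
  have ht := hp.tol_pos
  have hD0 : (0 : ℝ) < W.volume := by exact_mod_cast pos_iff_ne_zero.2 hD
  have hn : 0 < Fintype.card V := by
    rw [Fintype.card_pos_iff]
    by_contra h
    rw [not_nonempty_iff] at h
    exact hD (by simp [WGraph.volume])
  have hexp := exp_neg_two_logSize_le hn
  set ν : ℝ := 1 / Fintype.card V with hν
  have hlS : (1 : ℝ) ≤ logSize V := by exact_mod_cast one_le_logSize (V := V)
  set r := ⌈p.repConst * logSize V⌉₊ with hr
  have hr0 : p.repConst * logSize V ≤ r := Nat.le_ceil _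
  have hrpos : 0 < r := by
    rw [hr, Nat.ceil_pos]
    have := hp.repConst_pos
    positivity
  have hr' : (0 : ℝ) < r := by exact_mod_cast hrpos
  set good : Finset V → Prop := fun L => ¬W.cutWeight L < (1 / 2 + p.gain / 2) * W.maxCut with hgood
  have hA : pr (repeated r (reduceAndBalance W p))
      (fun cuts => ¬(cuts.length = r ∧ ∃ L ∈ cuts, good L)) ≤ ν / 2 := by
    have h1 : pr (repeated r (reduceAndBalance W p))
        (fun cuts => ¬(cuts.length = r ∧ ∃ L ∈ cuts, good L)) ≤
        pr (repeated r (reduceAndBalance W p)) fun cuts =>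
          ∀ L ∈ cuts, W.cutWeight L < (1 / 2 + p.gain / 2) * W.maxCut := by
      refine pr_mono_of_ens ((ens_repeated_length _ r).mono fun cuts _ hl h => ?_)
      by_contra! h'
      obtain ⟨L, hL, hL'⟩ := h'
      exact h ⟨hl, L, hL, not_lt.2 hL'⟩
    refine h1.trans ?_
    rw [pr_repeated_all]
    calc pr (reduceAndBalance W p)
          (fun L => W.cutWeight L < (1 / 2 + p.gain / 2) * W.maxCut) ^ r ≤
          Real.exp (-(p.gain / 8)) ^ r :=
          pow_le_pow_left₀ (pr_nonneg _ _) ((pr_reduceAndBalance_lt_le W hp hD).trans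
            (by linarith [Real.add_one_le_exp (-(p.gain / 8))])) r
      _ = Real.exp (-(r * (p.gain / 8))) := by rw [← Real.exp_nat_mul]; congr 1; ring
      _ ≤ Real.exp (-(2 * logSize V)) := by
          refine Real.exp_le_exp.2 (neg_le_neg ?_)
          have h2 := mul_le_mul_of_nonneg_right hr0 hg.le
          have h3 := mul_le_mul_of_nonneg_right hp.repConst_gain (by linarith : (0 : ℝ) ≤ logSize V)
          linarith
      _ ≤ ν / 2 := hexp
  have hB : ∀ cuts : List (Finset V), cuts.length = r →
      pr (repeated r (randomEdge W)) (fun es => ∃ L ∈ cuts.toFinset,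
        (r : ℝ) * (p.tol * 1) ≤ |((es.countP fun o => ∃ e ∈ o, Separates L e : ℕ) : ℝ) -
          r * pr (randomEdge W) (fun o => ∃ e ∈ o, Separates L e)|) ≤ ν / 2 := by
    intro cuts hcuts
    refine (pr_exists_le_card _ _ _ (c := 2 * Real.exp (-(r * p.tol ^ 2 * 1 / 4)))
      fun L _ => ?_).trans ?_
    · convert chernoff (randomEdge W) (fun o => ∃ e ∈ o, Separates L e) r
        (M := 1) (pr_le_one _ _) ht.le hp.tol_le
    · have hcard : (cuts.toFinset.card : ℝ) ≤ r := by
        rw [← hcuts]; exact_mod_cast List.toFinset_card_le cuts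
      -- The exponent is `2y` and `r = 8y / tol²`, so one factor `e^{-y}` absorbs the number of cuts
      -- in the union bound and the other gives `1/(2n)`.
      set y := (r : ℝ) * p.tol ^ 2 / 8 with hy
      have hy1 : (2 + 16 / p.tol ^ 2) * logSize V ≤ y := by
        have h2 := mul_le_mul_of_nonneg_right hr0 (pow_nonneg ht.le 2)
        have h3 := mul_le_mul_of_nonneg_right hp.repConst_sq (by linarith : (0 : ℝ) ≤ logSize V)
        rw [hy]
        linarith
      have h16 : 0 ≤ 16 / p.tol ^ 2 := by positivity
      have hy2 : 2 * (logSize V : ℝ) + 16 / p.tol ^ 2 ≤ y := by nlinarith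
      have hyexp : y * Real.exp (-y) ≤ 1 := by
        rw [Real.exp_neg, ← div_eq_mul_inv, div_le_one (Real.exp_pos _)]
        linarith [Real.add_one_le_exp y]
      have hsmall : 16 / p.tol ^ 2 * Real.exp (-(16 / p.tol ^ 2)) ≤ 1 := by
        have := exp_neg_le_one_div (show 0 < 16 / p.tol ^ 2 by positivity)
        have h4 := mul_le_mul_of_nonneg_left this h16
        rwa [mul_one_div_cancel (by positivity)] at h4
      calc (cuts.toFinset.card : ℝ) * (2 * Real.exp (-(r * p.tol ^ 2 * 1 / 4))) ≤
            r * (2 * Real.exp (-(r * p.tol ^ 2 * 1 / 4))) :=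
            mul_le_mul_of_nonneg_right hcard (by positivity)
        _ = 16 / p.tol ^ 2 * (y * Real.exp (-y)) * Real.exp (-y) := by
            have e1 : -((r : ℝ) * p.tol ^ 2 * 1 / 4) = -y + -y := by rw [hy]; ring
            rw [e1, Real.exp_add, hy]
            field_simp
            ring
        _ ≤ 16 / p.tol ^ 2 * 1 * Real.exp (-y) :=
            mul_le_mul_of_nonneg_right (mul_le_mul_of_nonneg_left hyexp h16) (Real.exp_pos _).le
        _ ≤ 16 / p.tol ^ 2 * 1 * Real.exp (-(2 * logSize V) + -(16 / p.tol ^ 2)) :=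
            mul_le_mul_of_nonneg_left (Real.exp_le_exp.2 (by linarith)) (by positivity)
        _ = 16 / p.tol ^ 2 * Real.exp (-(16 / p.tol ^ 2)) * Real.exp (-(2 * logSize V)) := by
            rw [Real.exp_add]; ring
        _ ≤ 1 * Real.exp (-(2 * logSize V)) :=
            mul_le_mul_of_nonneg_right hsmall (Real.exp_pos _).le
        _ ≤ ν / 2 := by rw [one_mul]; exact hexp
  unfold approxMaxCut
  rw [← hr]
  refine (pr_bind_le _ hA (d := ν / 2) (by positivity) fun cuts hcuts => ?_).trans_eq (by ring)
  rw [not_not] at hcuts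
  obtain ⟨hlen, L, hL, hLgood⟩ := hcuts
  refine (pr_bind_le _ (hB cuts hlen) le_rfl fun es hes => ?_).trans_eq (add_zero _)
  refine le_of_eq (pr_eq_zero ?_)
  refine ens_tick_bind (f := fun _ => pure _) (ens_pure.2 ?_)
  push Not at hes
  set F : Finset V → ℕ := fun L =>
    es.reduceOption.countP fun e => ¬(e.1 ∈ L ↔ e.2 ∈ L) with hF
  have hFcount : ∀ L ∈ cuts, |(F L : ℝ) - r * (2 * W.cutWeight L / W.volume)| < r * p.tol := by
    intro L hL
    have h1 := hes L (List.mem_toFinset.2 hL)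
    rw [mul_one, pr_randomEdge_separates W hD] at h1
    refine lt_of_eq_of_lt ?_ h1
    have : F L = es.countP fun o => ∃ e ∈ o, Separates L e := by
      rw [← countP_reduceOption]
      exact List.countP_congr fun e _ => by
        rw [decide_eq_true_iff, decide_eq_true_iff]; exact Iff.rfl
    rw [this]
  have hne : cuts.argmax F ≠ none := by
    rw [Ne, List.argmax_eq_none]
    rintro rfl
    simp at hL
  obtain ⟨M, hM⟩ := Option.ne_none_iff_exists'.1 hne
  have hMmem : M ∈ cuts := List.argmax_mem (Option.mem_def.2 hM)
  have hLM : F L ≤ F M := List.le_of_mem_argmax hL (Option.mem_def.2 hM)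
  rw [hM, Option.getD_some, not_lt]
  have h1 := abs_lt.1 (hFcount L hL)
  have h2 := abs_lt.1 (hFcount M hMmem)
  have h3 : (F L : ℝ) ≤ F M := by exact_mod_cast hLM
  have h4 : (r : ℝ) * (2 * W.cutWeight L / W.volume - 2 * p.tol) ≤
      r * (2 * W.cutWeight M / W.volume) := by linarith
  have h5 := le_of_mul_le_mul_left h4 hr'
  rw [le_div_iff₀ hD0, sub_mul, div_mul_cancel₀ _ hD0.ne'] at h5
  have h6 := W.volume_le_maxCut
  have h7 : (1 / 2 + p.gain / 2) * W.maxCut ≤ W.cutWeight L := not_lt.1 hLgood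
  have h8 : W.volume / 4 * (16 * p.tol) ≤ W.maxCut * (16 * p.tol) :=
    mul_le_mul_of_nonneg_right h6 (by positivity)
  have h9 : W.maxCut * (16 * p.tol) = W.maxCut * p.gain := by rw [hp.gain_eq]
  linarith

/-- The approximation factor on weighted graphs. -/
theorem prob_approxMaxCut_ge {p : Params} (hp : p.Sampling) :
    1 - 1 / (Fintype.card V : ℝ) ≤
      (approxMaxCut W p).prob {L | (1 / 2 + p.gain / 4) * W.maxCut ≤ W.cutWeight L} := by
  rw [prob_eq]
  have h1 := pr_not (approxMaxCut W p)
    (fun L => W.cutWeight L < (1 / 2 + p.gain / 4) * W.maxCut)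
  simp only [not_lt] at h1
  simp only [Set.mem_ofPred_eq]
  rw [h1]
  by_cases hD : W.volume = 0
  · have h2 : pr (approxMaxCut W p)
        (fun L => W.cutWeight L < (1 / 2 + p.gain / 4) * W.maxCut) = 0 := by
      refine pr_eq_zero (Ens.true.mono fun L _ _ => ?_)
      rw [W.maxCut_eq_zero hD, mul_zero, not_lt]
      exact W.cutWeight_nonneg L
    rw [h2]
    have : 0 ≤ 1 / (Fintype.card V : ℝ) := by positivity
    linarith
  · linarith [pr_approxMaxCut_lt_le W hp hD]


/-! ### The running time on weighted graphs -/

theorem ens_randomCopy_cost (v : V) : Ens (randomCopy W v) fun _ k => (k : ℝ) ≤ 1 :=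
  ens_choose.2 fun _ _ => by simp

theorem ens_randomEdge_cost : Ens (randomEdge W) fun _ k => (k : ℝ) ≤ logSize V + 2 := by
  unfold randomEdge
  refine ens_tick_bind (f := fun _ => _ >>= _) ?_
  refine Ens.bind (fun _ k => k = 1) (ens_choose.2 fun _ _ => rfl) fun o k hk => ?_
  rcases o with _ | u
  · refine ens_pure.2 ?_
    rw [hk]; push_cast; linarith
  · refine Ens.bind (fun _ k => k = 1) (ens_choose.2 fun _ _ => rfl) fun o j hj => ?_
    rcases o with _ | v <;>
    · refine ens_pure.2 ?_
      rw [hk, hj]; push_cast; linarith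

theorem ens_randomCopyEdge_cost :
    Ens (randomCopyEdge W) fun _ k => (k : ℝ) ≤ logSize V + 4 := by
  unfold randomCopyEdge
  refine Ens.bind _ (ens_randomEdge_cost W) fun o k hk => ?_
  rcases o with _ | ⟨u, v⟩
  · refine ens_pure.2 ?_
    push_cast; linarith
  · refine Ens.bind _ (ens_randomCopy_cost W u) fun o i hi => ?_
    refine Ens.bind _ (ens_randomCopy_cost W v) fun o' j hj => ?_
    rcases o with _ | x <;> rcases o' with _ | y <;>
    · refine ens_pure.2 ?_
      push_cast; linarith

theorem ens_balanceSample_cost {p : Params} {es : List (Option (W.Copy × W.Copy))} {w : ℕ}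
    (hes : es.length = w) {B : ℝ} (hB0 : 0 ≤ B)
    (hB : ∀ H : MultiGraph W.Copy, (H.maxDeg : ℝ) ≤ p.degConst * logSize V →
      Ens (balance H p) fun _ k => (k : ℝ) ≤ B) :
    Ens (balanceSample W p es) fun _ k =>
      (k : ℝ) ≤ logSize V * (Fintype.card V + w) + (B + (Fintype.card V + 1)) := by
  unfold balanceSample
  simp only
  rw [hes]
  split_ifs with h
  · refine ens_tick_bind (f := fun _ => _ >>= _) (Ens.bind _ (hB _ h) fun L k hk => ?_)
    refine Ens.bind _ (ens_collect_cost (c := 1) fun v _ => Ens.bind _ (ens_randomCopy_cost W v)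
      fun x j hj => ens_pure.2 (by simpa using hj)) fun sides j hj => ens_pure.2 ?_
    rw [Finset.length_toList, Finset.card_univ] at hj
    push_cast
    linarith
  · refine ens_tick_bind (f := fun _ => randomCut _)
      ((ens_randomCut_cost Finset.univ).mono fun L k hk => ?_)
    rw [Finset.card_univ] at hk
    push_cast
    linarith

theorem ens_reduceAndBalance_cost {p : Params} {B : ℝ} (hB0 : 0 ≤ B)
    (hB : ∀ H : MultiGraph W.Copy, (H.maxDeg : ℝ) ≤ p.degConst * logSize V →
      Ens (balance H p) fun _ k => (k : ℝ) ≤ B) :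
    Ens (reduceAndBalance W p) fun _ k => (k : ℝ) ≤
      logSize V * (Fintype.card V + 1) +
        ⌈p.sampleConst * Fintype.card V⌉₊ * (logSize V + 4) +
        (logSize V * (Fintype.card V + ⌈p.sampleConst * Fintype.card V⌉₊) +
          (B + (Fintype.card V + 1))) := by
  rw [reduceAndBalance_eq]
  refine ens_tick_bind (f := fun _ => _ >>= _) (Ens.bind _ ((ens_repeated_cost _
    (ens_randomCopyEdge_cost W)).and (ens_repeated_length _ _)) fun es k hk => ?_)
  refine (ens_balanceSample_cost W hk.2 hB0 hB).mono fun L j hj => ?_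
  push_cast
  linarith [hk.1]

theorem ens_approxMaxCut_cost {p : Params} {X : ℝ}
    (hX : Ens (reduceAndBalance W p) fun _ k => (k : ℝ) ≤ X) :
    Ens (approxMaxCut W p) fun _ k => (k : ℝ) ≤
      ⌈p.repConst * logSize V⌉₊ * X + ⌈p.repConst * logSize V⌉₊ * (logSize V + 2) +
        logSize V * (⌈p.repConst * logSize V⌉₊ + 1) * (⌈p.repConst * logSize V⌉₊ + 1) := by
  unfold approxMaxCut
  refine Ens.bind _ ((ens_repeated_cost _ hX).and (ens_repeated_length _ _)) fun cuts k hk => ?_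
  refine Ens.bind _ ((ens_repeated_cost _ (ens_randomEdge_cost W)).and
    (ens_repeated_length _ _)) fun es j hj => ?_
  refine ens_tick_bind (f := fun _ => pure _) (ens_pure.2 ?_)
  rw [hk.2, hj.2]
  push_cast
  linarith [hk.1, hj.1]

theorem logSize_le (hn : 2 ≤ Fintype.card V) :
    (logSize V : ℝ) ≤ 5 * Real.log (Fintype.card V) := by
  have hn' : (2 : ℝ) ≤ Fintype.card V := by exact_mod_cast hn
  have h1 := clog_two_le (x := Fintype.card V + 2) (by omega)
  have h2 : Real.log ((Fintype.card V + 2 : ℕ) : ℝ) ≤ 2 * Real.log (Fintype.card V) := by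
    rw [← Real.log_rpow (by linarith)]
    refine Real.log_le_log (by positivity) ?_
    rw [show (2 : ℝ) = ((2 : ℕ) : ℝ) by norm_num, Real.rpow_natCast]
    push_cast
    nlinarith
  have h3 : Real.log 2 ≤ Real.log (Fintype.card V) := Real.log_le_log (by norm_num) hn'
  have h4 := Real.log_two_gt_d9
  unfold logSize
  linarith

/-- The running time of the algorithm for weighted graphs. -/
theorem exists_ens_approxMaxCut_cost {p : Params} (hp : p.Sampling) {μ : ℝ} (hμ₁ : p.mu₁ ≤ μ)
    (hμ₂ : p.mu₂ ≤ μ) (hμ1 : μ ≤ 1) : ∃ (C : ℝ) (K : ℕ), 0 ≤ C ∧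
    ∀ (V : Type) [Fintype V] (W : WGraph V), 2 ≤ Fintype.card V →
      Ens (approxMaxCut W p) fun _ t => (t : ℝ) ≤
        C * (Fintype.card V : ℝ) ^ (3 / 2 + μ) * Real.log (Fintype.card V) ^ K := by
  obtain ⟨C, K, hC, hcost⟩ := exists_ens_balance_cost hp.toGood hμ₁ hμ₂ hμ1 (5 * p.degConst) 1
  have hμ0 : 0 < μ := lt_of_lt_of_le hp.mu₁_pos hμ₁
  have hs := hp.sampleConst_pos
  have hr := hp.repConst_pos
  have hd : 0 ≤ p.degConst := by linarith [hp.degConst_ge]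
  set C' := C * 2 ^ (3 / 2 + μ) with hC'
  have hC'0 : 0 ≤ C' := by positivity
  set B := 6 + 15 * (p.sampleConst + 1) + 3 * (p.sampleConst + 2) + C' + 2 with hB
  set R := 3 * p.repConst + 1 with hR
  have hB0 : 0 ≤ B := by positivity
  have hR0 : 0 ≤ R := by positivity
  refine ⟨(R * B + 9 * R + 3 * (R + 1) ^ 2) * 2 ^ (K + 3), K + 3, by positivity,
    fun V _ W hn => ?_⟩
  have hn' : (2 : ℝ) ≤ Fintype.card V := by exact_mod_cast hn
  have hlS := logSize_le hn
  have hlS1 : (1 : ℝ) ≤ logSize V := by exact_mod_cast one_le_logSize (V := V)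
  have hcopy : (Fintype.card W.Copy : ℝ) ≤ 2 * (Fintype.card V : ℝ) := by
    exact_mod_cast W.card_copy_le
  set n : ℝ := (Fintype.card V : ℝ) with hndef
  set l := Real.log n with hl
  have hl2 : Real.log 2 ≤ l := Real.log_le_log (by norm_num) hn'
  have hlog2 := Real.log_two_gt_d9
  -- Since `T ≥ 1` and `P ≥ n`, all lower-order terms are absorbed by `P T^{K+3}`; the factor
  -- `2^{K+3}` in the constant converts back to powers of `log n`.
  set T := 2 * l with hT
  have hT1 : 1 ≤ T := by linarith
  have hTK : 1 ≤ T ^ K := one_le_pow₀ hT1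
  set P := n ^ (3 / 2 + μ) with hP
  have hnP : n ≤ P := by
    calc n = n ^ (1 : ℝ) := (Real.rpow_one n).symm
      _ ≤ P := Real.rpow_le_rpow_of_exponent_le (by linarith) (by linarith)
  have hP1 : 1 ≤ P := by linarith
  have hlog2n : Real.log (2 * n) ≤ T := by
    rw [Real.log_mul (by norm_num) (by linarith)]
    linarith
  have hlogn : l ≤ Real.log (2 * n) := Real.log_le_log (by linarith) (by linarith)
  have hbal : ∀ H : MultiGraph W.Copy, (H.maxDeg : ℝ) ≤ p.degConst * logSize V →
      Ens (balance H p) fun _ k => (k : ℝ) ≤ C' * P * T ^ K := by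
    intro H hH
    refine (hcost W.Copy H (2 * n) (by linarith) hcopy ?_).mono fun _ k hk => hk.trans ?_
    · rw [pow_one]
      refine hH.trans ?_
      have := mul_le_mul_of_nonneg_left (hlS.trans
        (mul_le_mul_of_nonneg_left hlogn (by norm_num))) hd
      linarith
    · have h0 : 0 ≤ Real.log (2 * n) := by linarith
      calc C * (2 * n) ^ (3 / 2 + μ) * Real.log (2 * n) ^ K =
            C' * P * Real.log (2 * n) ^ K := by
            rw [Real.mul_rpow (by norm_num) (by linarith), hC', hP]; ring
        _ ≤ C' * P * T ^ K :=
            mul_le_mul_of_nonneg_left (pow_le_pow_left₀ h0 hlog2n K) (by positivity)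
  set w := ⌈p.sampleConst * n⌉₊ with hw
  have hw1 : (w : ℝ) ≤ (p.sampleConst + 1) * n := by
    refine (Nat.ceil_lt_add_one (by positivity)).le.trans ?_
    linarith
  have hlST : (logSize V : ℝ) ≤ 3 * T := by linarith
  have hPT : 0 ≤ P * T ^ K := by positivity
  have hX : Ens (reduceAndBalance W p) fun _ k => (k : ℝ) ≤ B * (P * T ^ (K + 1)) := by
    refine (ens_reduceAndBalance_cost W (by positivity) hbal).mono fun _ k hk => hk.trans ?_
    rw [← hndef, ← hw]
    have hnT : n * T ≤ P * T ^ (K + 1) := by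
      rw [pow_succ]
      refine mul_le_mul hnP (le_mul_of_one_le_left (by linarith) hTK) (by linarith) (by linarith)
    have hPT' : P * T ^ K ≤ P * T ^ (K + 1) := by
      refine mul_le_mul_of_nonneg_left ?_ (by linarith)
      exact pow_le_pow_right₀ hT1 (Nat.le_succ K)
    have h1 : (logSize V : ℝ) * (n + 1) ≤ 3 * T * (2 * n) :=
      mul_le_mul hlST (by linarith) (by linarith) (by linarith)
    have h2 : (w : ℝ) * (logSize V + 4) ≤ (p.sampleConst + 1) * n * (15 * T) :=
      mul_le_mul hw1 (by linarith) (by linarith) (by positivity)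
    have h3 : (logSize V : ℝ) * (n + w) ≤ 3 * T * ((p.sampleConst + 2) * n) :=
      mul_le_mul hlST (by linarith) (by positivity) (by linarith)
    have h4 : n + 1 ≤ 2 * (n * T) := by nlinarith
    have h5 : C' * P * T ^ K ≤ C' * (P * T ^ (K + 1)) := by
      rw [mul_assoc]; exact mul_le_mul_of_nonneg_left hPT' hC'0
    have h6 : (6 + 15 * (p.sampleConst + 1) + 3 * (p.sampleConst + 2) + 2) * (n * T) ≤
        (6 + 15 * (p.sampleConst + 1) + 3 * (p.sampleConst + 2) + 2) * (P * T ^ (K + 1)) :=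
      mul_le_mul_of_nonneg_left hnT (by positivity)
    rw [hB]
    linarith
  refine (ens_approxMaxCut_cost W hX).mono fun _ k hk => hk.trans ?_
  set r := ⌈p.repConst * logSize V⌉₊ with hrdef
  have hr1 : (r : ℝ) ≤ R * T := by
    refine (Nat.ceil_lt_add_one (by positivity)).le.trans ?_
    have := mul_le_mul_of_nonneg_left hlST hr.le
    rw [hR]
    linarith
  have hY : 0 ≤ P * T ^ (K + 1) := by positivity
  have h1 : (r : ℝ) * (B * (P * T ^ (K + 1))) ≤ R * B * (P * T ^ (K + 3)) := by
    calc (r : ℝ) * (B * (P * T ^ (K + 1))) ≤ R * T * (B * (P * T ^ (K + 1))) :=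
          mul_le_mul_of_nonneg_right hr1 (by positivity)
      _ = R * B * (P * T ^ (K + 2)) := by ring
      _ ≤ R * B * (P * T ^ (K + 3)) := by
          refine mul_le_mul_of_nonneg_left (mul_le_mul_of_nonneg_left ?_ (by linarith))
            (by positivity)
          exact pow_le_pow_right₀ hT1 (by omega)
  have hT3 : T ^ 3 ≤ P * T ^ (K + 3) := by
    calc T ^ 3 ≤ T ^ (K + 3) := pow_le_pow_right₀ hT1 (by omega)
      _ ≤ P * T ^ (K + 3) := le_mul_of_one_le_left (by positivity) hP1
  have h2 : (r : ℝ) * (logSize V + 2) ≤ 9 * R * (P * T ^ (K + 3)) := by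
    calc (r : ℝ) * (logSize V + 2) ≤ R * T * (9 * T) :=
          mul_le_mul hr1 (by linarith) (by linarith) (by positivity)
      _ = 9 * R * T ^ 2 := by ring
      _ ≤ 9 * R * T ^ 3 :=
          mul_le_mul_of_nonneg_left (pow_le_pow_right₀ hT1 (by norm_num)) (by positivity)
      _ ≤ _ := mul_le_mul_of_nonneg_left hT3 (by positivity)
  have h3 : (logSize V : ℝ) * (r + 1) * (r + 1) ≤ 3 * (R + 1) ^ 2 * (P * T ^ (K + 3)) := by
    have h4 : (r : ℝ) + 1 ≤ (R + 1) * T := by linarith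
    calc (logSize V : ℝ) * (r + 1) * (r + 1) ≤ 3 * T * ((R + 1) * T) * ((R + 1) * T) :=
          mul_le_mul (mul_le_mul hlST h4 (by positivity) (by linarith)) h4 (by positivity)
            (by positivity)
      _ = 3 * (R + 1) ^ 2 * T ^ 3 := by ring
      _ ≤ _ := mul_le_mul_of_nonneg_left hT3 (by positivity)
  have h4 : (R * B + 9 * R + 3 * (R + 1) ^ 2) * 2 ^ (K + 3) * P * l ^ (K + 3) =
      (R * B + 9 * R + 3 * (R + 1) ^ 2) * (P * T ^ (K + 3)) := by
    rw [hT, mul_pow]; ring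
  rw [h4]
  linarith

end

/-! ### The choice of the constants -/

/-- Constants for which the running time has exponent `3 / 2 + μ`. -/
def paramsOf (μ : ℝ) : Params where
  eps₁ := μ / 400
  mu₁ := μ
  mu₂ := μ
  tau := 1 / 2
  delta := μ / 200
  gamma := μ / 60000
  eta := 8 / 25
  walkConst := 3840000 * (8 + 8 / (μ / 60000) ^ 2) + 100 * (8 + 8 / (μ / 200) ^ 3)
  startConst := 48 / (μ / 200)
  sizeConst := (μ / 60000) ^ 2 * (μ / 200) ^ 2 / 1000
  sampleConst := 4 * (2 + 32 / (μ / 60000 / 1000)) / (μ / 60000 / 1000 / 16) ^ 2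
  degConst := 4 * (4 * (2 + 32 / (μ / 60000 / 1000)) / (μ / 60000 / 1000 / 16) ^ 2 + 1)
  repConst := 8 * (2 + 16 / (μ / 60000 / 1000 / 16) ^ 2) / (μ / 60000 / 1000 / 16) ^ 2

theorem sampling_paramsOf {μ : ℝ} (h : 0 < μ) (h1 : μ ≤ 1) : (paramsOf μ).Sampling where
  delta_pos := by simp only [paramsOf]; positivity
  delta_le := by simp only [paramsOf]; linarith
  gamma_pos := by simp only [paramsOf]; positivity
  gamma_le := by simp only [paramsOf]; linarith
  gamma_le_delta := by simp only [paramsOf]; linarith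
  eta_eq := rfl
  tau_eq := rfl
  sizeConst_eq := rfl
  walkConst_ge := le_add_of_nonneg_right (by positivity)
  walkConst_ge' := le_add_of_nonneg_left (by positivity)
  startConst_ge := le_rfl
  mu₁_pos := h
  mu₁_le := h1
  mu₂_pos := h
  mu₂_le := h1
  delta_le₁ := le_rfl
  delta_le₂ := le_rfl
  eps₁_pos := by simp only [paramsOf]; positivity
  eps₁_le := le_rfl
  gamma_le₁ := by simp only [paramsOf]; linarith
  gamma_le₂ := by simp only [paramsOf]; linarith
  sampleConst_ge := le_rfl
  degConst_ge := le_rfl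
  repConst_ge := le_rfl

theorem valid_paramsOf {μ : ℝ} (h : 0 < μ) (h1 : μ ≤ 1) : (paramsOf μ).Valid where
  eps₁_pos := (sampling_paramsOf h h1).eps₁_pos
  eps₁_lt := by simp only [paramsOf]; linarith
  mu₁_pos := h
  mu₂_pos := h
  tau_pos := by simp only [paramsOf]; norm_num
  tau_lt := by simp only [paramsOf]; norm_num
  delta_pos := (sampling_paramsOf h h1).delta_pos
  delta_lt := by simp only [paramsOf]; linarith
  gamma_pos := (sampling_paramsOf h h1).gamma_pos
  gamma_lt := by simp only [paramsOf]; linarith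
  eta_pos := by simp only [paramsOf]; norm_num
  eta_lt := by simp only [paramsOf]; norm_num
  walkConst_pos := by simp only [paramsOf]; positivity
  startConst_pos := by simp only [paramsOf]; positivity
  sizeConst_pos := by simp only [paramsOf]; positivity
  sampleConst_pos := by simp only [paramsOf]; positivity
  degConst_pos := by simp only [paramsOf]; positivity
  repConst_pos := by simp only [paramsOf]; positivity
  soto_gt := lt_of_lt_of_le (by norm_num) (sampling_paramsOf h h1).soto_ge
  zeta_tau_lt := by
    have hlog := (sampling_paramsOf h h1).tame.log_le
    have he := (sampling_paramsOf h h1).tame.eps_nonneg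
    have h0 : Real.log (1 - (paramsOf μ).eps₁) ≤ 0 :=
      Real.log_nonpos (by simp only [paramsOf]; linarith) (by linarith)
    unfold Params.zeta
    simp only [paramsOf] at hlog h0 ⊢
    rw [div_mul_eq_mul_div, div_lt_iff₀ h]
    nlinarith

end MaxCut

end

end

theorem theorem1 (b : ℝ) (hb : 3 / 2 < b) :
    ∃ p : MaxCut.Params, p.Valid ∧ ∃ δ : ℝ, 0 < δ ∧
      -- Balance on multigraphs: approximation factor, and running time for polylogarithmic degrees
      (∀ (V : Type) [Fintype V] (G : MaxCut.MultiGraph V),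
        (1 / 2 + δ) * G.toWGraph.maxCut ≤
          (MaxCut.balance G p).expect G.toWGraph.cutWeight) ∧
      (∀ (A : ℝ) (k : ℕ), ∃ (C : ℝ) (K : ℕ), ∀ (V : Type) [Fintype V] (G : MaxCut.MultiGraph V),
        2 ≤ Fintype.card V → (G.maxDeg : ℝ) ≤ A * Real.log (Fintype.card V) ^ k →
          (MaxCut.balance G p).RunsWithin
            (C * (Fintype.card V : ℝ) ^ b * Real.log (Fintype.card V) ^ K)) ∧
      -- arbitrary weighted graphs: approximation factor with high probability, and running time
      (∀ (V : Type) [Fintype V] (W : MaxCut.WGraph V),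
        1 - 1 / (Fintype.card V : ℝ) ≤
          (MaxCut.approxMaxCut W p).prob {L | (1 / 2 + δ) * W.maxCut ≤ W.cutWeight L}) ∧
      (∃ (C : ℝ) (K : ℕ), ∀ (V : Type) [Fintype V] (W : MaxCut.WGraph V),
        2 ≤ Fintype.card V →
          (MaxCut.approxMaxCut W p).RunsWithin
            (C * (Fintype.card V : ℝ) ^ b * Real.log (Fintype.card V) ^ K)) := by
  -- The exponents `μ₁ = μ₂ = μ` give running time with exponent `3/2 + μ ≤ b`; the cap at one is a
  -- hypothesis of the analysis.
  set μ := min (b - 3 / 2) 1 with hμ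
  have hμ0 : 0 < μ := lt_min (by linarith) one_pos
  have hμ1 : μ ≤ 1 := min_le_right _ _
  have hμb : 3 / 2 + μ ≤ b := by linarith [min_le_left (b - 3 / 2) 1]
  have hp := MaxCut.sampling_paramsOf hμ0 hμ1
  have hg := hp.gain_pos
  have hpow : ∀ {C : ℝ}, 0 ≤ C → ∀ (K n : ℕ), 2 ≤ n →
      C * (n : ℝ) ^ (3 / 2 + μ) * Real.log n ^ K ≤ C * (n : ℝ) ^ b * Real.log n ^ K := by
    intro C hC K n hn
    have hn' : (1 : ℝ) ≤ n := by exact_mod_cast le_trans one_le_two hn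
    exact mul_le_mul_of_nonneg_right (mul_le_mul_of_nonneg_left
      (Real.rpow_le_rpow_of_exponent_le hn' hμb) hC) (pow_nonneg (Real.log_nonneg hn') K)
  -- Balance itself achieves the full gain; sampling, the Markov argument and the selection leave a
  -- quarter of it on weighted graphs, and one `δ` has to serve both.
  refine ⟨MaxCut.paramsOf μ, MaxCut.valid_paramsOf hμ0 hμ1, (MaxCut.paramsOf μ).gain / 4,
    by positivity, ?_, ?_, ?_, ?_⟩
  · intro V _ G
    rw [MaxCut.RandAlg.expect_eq]
    refine le_trans ?_ (MaxCut.E_balance_cutWeight_ge G hp.toGood)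
    refine mul_le_mul_of_nonneg_right ?_ G.toWGraph.maxCut_nonneg
    have : (MaxCut.paramsOf μ).gain = (MaxCut.paramsOf μ).gamma / 1000 := rfl
    linarith
  · intro A k
    obtain ⟨C, K, hC, h⟩ := MaxCut.exists_ens_balance_cost hp.toGood le_rfl le_rfl hμ1 A k
    refine ⟨C, K, fun V _ G hn hG => ?_⟩
    rw [MaxCut.RandAlg.runsWithin_iff]
    exact (h V G _ (by exact_mod_cast hn) le_rfl hG).mono fun _ _ ht =>
      ht.trans (hpow hC K _ hn)
  · intro V _ W
    exact MaxCut.prob_approxMaxCut_ge W hp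
  · obtain ⟨C, K, hC, h⟩ := MaxCut.exists_ens_approxMaxCut_cost hp (μ := μ) le_rfl le_rfl hμ1
    refine ⟨C, K, fun V _ W hn => ?_⟩
    rw [MaxCut.RandAlg.runsWithin_iff]
    exact (h V W hn).mono fun _ _ ht => ht.trans (hpow hC K _ hn)
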